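/- **Setting.** Let $(\mathcal C,J)$ be a site and let $\mathbb D$ be a $\mathcal C$-indexed category, i.e. a pseudofunctor $\mathbb D:\mathcal C^{\mathrm{op}}\to\mathbf{CAT}$. Here $\mathbf{CAT}$ is a 2-category of categories whose hom-sets, and whose sets of objects, lie in universes at least as large as those in which the objects and the arrows of $\mathcal C$ live. All $2$-categorical notions are the weak ones: indexed functors are pseudonatural transformations; a *2-adjunction* $L\dashv R$ is a pair of pseudofunctors with a pseudonatural unit $\eta:1\Rightarrow RL$ such that every functor $\mathrm{Hom}(La,c)\to\mathrm{Hom}(a,Rc)$, $f\mapsto R(f)\circ\eta_a$, is an equivalence of categories; it is a *2-adjoint biequivalence* if moreover $L$ and $R$ are biequivalences. "Isomorphic" pseudofunctors are pseudofunctors related by a pseudonatural equivalence. - An indexed functor $p:\mathbb E\to\mathbb D$ is an *indexed fibration* if every $p^X:\mathbb E(X)\to\mathbb D(X)$ is a (Street) fibration and every $\mathbb E(y)$, for $y:Y\to X$ in $\mathcal C$, sends $p^X$-cartesian arrows to $p^Y$-cartesian arrows. $[\mathcal C^{\mathrm{op}},\mathbf{CAT}]/^{\mathrm{fib}}\mathbb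 D$ is the 2-category whose objects are the indexed fibrations over $\mathbb D$, whose arrows $p\to p'$ are pairs $(F,\varphi)$ of an indexed functor $F$ preserving cartesian arrows and an invertible $\varphi:p'F\cong p$, and whose 2-cells are the modifications compatible with the $\varphi$'s. $\mathrm{St}(\mathcal C,J)/^{\mathrm{fib}}\mathbb D'$ is its full sub-2-category, for $\mathbb D'$ in place of $\mathbb D$, on the fibrations whose total indexed category is a $J$-stack. - $\mathcal G(\mathbb D)$ is the Grothendieck construction: its objects are pairs $(X,U)$ with $U\in\mathbb D(X)$, and an arrow $(Y,V)\to(X,U)$ is a pair $(y:Y\to X,\ a:V\to\mathbb D(y)U)$. $J_{\mathbb D}$ is the Giraud topology: a sieve $S$ on $(X,U)$ is covering iff the arrows $y:Y\to X$ whose cartesian lift $(y,1):(Y,\mathbb D(y)U)\to(X,U)$ lies in $S$ form a $J$-covering sieve. - $R_{\mathbb D}:[\mathcal C^{\mathrm{op}},\mathbf{CAT}]/^{\mathrm{fib}}\mathbb D\to[\mathcal G(\mathbb D)^{\mathrm{op}},\mathbf{CAT}]$ sends $p$ to the indexed category whose value at $(X,U)$ is the essential fibre of $p^X$ at $U$ (objects: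 pairs $(A,\alpha:U\cong p^X A)$), with transition along $(y,a)$ given by cartesian lifting of $V\to\mathbb D(y)U\cong\mathbb D(y)p^X A\cong p^Y\mathbb E(y)A$; it sends $(F,\varphi)$ to $(A,\alpha)\mapsto(FA,\varphi^{-1}\alpha)$. **Theorem.** 1. $R_{\mathbb D}$ has a left 2-adjoint $L_{\mathbb D}$, and $L_{\mathbb D}\dashv R_{\mathbb D}$ is a 2-adjoint biequivalence. For every $\mathcal G(\mathbb D)$-indexed category $\mathbb A$ and every $X\in\mathcal C$, the functor $L_{\mathbb D}(\mathbb A)(X)\to\mathbb D(X)$ is, up to equivalence over $\mathbb D(X)$, the Grothendieck construction of $\mathbb A(X,-)$. 2. The inclusions $i_J:\mathrm{St}(\mathcal C,J)\to[\mathcal C^{\mathrm{op}},\mathbf{CAT}]$ and $i_{J_{\mathbb D}}:\mathrm{St}(\mathcal G(\mathbb D),J_{\mathbb D})\to[\mathcal G(\mathbb D)^{\mathrm{op}},\mathbf{CAT}]$ have left 2-adjoints $s_J$ and $s_{J_{\mathbb D}}$ (stackification). Write $\eta$ for the unit of $s_J\dashv i_J$. 3. $s_J$ preserves indexed fibrations,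 and arrows preserving cartesian arrows between indexed fibrations over a common base. So it induces $s_J/\mathbb D:[\mathcal C^{\mathrm{op}},\mathbf{CAT}]/^{\mathrm{fib}}\mathbb D\to\mathrm{St}(\mathcal C,J)/^{\mathrm{fib}}s_J(\mathbb D)$. This pseudofunctor is left 2-adjoint to $i_J/\mathbb D:=\eta_{\mathbb D}^*$, the pseudopullback along $\eta_{\mathbb D}:\mathbb D\to s_J(\mathbb D)$. 4. The values of $R_{\mathbb D}\circ i_J/\mathbb D$ are $J_{\mathbb D}$-stacks. Let $R^J_{\mathbb D}:\mathrm{St}(\mathcal C,J)/^{\mathrm{fib}}s_J(\mathbb D)\to\mathrm{St}(\mathcal G(\mathbb D),J_{\mathbb D})$ be the corestriction of this composite to stacks, and let $L^J_{\mathbb D}:=s_J/\mathbb D\circ L_{\mathbb D}\circ i_{J_{\mathbb D}}$. Then $L^J_{\mathbb D}\dashv R^J_{\mathbb D}$ is a 2-adjoint biequivalence. 5. The resulting square commutes up to isomorphism: $$i_{J_{\mathbb D}}\circ R^J_{\mathbb D}\simeq R_{\mathbb D}\circ i_J/\mathbb D,\qquad i_J/\mathbb D\circ L^J_{\mathbb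 D}\simeq L_{\mathbb D}\circ i_{J_{\mathbb D}},$$ $$L^J_{\mathbb D}\circ s_{J_{\mathbb D}}\simeq s_J/\mathbb D\circ L_{\mathbb D},\qquad R^J_{\mathbb D}\circ s_J/\mathbb D\simeq s_{J_{\mathbb D}}\circ R_{\mathbb D}.$$ -/

import Mathlib

open CategoryTheory Bicategory Opposite
open scoped Pseudofunctor.StrongTrans

universe w₁ w₂ v₁ v₂ u₁ u₂ v u v' u' w w'

set_option linter.checkUnivs false

namespace Bicat

section Biadjunction

variable {B : Type u₁} [Bicategory.{w₁, v₁} B] {B' : Type u₂} [Bicategory.{w₂, v₂} B']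

/-- A pseudofunctor is a biequivalence when it is an equivalence on all hom-categories and
every object of the target is equivalent to an object in the image. -/
structure IsBiequivalence (F : B ⥤ᵖ B') : Prop where
  isEquivalence_mapFunctor (a b : B) : (F.mapFunctor a b).IsEquivalence
  exists_equivalence (c : B') : ∃ a : B, Nonempty (F.obj a ≌ c)

/-- For a pseudonatural transformation `η : 𝟭 ⟶ L ⋙ R`, the functor
`Hom(L a, c) ⥤ Hom(a, R c)` sending `f` to `η_a ≫ R f`. -/
def transpose {L : B ⥤ᵖ B'} {R : B' ⥤ᵖ B} (η : Pseudofunctor.id B ⟶ L.comp R) (a : B) (c : B') :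
    (L.obj a ⟶ c) ⥤ (a ⟶ R.obj c) where
  obj f := η.app a ≫ R.map f
  map α := η.app a ◁ R.map₂ α
  map_id f := by rw [PrelaxFunctor.map₂_id]; exact whiskerLeft_id _ _
  map_comp α β := by rw [PrelaxFunctor.map₂_comp]; exact whiskerLeft_comp _ _ _

/-- A 2-adjunction (biadjunction) `L ⊣ R`: a pseudonatural unit `η : 𝟭 ⟶ L ⋙ R` such that the
(pseudonatural) functors `Hom(L a, c) ⥤ Hom(a, R c)`, `f ↦ η_a ≫ R f`, are equivalences. -/
structure Biadjunction (L : B ⥤ᵖ B') (R : B' ⥤ᵖ B) where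
  unit : Pseudofunctor.id B ⟶ L.comp R
  isEquivalence_transpose (a : B) (c : B') : (transpose unit a c).IsEquivalence

end Biadjunction

section FullSub

variable {A : Type u₁} [Bicategory.{w₁, v₁} A] {B : Type u₂} [Bicategory.{w₂, v₂} B]

/-- The full sub-bicategory on the objects satisfying `P`. -/
abbrev FullSub (P : B → Prop) : Type u₂ :=
  InducedBicategory B (Subtype.val : {b : B // P b} → B)

namespace FullSub

/-- The inclusion of a full sub-bicategory. -/
abbrev incl (P : B → Prop) : FullSub P ⥤ᵖ B :=
  InducedBicategory.forget.toPseudofunctor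

/-- Corestriction of a pseudofunctor to a full sub-bicategory. -/
def lift {P : B → Prop} (F : A ⥤ᵖ B) (h : ∀ a, P (F.obj a)) : A ⥤ᵖ FullSub P where
  obj a := ⟨F.obj a, h a⟩
  map f := InducedBicategory.mkHom (F.map f)
  map₂ η := ⟨F.map₂ η⟩
  mapId a := InducedBicategory.isoMk (F.mapId a)
  mapComp f g := InducedBicategory.isoMk (F.mapComp f g)

end FullSub

end FullSub

section Slice

/-- A class `fib` of 1-cells of a bicategory (to be thought of as fibrations), together with a class
`cart` of 1-cells `f : e ⟶ e'` between the domains of two 1-cells `p`, `q` (to be thought of as the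
1-cells preserving cartesian arrows), containing identities and closed under composition. -/
structure FibrationClass (B : Type u₁) [Bicategory.{w₁, v₁} B] where
  fib {e b : B} (p : e ⟶ b) : Prop
  cart {e e' b b' : B} (p : e ⟶ b) (q : e' ⟶ b') (f : e ⟶ e') : Prop
  cart_id {e b : B} (p : e ⟶ b) : cart p p (𝟙 e)
  cart_comp {e e' e'' b b' b'' : B} {p : e ⟶ b} {q : e' ⟶ b'} {r : e'' ⟶ b''}
    {f : e ⟶ e'} {g : e' ⟶ e''} (hf : cart p q f) (hg : cart q r g) : cart p r (f ≫ g)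

variable {B : Type u₁} [Bicategory.{w₁, v₁} B]

/-- Objects of the slice over `b`: the 1-cells `total ⟶ b` in the class of fibrations. -/
structure Slice (W : FibrationClass B) (b : B) where
  total : B
  proj : total ⟶ b
  fib : W.fib proj

namespace Slice

variable {W : FibrationClass B} {b : B}

/-- A 1-cell of the slice: a 1-cell `F` between the total objects preserving cartesian arrows,
together with an invertible 2-cell `φ : F ≫ q ≅ p`. -/
structure Hom (p q : Slice W b) where
  hom : p.total ⟶ q.total
  iso : hom ≫ q.proj ≅ p.proj
  cart : W.cart p.proj q.proj hom

/-- A 2-cell of the slice: a 2-cell between the underlying 1-cells compatible with the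
invertible 2-cells over `b`. -/
@[ext]
structure Hom₂ {p q : Slice W b} (F G : Hom p q) where
  hom : F.hom ⟶ G.hom
  w : hom ▷ q.proj ≫ G.iso.hom = F.iso.hom

attribute [simp] Hom₂.w

/-- Identities and composition of 1-cells of the slice. -/
instance : CategoryStruct (Slice W b) where
  Hom p q := Hom p q
  id p := ⟨𝟙 _, λ_ _, W.cart_id _⟩
  comp F G := ⟨F.hom ≫ G.hom, α_ _ _ _ ≪≫ whiskerLeftIso F.hom G.iso ≪≫ F.iso,
    W.cart_comp F.cart G.cart⟩

@[simp] lemma id_hom (p : Slice W b) : Hom.hom (𝟙 p) = 𝟙 p.total := rfl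
@[simp] lemma id_iso (p : Slice W b) : Hom.iso (𝟙 p) = λ_ p.proj := rfl
@[simp] lemma comp_hom {p q r : Slice W b} (F : p ⟶ q) (G : q ⟶ r) :
    Hom.hom (F ≫ G) = F.hom ≫ G.hom := rfl
@[simp] lemma comp_iso {p q r : Slice W b} (F : p ⟶ q) (G : q ⟶ r) :
    Hom.iso (F ≫ G) = α_ _ _ _ ≪≫ whiskerLeftIso F.hom G.iso ≪≫ F.iso := rfl

/-- The hom-categories of the slice. -/
instance (p q : Slice W b) : Category (p ⟶ q) where
  Hom F G := Hom₂ F G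
  id F := ⟨𝟙 _, by simp⟩
  comp η θ := ⟨η.hom ≫ θ.hom, by simp⟩
  id_comp _ := Hom₂.ext (Category.id_comp _)
  comp_id _ := Hom₂.ext (Category.comp_id _)
  assoc _ _ _ := Hom₂.ext (Category.assoc _ _ _)

@[simp] lemma id₂_hom {p q : Slice W b} (F : p ⟶ q) : Hom₂.hom (𝟙 F) = 𝟙 F.hom := rfl
@[simp] lemma comp₂_hom {p q : Slice W b} {F G H : p ⟶ q} (η : F ⟶ G) (θ : G ⟶ H) :
    Hom₂.hom (η ≫ θ) = η.hom ≫ θ.hom := rfl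

@[ext]
lemma hom₂_ext {p q : Slice W b} {F G : p ⟶ q} {η θ : F ⟶ G} (h : η.hom = θ.hom) : η = θ :=
  Hom₂.ext h

/-- Invertible 2-cells of the slice. -/
@[simps]
def isoMk {p q : Slice W b} {F G : p ⟶ q} (e : F.hom ≅ G.hom)
    (w : e.hom ▷ q.proj ≫ G.iso.hom = F.iso.hom) : F ≅ G where
  hom := ⟨e.hom, w⟩
  inv := ⟨e.inv, by rw [← w]; simp⟩
  hom_inv_id := hom₂_ext e.hom_inv_id
  inv_hom_id := hom₂_ext e.inv_hom_id

/-- Left whiskering in the slice. -/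
def whiskerL {p q r : Slice W b} (F : p ⟶ q) {G G' : q ⟶ r} (η : G ⟶ G') : F ≫ G ⟶ F ≫ G' :=
  Hom₂.mk (F.hom ◁ η.hom) (by simp [← whiskerLeft_comp_assoc])

/-- Right whiskering in the slice. -/
def whiskerR {p q r : Slice W b} {F F' : p ⟶ q} (η : F ⟶ F') (G : q ⟶ r) : F ≫ G ⟶ F' ≫ G :=
  Hom₂.mk (η.hom ▷ G.hom) (by
    simp only [comp_hom, comp_iso, Iso.trans_hom, whiskerLeftIso_hom]
    rw [associator_naturality_left_assoc, ← whisker_exchange_assoc, η.w])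

lemma assoc_w {p q r t : Slice W b} (F : p ⟶ q) (G : q ⟶ r) (H : r ⟶ t) :
    (α_ F.hom G.hom H.hom).hom ▷ t.proj ≫ (F ≫ G ≫ H).iso.hom = ((F ≫ G) ≫ H).iso.hom := by
  simp

lemma left_w {p q : Slice W b} (F : p ⟶ q) :
    (λ_ F.hom).hom ▷ q.proj ≫ F.iso.hom = (𝟙 p ≫ F).iso.hom := by
  simp

lemma right_w {p q : Slice W b} (F : p ⟶ q) :
    (ρ_ F.hom).hom ▷ q.proj ≫ F.iso.hom = (F ≫ 𝟙 q).iso.hom := by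
  simp

/-- The slice bicategory of fibrations over `b`. -/
instance : Bicategory (Slice W b) where
  whiskerLeft F _ _ η := whiskerL F η
  whiskerRight η G := whiskerR η G
  associator F G H := isoMk (α_ F.hom G.hom H.hom) (assoc_w F G H)
  leftUnitor F := isoMk (λ_ F.hom) (left_w F)
  rightUnitor F := isoMk (ρ_ F.hom) (right_w F)
  whiskerLeft_id _ _ := hom₂_ext (whiskerLeft_id _ _)
  whiskerLeft_comp _ _ _ _ _ _ := hom₂_ext (whiskerLeft_comp _ _ _)
  id_whiskerLeft _ := hom₂_ext (id_whiskerLeft _)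
  comp_whiskerLeft _ _ _ _ _ := hom₂_ext (comp_whiskerLeft _ _ _)
  id_whiskerRight _ _ := hom₂_ext (id_whiskerRight _ _)
  comp_whiskerRight _ _ _ := hom₂_ext (comp_whiskerRight _ _ _)
  whiskerRight_id _ := hom₂_ext (whiskerRight_id _)
  whiskerRight_comp _ _ _ := hom₂_ext (whiskerRight_comp _ _ _)
  whisker_assoc _ _ _ _ _ := hom₂_ext (whisker_assoc _ _ _)
  whisker_exchange _ _ := hom₂_ext (whisker_exchange _ _)
  pentagon _ _ _ _ := hom₂_ext (pentagon _ _ _ _)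
  triangle _ _ := hom₂_ext (triangle _ _)

variable {B' : Type u₂} [Bicategory.{w₂, v₂} B']

/-- `T` sends fibrations to fibrations and, over every base, 1-cells preserving cartesian arrows to
1-cells preserving cartesian arrows. -/
structure _root_.Bicat.PreservesFibrations (W : FibrationClass B) (W' : FibrationClass B')
    (T : B ⥤ᵖ B') : Prop where
  fib {e b : B} (p : e ⟶ b) (hp : W.fib p) : W'.fib (T.map p)
  cart {b : B} {p q : Slice W b} (F : p ⟶ q) :
    W'.cart (T.map p.proj) (T.map q.proj) (T.map F.hom)

/-- The action of `T` on 1-cells of slices. -/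
def mapSliceHom {W' : FibrationClass B'} {T : B ⥤ᵖ B'} (hT : PreservesFibrations W W' T)
    {b : B} {p q : Slice W b} (F : p ⟶ q) :
    (⟨T.obj p.total, T.map p.proj, hT.fib p.proj p.fib⟩ : Slice W' (T.obj b)) ⟶
      ⟨T.obj q.total, T.map q.proj, hT.fib q.proj q.fib⟩ :=
  Hom.mk (T.map F.hom) ((T.mapComp F.hom q.proj).symm ≪≫ T.map₂Iso F.iso) (hT.cart F)

lemma mapComp_w {W' : FibrationClass B'} {T : B ⥤ᵖ B'} (hT : PreservesFibrations W W' T)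
    {b : B} {p q r : Slice W b} (F : p ⟶ q) (G : q ⟶ r) :
    (T.mapComp F.hom G.hom).hom ▷ T.map r.proj ≫ (mapSliceHom hT F ≫ mapSliceHom hT G).iso.hom =
      (mapSliceHom hT (F ≫ G)).iso.hom := by
  change _ ≫ (α_ _ _ _).hom ≫ T.map F.hom ◁ ((T.mapComp G.hom r.proj).inv ≫ T.map₂ G.iso.hom) ≫
    (T.mapComp F.hom q.proj).inv ≫ T.map₂ F.iso.hom =
    (T.mapComp (F.hom ≫ G.hom) r.proj).inv ≫
      T.map₂ ((α_ _ _ _).hom ≫ F.hom ◁ G.iso.hom ≫ F.iso.hom)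
  simp

/-- The pseudofunctor between slices induced by a pseudofunctor preserving fibrations. -/
def mapSlice {W' : FibrationClass B'} (T : B ⥤ᵖ B') (hT : PreservesFibrations W W' T) (b : B) :
    Slice W b ⥤ᵖ Slice W' (T.obj b) where
  obj p := ⟨T.obj p.total, T.map p.proj, hT.fib p.proj p.fib⟩
  map F := mapSliceHom hT F
  map₂ {p q F G} η := Hom₂.mk (T.map₂ η.hom) (by
    have h := T.map₂_whisker_right η.hom q.proj
    have h' := congrArg T.map₂ η.w
    rw [PrelaxFunctor.map₂_comp, h] at h'
    have h'' : T.map₂ η.hom ▷ T.map q.proj ≫ (T.mapComp G.hom q.proj).inv ≫ T.map₂ G.iso.hom =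
      (T.mapComp F.hom q.proj).inv ≫ T.map₂ F.iso.hom := by
      simpa using (T.mapComp F.hom q.proj).inv ≫= h'
    exact h'')
  map₂_id F := hom₂_ext (T.map₂_id _)
  map₂_comp η θ := hom₂_ext (T.map₂_comp _ _)
  mapId p := isoMk (T.mapId p.total) (by
    have h : (T.mapId p.total).hom ▷ T.map p.proj ≫ (λ_ (T.map p.proj)).hom =
        (T.mapComp _ _).inv ≫ T.map₂ (λ_ p.proj).hom := by simp
    exact h)
  mapComp F G := isoMk (T.mapComp F.hom G.hom) (mapComp_w hT F G)
  map₂_whisker_left F _ _ η := hom₂_ext (T.map₂_whisker_left F.hom η.hom)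
  map₂_whisker_right η F := hom₂_ext (T.map₂_whisker_right η.hom F.hom)
  map₂_associator F G H := hom₂_ext (T.map₂_associator _ _ _)
  map₂_left_unitor F := hom₂_ext (T.map₂_left_unitor _)
  map₂_right_unitor F := hom₂_ext (T.map₂_right_unitor _)

end Slice
end Slice
end Bicat

/-- `K`-indexed categories: pseudofunctors `Kᵒᵖ ⥤ Cat`. -/
abbrev IndCat (K : Type u) [Category.{v} K] := LocallyDiscrete Kᵒᵖ ⥤ᵖ Cat.{v', u'}

namespace CategoryTheory.Pseudofunctor

variable {K : Type u} [Category.{v} K]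

section

variable (A : IndCat.{v, u, v', u'} K)

/-- The category `A(X)`. -/
abbrev fibre (X : K) : Cat.{v', u'} := A.obj ⟨op X⟩

/-- Restriction along `f`. -/
def res {X Y : K} (f : Y ⟶ X) : A.fibre X ⥤ A.fibre Y := (A.map f.op.toLoc).toFunctor

/-- The unit constraint of an indexed category. -/
def resId (X : K) : A.res (𝟙 X) ≅ 𝟭 (A.fibre X) := Cat.Hom.toNatIso (A.mapId ⟨op X⟩)

/-- The composition constraint of an indexed category. -/
def resComp {X Y Z : K} (f : Y ⟶ X) (g : Z ⟶ Y) (k : Z ⟶ X) (hk : g ≫ f = k) :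
    A.res k ≅ A.res f ⋙ A.res g :=
  Cat.Hom.toNatIso (A.mapComp' f.op.toLoc g.op.toLoc k.op.toLoc (by rw [← hk]; rfl))

lemma resComp_rfl {X Y Z : K} (f : Y ⟶ X) (g : Z ⟶ Y) :
    A.resComp f g _ rfl = Cat.Hom.toNatIso (A.mapComp f.op.toLoc g.op.toLoc) :=
  congrArg Cat.Hom.toNatIso (A.mapComp'_eq_mapComp f.op.toLoc g.op.toLoc)

lemma resComp_id_left {X Y : K} (f : Y ⟶ X) (h : 𝟙 Y ≫ f = f) (a : A.fibre X) :
    (A.resComp f (𝟙 Y) f h).hom.app a = (A.resId Y).inv.app ((A.res f).obj a) :=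
  (congrArg (fun t => t.toNatTrans.app a) (A.mapComp'_comp_id_hom f.op.toLoc)).trans
    (Category.id_comp _)

lemma resComp_id_right {X Y : K} (f : Y ⟶ X) (h : f ≫ 𝟙 X = f) (a : A.fibre X) :
    (A.resComp (𝟙 X) f f h).hom.app a = (A.res f).map ((A.resId X).inv.app a) :=
  (congrArg (fun t => t.toNatTrans.app a) (A.mapComp'_id_comp_hom f.op.toLoc)).trans
    (Category.id_comp _)

lemma resComp_assoc {X Y Z W : K} (f : Y ⟶ X) (g : Z ⟶ Y) (h : W ⟶ Z)
    (gf : Z ⟶ X) (hg : W ⟶ Y) (k : W ⟶ X) (h₁ : g ≫ f = gf) (h₂ : h ≫ g = hg)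
    (h₃ : h ≫ gf = k) (h₄ : hg ≫ f = k) (a : A.fibre X) :
    (A.resComp gf h k h₃).hom.app a ≫ (A.res h).map ((A.resComp f g gf h₁).hom.app a) =
      (A.resComp f hg k h₄).hom.app a ≫ (A.resComp g h hg h₂).hom.app ((A.res f).obj a) :=
  (congrArg (fun t => t.toNatTrans.app a)
    (A.mapComp'₀₂₃_hom_comp_mapComp'_hom_whiskerRight f.op.toLoc g.op.toLoc h.op.toLoc
      gf.op.toLoc hg.op.toLoc k.op.toLoc (by rw [← h₁]; rfl) (by rw [← h₂]; rfl)
      (by rw [← h₃]; rfl))).trans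
    (congrArg (fun t => (A.resComp f hg k h₄).hom.app a ≫ t) (Category.comp_id _))

end

section Mk

variable {F : K → Type u'} [∀ X, Category.{v'} (F X)] {rs : ∀ {X Y : K}, (Y ⟶ X) → (F X ⥤ F Y)}
    {rsId : ∀ X, rs (𝟙 X) ≅ 𝟭 (F X)}
    {rsComp : ∀ {X Y Z : K} (f : Y ⟶ X) (g : Z ⟶ Y) (k : Z ⟶ X), g ≫ f = k →
      (rs k ≅ rs f ⋙ rs g)}

lemma mkInd_assoc
    (assoc : ∀ {X Y Z W : K} (f : Y ⟶ X) (g : Z ⟶ Y) (h : W ⟶ Z)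
      (gf : Z ⟶ X) (hg : W ⟶ Y) (k : W ⟶ X) (h₁ : g ≫ f = gf) (h₂ : h ≫ g = hg)
      (h₃ : h ≫ gf = k) (h₄ : hg ≫ f = k) (a : F X),
      (rsComp gf h k h₃).hom.app a ≫ (rs h).map ((rsComp f g gf h₁).hom.app a) =
        (rsComp f hg k h₄).hom.app a ≫ (rsComp g h hg h₂).hom.app ((rs f).obj a))
    {X Y Z W : K} (f : Y ⟶ X) (g : Z ⟶ Y) (h : W ⟶ Z) (a : F X) (k k' : W ⟶ X)
    (e : h ≫ g ≫ f = k) (e' : (h ≫ g) ≫ f = k') :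
    (rsComp (g ≫ f) h k e).hom.app a ≫
      (rs h).map ((rsComp f g _ rfl).hom.app a) ≫ 𝟙 _ ≫
        (rsComp g h _ rfl).inv.app ((rs f).obj a) ≫
          (rsComp f (h ≫ g) k' e').inv.app a =
          eqToHom (by rw [← e, ← e', Category.assoc]) := by
  obtain rfl : k = k' := by rw [← e, ← e', Category.assoc]
  rw [Category.id_comp, reassoc_of% (assoc f g h _ _ k rfl rfl e e' a)]
  simp

lemma mkInd_left
    (id_left : ∀ {X Y : K} (f : Y ⟶ X) (h : 𝟙 Y ≫ f = f) (a : F X),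
      (rsComp f (𝟙 Y) f h).hom.app a = (rsId Y).inv.app ((rs f).obj a))
    {X Y : K} (f : Y ⟶ X) (a : F X) (k : Y ⟶ X) (e : 𝟙 Y ≫ f = k) :
    (rsComp f (𝟙 Y) k e).hom.app a ≫ (rsId Y).hom.app ((rs f).obj a) ≫ 𝟙 _ =
      (eqToHom (by rw [← e, Category.id_comp]) : (rs k).obj a ⟶ (rs f).obj a) := by
  obtain rfl : f = k := by simpa using e
  rw [id_left, Category.comp_id]
  simp

lemma mkInd_right
    (id_right : ∀ {X Y : K} (f : Y ⟶ X) (h : f ≫ 𝟙 X = f) (a : F X),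
      (rsComp (𝟙 X) f f h).hom.app a = (rs f).map ((rsId X).inv.app a))
    {X Y : K} (f : Y ⟶ X) (a : F X) (k : Y ⟶ X) (e : f ≫ 𝟙 X = k) :
    (rsComp (𝟙 X) f k e).hom.app a ≫ (rs f).map ((rsId X).hom.app a) ≫ 𝟙 _ =
      (eqToHom (by rw [← e, Category.comp_id]) : (rs k).obj a ⟶ (rs f).obj a) := by
  obtain rfl : f = k := by simpa using e
  rw [id_right, Category.comp_id, ← Functor.map_comp]
  simp

/-- Constructor for indexed categories. -/
def mkInd (F : K → Type u') [∀ X, Category.{v'} (F X)] (rs : ∀ {X Y : K}, (Y ⟶ X) → (F X ⥤ F Y))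
    (rsId : ∀ X, rs (𝟙 X) ≅ 𝟭 (F X))
    (rsComp : ∀ {X Y Z : K} (f : Y ⟶ X) (g : Z ⟶ Y) (k : Z ⟶ X), g ≫ f = k →
      (rs k ≅ rs f ⋙ rs g))
    (id_left : ∀ {X Y : K} (f : Y ⟶ X) (h : 𝟙 Y ≫ f = f) (a : F X),
      (rsComp f (𝟙 Y) f h).hom.app a = (rsId Y).inv.app ((rs f).obj a))
    (id_right : ∀ {X Y : K} (f : Y ⟶ X) (h : f ≫ 𝟙 X = f) (a : F X),
      (rsComp (𝟙 X) f f h).hom.app a = (rs f).map ((rsId X).inv.app a))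
    (assoc : ∀ {X Y Z W : K} (f : Y ⟶ X) (g : Z ⟶ Y) (h : W ⟶ Z)
      (gf : Z ⟶ X) (hg : W ⟶ Y) (k : W ⟶ X) (h₁ : g ≫ f = gf) (h₂ : h ≫ g = hg)
      (h₃ : h ≫ gf = k) (h₄ : hg ≫ f = k) (a : F X),
      (rsComp gf h k h₃).hom.app a ≫ (rs h).map ((rsComp f g gf h₁).hom.app a) =
        (rsComp f hg k h₄).hom.app a ≫ (rsComp g h hg h₂).hom.app ((rs f).obj a)) :
    IndCat.{v, u, v', u'} K :=
  LocallyDiscrete.mkPseudofunctor (fun X => Cat.of (F X.unop)) (fun f => (rs f.unop).toCatHom)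
    (fun X => Cat.Hom.isoMk (rsId X.unop))
    (fun f g => Cat.Hom.isoMk (rsComp f.unop g.unop _ rfl))
    (fun f g h => Cat.Hom₂.ext (NatTrans.ext (funext fun a =>
      (mkInd_assoc assoc f.unop g.unop h.unop a _ _ rfl rfl).trans
        (Cat.eqToHom_app (rs (h.unop ≫ g.unop ≫ f.unop)).toCatHom
          (rs ((h.unop ≫ g.unop) ≫ f.unop)).toCatHom _ a).symm)))
    (fun f => Cat.Hom₂.ext (NatTrans.ext (funext fun a =>
      (mkInd_right id_right f.unop a _ rfl).trans
        (Cat.eqToHom_app (rs (f.unop ≫ 𝟙 _)).toCatHom (rs f.unop).toCatHom _ a).symm)))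
    (fun f => Cat.Hom₂.ext (NatTrans.ext (funext fun a =>
      (mkInd_left id_left f.unop a _ rfl).trans
        (Cat.eqToHom_app (rs (𝟙 _ ≫ f.unop)).toCatHom (rs f.unop).toCatHom _ a).symm)))

section
variable (F : K → Type u') [∀ X, Category.{v'} (F X)] (rs : ∀ {X Y : K}, (Y ⟶ X) → (F X ⥤ F Y))
    (rsId : ∀ X, rs (𝟙 X) ≅ 𝟭 (F X))
    (rsComp : ∀ {X Y Z : K} (f : Y ⟶ X) (g : Z ⟶ Y) (k : Z ⟶ X), g ≫ f = k →
      (rs k ≅ rs f ⋙ rs g)) (id_left) (id_right) (assoc)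

lemma mkInd_resComp {X Y Z : K} (f : Y ⟶ X) (g : Z ⟶ Y) (k : Z ⟶ X) (hk : g ≫ f = k) :
    (mkInd F rs rsId rsComp id_left id_right assoc).resComp f g k hk = rsComp f g k hk := by
  subst hk
  exact resComp_rfl _ f g

end

end Mk

section Trans

variable {A B C : IndCat.{v, u, v', u'} K}

/-- The component of an indexed functor at `X`. -/
def StrongTrans.comp (F : A ⟶ B) (X : K) : A.fibre X ⥤ B.fibre X := (F.app ⟨op X⟩).toFunctor

/-- The pseudonaturality constraint of an indexed functor. -/
def StrongTrans.nat (F : A ⟶ B) {X Y : K} (f : Y ⟶ X) :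
    A.res f ⋙ F.comp Y ≅ F.comp X ⋙ B.res f := Cat.Hom.toNatIso (F.naturality f.op.toLoc)

lemma StrongTrans.nat_id (F : A ⟶ B) (X : K) (a : A.fibre X) :
    (F.nat (𝟙 X)).hom.app a ≫ (B.resId X).hom.app ((F.comp X).obj a) =
      (F.comp X).map ((A.resId X).hom.app a) :=
  (congrArg (fun t => t.toNatTrans.app a) (F.naturality_id ⟨op X⟩)).trans
    (congrArg (fun t => (F.comp X).map ((A.resId X).hom.app a) ≫ t) (Category.comp_id _)
      |>.trans (Category.comp_id _))

lemma StrongTrans.nat_comp (F : A ⟶ B) {X Y Z : K} (f : Y ⟶ X) (g : Z ⟶ Y) (k : Z ⟶ X)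
    (hk : g ≫ f = k) (a : A.fibre X) :
    (F.nat k).hom.app a ≫ (B.resComp f g k hk).hom.app ((F.comp X).obj a) =
      (F.comp Z).map ((A.resComp f g k hk).hom.app a) ≫ (F.nat g).hom.app ((A.res f).obj a) ≫
        (B.res g).map ((F.nat f).hom.app a) := by
  subst hk
  rw [resComp_rfl, resComp_rfl]
  have := (congrArg (fun t => t.toNatTrans.app a) (F.naturality_comp f.op.toLoc g.op.toLoc))
  refine this.trans ?_
  change (F.comp Z).map ((A.mapComp f.op.toLoc g.op.toLoc).hom.toNatTrans.app a) ≫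
    𝟙 _ ≫ (F.nat g).hom.app ((A.res f).obj a) ≫ 𝟙 _ ≫ (B.res g).map ((F.nat f).hom.app a) ≫ 𝟙 _ = _
  simp only [Category.id_comp, Category.comp_id]
  rfl

/-- A natural isomorphism as an invertible 2-cell of `Cat`. -/
def mkIso {X Y : Cat.{v', u'}} {F G : X ⟶ Y} (e : F.toFunctor ≅ G.toFunctor) : F ≅ G where
  hom := Cat.Hom₂.ofNatTrans e.hom
  inv := Cat.Hom₂.ofNatTrans e.inv
  hom_inv_id := Cat.Hom₂.ext e.hom_inv_id
  inv_hom_id := Cat.Hom₂.ext e.inv_hom_id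

/-- Constructor for indexed functors. -/
def mkTrans (F : ∀ X, A.fibre X ⥤ B.fibre X)
    (nat : ∀ {X Y : K} (f : Y ⟶ X), A.res f ⋙ F Y ≅ F X ⋙ B.res f)
    (nat_id : ∀ (X : K) (a : A.fibre X),
      (nat (𝟙 X)).hom.app a ≫ (B.resId X).hom.app ((F X).obj a) =
        (F X).map ((A.resId X).hom.app a))
    (nat_comp : ∀ {X Y Z : K} (f : Y ⟶ X) (g : Z ⟶ Y) (k : Z ⟶ X) (hk : g ≫ f = k)
      (a : A.fibre X),
      (nat k).hom.app a ≫ (B.resComp f g k hk).hom.app ((F X).obj a) =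
        (F Z).map ((A.resComp f g k hk).hom.app a) ≫ (nat g).hom.app ((A.res f).obj a) ≫
          (B.res g).map ((nat f).hom.app a)) : A ⟶ B :=
  StrongTrans.mk (fun X => Cat.Hom.ofFunctor (F X.as.unop))
    (fun f => mkIso (nat f.as.unop))
    (fun {X Y f g} η => by
      obtain rfl := LocallyDiscrete.eq_of_hom η
      obtain rfl : η = 𝟙 f := Subsingleton.elim _ _
      rw [PrelaxFunctor.map₂_id, PrelaxFunctor.map₂_id]
      exact (congrArg (· ≫ _) (id_whiskerRight _ _)).trans ((Category.id_comp _).trans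
        ((congrArg (_ ≫ ·) (whiskerLeft_id _ _)).trans (Category.comp_id _)).symm))
    (fun X => Cat.Hom₂.ext (NatTrans.ext (funext fun a => by
      have := nat_id X.as.unop a
      refine this.trans (Eq.symm ?_)
      exact (congrArg (fun t => (F X.as.unop).map ((A.resId X.as.unop).hom.app a) ≫ t)
        (Category.comp_id _)).trans (Category.comp_id _))))
    (fun f g => Cat.Hom₂.ext (NatTrans.ext (funext fun a => by
      have := nat_comp f.as.unop g.as.unop _ rfl a
      rw [resComp_rfl, resComp_rfl] at this
      refine this.trans (Eq.symm ?_)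
      change (F _).map ((A.mapComp f g).hom.toNatTrans.app a) ≫
        𝟙 _ ≫ (nat g.as.unop).hom.app ((A.res f.as.unop).obj a) ≫ 𝟙 _ ≫
        (B.res g.as.unop).map ((nat f.as.unop).hom.app a) ≫ 𝟙 _ = _
      simp only [Category.id_comp, Category.comp_id]
      rfl)))

/-- Constructor for indexed natural transformations. -/
def mkMod {F G : A ⟶ B} (α : ∀ X, F.comp X ⟶ G.comp X)
    (nat : ∀ {X Y : K} (f : Y ⟶ X) (a : A.fibre X),
      (α Y).app ((A.res f).obj a) ≫ (G.nat f).hom.app a =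
        (F.nat f).hom.app a ≫ (B.res f).map ((α X).app a)) : F ⟶ G :=
  StrongTrans.Hom.of ⟨fun X => Cat.Hom₂.ofNatTrans (α X.as.unop), fun f => by
    ext a
    exact nat f.as.unop a⟩

/-- Constructor for invertible indexed natural transformations. -/
def mkModIso {F G : A ⟶ B} (α : ∀ X, F.comp X ≅ G.comp X)
    (nat : ∀ {X Y : K} (f : Y ⟶ X) (a : A.fibre X),
      (α Y).hom.app ((A.res f).obj a) ≫ (G.nat f).hom.app a =
        (F.nat f).hom.app a ≫ (B.res f).map ((α X).hom.app a)) : F ≅ G :=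
  StrongTrans.isoMk (fun X => mkIso (α X.as.unop)) (fun f => by
    ext a
    exact nat f.as.unop a)

/-- The component of an indexed natural transformation at `X`. -/
def StrongTrans.Hom.comp {F G : A ⟶ B} (α : F ⟶ G) (X : K) : F.comp X ⟶ G.comp X :=
  (α.as.app ⟨op X⟩).toNatTrans

lemma StrongTrans.Hom.nat {F G : A ⟶ B} (α : F ⟶ G) {X Y : K} (f : Y ⟶ X) (a : A.fibre X) :
      (α.comp Y).app ((A.res f).obj a) ≫ (G.nat f).hom.app a =
        (F.nat f).hom.app a ≫ (B.res f).map ((α.comp X).app a) :=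
  (congrArg (fun t => t.toNatTrans.app a) (α.as.naturality f.op.toLoc))

@[simp] lemma StrongTrans.id_comp_obj (X : K) (a : A.fibre X) :
    (StrongTrans.comp (𝟙 A) X).obj a = a := rfl

@[simp] lemma StrongTrans.id_comp_map (X : K) {a b : A.fibre X} (f : a ⟶ b) :
    (StrongTrans.comp (𝟙 A) X).map f = f := rfl

@[simp] lemma StrongTrans.comp_comp_obj (F : A ⟶ B) (G : B ⟶ C) (X : K) (a : A.fibre X) :
    (StrongTrans.comp (F ≫ G) X).obj a = (G.comp X).obj ((F.comp X).obj a) := rfl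

@[simp] lemma StrongTrans.comp_comp_map (F : A ⟶ B) (G : B ⟶ C) (X : K) {a b : A.fibre X}
    (f : a ⟶ b) : (StrongTrans.comp (F ≫ G) X).map f = (G.comp X).map ((F.comp X).map f) := rfl

lemma StrongTrans.id_nat_app {X Y : K} (f : Y ⟶ X) (a : A.fibre X) :
    (StrongTrans.nat (𝟙 A) f).hom.app a = 𝟙 _ :=
  Category.id_comp _

lemma StrongTrans.comp_nat_app (F : A ⟶ B) (G : B ⟶ C) {X Y : K} (f : Y ⟶ X) (a : A.fibre X) :
    (StrongTrans.nat (F ≫ G) f).hom.app a =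
      (G.comp Y).map ((F.nat f).hom.app a) ≫ (G.nat f).hom.app ((F.comp X).obj a) := by
  have h : (StrongTrans.nat (F ≫ G) f).hom.app a =
    𝟙 _ ≫ (G.comp Y).map ((F.nat f).hom.app a) ≫ 𝟙 _ ≫
      (G.nat f).hom.app ((F.comp X).obj a) ≫ 𝟙 _ := rfl
  rw [h, Category.id_comp, Category.id_comp]
  exact congrArg (fun t => (G.comp Y).map ((F.nat f).hom.app a) ≫ t) (Category.comp_id _)

/-- The component of an invertible indexed natural transformation. -/
def compIso {F G : A ⟶ B} (α : F ≅ G) (X : K) : F.comp X ≅ G.comp X where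
  hom := α.hom.comp X
  inv := α.inv.comp X
  hom_inv_id := congrArg (fun t : F ⟶ F => t.comp X) α.hom_inv_id
  inv_hom_id := congrArg (fun t : G ⟶ G => t.comp X) α.inv_hom_id

end Trans

end CategoryTheory.Pseudofunctor

namespace Fib

section Cartesian

variable {E : Type u₁} [Category.{v₁} E] {B : Type u₂} [Category.{v₂} B]

/-- `f` is a `P`-cartesian arrow. -/
def IsCart (P : E ⥤ B) {a e : E} (f : a ⟶ e) : Prop := P.IsStronglyCartesian (P.map f) f

lemma isCart_iff (P : E ⥤ B) {a e : E} (f : a ⟶ e) : IsCart P f ↔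
    ∀ ⦃z : E⦄ (g : z ⟶ e) (h : P.obj z ⟶ P.obj a), h ≫ P.map f = P.map g →
      ∃! k : z ⟶ a, P.map k = h ∧ k ≫ f = g := by
  have key : ∀ {z : E} (k : z ⟶ a) (h : P.obj z ⟶ P.obj a),
      P.IsHomLift h k ↔ P.map k = h := fun k h =>
    ⟨fun H => by simpa using (IsHomLift.fac P h k).symm, fun H => H ▸ inferInstance⟩
  constructor
  · intro H z g h hg
    have : P.IsStronglyCartesian (P.map f) f := H
    simpa only [key] using
      Functor.IsStronglyCartesian.universal_property P (P.map f) f h (P.map g) hg.symm g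
  · intro H
    refine { toIsHomLift := inferInstance, universal_property' := ?_ }
    intro z h g hg
    simp only [key]
    exact H g h (by simpa using IsHomLift.fac P (h ≫ P.map f) g)

lemma IsCart.comp {P : E ⥤ B} {a b c : E} {f : a ⟶ b} {g : b ⟶ c} (hf : IsCart P f)
    (hg : IsCart P g) : IsCart P (f ≫ g) := by
  have : P.IsStronglyCartesian (P.map f) f := hf
  have : P.IsStronglyCartesian (P.map g) g := hg
  unfold IsCart
  rw [P.map_comp]
  infer_instance

lemma isCart_of_isIso (P : E ⥤ B) {a b : E} (f : a ⟶ b) [IsIso f] : IsCart P f := by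
  unfold IsCart
  infer_instance

lemma IsCart.ext {P : E ⥤ B} {a e z : E} {f : a ⟶ e} (hf : IsCart P f) {k k' : z ⟶ a}
    (h : P.map k = P.map k') (h' : k ≫ f = k' ≫ f) : k = k' :=
  ((isCart_iff P f).1 hf (k' ≫ f) (P.map k') (by simp)).unique ⟨h, h'⟩ ⟨rfl, rfl⟩

/-- A functor `P` is a fibration (in the sense of Street): every arrow `t : b ⟶ P e` has a
cartesian lift, up to an isomorphism `b ≅ P a`. -/
def IsFibration (P : E ⥤ B) : Prop :=
  ∀ (e : E) (b : B) (t : b ⟶ P.obj e), ∃ (a : E) (θ : b ≅ P.obj a) (f : a ⟶ e),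
    IsCart P f ∧ θ.hom ≫ P.map f = t

/-- The objects of the essential fibre of `P` at `b`: pairs `(A, α : b ≅ P A)`. -/
structure EssFib (P : E ⥤ B) (b : B) where
  pt : E
  iso : b ≅ P.obj pt

namespace EssFib

variable {P : E ⥤ B} {b : B}

/-- Arrows of the essential fibre. -/
@[ext]
structure Hom (x y : EssFib P b) where
  hom : x.pt ⟶ y.pt
  w : x.iso.hom ≫ P.map hom = y.iso.hom

attribute [simp] Hom.w

/-- Arrows of the essential fibre are the arrows of `E` compatible with the isomorphisms. -/
instance : Category (EssFib P b) where
  Hom := Hom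
  id x := ⟨𝟙 _, by simp⟩
  comp f g := ⟨f.hom ≫ g.hom, by simp [← Category.assoc]⟩
  id_comp _ := Hom.ext (Category.id_comp _)
  comp_id _ := Hom.ext (Category.comp_id _)
  assoc _ _ _ := Hom.ext (Category.assoc _ _ _)

@[ext] lemma hom_ext {x y : EssFib P b} {f g : x ⟶ y} (h : f.hom = g.hom) : f = g := Hom.ext h
@[simp] lemma id_hom (x : EssFib P b) : Hom.hom (𝟙 x) = 𝟙 x.pt := rfl
@[simp] lemma comp_hom {x y z : EssFib P b} (f : x ⟶ y) (g : y ⟶ z) :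
    Hom.hom (f ≫ g) = f.hom ≫ g.hom := rfl

lemma ext_of_isCart {x y : EssFib P b} {e : E} {f : y.pt ⟶ e} (hf : IsCart P f) {k k' : x ⟶ y}
    (h : k.hom ≫ f = k'.hom ≫ f) : k = k' :=
  hom_ext (hf.ext (by rw [← cancel_epi x.iso.hom, k.w, k'.w]) h)

/-- Isomorphisms of the essential fibre. -/
@[simps]
def isoMk {x y : EssFib P b} (e : x.pt ≅ y.pt) (w : x.iso.hom ≫ P.map e.hom = y.iso.hom) :
    x ≅ y where
  hom := ⟨e.hom, w⟩
  inv := ⟨e.inv, by rw [← w]; simp [← P.map_comp]⟩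
  hom_inv_id := hom_ext e.hom_inv_id
  inv_hom_id := hom_ext e.inv_hom_id

end EssFib

/-- The data exhibiting an object `x` of the essential fibre at `b` as the domain of a cartesian
lift of `t : b ⟶ P e`. -/
structure Lift {P : E ⥤ B} {b : B} (x : EssFib P b) {e : E} (t : b ⟶ P.obj e) where
  hom : x.pt ⟶ e
  isCart : IsCart P hom
  w : x.iso.hom ≫ P.map hom = t

namespace Lift

variable {P : E ⥤ B} {b : B} {x y : EssFib P b} {e : E} {t : b ⟶ P.obj e}

lemma exists_desc (L : Lift y t) (g : x.pt ⟶ e) (hg : x.iso.hom ≫ P.map g = t) :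
    ∃ k : x ⟶ y, k.hom ≫ L.hom = g := by
  obtain ⟨k, ⟨h₁, h₂⟩, -⟩ := (isCart_iff P L.hom).1 L.isCart g (x.iso.inv ≫ y.iso.hom) (by
    rw [Category.assoc, L.w, ← hg]; simp)
  exact ⟨⟨k, by rw [h₁]; simp⟩, h₂⟩

/-- The comparison given by the universal property of a cartesian lift. -/
noncomputable def desc (L : Lift y t) (g : x.pt ⟶ e) (hg : x.iso.hom ≫ P.map g = t) : x ⟶ y :=
  (L.exists_desc g hg).choose

lemma fac (L : Lift y t) (g : x.pt ⟶ e) (hg : x.iso.hom ≫ P.map g = t) :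
    (L.desc g hg).hom ≫ L.hom = g :=
  (L.exists_desc g hg).choose_spec

/-- The domains of two cartesian lifts are isomorphic. -/
noncomputable def unique (L : Lift x t) (M : Lift y t) : x ≅ y where
  hom := M.desc L.hom L.w
  inv := L.desc M.hom M.w
  hom_inv_id := EssFib.ext_of_isCart L.isCart (by
    rw [EssFib.comp_hom, Category.assoc, fac, fac]; simp)
  inv_hom_id := EssFib.ext_of_isCart M.isCart (by
    rw [EssFib.comp_hom, Category.assoc, fac, fac]; simp)

lemma unique_hom (L : Lift x t) (M : Lift y t) : (L.unique M).hom.hom ≫ M.hom = L.hom :=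
  M.fac _ L.w

lemma unique_inv (L : Lift x t) (M : Lift y t) : (L.unique M).inv.hom ≫ L.hom = M.hom :=
  L.fac _ M.w

end Lift

/-- The domain of a chosen cartesian lift. -/
noncomputable def IsFibration.dom {P : E ⥤ B} (hP : IsFibration P) {e : E} {b : B}
    (t : b ⟶ P.obj e) : EssFib P b :=
  ⟨(hP e b t).choose, (hP e b t).choose_spec.choose⟩

/-- A chosen cartesian lift. -/
noncomputable def IsFibration.lift {P : E ⥤ B} (hP : IsFibration P) {e : E} {b : B}
    (t : b ⟶ P.obj e) : Lift (hP.dom t) t where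
  hom := (hP e b t).choose_spec.choose_spec.choose
  isCart := (hP e b t).choose_spec.choose_spec.choose_spec.1
  w := (hP e b t).choose_spec.choose_spec.choose_spec.2

end Cartesian

section Indexed

open Pseudofunctor StrongTrans

variable {K : Type u} [Category.{v} K]

/-- A `K`-indexed functor is a `K`-indexed fibration when its components are fibrations and the
restriction functors preserve cartesian arrows. -/
structure IsIndexedFibration {E D : IndCat.{v, u, v', u'} K} (p : E ⟶ D) : Prop where
  isFibration (X : K) : IsFibration (StrongTrans.comp p X)
  isCart_res {X Y : K} (y : Y ⟶ X) {a e : E.fibre X} (f : a ⟶ e)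
    (hf : IsCart (StrongTrans.comp p X) f) : IsCart (StrongTrans.comp p Y) ((E.res y).map f)

/-- An indexed functor preserves cartesian arrows when its components do. -/
def PreservesCart {E E' D D' : IndCat.{v, u, v', u'} K} (p : E ⟶ D) (q : E' ⟶ D')
    (F : E ⟶ E') : Prop :=
  ∀ (X : K) ⦃a e : E.fibre X⦄ (f : a ⟶ e), IsCart (StrongTrans.comp p X) f →
    IsCart (StrongTrans.comp q X) ((StrongTrans.comp F X).map f)

/-- The class of `K`-indexed fibrations. -/
def fibClass (K : Type u) [Category.{v} K] : Bicat.FibrationClass (IndCat.{v, u, v', u'} K) where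
  fib p := IsIndexedFibration p
  cart p q F := PreservesCart p q F
  cart_id _ := fun _ _ _ _ hf => hf
  cart_comp hF hG := fun X _ _ _ hf => hG X _ (hF X _ hf)

/-- The bicategory of `K`-indexed fibrations over `D`. -/
abbrev FibOver (D : IndCat.{v, u, v', u'} K) := Bicat.Slice (fibClass.{v, u, v', u'} K) D

end Indexed

section R

open Pseudofunctor StrongTrans
open scoped CoGrothendieck

variable {K : Type u} [Category.{v} K] {D : IndCat.{v, u, v', u'} K}

lemma nat_id_inv {A B : IndCat.{v, u, v', u'} K} (F : A ⟶ B) (X : K) (a : A.fibre X) :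
    (B.resId X).inv.app ((StrongTrans.comp F X).obj a) ≫ (StrongTrans.nat F (𝟙 X)).inv.app a =
      (StrongTrans.comp F X).map ((A.resId X).inv.app a) := by
  have h := StrongTrans.nat_id F X a
  have e : (StrongTrans.comp F X).map ((A.resId X).inv.app a) ≫
      (StrongTrans.comp F X).map ((A.resId X).hom.app a) = 𝟙 _ := by
    rw [← Functor.map_comp, Iso.inv_hom_id_app]; simp
  rw [← h] at e
  rw [← cancel_mono ((StrongTrans.nat F (𝟙 X)).hom.app a),
    ← cancel_mono ((B.resId X).hom.app ((StrongTrans.comp F X).obj a))]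
  simp only [Category.assoc]
  rw [e, Iso.inv_hom_id_app_assoc]
  exact Iso.inv_hom_id_app _ _

lemma nat_comp_inv {A B : IndCat.{v, u, v', u'} K} (F : A ⟶ B) {X Y Z : K} (f : Y ⟶ X)
    (g : Z ⟶ Y) (k : Z ⟶ X) (hk : g ≫ f = k) (a : A.fibre X) :
    (B.resComp f g k hk).inv.app ((StrongTrans.comp F X).obj a) ≫
      (StrongTrans.nat F k).inv.app a =
    (B.res g).map ((StrongTrans.nat F f).inv.app a) ≫
      (StrongTrans.nat F g).inv.app ((A.res f).obj a) ≫
        (StrongTrans.comp F Z).map ((A.resComp f g k hk).inv.app a) := by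
  have h := StrongTrans.nat_comp F f g k hk a
  have e₁ : (StrongTrans.comp F Z).map ((A.resComp f g k hk).inv.app a) ≫
      (StrongTrans.comp F Z).map ((A.resComp f g k hk).hom.app a) = 𝟙 _ := by
    rw [← Functor.map_comp, Iso.inv_hom_id_app]; simp
  have e₂ : (B.res g).map ((StrongTrans.nat F f).inv.app a) ≫
      (B.res g).map ((StrongTrans.nat F f).hom.app a) = 𝟙 _ := by
    rw [← Functor.map_comp, Iso.inv_hom_id_app]; simp
  have e₃ : (StrongTrans.nat F g).inv.app ((A.res f).obj a) ≫
      (StrongTrans.nat F g).hom.app ((A.res f).obj a) = 𝟙 _ := Iso.inv_hom_id_app _ _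
  have e₄ : (StrongTrans.nat F k).inv.app a ≫ (StrongTrans.nat F k).hom.app a = 𝟙 _ :=
    Iso.inv_hom_id_app _ _
  rw [← cancel_mono ((StrongTrans.nat F k).hom.app a),
    ← cancel_mono ((B.resComp f g k hk).hom.app ((StrongTrans.comp F X).obj a))]
  simp only [Category.assoc]
  rw [reassoc_of% e₄]
  rw [h, reassoc_of% e₁, reassoc_of% e₃, e₂]
  exact Iso.inv_hom_id_app _ _

/-- The second component of an object of the Grothendieck construction. -/
def cfib (X : ∫ᶜ D) : D.fibre X.base := X.fiber

/-- The second component of an arrow of the Grothendieck construction. -/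
def chom {X Y : ∫ᶜ D} (f : Y ⟶ X) : cfib Y ⟶ (D.res f.base).obj (cfib X) := f.fiber

lemma chom_id (X : ∫ᶜ D) : chom (𝟙 X) = (D.resId X.base).inv.app (cfib X) := rfl

lemma base_comp {X Y Z : ∫ᶜ D} (f : Y ⟶ X) (g : Z ⟶ Y) (k : Z ⟶ X) (hk : g ≫ f = k) :
    g.base ≫ f.base = k.base := by
  subst hk; rfl

lemma chom_comp {X Y Z : ∫ᶜ D} (f : Y ⟶ X) (g : Z ⟶ Y) (k : Z ⟶ X) (hk : g ≫ f = k) :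
    chom k = chom g ≫ (D.res g.base).map (chom f) ≫
      (D.resComp f.base g.base k.base (base_comp f g k hk)).inv.app (cfib X) := by
  subst hk
  rw [show D.resComp f.base g.base (g ≫ f).base _ = _ from resComp_rfl _ _ _]
  rfl

namespace FibOver

variable (p : FibOver D)

/-- The functor `p^X : E(X) ⥤ D(X)`. -/
abbrev pr (X : K) : p.total.fibre X ⥤ D.fibre X := StrongTrans.comp p.proj X

/-- The fibre of `R(p)` at `(X, U)`: the essential fibre of `p^X` at `U`. -/
abbrev rFib (X : ∫ᶜ D) := EssFib (pr p X.base) (cfib X)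

variable {p}

/-- The arrow `V ⟶ D(y) U ≅ D(y) (p A) ≅ p (E(y) A)`. -/
def tgt {X Y : ∫ᶜ D} (f : Y ⟶ X) (x : rFib p X) :
    cfib Y ⟶ (pr p Y.base).obj ((p.total.res f.base).obj x.pt) :=
  chom f ≫ (D.res f.base).map x.iso.hom ≫ (StrongTrans.nat p.proj f.base).inv.app x.pt

lemma tgt_map {X Y : ∫ᶜ D} (f : Y ⟶ X) {x y : rFib p X} (k : x ⟶ y) :
    tgt f x ≫ (pr p Y.base).map ((p.total.res f.base).map k.hom) = tgt f y := by
  have h := (StrongTrans.nat p.proj f.base).inv.naturality k.hom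
  have h' := congrArg (D.res f.base).map k.w
  rw [Functor.map_comp] at h'
  unfold tgt
  rw [Category.assoc, Category.assoc, ← h', Category.assoc]
  exact congrArg (fun t => chom f ≫ (D.res f.base).map x.iso.hom ≫ t) h.symm

/-- The chosen cartesian lift of `tgt f x`. -/
noncomputable def rLift₀ {X Y : ∫ᶜ D} (f : Y ⟶ X) (x : rFib p X) :
    Lift ((p.fib.isFibration Y.base).dom (tgt f x)) (tgt f x) :=
  (p.fib.isFibration Y.base).lift _

lemma rRes_aux {X Y : ∫ᶜ D} (f : Y ⟶ X) {x y : rFib p X} (k : x ⟶ y) {z : rFib p Y}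
    (L : Lift z (tgt f x)) :
    z.iso.hom ≫ (pr p Y.base).map (L.hom ≫ (p.total.res f.base).map k.hom) = tgt f y := by
  rw [Functor.map_comp, ← Category.assoc, L.w, tgt_map]

/-- The transition functor of `R(p)` along `(y, a)`: cartesian lifting. -/
noncomputable def rRes {X Y : ∫ᶜ D} (f : Y ⟶ X) : rFib p X ⥤ rFib p Y where
  obj x := (p.fib.isFibration Y.base).dom (tgt f x)
  map {x y} k := (rLift₀ f y).desc ((rLift₀ f x).hom ≫ (p.total.res f.base).map k.hom)
    (rRes_aux f k _)
  map_id x := EssFib.ext_of_isCart (rLift₀ f x).isCart (by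
    rw [Lift.fac]; simp)
  map_comp {x y z} k l := EssFib.ext_of_isCart (rLift₀ f z).isCart (by
    simp only [EssFib.comp_hom, Category.assoc]
    rw [Lift.fac, Lift.fac, ← Category.assoc, Lift.fac]; simp)

/-- The chosen cartesian lift of `tgt f x`. -/
noncomputable def rLift {X Y : ∫ᶜ D} (f : Y ⟶ X) (x : rFib p X) :
    Lift ((rRes f).obj x) (tgt f x) :=
  rLift₀ f x

lemma rRes_map_hom {X Y : ∫ᶜ D} (f : Y ⟶ X) {x y : rFib p X} (k : x ⟶ y) :
    ((rRes f).map k).hom ≫ (rLift f y).hom =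
      (rLift f x).hom ≫ (p.total.res f.base).map k.hom :=
  Lift.fac _ _ (rRes_aux f k _)

lemma idLift_w (X : ∫ᶜ D) (x : rFib p X) :
    x.iso.hom ≫ (pr p X.base).map ((p.total.resId X.base).inv.app x.pt) = tgt (𝟙 X) x := by
  have h := nat_id_inv p.proj X.base x.pt
  have h' := (D.resId X.base).inv.naturality x.iso.hom
  unfold tgt
  rw [← h, chom_id, ← Category.assoc, ← Category.assoc]
  exact congrArg (· ≫ _) h'

/-- An object is a cartesian lift for the transition along an identity. -/
def idLift (X : ∫ᶜ D) (x : rFib p X) : Lift x (tgt (𝟙 X) x) where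
  hom := (p.total.resId X.base).inv.app x.pt
  isCart := isCart_of_isIso _ _
  w := idLift_w X x

lemma rId_aux (X : ∫ᶜ D) {x y : rFib p X} (k : x ⟶ y) :
    (rRes (𝟙 X)).map k ≫ ((rLift (𝟙 X) y).unique (idLift X y)).hom =
      ((rLift (𝟙 X) x).unique (idLift X x)).hom ≫ k := by
  refine EssFib.ext_of_isCart (idLift X y).isCart ?_
  have h := Lift.unique_hom (rLift (𝟙 X) y) (idLift X y)
  have h' := Lift.unique_hom (rLift (𝟙 X) x) (idLift X x)
  have h'' := (p.total.resId X.base).inv.naturality k.hom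
  simp only [EssFib.comp_hom, Category.assoc]
  rw [h, rRes_map_hom, ← h', Category.assoc]
  exact congrArg (_ ≫ ·) h''.symm

/-- The unit constraint of `R(p)`. -/
noncomputable def rId (X : ∫ᶜ D) : rRes (p := p) (𝟙 X) ≅ 𝟭 (rFib p X) :=
  NatIso.ofComponents (fun x => (rLift (𝟙 X) x).unique (idLift X x)) (rId_aux X)

lemma rId_hom (X : ∫ᶜ D) (x : rFib p X) :
    ((rId X).hom.app x).hom ≫ (p.total.resId X.base).inv.app x.pt = (rLift (𝟙 X) x).hom :=
  Lift.unique_hom (rLift (𝟙 X) x) (idLift X x)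

lemma rId_inv (X : ∫ᶜ D) (x : rFib p X) :
    ((rId X).inv.app x).hom ≫ (rLift (𝟙 X) x).hom = (p.total.resId X.base).inv.app x.pt :=
  Lift.unique_inv (rLift (𝟙 X) x) (idLift X x)

lemma tgt_comp {X Y Z : ∫ᶜ D} (f : Y ⟶ X) (g : Z ⟶ Y) (k : Z ⟶ X) (hk : g ≫ f = k)
    (x : rFib p X) (y : rFib p Y) (L : Lift y (tgt f x)) :
    tgt g y ≫ (pr p Z.base).map ((p.total.res g.base).map L.hom) ≫ (pr p Z.base).map
      ((p.total.resComp f.base g.base k.base (base_comp f g k hk)).inv.app x.pt) = tgt k x := by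
  have h₂ := congrArg (D.res g.base).map L.w
  have h₃ := nat_comp_inv p.proj _ _ _ (base_comp f g k hk) x.pt
  have h₄ := (StrongTrans.nat p.proj g.base).inv.naturality L.hom
  have h₅ := (D.resComp _ _ _ (base_comp f g k hk)).inv.naturality x.iso.hom
  rw [Functor.comp_map, Functor.comp_map] at h₄
  rw [Functor.comp_map] at h₅
  unfold tgt at h₂ ⊢
  rw [chom_comp f g k hk]
  simp only [Category.assoc, Functor.map_comp] at h₂ ⊢
  rw [← reassoc_of% h₄, reassoc_of% h₂, ← h₃, reassoc_of% h₅]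

/-- A composite of cartesian lifts, seen as a cartesian lift for the transition along a
composite. -/
def compLift {X Y Z : ∫ᶜ D} (f : Y ⟶ X) (g : Z ⟶ Y) (k : Z ⟶ X) (hk : g ≫ f = k)
    (x : rFib p X) {y : rFib p Y} (L : Lift y (tgt f x)) {z : rFib p Z} (M : Lift z (tgt g y)) :
    Lift z (tgt k x) where
  hom := M.hom ≫ (p.total.res g.base).map L.hom ≫
    (p.total.resComp f.base g.base k.base (base_comp f g k hk)).inv.app x.pt
  isCart := M.isCart.comp ((p.fib.isCart_res _ _ L.isCart).comp (isCart_of_isIso _ _))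
  w := by
    rw [Functor.map_comp, Functor.map_comp, ← Category.assoc, M.w, tgt_comp f g k hk x y L]

/-- The comparison of the transition along a composite with the composite transition. -/
noncomputable def rCompApp {X Y Z : ∫ᶜ D} (f : Y ⟶ X) (g : Z ⟶ Y) (k : Z ⟶ X) (hk : g ≫ f = k)
    (x : rFib p X) : (rRes k).obj x ≅ (rRes g).obj ((rRes f).obj x) :=
  (rLift k x).unique (compLift f g k hk x (rLift f x) (rLift g ((rRes f).obj x)))

lemma rCompApp_hom {X Y Z : ∫ᶜ D} (f : Y ⟶ X) (g : Z ⟶ Y) (k : Z ⟶ X) (hk : g ≫ f = k)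
    (x : rFib p X) :
    (rCompApp f g k hk x).hom.hom ≫ (rLift g ((rRes f).obj x)).hom ≫
      (p.total.res g.base).map (rLift f x).hom =
    (rLift k x).hom ≫
      (p.total.resComp f.base g.base k.base (base_comp f g k hk)).hom.app x.pt := by
  have h := Lift.unique_hom (rLift k x)
    (compLift f g k hk x (rLift f x) (rLift g ((rRes f).obj x)))
  rw [← h]
  simp only [compLift, Category.assoc, Iso.inv_hom_id_app]
  exact congrArg (fun t => _ ≫ _ ≫ t) (Category.comp_id _).symm

lemma isCart_comp₂ {X Y Z : ∫ᶜ D} (f : Y ⟶ X) (g : Z ⟶ Y) (x : rFib p X) :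
    IsCart (pr p Z.base) ((rLift g ((rRes f).obj x)).hom ≫
      (p.total.res g.base).map (rLift f x).hom) :=
  (rLift g _).isCart.comp (p.fib.isCart_res _ _ (rLift f x).isCart)

lemma rComp_aux {X Y Z : ∫ᶜ D} (f : Y ⟶ X) (g : Z ⟶ Y) (k : Z ⟶ X) (hk : g ≫ f = k)
    {x y : rFib p X} (l : x ⟶ y) :
    (rRes k).map l ≫ (rCompApp f g k hk y).hom =
      (rCompApp f g k hk x).hom ≫ (rRes g).map ((rRes f).map l) := by
  refine EssFib.ext_of_isCart (isCart_comp₂ f g y) ?_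
  have h₁ := rCompApp_hom f g k hk y
  have h₂ := rCompApp_hom f g k hk x
  have h₃ := rRes_map_hom k l
  have h₄ := rRes_map_hom g ((rRes f).map l)
  have h₅ := congrArg (p.total.res g.base).map (rRes_map_hom f l)
  have h₆ := (p.total.resComp f.base g.base k.base (base_comp f g k hk)).hom.naturality l.hom
  rw [Functor.comp_map] at h₆
  simp only [EssFib.comp_hom, Category.assoc, Functor.map_comp] at h₅ ⊢
  rw [h₁, reassoc_of% h₃, reassoc_of% h₄, h₅, h₆]
  simpa only [Category.assoc] using congrArg (· ≫ _) h₂.symm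

/-- The composition constraint of `R(p)`. -/
noncomputable def rComp {X Y Z : ∫ᶜ D} (f : Y ⟶ X) (g : Z ⟶ Y) (k : Z ⟶ X) (hk : g ≫ f = k) :
    rRes (p := p) k ≅ rRes f ⋙ rRes g :=
  NatIso.ofComponents (fun x => rCompApp f g k hk x) (rComp_aux f g k hk)

lemma rComp_hom {X Y Z : ∫ᶜ D} (f : Y ⟶ X) (g : Z ⟶ Y) (k : Z ⟶ X) (hk : g ≫ f = k)
    (x : rFib p X) :
    ((rComp f g k hk).hom.app x).hom ≫ (rLift g ((rRes f).obj x)).hom ≫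
      (p.total.res g.base).map (rLift f x).hom =
    (rLift k x).hom ≫
      (p.total.resComp f.base g.base k.base (base_comp f g k hk)).hom.app x.pt :=
  rCompApp_hom f g k hk x

lemma rComp_id_left {X Y : ∫ᶜ D} (f : Y ⟶ X) (h : 𝟙 Y ≫ f = f) (x : rFib p X) :
    (rComp f (𝟙 Y) f h).hom.app x = (rId Y).inv.app ((rRes f).obj x) := by
  refine EssFib.ext_of_isCart (isCart_comp₂ f (𝟙 Y) x) ?_
  have h₁ := rId_inv Y ((rRes f).obj x)
  have h₂ := (p.total.resId Y.base).inv.naturality (rLift f x).hom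
  refine (rComp_hom f (𝟙 Y) f h x).trans ?_
  rw [reassoc_of% h₁]
  exact (congrArg (_ ≫ ·) (p.total.resComp_id_left f.base (Category.id_comp _) x.pt)).trans h₂

lemma rComp_id_right {X Y : ∫ᶜ D} (f : Y ⟶ X) (h : f ≫ 𝟙 X = f) (x : rFib p X) :
    (rComp (𝟙 X) f f h).hom.app x = (rRes f).map ((rId X).inv.app x) := by
  refine EssFib.ext_of_isCart (isCart_comp₂ (𝟙 X) f x) ?_
  have h₁ := congrArg (p.total.res f.base).map (rId_inv X x)
  have h₂ := rRes_map_hom f ((rId X).inv.app x)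
  rw [Functor.map_comp] at h₁
  refine (rComp_hom (𝟙 X) f f h x).trans ?_
  refine Eq.trans ?_ ((reassoc_of% h₂) _).symm
  refine Eq.trans ?_ (congrArg (_ ≫ ·) h₁.symm)
  exact congrArg (_ ≫ ·) (p.total.resComp_id_right f.base (Category.comp_id _) x.pt)

lemma rComp_assoc {X Y Z W : ∫ᶜ D} (f : Y ⟶ X) (g : Z ⟶ Y) (h : W ⟶ Z)
    (gf : Z ⟶ X) (hg : W ⟶ Y) (k : W ⟶ X) (h₁ : g ≫ f = gf) (h₂ : h ≫ g = hg)
    (h₃ : h ≫ gf = k) (h₄ : hg ≫ f = k) (x : rFib p X) :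
    (rComp gf h k h₃).hom.app x ≫ (rRes h).map ((rComp f g gf h₁).hom.app x) =
      (rComp f hg k h₄).hom.app x ≫ (rComp g h hg h₂).hom.app ((rRes f).obj x) := by
  have hc : IsCart (pr p W.base) ((rLift h ((rRes g).obj ((rRes f).obj x))).hom ≫
      (p.total.res h.base).map ((rLift g ((rRes f).obj x)).hom ≫
      (p.total.res g.base).map (rLift f x).hom)) :=
    (rLift h _).isCart.comp (p.fib.isCart_res _ _ (isCart_comp₂ f g x))
  refine EssFib.ext_of_isCart hc ?_
  have e₁ := rComp_hom gf h k h₃ x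
  have e₂ := congrArg (p.total.res h.base).map (rComp_hom f g gf h₁ x)
  have e₃ := rComp_hom f hg k h₄ x
  have e₄ := rComp_hom g h hg h₂ ((rRes f).obj x)
  have e₅ := rRes_map_hom h ((rComp f g gf h₁).hom.app x)
  have e₆ := p.total.resComp_assoc f.base g.base h.base gf.base hg.base k.base
    (base_comp _ _ _ h₁) (base_comp _ _ _ h₂) (base_comp _ _ _ h₃) (base_comp _ _ _ h₄) x.pt
  have e₇ := (p.total.resComp g.base h.base hg.base (base_comp _ _ _ h₂)).hom.naturality
    (rLift f x).hom
  rw [Functor.comp_map] at e₇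
  simp only [EssFib.comp_hom, Category.assoc, Functor.map_comp] at e₂ ⊢
  refine Eq.trans (congrArg (_ ≫ ·) ((reassoc_of% e₅) _)) ?_
  refine Eq.trans (congrArg (fun t => _ ≫ _ ≫ t) e₂) ?_
  refine Eq.trans ((reassoc_of% e₁) _) ?_
  refine Eq.trans (congrArg (_ ≫ ·) e₆) ?_
  refine Eq.trans ((reassoc_of% e₃) _).symm ?_
  refine Eq.trans (congrArg (fun t => _ ≫ _ ≫ t) e₇) ?_
  exact congrArg (_ ≫ ·) ((reassoc_of% e₄) _).symm

variable (p)

/-- The `𝒢(D)`-indexed category of essential fibres of an indexed fibration over `D`. -/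
noncomputable def rObj : IndCat.{max v v', max u u', v', max u' v'} (∫ᶜ D) :=
  mkInd (rFib p) rRes rId rComp rComp_id_left rComp_id_right rComp_assoc

variable {p}

lemma rObj_resComp {X Y Z : ∫ᶜ D} (f : Y ⟶ X) (g : Z ⟶ Y) (k : Z ⟶ X) (hk : g ≫ f = k)
    (x : rFib p X) : ((rObj p).resComp f g k hk).hom.app x = (rComp f g k hk).hom.app x :=
  congrArg (fun t : (rRes k ≅ rRes f ⋙ rRes g) => t.hom.app x)
    (mkInd_resComp (rFib p) rRes rId rComp rComp_id_left rComp_id_right rComp_assoc f g k hk)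

lemma rObj_resId (X : ∫ᶜ D) (x : rFib p X) :
    ((rObj p).resId X).hom.app x = (rId X).hom.app x := rfl

end FibOver
end R
end Fib

namespace Fib
section R

open Pseudofunctor StrongTrans
open scoped CoGrothendieck

variable {K : Type u} [Category.{v} K] {D : IndCat.{v, u, v', u'} K}

namespace FibOver

variable {p q r : FibOver D}

/-- The component at `X` of the invertible 2-cell of an arrow of indexed fibrations. -/
def phi (F : p ⟶ q) (X : K) (a : p.total.fibre X) :
    (pr q X).obj ((StrongTrans.comp F.hom X).obj a) ≅ (pr p X).obj a :=
  (Pseudofunctor.compIso F.iso X).app a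

lemma phi_naturality (F : p ⟶ q) (X : K) {a b : p.total.fibre X} (k : a ⟶ b) :
    (phi F X a).inv ≫ (pr q X).map ((StrongTrans.comp F.hom X).map k) =
      (pr p X).map k ≫ (phi F X b).inv :=
  ((Pseudofunctor.compIso F.iso X).inv.naturality k).symm

lemma phi_nat (F : p ⟶ q) {X Y : K} (f : Y ⟶ X) (a : p.total.fibre X) :
    (StrongTrans.nat p.proj f).inv.app a ≫ (phi F Y ((p.total.res f).obj a)).inv ≫
      (pr q Y).map ((StrongTrans.nat F.hom f).hom.app a) =
    (D.res f).map (phi F X a).inv ≫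
      (StrongTrans.nat q.proj f).inv.app ((StrongTrans.comp F.hom X).obj a) := by
  have h := StrongTrans.Hom.nat F.iso.inv f a
  rw [StrongTrans.comp_nat_app] at h
  rw [← cancel_epi ((StrongTrans.nat p.proj f).hom.app a), Iso.hom_inv_id_app_assoc,
    ← cancel_mono ((StrongTrans.nat q.proj f).hom.app ((StrongTrans.comp F.hom X).obj a))]
  simp only [Category.assoc, Iso.inv_hom_id_app]
  refine h.trans ?_
  exact congrArg (_ ≫ ·) (Category.comp_id _).symm

/-- The functor induced on essential fibres by an arrow of indexed fibrations:
`(A, α) ↦ (F A, φ⁻¹ ∘ α)`. -/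
abbrev rMapApp (F : p ⟶ q) (X : ∫ᶜ D) : rFib p X ⥤ rFib q X where
  obj x := ⟨(StrongTrans.comp F.hom X.base).obj x.pt, x.iso ≪≫ (phi F X.base x.pt).symm⟩
  map k := ⟨(StrongTrans.comp F.hom X.base).map k.hom, by
    simp only [Iso.trans_hom, Iso.symm_hom, Category.assoc]
    rw [phi_naturality, ← Category.assoc, k.w]⟩
  map_id _ := EssFib.hom_ext (CategoryTheory.Functor.map_id _ _)
  map_comp _ _ := EssFib.hom_ext (CategoryTheory.Functor.map_comp _ _ _)

lemma rMapApp_map_hom (F : p ⟶ q) (X : ∫ᶜ D) {x y : rFib p X} (k : x ⟶ y) :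
    ((rMapApp F X).map k).hom = (StrongTrans.comp F.hom X.base).map k.hom := rfl

/-- Arrows of indexed fibrations send cartesian lifts to cartesian lifts. -/
def mapLift (F : p ⟶ q) {X Y : ∫ᶜ D} (f : Y ⟶ X) (x : rFib p X) {y : rFib p Y}
    (L : Lift y (tgt f x)) : Lift ((rMapApp F Y).obj y) (tgt f ((rMapApp F X).obj x)) where
  hom := (StrongTrans.comp F.hom Y.base).map L.hom ≫ (StrongTrans.nat F.hom f.base).hom.app x.pt
  isCart := (F.cart _ _ L.isCart).comp (isCart_of_isIso _ ((StrongTrans.nat F.hom f.base).app x.pt).hom)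
  w := by
    have h₁ := phi_naturality F Y.base L.hom
    have h₂ := phi_nat F f.base x.pt
    have h₃ : ((rMapApp F Y).obj y).iso.hom = y.iso.hom ≫ (phi F Y.base y.pt).inv := rfl
    have h₄ : (D.res f.base).map ((rMapApp F X).obj x).iso.hom =
      (D.res f.base).map x.iso.hom ≫ (D.res f.base).map (phi F X.base x.pt).inv :=
      Functor.map_comp _ _ _
    have h₅ := L.w
    rw [h₃, Functor.map_comp]
    unfold tgt at h₅ ⊢
    rw [h₄]
    simp only [Category.assoc]
    rw [reassoc_of% h₁, reassoc_of% h₅, h₂]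

/-- The pseudonaturality comparison for `R` on arrows, at an object. -/
noncomputable def rNatApp (F : p ⟶ q) {X Y : ∫ᶜ D} (f : Y ⟶ X) (x : rFib p X) :
    (rMapApp F Y).obj ((rRes f).obj x) ≅ (rRes f).obj ((rMapApp F X).obj x) :=
  (mapLift F f x (rLift f x)).unique (rLift f ((rMapApp F X).obj x))

lemma rNatApp_hom (F : p ⟶ q) {X Y : ∫ᶜ D} (f : Y ⟶ X) (x : rFib p X) :
    (rNatApp F f x).hom.hom ≫ (rLift f ((rMapApp F X).obj x)).hom =
      (StrongTrans.comp F.hom Y.base).map (rLift f x).hom ≫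
        (StrongTrans.nat F.hom f.base).hom.app x.pt :=
  Lift.unique_hom _ _

lemma rNat_aux (F : p ⟶ q) {X Y : ∫ᶜ D} (f : Y ⟶ X) {x y : rFib p X} (k : x ⟶ y) :
    (rMapApp F Y).map ((rRes f).map k) ≫ (rNatApp F f y).hom =
      (rNatApp F f x).hom ≫ (rRes f).map ((rMapApp F X).map k) := by
  refine EssFib.ext_of_isCart (rLift f ((rMapApp F X).obj y)).isCart ?_
  have h₁ := rNatApp_hom F f y
  have h₂ := rNatApp_hom F f x
  have h₃ := rRes_map_hom f ((rMapApp F X).map k)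
  have h₄ := congrArg (StrongTrans.comp F.hom Y.base).map (rRes_map_hom f k)
  have h₅ := (StrongTrans.nat F.hom f.base).hom.naturality k.hom
  rw [Functor.comp_map, Functor.comp_map] at h₅
  simp only [EssFib.comp_hom, Category.assoc, Functor.map_comp] at h₃ h₄ ⊢
  rw [h₁, h₃, reassoc_of% h₄, reassoc_of% h₂, h₅]

/-- The pseudonaturality constraint for `R` on arrows. -/
noncomputable def rNat (F : p ⟶ q) {X Y : ∫ᶜ D} (f : Y ⟶ X) :
    rRes f ⋙ rMapApp F Y ≅ rMapApp F X ⋙ rRes f :=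
  NatIso.ofComponents (fun x => rNatApp F f x) (rNat_aux F f)

lemma rNat_hom (F : p ⟶ q) {X Y : ∫ᶜ D} (f : Y ⟶ X) (x : rFib p X) :
    ((rNat F f).hom.app x).hom ≫ (rLift f ((rMapApp F X).obj x)).hom =
      (StrongTrans.comp F.hom Y.base).map (rLift f x).hom ≫
        (StrongTrans.nat F.hom f.base).hom.app x.pt :=
  rNatApp_hom F f x

lemma rNat_id (F : p ⟶ q) (X : ∫ᶜ D) (x : rFib p X) :
    (rNat F (𝟙 X)).hom.app x ≫ (rId X).hom.app ((rMapApp F X).obj x) =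
      (rMapApp F X).map ((rId X).hom.app x) := by
  refine EssFib.ext_of_isCart (idLift X ((rMapApp F X).obj x)).isCart ?_
  have h₁ := rId_hom X ((rMapApp F X).obj x)
  have h₂ := rNat_hom F (𝟙 X) x
  have h₃ := congrArg (StrongTrans.comp F.hom X.base).map (rId_hom X x)
  have h₄ := nat_id_inv F.hom X.base x.pt
  have h₅ : (StrongTrans.comp F.hom X.base).map ((p.total.resId X.base).inv.app x.pt) ≫
      (StrongTrans.nat F.hom (𝟙 X.base)).hom.app x.pt =
        (q.total.resId X.base).inv.app ((StrongTrans.comp F.hom X.base).obj x.pt) := by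
    rw [← h₄, Category.assoc, Iso.inv_hom_id_app]
    exact Category.comp_id _
  rw [Functor.map_comp] at h₃
  simp only [EssFib.comp_hom, Category.assoc]
  refine (congrArg (_ ≫ ·) h₁).trans (h₂.trans ?_)
  rw [← h₃, Category.assoc]
  exact congrArg (_ ≫ ·) h₅

lemma rNat_comp (F : p ⟶ q) {X Y Z : ∫ᶜ D} (f : Y ⟶ X) (g : Z ⟶ Y) (k : Z ⟶ X)
    (hk : g ≫ f = k) (x : rFib p X) :
    (rNat F k).hom.app x ≫ (rComp f g k hk).hom.app ((rMapApp F X).obj x) =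
      (rMapApp F Z).map ((rComp f g k hk).hom.app x) ≫ (rNat F g).hom.app ((rRes f).obj x) ≫
        (rRes g).map ((rNat F f).hom.app x) := by
  refine EssFib.ext_of_isCart (isCart_comp₂ f g ((rMapApp F X).obj x)) ?_
  have h₁ := rComp_hom f g k hk ((rMapApp F X).obj x)
  have h₂ := rNat_hom F k x
  have h₃ := rNat_hom F g ((rRes f).obj x)
  have h₄ := congrArg (q.total.res g.base).map (rNat_hom F f x)
  have h₅ := congrArg (StrongTrans.comp F.hom Z.base).map (rComp_hom f g k hk x)
  have h₆ := StrongTrans.nat_comp F.hom f.base g.base k.base (base_comp f g k hk) x.pt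
  have h₇ := rRes_map_hom g ((rNat F f).hom.app x)
  have h₈ := (StrongTrans.nat F.hom g.base).hom.naturality (rLift f x).hom
  rw [Functor.comp_map, Functor.comp_map] at h₈
  simp only [EssFib.comp_hom, Category.assoc, Functor.map_comp] at h₄ h₅ ⊢
  refine (congrArg (_ ≫ ·) h₁).trans ?_
  refine ((reassoc_of% h₂) _).trans ?_
  refine (congrArg (_ ≫ ·) h₆).trans ?_
  refine ((reassoc_of% h₅) _).symm.trans ?_
  refine (congrArg (fun t => _ ≫ _ ≫ t) ((reassoc_of% h₈) _)).trans ?_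
  refine (congrArg (_ ≫ ·) ((reassoc_of% h₃) _)).symm.trans ?_
  refine (congrArg (fun t => _ ≫ _ ≫ _ ≫ t) h₄.symm).trans ?_
  exact (congrArg (fun t => _ ≫ _ ≫ t) ((reassoc_of% h₇) _)).symm

/-- `R` on arrows. -/
noncomputable def rMap (F : p ⟶ q) : rObj p ⟶ rObj q :=
  mkTrans (A := rObj p) (B := rObj q) (rMapApp F) (rNat F) (rNat_id F)
    (fun f g k hk x =>
      (congrArg (_ ≫ ·) (rObj_resComp f g k hk ((rMapApp F _).obj x))).trans
        ((rNat_comp F f g k hk x).trans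
          (congrArg (fun t => (rMapApp F _).map t ≫ _) (rObj_resComp f g k hk x).symm)))

lemma rTwo_aux {F G : p ⟶ q} (η : F ⟶ G) (X : K) (a : p.total.fibre X) :
    (phi F X a).inv ≫ (pr q X).map ((StrongTrans.Hom.comp η.hom X).app a) =
      (phi G X a).inv := by
  have h : F.iso.inv ≫ η.hom ▷ q.proj = G.iso.inv := by
    rw [Iso.inv_comp_eq, ← cancel_mono G.iso.hom, Category.assoc, Iso.inv_hom_id,
      Category.comp_id]
    exact η.w
  exact congrArg (fun t : p.proj ⟶ G.hom ≫ q.proj => (StrongTrans.Hom.comp t X).app a) h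

/-- The natural transformation induced on essential fibres. -/
def rTwoApp {F G : p ⟶ q} (η : F ⟶ G) (X : ∫ᶜ D) : rMapApp F X ⟶ rMapApp G X where
  app x := ⟨(StrongTrans.Hom.comp η.hom X.base).app x.pt, by
    have h := rTwo_aux η X.base x.pt
    change (x.iso.hom ≫ (phi F X.base x.pt).inv) ≫ _ = x.iso.hom ≫ (phi G X.base x.pt).inv
    rw [Category.assoc]
    exact congrArg (_ ≫ ·) h⟩
  naturality x y k := EssFib.hom_ext ((StrongTrans.Hom.comp η.hom X.base).naturality k.hom)

lemma rTwo_nat {F G : p ⟶ q} (η : F ⟶ G) {X Y : ∫ᶜ D} (f : Y ⟶ X) (x : rFib p X) :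
    (rTwoApp η Y).app ((rRes f).obj x) ≫ (rNat G f).hom.app x =
      (rNat F f).hom.app x ≫ (rRes f).map ((rTwoApp η X).app x) := by
  refine EssFib.ext_of_isCart (rLift f ((rMapApp G X).obj x)).isCart ?_
  have h₁ := rNat_hom G f x
  have h₂ := rNat_hom F f x
  have h₃ := rRes_map_hom f ((rTwoApp η X).app x)
  have h₄ := StrongTrans.Hom.nat η.hom f.base x.pt
  have h₅ := (StrongTrans.Hom.comp η.hom Y.base).naturality (rLift f x).hom
  simp only [EssFib.comp_hom, Category.assoc]
  refine (congrArg (_ ≫ ·) h₁).trans ?_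
  refine ((reassoc_of% h₅) _).symm.trans ?_
  refine (congrArg (_ ≫ ·) h₄).trans ?_
  refine ((reassoc_of% h₂) _).symm.trans ?_
  exact (congrArg (_ ≫ ·) h₃).symm

/-- `R` on 2-cells. -/
noncomputable def rTwo {F G : p ⟶ q} (η : F ⟶ G) : rMap F ⟶ rMap G :=
  mkMod (fun X => rTwoApp η X) (fun f x => rTwo_nat η f x)

lemma phi_id (X : K) (a : p.total.fibre X) : (phi (𝟙 p) X a).inv = 𝟙 _ := rfl

lemma phi_comp (F : p ⟶ q) (G : q ⟶ r) (X : K) (a : p.total.fibre X) :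
    (phi (F ≫ G) X a).inv =
      (phi F X a).inv ≫ (phi G X ((StrongTrans.comp F.hom X).obj a)).inv := by
  have h : (phi (F ≫ G) X a).inv =
    ((phi F X a).inv ≫ (phi G X ((StrongTrans.comp F.hom X).obj a)).inv) ≫ 𝟙 _ := rfl
  rw [h]
  exact Category.comp_id _

/-- The unit constraint of `R`. -/
def rMapIdApp (X : ∫ᶜ D) : rMapApp (𝟙 p) X ≅ 𝟭 (rFib p X) :=
  NatIso.ofComponents (fun x => EssFib.isoMk (Iso.refl x.pt) (by
    change (x.iso.hom ≫ (phi (𝟙 p) X.base x.pt).inv) ≫ (pr p X.base).map (𝟙 x.pt) = x.iso.hom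
    rw [phi_id]
    simp)) (fun k => EssFib.hom_ext ((Category.comp_id _).trans (Category.id_comp _).symm))

/-- The composition constraint of `R`. -/
def rMapCompApp (F : p ⟶ q) (G : q ⟶ r) (X : ∫ᶜ D) :
    rMapApp (F ≫ G) X ≅ rMapApp F X ⋙ rMapApp G X :=
  NatIso.ofComponents (fun x => EssFib.isoMk (Iso.refl _) (by
    have h := phi_comp F G X.base x.pt
    refine (congrArg (_ ≫ ·) (CategoryTheory.Functor.map_id _ _)).trans
      ((Category.comp_id _).trans ?_)
    exact (congrArg (_ ≫ ·) h).trans (Category.assoc _ _ _).symm))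
    (fun k => EssFib.hom_ext ((Category.comp_id _).trans (Category.id_comp _).symm))

lemma rMapId_nat {X Y : ∫ᶜ D} (f : Y ⟶ X) (x : rFib p X) :
    (rMapIdApp Y).hom.app ((rRes f).obj x) =
      (rNat (𝟙 p) f).hom.app x ≫ (rRes f).map ((rMapIdApp X).hom.app x) := by
  refine EssFib.ext_of_isCart (rLift f x).isCart ?_
  have h₁ := rNat_hom (𝟙 p) f x
  have h₂ := rRes_map_hom f ((rMapIdApp X).hom.app x)
  have h₃ := StrongTrans.id_nat_app f.base x.pt
  simp only [EssFib.comp_hom, Category.assoc]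
  refine (Category.id_comp _).trans ?_
  refine Eq.trans ?_ (congrArg (_ ≫ ·) h₂).symm
  refine Eq.trans ?_ ((reassoc_of% h₁) _).symm
  refine Eq.trans ?_ (congrArg (fun t => _ ≫ t ≫ _) h₃).symm
  refine Eq.trans ?_ (congrArg (_ ≫ ·) (Category.id_comp _)).symm
  refine Eq.trans ?_ (congrArg (_ ≫ ·) (CategoryTheory.Functor.map_id _ _)).symm
  exact (Category.comp_id _).symm

lemma rMapComp_nat (F : p ⟶ q) (G : q ⟶ r) {X Y : ∫ᶜ D} (f : Y ⟶ X) (x : rFib p X) :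
    (rMapCompApp F G Y).hom.app ((rRes f).obj x) ≫
      (rMapApp G Y).map ((rNat F f).hom.app x) ≫ (rNat G f).hom.app ((rMapApp F X).obj x) =
    (rNat (F ≫ G) f).hom.app x ≫ (rRes f).map ((rMapCompApp F G X).hom.app x) := by
  refine EssFib.ext_of_isCart (rLift f ((rMapApp G X).obj ((rMapApp F X).obj x))).isCart ?_
  have h₁ := rNat_hom (F ≫ G) f x
  have h₂ := rRes_map_hom f ((rMapCompApp F G X).hom.app x)
  have h₃ := StrongTrans.comp_nat_app F.hom G.hom f.base x.pt
  have h₄ := rNat_hom G f ((rMapApp F X).obj x)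
  have h₅ := congrArg (StrongTrans.comp G.hom Y.base).map (rNat_hom F f x)
  rw [Functor.map_comp, Functor.map_comp] at h₅
  simp only [EssFib.comp_hom, Category.assoc]
  refine (Category.id_comp _).trans ?_
  refine (congrArg (_ ≫ ·) h₄).trans ?_
  refine ((reassoc_of% h₅) _).trans ?_
  refine Eq.trans ?_ (congrArg (_ ≫ ·) h₂).symm
  refine Eq.trans ?_ ((reassoc_of% h₁) _).symm
  refine Eq.trans ?_ (congrArg (fun t => _ ≫ _ ≫ t) (CategoryTheory.Functor.map_id _ _)).symm
  refine Eq.trans ?_ (congrArg (fun t => _ ≫ t) (Category.comp_id _)).symm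
  exact (congrArg (_ ≫ ·) h₃).symm

end FibOver

open FibOver

lemma hom₂_ext {J : Type u₁} [Category.{v₁} J] {A B : IndCat.{v₁, u₁, v', u'} J} {F G : A ⟶ B}
    {α β : F ⟶ G} (h : ∀ X a, (StrongTrans.Hom.comp α X).app a =
      (StrongTrans.Hom.comp β X).app a) : α = β :=
  StrongTrans.homCategory.ext (fun X => Cat.Hom₂.ext (NatTrans.ext (funext (h X.as.unop))))

variable (D) in
/-- The pseudofunctor `R_D`, sending an indexed fibration over `D` to the `𝒢(D)`-indexed
category of its essential fibres. -/
noncomputable def R :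
    FibOver D ⥤ᵖ IndCat.{max v v', max u u', v', max u' v'} (∫ᶜ D) where
  obj p := rObj p
  map F := rMap F
  map₂ η := rTwo η
  map₂_id F := hom₂_ext fun X x => EssFib.hom_ext rfl
  map₂_comp η θ := hom₂_ext fun X x => EssFib.hom_ext rfl
  mapId p := mkModIso (fun X => rMapIdApp X) (fun f x =>
    (congrArg (_ ≫ ·) (StrongTrans.id_nat_app f x)).trans
      ((Category.comp_id _).trans (rMapId_nat f x)))
  mapComp F G := mkModIso (fun X => rMapCompApp F G X) (fun f x =>
    (congrArg (_ ≫ ·) (StrongTrans.comp_nat_app (rMap F) (rMap G) f x)).trans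
      (rMapComp_nat F G f x))
  map₂_whisker_left {p q r} F G H η := hom₂_ext fun X x => EssFib.hom_ext (by
    let a := ((StrongTrans.Hom.comp η.hom X.base).app ((StrongTrans.comp F.hom X.base).obj x.pt))
    have : a = 𝟙 _ ≫ a ≫ 𝟙 _ := by simp
    exact this)
  map₂_whisker_right {p q r} F G η H := hom₂_ext fun X x => EssFib.hom_ext (by
    let a := (StrongTrans.comp H.hom X.base).map ((StrongTrans.Hom.comp η.hom X.base).app x.pt)
    have : a = 𝟙 _ ≫ a ≫ 𝟙 _ := by simp
    exact this)
  map₂_associator {p q r t} F G H := hom₂_ext fun X x => EssFib.hom_ext (by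
    let a := (StrongTrans.comp H.hom X.base).map (𝟙
      ((StrongTrans.comp G.hom X.base).obj ((StrongTrans.comp F.hom X.base).obj x.pt)))
    have : 𝟙 _ = 𝟙 _ ≫ a ≫ 𝟙 _ ≫ 𝟙 _ ≫ 𝟙 _ := by simp [a]
    exact this)
  map₂_left_unitor {p q} F := hom₂_ext fun X x => EssFib.hom_ext (by
    let a := (StrongTrans.comp F.hom X.base).map (𝟙 x.pt)
    have : 𝟙 _ = 𝟙 _ ≫ a ≫ 𝟙 _ := by simp [a]
    exact this)
  map₂_right_unitor {p q} F := hom₂_ext fun X x => EssFib.hom_ext (by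
    have : 𝟙 ((StrongTrans.comp F.hom X.base).obj x.pt) = 𝟙 _ ≫ 𝟙 _ ≫ 𝟙 _ := by simp
    exact this)

end R
end Fib

namespace Fib
section BaseChange

open Pseudofunctor StrongTrans Limits FibOver

section

variable {A : Type*} {B : Type*} {E : Type*} [Category* A] [Category* B] [Category* E]
  {F : A ⥤ B} {P : E ⥤ B}

/-- An arrow of a pseudopullback is cartesian over `A` when its second component is cartesian. -/
lemma isCart_π₁ {x y : CategoricalPullback F P} (k : x ⟶ y) (h : IsCart P k.snd) :
    IsCart (CategoricalPullback.π₁ F P) k := by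
  rw [isCart_iff] at h ⊢
  intro z g (t : z.fst ⟶ x.fst) (ht : t ≫ k.fst = g.fst)
  obtain ⟨l, ⟨h₁, h₂⟩, h₃⟩ := h g.snd (z.iso.inv ≫ F.map t ≫ x.iso.hom) (by
    simp only [Category.assoc]
    rw [← k.w, ← Functor.map_comp_assoc, ht, g.w]
    simp)
  refine ⟨⟨t, l, by rw [h₁]; simp⟩, ⟨rfl, CategoricalPullback.hom_ext ht h₂⟩, ?_⟩
  rintro m ⟨m₁, m₂⟩
  refine CategoricalPullback.hom_ext m₁ (h₃ _ ⟨?_, congrArg CategoricalPullback.Hom.snd m₂⟩)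
  have m₁ : m.fst = t := m₁
  rw [← m₁, m.w]
  simp

/-- Pseudopullbacks of fibrations are fibrations. -/
lemma isFibration_π₁ (hP : IsFibration P) : IsFibration (CategoricalPullback.π₁ F P) := by
  intro y b t
  obtain ⟨a, θ, f, hf, hw⟩ := hP y.snd (F.obj b) (F.map t ≫ y.iso.hom)
  exact ⟨⟨b, a, θ⟩, Iso.refl b, ⟨t, f, hw.symm⟩, isCart_π₁ _ hf, Category.id_comp _⟩

lemma isCart_snd (hP : IsFibration P) {x y : CategoricalPullback F P} (k : x ⟶ y)
    (h : IsCart (CategoricalPullback.π₁ F P) k) : IsCart P k.snd := by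
  obtain ⟨a, θ, f, hf, hw⟩ := hP y.snd (F.obj x.fst) (F.map k.fst ≫ y.iso.hom)
  let z : CategoricalPullback F P := ⟨x.fst, a, θ⟩
  let m : z ⟶ y := ⟨k.fst, f, hw.symm⟩
  have hm : IsCart (CategoricalPullback.π₁ F P) m := isCart_π₁ m hf
  obtain ⟨i, ⟨i₁, i₂⟩, -⟩ := (isCart_iff _ _).1 hm k (𝟙 x.fst) (Category.id_comp _)
  obtain ⟨j, ⟨j₁, j₂⟩, -⟩ := (isCart_iff _ _).1 h m (𝟙 x.fst) (Category.id_comp _)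
  have hij : i ≫ j = 𝟙 x := h.ext (by
    rw [Functor.map_comp, i₁, j₁, CategoryTheory.Functor.map_id]; exact Category.id_comp _)
    (by rw [Category.assoc, j₂, i₂, Category.id_comp])
  have hji : j ≫ i = 𝟙 z := hm.ext (by
    rw [Functor.map_comp, i₁, j₁, CategoryTheory.Functor.map_id]; exact Category.id_comp _)
    (by rw [Category.assoc, i₂, j₂, Category.id_comp])
  have : IsIso i.snd := ⟨j.snd, congrArg CategoricalPullback.Hom.snd hij,
    congrArg CategoricalPullback.Hom.snd hji⟩
  have e : i.snd ≫ f = k.snd := congrArg CategoricalPullback.Hom.snd i₂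
  rw [← e]
  exact (isCart_of_isIso P i.snd).comp hf

end

variable {K : Type u} [Category.{v} K] {D D' : IndCat.{v, u, v', max u' v'} K} (η : D ⟶ D')

/-- The pseudopullback of `p : E ⟶ D'` along `η : D ⟶ D'` at `X`. -/
abbrev bFib (p : FibOver D') (X : K) :=
  CategoricalPullback (StrongTrans.comp η X) (pr p X)

variable {η} {p q r : FibOver D'}

/-- The restriction functors of the pseudopullback, computed componentwise. -/
abbrev bRes {X Y : K} (f : Y ⟶ X) : bFib η p X ⥤ bFib η p Y where
  obj x := ⟨(D.res f).obj x.fst, (p.total.res f).obj x.snd,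
    (StrongTrans.nat η f).app x.fst ≪≫ (D'.res f).mapIso x.iso ≪≫
      (StrongTrans.nat p.proj f).symm.app x.snd⟩
  map {x y} k := ⟨(D.res f).map k.fst, (p.total.res f).map k.snd, by
    have h₁ := (StrongTrans.nat η f).hom.naturality k.fst
    have h₂ := (StrongTrans.nat p.proj f).inv.naturality k.snd
    have h₃ := congrArg (D'.res f).map k.w
    rw [Functor.comp_map, Functor.comp_map] at h₁ h₂
    rw [Functor.map_comp, Functor.map_comp] at h₃
    simp only [Iso.trans_hom, Iso.app_hom, Functor.mapIso_hom, Iso.symm_hom, Category.assoc]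
    rw [reassoc_of% h₁, reassoc_of% h₃, h₂]⟩
  map_id x := CategoricalPullback.hom_ext (CategoryTheory.Functor.map_id _ _)
    (CategoryTheory.Functor.map_id _ _)
  map_comp k l := CategoricalPullback.hom_ext (Functor.map_comp _ _ _) (Functor.map_comp _ _ _)

lemma bRes_iso {X Y : K} (f : Y ⟶ X) (x : bFib η p X) :
    ((bRes f).obj x).iso.hom = (StrongTrans.nat η f).hom.app x.fst ≫
      (D'.res f).map x.iso.hom ≫ (StrongTrans.nat p.proj f).inv.app x.snd := rfl

lemma bId_w (X : K) (x : bFib η p X) :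
    (StrongTrans.comp η X).map ((D.resId X).hom.app x.fst) ≫ x.iso.hom =
      ((bRes (𝟙 X)).obj x).iso.hom ≫ (pr p X).map ((p.total.resId X).hom.app x.snd) := by
  have h₁ := StrongTrans.nat_id η X x.fst
  have h₂ := StrongTrans.nat_id p.proj X x.snd
  have h₃ := (D'.resId X).hom.naturality x.iso.hom
  have h₄ : (StrongTrans.nat p.proj (𝟙 X)).inv.app x.snd ≫
    (StrongTrans.nat p.proj (𝟙 X)).hom.app x.snd = 𝟙 _ := Iso.inv_hom_id_app _ _
  rw [bRes_iso, ← h₁, ← h₂]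
  simp only [Category.assoc]
  rw [reassoc_of% h₄]
  exact congrArg (_ ≫ ·) h₃.symm

/-- The unit constraint of the pseudopullback. -/
def bId (X : K) : bRes (η := η) (p := p) (𝟙 X) ≅ 𝟭 (bFib η p X) :=
  NatIso.ofComponents (fun x => CategoricalPullback.mkIso ((D.resId X).app x.fst)
    ((p.total.resId X).app x.snd) (bId_w X x))
    (fun k => CategoricalPullback.hom_ext ((D.resId X).hom.naturality k.fst)
      ((p.total.resId X).hom.naturality k.snd))

lemma bComp_w {X Y Z : K} (f : Y ⟶ X) (g : Z ⟶ Y) (k : Z ⟶ X) (hk : g ≫ f = k)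
    (x : bFib η p X) :
    (StrongTrans.comp η Z).map ((D.resComp f g k hk).hom.app x.fst) ≫
      ((bRes g).obj ((bRes f).obj x)).iso.hom =
    ((bRes k).obj x).iso.hom ≫ (pr p Z).map ((p.total.resComp f g k hk).hom.app x.snd) := by
  have h₁ := StrongTrans.nat_comp η f g k hk x.fst
  have h₂ := nat_comp_inv p.proj f g k hk x.snd
  have h₃ := (D'.resComp f g k hk).hom.naturality x.iso.hom
  have h₄ : (StrongTrans.comp p.proj Z).map ((p.total.resComp f g k hk).inv.app x.snd) ≫
      (pr p Z).map ((p.total.resComp f g k hk).hom.app x.snd) = 𝟙 _ := by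
    rw [← Functor.map_comp, Iso.inv_hom_id_app]; simp
  have h₅ : (D'.resComp f g k hk).hom.app ((pr p X).obj x.snd) ≫
    (D'.resComp f g k hk).inv.app ((pr p X).obj x.snd) = 𝟙 _ := Iso.hom_inv_id_app _ _
  have h₆ : ((bRes g).obj ((bRes f).obj x)).iso.hom =
    (StrongTrans.nat η g).hom.app ((D.res f).obj x.fst) ≫
      (D'.res g).map ((bRes f).obj x).iso.hom ≫
        (StrongTrans.nat p.proj g).inv.app ((p.total.res f).obj x.snd) := rfl
  have h₇ : (StrongTrans.nat p.proj k).inv.app x.snd ≫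
      (pr p Z).map ((p.total.resComp f g k hk).hom.app x.snd) =
    (D'.resComp f g k hk).hom.app ((pr p X).obj x.snd) ≫
      (D'.res g).map ((StrongTrans.nat p.proj f).inv.app x.snd) ≫
      (StrongTrans.nat p.proj g).inv.app ((p.total.res f).obj x.snd) := by
    rw [← cancel_epi ((D'.resComp f g k hk).inv.app ((pr p X).obj x.snd)),
      Iso.inv_hom_id_app_assoc, reassoc_of% h₂, h₄]
    exact congrArg (_ ≫ ·) (Category.comp_id _)
  rw [Functor.comp_map] at h₃
  rw [h₆, bRes_iso, bRes_iso]
  simp only [Category.assoc, Functor.map_comp]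
  rw [h₇, reassoc_of% h₃, reassoc_of% h₁]

/-- The composition constraint of the pseudopullback. -/
def bComp {X Y Z : K} (f : Y ⟶ X) (g : Z ⟶ Y) (k : Z ⟶ X) (hk : g ≫ f = k) :
    bRes (η := η) (p := p) k ≅ bRes f ⋙ bRes g :=
  NatIso.ofComponents (fun x => CategoricalPullback.mkIso ((D.resComp f g k hk).app x.fst)
    ((p.total.resComp f g k hk).app x.snd) (bComp_w f g k hk x))
    (fun l => CategoricalPullback.hom_ext ((D.resComp f g k hk).hom.naturality l.fst)
      ((p.total.resComp f g k hk).hom.naturality l.snd))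

variable (η p)

/-- The pseudopullback of an indexed fibration along `η`. -/
def bTotal : IndCat.{v, u, v', max u' v'} K :=
  mkInd (bFib η p) bRes bId bComp
    (fun f h x => CategoricalPullback.hom_ext (D.resComp_id_left f h x.fst)
      (p.total.resComp_id_left f h x.snd))
    (fun f h x => CategoricalPullback.hom_ext (D.resComp_id_right f h x.fst)
      (p.total.resComp_id_right f h x.snd))
    (fun f g h gf hg k h₁ h₂ h₃ h₄ x => CategoricalPullback.hom_ext
      (D.resComp_assoc f g h gf hg k h₁ h₂ h₃ h₄ x.fst)
      (p.total.resComp_assoc f g h gf hg k h₁ h₂ h₃ h₄ x.snd))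

variable {η p}

lemma bTotal_resComp {X Y Z : K} (f : Y ⟶ X) (g : Z ⟶ Y) (k : Z ⟶ X) (hk : g ≫ f = k)
    (x : bFib η p X) : ((bTotal η p).resComp f g k hk).hom.app x = (bComp f g k hk).hom.app x :=
  congrArg (fun t : (bRes k ≅ bRes f ⋙ bRes g) => t.hom.app x)
    (mkInd_resComp (bFib η p) bRes bId bComp _ _ _ f g k hk)

variable (η p)

/-- The projection of the pseudopullback to `D`. -/
def bProj : bTotal η p ⟶ D :=
  mkTrans (A := bTotal η p) (B := D) (fun _ => CategoricalPullback.π₁ _ _)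
    (fun _ => Iso.refl _)
    (fun _ _ => Category.id_comp _)
    (fun f g k hk x => (Category.id_comp _).trans (Eq.symm
      ((congrArg (_ ≫ ·) ((Category.id_comp _).trans (CategoryTheory.Functor.map_id _ _))).trans
        ((Category.comp_id _).trans
          (congrArg CategoricalPullback.Hom.fst (bTotal_resComp f g k hk x))))))

lemma bProj_fib : IsIndexedFibration (bProj η p) where
  isFibration X := isFibration_π₁ (p.fib.isFibration X)
  isCart_res y _ _ f hf := isCart_π₁ _ (p.fib.isCart_res y _ (isCart_snd (p.fib.isFibration _) f hf))

/-- The base change of an indexed fibration along `η`. -/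
def bObj : FibOver D := ⟨bTotal η p, bProj η p, bProj_fib η p⟩

variable {η p}

/-- The functor `(U, A, e) ↦ (U, F A, φ⁻¹ ∘ e)` on pseudopullbacks. -/
abbrev bMapApp (F : p ⟶ q) (X : K) : bFib η p X ⥤ bFib η q X where
  obj x := ⟨x.fst, (StrongTrans.comp F.hom X).obj x.snd, x.iso ≪≫ (phi F X x.snd).symm⟩
  map k := ⟨k.fst, (StrongTrans.comp F.hom X).map k.snd, by
    simp only [Iso.trans_hom, Iso.symm_hom, Category.assoc]
    rw [phi_naturality, ← Category.assoc, k.w, Category.assoc]⟩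
  map_id _ := CategoricalPullback.hom_ext rfl (CategoryTheory.Functor.map_id _ _)
  map_comp _ _ := CategoricalPullback.hom_ext rfl (CategoryTheory.Functor.map_comp _ _ _)

lemma bNat_w (F : p ⟶ q) {X Y : K} (f : Y ⟶ X) (x : bFib η p X) :
    (StrongTrans.comp η Y).map (𝟙 ((D.res f).obj x.fst)) ≫
      ((bRes f).obj ((bMapApp F X).obj x)).iso.hom =
    ((bMapApp F Y).obj ((bRes f).obj x)).iso.hom ≫
      (pr q Y).map ((StrongTrans.nat F.hom f).hom.app x.snd) := by
  have h := phi_nat F f x.snd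
  have h₁ : ((bMapApp F Y).obj ((bRes f).obj x)).iso.hom =
    ((StrongTrans.nat η f).hom.app x.fst ≫ (D'.res f).map x.iso.hom ≫
      (StrongTrans.nat p.proj f).inv.app x.snd) ≫
        (phi F Y ((p.total.res f).obj x.snd)).inv := rfl
  have h₂ : ((bRes f).obj ((bMapApp F X).obj x)).iso.hom =
    (StrongTrans.nat η f).hom.app x.fst ≫ (D'.res f).map (x.iso.hom ≫ (phi F X x.snd).inv) ≫
      (StrongTrans.nat q.proj f).inv.app ((StrongTrans.comp F.hom X).obj x.snd) := rfl
  rw [h₁, h₂, CategoryTheory.Functor.map_id]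
  refine (Category.id_comp _).trans ?_
  simp only [Functor.map_comp, Category.assoc]
  exact (congrArg (fun t => _ ≫ _ ≫ t) h).symm

/-- The pseudonaturality constraint for base change on arrows. -/
def bNat (F : p ⟶ q) {X Y : K} (f : Y ⟶ X) :
    bRes (η := η) f ⋙ bMapApp F Y ≅ bMapApp F X ⋙ bRes f :=
  NatIso.ofComponents (fun x => CategoricalPullback.mkIso (Iso.refl _)
    ((StrongTrans.nat F.hom f).app x.snd) (bNat_w F f x))
    (fun l => CategoricalPullback.hom_ext ((Category.comp_id _).trans (Category.id_comp _).symm)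
      ((StrongTrans.nat F.hom f).hom.naturality l.snd))

lemma bNat_comp (F : p ⟶ q) {X Y Z : K} (f : Y ⟶ X) (g : Z ⟶ Y) (k : Z ⟶ X) (hk : g ≫ f = k)
    (x : bFib η p X) :
    (bNat F k).hom.app x ≫ (bComp f g k hk).hom.app ((bMapApp F X).obj x) =
      (bMapApp F Z).map ((bComp f g k hk).hom.app x) ≫ (bNat F g).hom.app ((bRes f).obj x) ≫
        (bRes g).map ((bNat F f).hom.app x) := by
  refine CategoricalPullback.hom_ext ?_ (StrongTrans.nat_comp F.hom f g k hk x.snd)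
  have h : 𝟙 _ ≫ (D.resComp f g k hk).hom.app x.fst =
    (D.resComp f g k hk).hom.app x.fst ≫ 𝟙 _ ≫ (D.res g).map (𝟙 _) := by simp
  exact h

/-- Base change on the underlying indexed functors. -/
def bMapTrans (F : p ⟶ q) : bTotal η p ⟶ bTotal η q :=
  mkTrans (A := bTotal η p) (B := bTotal η q) (bMapApp F) (bNat F)
    (fun X x => CategoricalPullback.hom_ext (Category.id_comp _)
      (StrongTrans.nat_id F.hom X x.snd))
    (fun f g k hk x => by
      have h₁ := congrArg CategoricalPullback.Hom.fst (bTotal_resComp f g k hk ((bMapApp F _).obj x))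
      have h₂ := congrArg CategoricalPullback.Hom.fst (bTotal_resComp f g k hk x)
      have h₃ := congrArg CategoricalPullback.Hom.snd (bTotal_resComp f g k hk ((bMapApp F _).obj x))
      have h₄ := congrArg CategoricalPullback.Hom.snd (bTotal_resComp f g k hk x)
      exact CategoricalPullback.hom_ext
        ((congrArg (fun t => 𝟙 _ ≫ t) h₁).trans
          ((congrArg CategoricalPullback.Hom.fst (bNat_comp F f g k hk x)).trans
            (congrArg (fun t => t ≫ 𝟙 _ ≫ (D.res g).map (𝟙 _)) h₂.symm)))
        ((congrArg (fun t => (StrongTrans.nat F.hom k).hom.app x.snd ≫ t) h₃).trans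
          ((congrArg CategoricalPullback.Hom.snd (bNat_comp F f g k hk x)).trans
            (congrArg (fun t => (StrongTrans.comp F.hom _).map t ≫
              (StrongTrans.nat F.hom g).hom.app ((p.total.res f).obj x.snd) ≫
              (q.total.res g).map ((StrongTrans.nat F.hom f).hom.app x.snd)) h₄.symm))))

lemma bMap_nat (F : p ⟶ q) {X Y : K} (f : Y ⟶ X) (x : bFib η p X) :
    𝟙 _ ≫ (StrongTrans.nat (bProj η p) f).hom.app x =
      (StrongTrans.nat (bMapTrans F ≫ bProj η q) f).hom.app x ≫ (D.res f).map (𝟙 x.fst) := by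
  have h : (StrongTrans.nat (bMapTrans F ≫ bProj η q) f).hom.app x = 𝟙 ((D.res f).obj x.fst) :=
    (StrongTrans.comp_nat_app (bMapTrans F) (bProj η q) f x).trans (Category.id_comp _)
  have h' : 𝟙 ((D.res f).obj x.fst) ≫ 𝟙 ((D.res f).obj x.fst) =
    𝟙 ((D.res f).obj x.fst) ≫ (D.res f).map (𝟙 x.fst) := by simp
  exact h'.trans (congrArg (fun t : (D.res f).obj x.fst ⟶ (D.res f).obj x.fst =>
    t ≫ (D.res f).map (𝟙 x.fst)) h.symm)

variable (η) in
/-- Base change on arrows. -/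
def bMap (F : p ⟶ q) : bObj η p ⟶ bObj η q where
  hom := bMapTrans F
  iso := mkModIso (F := bMapTrans F ≫ bProj η q) (G := bProj η p) (fun _ => Iso.refl _)
    (fun f x => bMap_nat F f x)
  cart := fun X _ _ f hf => isCart_π₁ _ (F.cart X _ (isCart_snd (p.fib.isFibration X) f hf))

/-- The natural transformation induced on pseudopullbacks. -/
def bTwoApp {F G : p ⟶ q} (α : F ⟶ G) (X : K) :
    bMapApp (η := η) F X ⟶ bMapApp G X where
  app x := ⟨𝟙 _, (StrongTrans.Hom.comp α.hom X).app x.snd, by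
    have h := rTwo_aux α X x.snd
    simp only [Iso.trans_hom, Iso.symm_hom, Category.assoc]
    rw [CategoryTheory.Functor.map_id, Category.id_comp]
    exact (congrArg (_ ≫ ·) h).symm⟩
  naturality x y k := CategoricalPullback.hom_ext
    ((Category.comp_id _).trans (Category.id_comp _).symm)
    ((StrongTrans.Hom.comp α.hom X).naturality k.snd)

lemma bTwo_nat {F G : p ⟶ q} (α : F ⟶ G) {X Y : K} (f : Y ⟶ X) (x : bFib η p X) :
    (bTwoApp α Y).app ((bRes f).obj x) ≫ (bNat G f).hom.app x =
      (bNat F f).hom.app x ≫ (bRes f).map ((bTwoApp α X).app x) :=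
  CategoricalPullback.hom_ext
    (congrArg (_ ≫ ·) (CategoryTheory.Functor.map_id (D.res f) x.fst).symm)
    (StrongTrans.Hom.nat α.hom f x.snd)

variable (η) in
/-- Base change on 2-cells. -/
def bTwo {F G : p ⟶ q} (α : F ⟶ G) : bMap η F ⟶ bMap η G :=
  Bicat.Slice.Hom₂.mk
    (mkMod (F := bMapTrans F) (G := bMapTrans G) (fun X => bTwoApp α X)
      (fun f x => bTwo_nat α f x))
    (hom₂_ext fun _ _ => Category.id_comp _)

lemma bMapId_w (X : K) (x : bFib η p X) :
    (StrongTrans.comp η X).map (𝟙 x.fst) ≫ x.iso.hom =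
      ((bMapApp (𝟙 p) X).obj x).iso.hom ≫ (pr p X).map (𝟙 x.snd) := by
  have h : ((bMapApp (𝟙 p) X).obj x).iso.hom = x.iso.hom ≫ (phi (𝟙 p) X x.snd).inv := rfl
  rw [h, phi_id]
  simp

/-- The unit constraint of base change. -/
def bMapIdApp (X : K) : bMapApp (η := η) (𝟙 p) X ≅ 𝟭 (bFib η p X) :=
  NatIso.ofComponents (fun x => CategoricalPullback.mkIso (Iso.refl _) (Iso.refl _) (bMapId_w X x))
    (fun _ => CategoricalPullback.hom_ext ((Category.comp_id _).trans (Category.id_comp _).symm)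
      ((Category.comp_id _).trans (Category.id_comp _).symm))

lemma bMapComp_w (F : p ⟶ q) (G : q ⟶ r) (X : K) (x : bFib η p X) :
    (StrongTrans.comp η X).map (𝟙 x.fst) ≫ ((bMapApp G X).obj ((bMapApp F X).obj x)).iso.hom =
      ((bMapApp (F ≫ G) X).obj x).iso.hom ≫ (pr r X).map (𝟙 _) := by
  have h : ((bMapApp (F ≫ G) X).obj x).iso.hom = x.iso.hom ≫ (phi (F ≫ G) X x.snd).inv := rfl
  have h' : ((bMapApp G X).obj ((bMapApp F X).obj x)).iso.hom =
    (x.iso.hom ≫ (phi F X x.snd).inv) ≫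
      (phi G X ((StrongTrans.comp F.hom X).obj x.snd)).inv := rfl
  rw [h, h', phi_comp]
  refine Eq.trans ((congrArg (· ≫ _) (CategoryTheory.Functor.map_id _ _)).trans
    (Category.id_comp _)) (Eq.trans ?_ (Eq.symm ((congrArg (_ ≫ ·)
      (CategoryTheory.Functor.map_id _ _)).trans (Category.comp_id _))))
  exact Category.assoc _ _ _

/-- The composition constraint of base change. -/
def bMapCompApp (F : p ⟶ q) (G : q ⟶ r) (X : K) :
    bMapApp (η := η) (F ≫ G) X ≅ bMapApp F X ⋙ bMapApp G X :=
  NatIso.ofComponents (fun x => CategoricalPullback.mkIso (Iso.refl _) (Iso.refl _)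
      (bMapComp_w F G X x))
    (fun _ => CategoricalPullback.hom_ext ((Category.comp_id _).trans (Category.id_comp _).symm)
      ((Category.comp_id _).trans (Category.id_comp _).symm))

lemma bMapId_nat {X Y : K} (f : Y ⟶ X) (x : bFib η p X) :
    (bMapIdApp Y).hom.app ((bRes f).obj x) =
      (bNat (𝟙 p) f).hom.app x ≫ (bRes f).map ((bMapIdApp X).hom.app x) :=
  CategoricalPullback.hom_ext
    (Eq.symm ((congrArg (_ ≫ ·) (CategoryTheory.Functor.map_id _ _)).trans (Category.comp_id _)))
    (Eq.symm ((congrArg (_ ≫ ·) (CategoryTheory.Functor.map_id _ _)).trans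
      ((Category.comp_id _).trans (StrongTrans.id_nat_app f x.snd))))

lemma bMapComp_nat (F : p ⟶ q) (G : q ⟶ r) {X Y : K} (f : Y ⟶ X) (x : bFib η p X) :
    (bMapCompApp F G Y).hom.app ((bRes f).obj x) ≫
      (bMapApp G Y).map ((bNat F f).hom.app x) ≫ (bNat G f).hom.app ((bMapApp F X).obj x) =
    (bNat (F ≫ G) f).hom.app x ≫ (bRes f).map ((bMapCompApp F G X).hom.app x) :=
  CategoricalPullback.hom_ext
    ((Category.id_comp _).trans ((Category.id_comp _).trans (Eq.symm
      ((congrArg (_ ≫ ·) (CategoryTheory.Functor.map_id _ _)).trans (Category.comp_id _)))))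
    ((Category.id_comp _).trans (Eq.symm ((congrArg (_ ≫ ·)
      (CategoryTheory.Functor.map_id _ _)).trans
      ((Category.comp_id _).trans (StrongTrans.comp_nat_app F.hom G.hom f x.snd)))))

variable (η) in
/-- Base change of indexed fibrations along `η : D ⟶ D'`, by pseudopullback. -/
def baseChange : FibOver D' ⥤ᵖ FibOver D where
  obj p := bObj η p
  map F := bMap η F
  map₂ α := bTwo η α
  map₂_id F := Bicat.Slice.hom₂_ext (hom₂_ext fun X x => rfl)
  map₂_comp α β := Bicat.Slice.hom₂_ext (hom₂_ext fun X x =>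
    CategoricalPullback.hom_ext (Category.id_comp _).symm rfl)
  mapId p := Bicat.Slice.isoMk (mkModIso (F := bMapTrans (𝟙 p)) (G := 𝟙 (bTotal η p))
    (fun X => bMapIdApp X) (fun f x =>
    (congrArg (_ ≫ ·) (StrongTrans.id_nat_app f x)).trans
      ((Category.comp_id _).trans (bMapId_nat f x)))) (hom₂_ext fun _ _ => Category.id_comp _)
  mapComp F G := Bicat.Slice.isoMk (mkModIso (F := bMapTrans (F ≫ G))
    (G := bMapTrans F ≫ bMapTrans G) (fun X => bMapCompApp F G X) (fun f x =>
    (congrArg (_ ≫ ·) (StrongTrans.comp_nat_app (bMapTrans F) (bMapTrans G) f x)).trans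
      (bMapComp_nat F G f x))) (hom₂_ext fun X x => by
        have : 𝟙 x.fst ≫ 𝟙 _ ≫ 𝟙 _ ≫ 𝟙 _ = 𝟙 x.fst := by simp
        exact this)
  map₂_whisker_left {p q r} F G H α := Bicat.Slice.hom₂_ext (hom₂_ext fun X x =>
    CategoricalPullback.hom_ext (by
      have : 𝟙 x.fst = 𝟙 _ ≫ 𝟙 _ ≫ 𝟙 _ := by simp
      exact this) (by
      let a := ((StrongTrans.Hom.comp α.hom X).app ((StrongTrans.comp F.hom X).obj x.snd))
      have : a = 𝟙 _ ≫ a ≫ 𝟙 _ := by simp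
      exact this))
  map₂_whisker_right {p q r} F G α H := Bicat.Slice.hom₂_ext (hom₂_ext fun X x =>
    CategoricalPullback.hom_ext (by
      have : 𝟙 x.fst = 𝟙 _ ≫ 𝟙 _ ≫ 𝟙 _ := by simp
      exact this) (by
      let a := (StrongTrans.comp H.hom X).map ((StrongTrans.Hom.comp α.hom X).app x.snd)
      have : a = 𝟙 _ ≫ a ≫ 𝟙 _ := by simp
      exact this))
  map₂_associator {p q r t} F G H := Bicat.Slice.hom₂_ext (hom₂_ext fun X x =>
    CategoricalPullback.hom_ext (by
      have : 𝟙 x.fst = 𝟙 _ ≫ 𝟙 _ ≫ 𝟙 _ ≫ 𝟙 _ ≫ 𝟙 _ := by simp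
      exact this) (by
      let a := (StrongTrans.comp H.hom X).map (𝟙
        ((StrongTrans.comp G.hom X).obj ((StrongTrans.comp F.hom X).obj x.snd)))
      have : 𝟙 _ = 𝟙 _ ≫ a ≫ 𝟙 _ ≫ 𝟙 _ ≫ 𝟙 _ := by simp [a]
      exact this))
  map₂_left_unitor {p q} F := Bicat.Slice.hom₂_ext (hom₂_ext fun X x =>
    CategoricalPullback.hom_ext (by
      have : 𝟙 x.fst = 𝟙 _ ≫ 𝟙 _ ≫ 𝟙 _ := by simp
      exact this) (by
      let a := (StrongTrans.comp F.hom X).map (𝟙 x.snd)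
      have : 𝟙 _ = 𝟙 _ ≫ a ≫ 𝟙 _ := by simp [a]
      exact this))
  map₂_right_unitor {p q} F := Bicat.Slice.hom₂_ext (hom₂_ext fun X x =>
    CategoricalPullback.hom_ext (by
      have : 𝟙 x.fst = 𝟙 _ ≫ 𝟙 _ ≫ 𝟙 _ := by simp
      exact this) (by
      have : 𝟙 ((StrongTrans.comp F.hom X).obj x.snd) = 𝟙 _ ≫ 𝟙 _ ≫ 𝟙 _ := by simp
      exact this))

end BaseChange
end Fib

namespace Fib

section Giraud

open Pseudofunctor
open scoped CoGrothendieck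

variable {K : Type u} [Category.{v} K] {D : IndCat.{v, u, v', u'} K}

/-- The cartesian arrow `(Y, D(y) U) ⟶ (X, U)` over `y : Y ⟶ X`. -/
abbrev cl (X : ∫ᶜ D) {Y : K} (y : Y ⟶ X.base) :
    CoGrothendieck.domainCartesianLift X.fiber y ⟶ X :=
  CoGrothendieck.cartesianLift X.fiber y

lemma exists_cl (X : ∫ᶜ D) {Y : K} (y : Y ⟶ X.base) {A : ∫ᶜ D} (f : A ⟶ X) (z : A.base ⟶ Y)
    (hz : z ≫ y = f.base) :
    ∃ k : A ⟶ CoGrothendieck.domainCartesianLift X.fiber y, k.base = z ∧ k ≫ cl X y = f := by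
  have : (CoGrothendieck.forget D).IsStronglyCartesian y (cl X y) :=
    CoGrothendieck.isStronglyCartesian_homCartesianLift X.fiber y
  have : (CoGrothendieck.forget D).IsHomLift f.base f := IsHomLift.map (CoGrothendieck.forget D) f
  obtain ⟨k, ⟨h₁, h₂⟩, -⟩ := Functor.IsStronglyCartesian.universal_property
    (CoGrothendieck.forget D) y (cl X y) z f.base hz.symm f
  have h := IsHomLift.fac (CoGrothendieck.forget D) z k
  exact ⟨k, (h.trans ((Category.id_comp _).trans (Category.comp_id _))).symm, h₂⟩

/-- The sieve of those `y : Y ⟶ X` whose cartesian lift at `U` belongs to `S`. -/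
def cartSieve {X : ∫ᶜ D} (S : Sieve X) : Sieve X.base where
  arrows _ y := S (cl X y)
  downward_closed {Y Z} y hy z := by
    obtain ⟨k, -, hk⟩ := exists_cl X y (cl X (z ≫ y)) z rfl
    rw [← hk]
    exact S.downward_closed hy k

/-- The Giraud topology on the Grothendieck construction: a sieve `S` on `(X, U)` is covering when
the arrows of the base whose cartesian lifts belong to `S` form a covering sieve. -/
def giraud (J : GrothendieckTopology K) (D : IndCat.{v, u, v', u'} K) :
    GrothendieckTopology (∫ᶜ D) where
  sieves X := {S | cartSieve S ∈ J X.base}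
  top_mem' X := J.superset_covering (fun _ _ _ => trivial) (J.top_mem X.base)
  pullback_stable' X Y S f hS := by
    refine J.superset_covering ?_ (J.pullback_stable f.base hS)
    intro Z z hz
    obtain ⟨k, -, hk⟩ := exists_cl X (z ≫ f.base) (cl Y z ≫ f) (𝟙 Z) (Category.id_comp _)
    change S (cl Y z ≫ f)
    rw [← hk]
    exact S.downward_closed hz k
  transitive' X S hS R hR := by
    refine J.transitive hS _ ?_
    intro Y y hy
    refine J.superset_covering ?_ (hR hy)
    intro Z z hz
    obtain ⟨k, hk, hk'⟩ := exists_cl X y (cl X (z ≫ y)) z rfl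
    obtain ⟨l, -, hl⟩ := exists_cl (CoGrothendieck.domainCartesianLift X.fiber y) z k (𝟙 Z)
      ((Category.id_comp _).trans hk.symm)
    change R (cl X (z ≫ y))
    rw [← hk', ← hl, Category.assoc]
    exact R.downward_closed hz l

end Giraud

section Stacks

open Pseudofunctor Bicat
open scoped CoGrothendieck

variable {K : Type u} [Category.{v} K]

/-- `J`-stacks, as a full sub-bicategory of the indexed categories. -/
abbrev St (J : GrothendieckTopology K) :=
  FullSub (fun A : IndCat.{v, u, v', u'} K => A.IsStack J)

/-- Indexed fibrations over `D` whose total indexed category is a `J`-stack. -/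
abbrev StOver (J : GrothendieckTopology K) (D : IndCat.{v, u, v', u'} K) :=
  FullSub (fun p : FibOver D => p.total.IsStack J)

variable {J : GrothendieckTopology K}

/-- The inclusion of stacks. -/
abbrev stIncl (J : GrothendieckTopology K) :
    St.{v, u, v', u'} J ⥤ᵖ IndCat.{v, u, v', u'} K := FullSub.incl _

/-- The restriction `A(X, -)` of a `𝒢(D)`-indexed category to `D(X)`. -/
abbrev restr {D : IndCat.{v, u, v', u'} K} (A : IndCat.{max v v', max u u', v₁, u₁} (∫ᶜ D))
    (X : K) : IndCat.{v', u', v₁, u₁} (D.fibre X) :=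
  (CoGrothendieck.ι D X).op.toPseudofunctor.comp A

/-- `s_J / D`: the action on fibrations over `D` of a stackification `s` that preserves indexed
fibrations. -/
abbrev sOver (s : IndCat.{v, u, v', u'} K ⥤ᵖ St.{v, u, v', u'} J)
    (hs : PreservesFibrations (fibClass K) (fibClass K) (s.comp (stIncl J)))
    (D : IndCat.{v, u, v', u'} K) : FibOver D ⥤ᵖ StOver J ((s.comp (stIncl J)).obj D) :=
  FullSub.lift (Slice.mapSlice (s.comp (stIncl J)) hs D) (fun p => (s.obj p.total).2)

/-- `i_J / D`: base change of fibred stacks along the unit of the stackification at `D`. -/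
abbrev iOver {s : IndCat.{v, u, v', max u' v'} K ⥤ᵖ St.{v, u, v', max u' v'} J}
    (σ : Biadjunction s (stIncl J)) (D : IndCat.{v, u, v', max u' v'} K) :
    StOver J ((s.comp (stIncl J)).obj D) ⥤ᵖ FibOver D :=
  (FullSub.incl _).comp (baseChange (σ.unit.app D))

/-- `R_D^J`: the composite of `i_J / D` and `R_D`, corestricted to stacks. -/
noncomputable abbrev rStack {s : IndCat.{v, u, v', max u' v'} K ⥤ᵖ St.{v, u, v', max u' v'} J}
    (σ : Biadjunction s (stIncl J)) (D : IndCat.{v, u, v', max u' v'} K)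
    (hR : ∀ q : StOver J ((s.comp (stIncl J)).obj D),
      Pseudofunctor.IsStack (((iOver σ D).comp (R D)).obj q) (giraud J D)) :
    StOver J ((s.comp (stIncl J)).obj D) ⥤ᵖ St (giraud J D) :=
  FullSub.lift ((iOver σ D).comp (R D)) hR

/-- `L_D^J`: the composite of the inclusion of stacks, a pseudofunctor `L` and `s_J / D`. -/
abbrev lStack (s : IndCat.{v, u, v', max u' v'} K ⥤ᵖ St.{v, u, v', max u' v'} J)
    (hs : PreservesFibrations (fibClass K) (fibClass K) (s.comp (stIncl J)))
    {D : IndCat.{v, u, v', max u' v'} K}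
    (L : IndCat.{max v v', max u u' v', v', max u' v'} (∫ᶜ D) ⥤ᵖ FibOver D) :
    St.{max v v', max u u' v', v', max u' v'} (giraud J D) ⥤ᵖ
      StOver J ((s.comp (stIncl J)).obj D) :=
  ((stIncl (giraud J D)).comp L).comp (sOver s hs D)

end Stacks
end Fib

open Fib Bicat

open Fib Bicat

namespace Bicat

section

variable {A : Type u₁} [Bicategory.{w₁, v₁} A] {B : Type u₂} [Bicategory.{w₂, v₂} B]

/-- For `η : a ⟶ R b`, the functor `Hom(b, c) ⥤ Hom(a, R c)` sending `f` to `η ≫ R f`. -/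
@[simps]
def post (R : B ⥤ᵖ A) {a : A} {b : B} (η : a ⟶ R.obj b) (c : B) :
    (b ⟶ c) ⥤ (a ⟶ R.obj c) where
  obj f := η ≫ R.map f
  map α := η ◁ R.map₂ α

/-- `η : a ⟶ R b` is a universal arrow from `a` to `R`. -/
def IsUniv (R : B ⥤ᵖ A) {a : A} {b : B} (η : a ⟶ R.obj b) : Prop :=
  ∀ c, (post R η c).IsEquivalence

namespace IsUniv

variable {R : B ⥤ᵖ A} {a : A} {b c : B} {η : a ⟶ R.obj b} (hη : IsUniv R η)

include hη

lemma exists_lift (x : a ⟶ R.obj c) : ∃ f : b ⟶ c, Nonempty (η ≫ R.map f ≅ x) := by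
  have := hη c
  exact ⟨(post R η c).objPreimage x, ⟨(post R η c).objObjPreimageIso x⟩⟩

lemma exists_iso {f g : b ⟶ c} (e : η ≫ R.map f ≅ η ≫ R.map g) :
    ∃ e' : f ≅ g, η ◁ R.map₂ e'.hom = e.hom := by
  have := hη c
  exact ⟨(post R η c).preimageIso e, (post R η c).map_preimage e.hom⟩

lemma exists_map₂ {f g : b ⟶ c} (e : η ≫ R.map f ⟶ η ≫ R.map g) :
    ∃ e' : f ⟶ g, η ◁ R.map₂ e' = e := by
  have := hη c
  exact ⟨(post R η c).preimage e, (post R η c).map_preimage e⟩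

lemma ext {f g : b ⟶ c} {x y : f ⟶ g} (h : η ◁ R.map₂ x = η ◁ R.map₂ y) : x = y := by
  have := hη c
  exact (post R η c).map_injective h

end IsUniv

/-- A choice of universal arrows. -/
structure UnivData (R : B ⥤ᵖ A) where
  obj : A → B
  η (a : A) : a ⟶ R.obj (obj a)
  univ (a : A) : IsUniv R (η a)

namespace UnivData

variable {R : B ⥤ᵖ A} (U : UnivData R)

/-- The action on arrows of the left adjoint. -/
noncomputable def map {a b : A} (f : a ⟶ b) : U.obj a ⟶ U.obj b :=
  ((U.univ a).exists_lift (f ≫ U.η b)).choose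

/-- The naturality constraint of the unit. -/
noncomputable def nat {a b : A} (f : a ⟶ b) : f ≫ U.η b ≅ U.η a ≫ R.map (U.map f) :=
  ((U.univ a).exists_lift (f ≫ U.η b)).choose_spec.some.symm

lemma exists_map₂ {a b : A} {f g : a ⟶ b} (θ : f ⟶ g) : ∃ θ' : U.map f ⟶ U.map g,
    θ ▷ U.η b ≫ (U.nat g).hom = (U.nat f).hom ≫ U.η a ◁ R.map₂ θ' := by
  obtain ⟨θ', h⟩ := (U.univ a).exists_map₂ ((U.nat f).inv ≫ θ ▷ U.η b ≫ (U.nat g).hom)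
  exact ⟨θ', by rw [h]; simp⟩

/-- The action on 2-cells of the left adjoint. -/
noncomputable def map₂ {a b : A} {f g : a ⟶ b} (θ : f ⟶ g) : U.map f ⟶ U.map g :=
  (U.exists_map₂ θ).choose

lemma map₂_spec {a b : A} {f g : a ⟶ b} (θ : f ⟶ g) :
    (U.nat f).hom ≫ U.η a ◁ R.map₂ (U.map₂ θ) = θ ▷ U.η b ≫ (U.nat g).hom :=
  (U.exists_map₂ θ).choose_spec.symm

lemma exists_mapId (a : A) : ∃ e : U.map (𝟙 a) ≅ 𝟙 (U.obj a),
    (U.nat (𝟙 a)).hom ≫ U.η a ◁ R.map₂ e.hom =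
      (λ_ (U.η a)).hom ≫ (ρ_ (U.η a)).inv ≫ U.η a ◁ (R.mapId _).inv := by
  obtain ⟨e, h⟩ := (U.univ a).exists_iso ((U.nat (𝟙 a)).symm ≪≫ λ_ (U.η a) ≪≫ (ρ_ (U.η a)).symm ≪≫
    whiskerLeftIso (U.η a) (R.mapId _).symm)
  exact ⟨e, by rw [h]; simp⟩

/-- The unit constraint of the left adjoint. -/
noncomputable def mapId (a : A) : U.map (𝟙 a) ≅ 𝟙 (U.obj a) := (U.exists_mapId a).choose

lemma mapId_spec (a : A) : (U.nat (𝟙 a)).hom ≫ U.η a ◁ R.map₂ (U.mapId a).hom =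
      (λ_ (U.η a)).hom ≫ (ρ_ (U.η a)).inv ≫ U.η a ◁ (R.mapId _).inv :=
  (U.exists_mapId a).choose_spec

/-- The naturality constraint at a composite, up to `R.mapComp`. -/
noncomputable def natComp {a b c : A} (f : a ⟶ b) (g : b ⟶ c) :
    (f ≫ g) ≫ U.η c ≅ U.η a ≫ R.map (U.map f ≫ U.map g) :=
  α_ _ _ _ ≪≫ whiskerLeftIso f (U.nat g) ≪≫ (α_ _ _ _).symm ≪≫
    whiskerRightIso (U.nat f) _ ≪≫ α_ _ _ _ ≪≫ whiskerLeftIso (U.η a) (R.mapComp _ _).symm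

lemma exists_mapComp {a b c : A} (f : a ⟶ b) (g : b ⟶ c) :
    ∃ e : U.map (f ≫ g) ≅ U.map f ≫ U.map g,
      (U.nat (f ≫ g)).hom ≫ U.η a ◁ R.map₂ e.hom = (U.natComp f g).hom := by
  obtain ⟨e, h⟩ := (U.univ a).exists_iso ((U.nat (f ≫ g)).symm ≪≫ U.natComp f g)
  exact ⟨e, by rw [h]; simp⟩

/-- The composition constraint of the left adjoint. -/
noncomputable def mapComp {a b c : A} (f : a ⟶ b) (g : b ⟶ c) :
    U.map (f ≫ g) ≅ U.map f ≫ U.map g := (U.exists_mapComp f g).choose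

lemma mapComp_spec {a b c : A} (f : a ⟶ b) (g : b ⟶ c) :
    (U.nat (f ≫ g)).hom ≫ U.η a ◁ R.map₂ (U.mapComp f g).hom = (U.natComp f g).hom :=
  (U.exists_mapComp f g).choose_spec

lemma ext {a b : A} {f : a ⟶ b} {g : U.obj a ⟶ U.obj b} {x y : U.map f ⟶ g}
    (h : (U.nat f).hom ≫ U.η a ◁ R.map₂ x = (U.nat f).hom ≫ U.η a ◁ R.map₂ y) : x = y :=
  (U.univ a).ext ((cancel_epi _).1 h)

lemma natComp_whiskerRight {a b c : A} (f : a ⟶ b) (g : b ⟶ c) {k : U.obj a ⟶ U.obj b}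
    (x : U.map f ⟶ k) :
    (U.natComp f g).hom ≫ U.η a ◁ R.map₂ (x ▷ U.map g) =
      (α_ _ _ _).hom ≫ f ◁ (U.nat g).hom ≫ (α_ _ _ _).inv ≫
        ((U.nat f).hom ≫ U.η a ◁ R.map₂ x) ▷ R.map (U.map g) ≫ (α_ _ _ _).hom ≫
          U.η a ◁ (R.mapComp _ _).inv := by
  simp [natComp, ← whiskerLeft_comp]

lemma natComp_whiskerLeft {a b c : A} (f : a ⟶ b) (g : b ⟶ c) {k : U.obj b ⟶ U.obj c}
    (x : U.map g ⟶ k) :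
    (U.natComp f g).hom ≫ U.η a ◁ R.map₂ (U.map f ◁ x) =
      (α_ _ _ _).hom ≫ f ◁ ((U.nat g).hom ≫ U.η b ◁ R.map₂ x) ≫ (α_ _ _ _).inv ≫
        (U.nat f).hom ▷ R.map k ≫ (α_ _ _ _).hom ≫ U.η a ◁ (R.mapComp _ _).inv := by
  simp only [natComp, Iso.trans_hom, whiskerLeftIso_hom, Iso.symm_hom, whiskerRightIso_hom,
    Category.assoc, Pseudofunctor.map₂_whisker_left, whiskerLeft_comp,
    whiskerLeft_inv_hom_assoc]
  rw [← associator_naturality_right_assoc, ← whisker_exchange_assoc,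
    ← associator_inv_naturality_right_assoc]

/-- The left adjoint pseudofunctor given by universal arrows. -/
noncomputable def left : A ⥤ᵖ B where
  obj := U.obj
  map := U.map
  map₂ := U.map₂
  map₂_id f := U.ext (by simp [map₂_spec])
  map₂_comp θ θ' := U.ext (by simp [map₂_spec, reassoc_of% @map₂_spec])
  mapId := U.mapId
  mapComp := U.mapComp
  map₂_whisker_left f g h θ := by
    rw [← cancel_mono (U.mapComp f h).hom]
    refine U.ext ?_
    simp only [Category.assoc, Iso.inv_hom_id, Category.comp_id, PrelaxFunctor.map₂_comp,
      whiskerLeft_comp]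
    rw [reassoc_of% @map₂_spec, mapComp_spec, reassoc_of% @mapComp_spec, natComp_whiskerLeft,
      map₂_spec]
    simp [natComp]
  map₂_whisker_right θ h := by
    rw [← cancel_mono (U.mapComp _ h).hom]
    refine U.ext ?_
    simp only [Category.assoc, Iso.inv_hom_id, Category.comp_id, PrelaxFunctor.map₂_comp,
      whiskerLeft_comp]
    rw [reassoc_of% @map₂_spec, mapComp_spec, reassoc_of% @mapComp_spec, natComp_whiskerRight,
      map₂_spec]
    simp only [natComp, Iso.trans_hom, whiskerLeftIso_hom, Iso.symm_hom, whiskerRightIso_hom,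
      comp_whiskerRight, Category.assoc]
    rw [associator_naturality_left_assoc, ← whisker_exchange_assoc,
      associator_inv_naturality_left_assoc]
  map₂_associator f g h := by
    rw [← cancel_mono (U.mapComp f (g ≫ h)).hom, ← cancel_mono (U.map f ◁ (U.mapComp g h).hom)]
    refine U.ext ?_
    simp only [Category.assoc, Iso.inv_hom_id, Category.comp_id, PrelaxFunctor.map₂_comp,
      whiskerLeft_comp, whiskerLeft_inv_hom]
    rw [reassoc_of% @map₂_spec, reassoc_of% @mapComp_spec, reassoc_of% @mapComp_spec,
      reassoc_of% @natComp_whiskerRight,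
      natComp_whiskerLeft, mapComp_spec, mapComp_spec]
    simp [natComp]
    rw [associator_inv_naturality_right_assoc, whisker_exchange_assoc,
      associator_naturality_right_assoc]
    simp
  map₂_left_unitor f := by
    refine U.ext ?_
    simp only [PrelaxFunctor.map₂_comp, whiskerLeft_comp]
    rw [map₂_spec, reassoc_of% @mapComp_spec, reassoc_of% @natComp_whiskerRight, mapId_spec]
    simp
  map₂_right_unitor f := by
    refine U.ext ?_
    simp only [PrelaxFunctor.map₂_comp, whiskerLeft_comp]
    rw [map₂_spec, reassoc_of% @mapComp_spec, reassoc_of% @natComp_whiskerLeft, mapId_spec]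
    simp only [whiskerLeft_comp, Category.assoc,
      Pseudofunctor.map₂_right_unitor, whiskerLeft_inv_hom_assoc]
    rw [associator_inv_naturality_right_assoc, whisker_exchange_assoc,
      associator_naturality_right_assoc]
    simp

/-- The unit of the biadjunction given by universal arrows. -/
noncomputable def unit : Pseudofunctor.id A ⟶ U.left.comp R where
  app := U.η
  naturality := U.nat
  naturality_naturality θ := (U.map₂_spec θ).symm
  naturality_id a := by
    change (U.nat (𝟙 a)).hom ≫ U.η a ◁ (R.map₂ (U.mapId a).hom ≫ (R.mapId _).hom) =
      𝟙 (𝟙 a) ▷ U.η a ≫ (λ_ _).hom ≫ (ρ_ _).inv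
    rw [whiskerLeft_comp, reassoc_of% @mapId_spec]
    simp
  naturality_comp {a b c} f g := by
    change (U.nat (f ≫ g)).hom ≫ U.η a ◁ (R.map₂ (U.mapComp f g).hom ≫ (R.mapComp _ _).hom) =
      𝟙 (f ≫ g) ▷ U.η c ≫ (α_ _ _ _).hom ≫ f ◁ (U.nat g).hom ≫ (α_ _ _ _).inv ≫
        (U.nat f).hom ▷ R.map (U.map g) ≫ (α_ _ _ _).hom
    rw [whiskerLeft_comp, reassoc_of% @mapComp_spec]
    simp [natComp]

/-- The left biadjoint given by universal arrows. -/
noncomputable def biadjunction : Biadjunction U.left R := ⟨U.unit, fun a c => U.univ a c⟩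

end UnivData

lemma Biadjunction.isUniv {L : A ⥤ᵖ B} {R : B ⥤ᵖ A} (σ : Biadjunction L R) (a : A) :
    IsUniv R (σ.unit.app a) := σ.isEquivalence_transpose a

end

section

variable {A : Type u₁} [Bicategory.{w₁, v₁} A] {B : Type u₂} [Bicategory.{w₂, v₂} B]

/-- A 1-cell is an equivalence when it has a quasi-inverse. -/
def IsEquiv {a b : A} (f : a ⟶ b) : Prop :=
  ∃ g : b ⟶ a, Nonempty (f ≫ g ≅ 𝟙 a) ∧ Nonempty (g ≫ f ≅ 𝟙 b)

namespace IsEquiv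

lemma id (a : A) : IsEquiv (𝟙 a) := ⟨𝟙 a, ⟨λ_ _⟩, ⟨λ_ _⟩⟩

lemma of_equivalence {a b : A} (e : a ≌ b) : IsEquiv e.hom := ⟨e.inv, ⟨e.unit.symm⟩, ⟨e.counit⟩⟩

lemma of_iso {a b : A} {f g : a ⟶ b} (e : f ≅ g) (hf : IsEquiv f) : IsEquiv g := by
  obtain ⟨h, ⟨i⟩, ⟨j⟩⟩ := hf
  exact ⟨h, ⟨whiskerRightIso e.symm h ≪≫ i⟩, ⟨whiskerLeftIso h e.symm ≪≫ j⟩⟩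

lemma exists_inv {a b : A} {f : a ⟶ b} (hf : IsEquiv f) : ∃ g : b ⟶ a, IsEquiv g ∧
    Nonempty (f ≫ g ≅ 𝟙 a) ∧ Nonempty (g ≫ f ≅ 𝟙 b) := by
  obtain ⟨g, h, h'⟩ := hf
  exact ⟨g, ⟨f, h', h⟩, h, h'⟩

lemma nonempty_equivalence {a b : A} {f : a ⟶ b} (hf : IsEquiv f) : Nonempty (a ≌ b) := by
  obtain ⟨g, ⟨h⟩, ⟨h'⟩⟩ := hf
  exact ⟨Bicategory.Equivalence.mkOfAdjointifyCounit h.symm h'⟩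

lemma comp {a b c : A} {f : a ⟶ b} {g : b ⟶ c} (hf : IsEquiv f) (hg : IsEquiv g) :
    IsEquiv (f ≫ g) := by
  obtain ⟨f', ⟨i⟩, ⟨i'⟩⟩ := hf
  obtain ⟨g', ⟨j⟩, ⟨j'⟩⟩ := hg
  exact ⟨g' ≫ f', ⟨α_ _ _ _ ≪≫ whiskerLeftIso f ((α_ _ _ _).symm ≪≫ whiskerRightIso j f' ≪≫ λ_ _)
    ≪≫ i⟩, ⟨α_ _ _ _ ≪≫ whiskerLeftIso g' ((α_ _ _ _).symm ≪≫ whiskerRightIso i' g ≪≫ λ_ _)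
    ≪≫ j'⟩⟩

lemma map (F : A ⥤ᵖ B) {a b : A} {f : a ⟶ b} (hf : IsEquiv f) : IsEquiv (F.map f) := by
  obtain ⟨g, ⟨i⟩, ⟨j⟩⟩ := hf
  exact ⟨F.map g, ⟨(F.mapComp f g).symm ≪≫ F.map₂Iso i ≪≫ F.mapId a⟩,
    ⟨(F.mapComp g f).symm ≪≫ F.map₂Iso j ≪≫ F.mapId b⟩⟩

lemma isEquivalence_precomp {a b : A} {f : a ⟶ b} (hf : IsEquiv f) (c : A) :
    (precomp c f).IsEquivalence := by
  obtain ⟨g, ⟨i⟩, ⟨j⟩⟩ := hf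
  exact (CategoryTheory.Equivalence.mk (precomp c f) (precomp c g)
    (NatIso.ofComponents (fun x => (λ_ x).symm ≪≫ whiskerRightIso j.symm x ≪≫ α_ _ _ _) (by
      intro x y t
      change t ≫ (λ_ y).inv ≫ j.inv ▷ y ≫ (α_ _ _ _).hom =
        ((λ_ x).inv ≫ j.inv ▷ x ≫ (α_ _ _ _).hom) ≫ g ◁ f ◁ t
      simp only [Category.assoc]
      rw [← associator_naturality_right, ← whisker_exchange_assoc, leftUnitor_inv_naturality_assoc]))
    (NatIso.ofComponents (fun x => (α_ _ _ _).symm ≪≫ whiskerRightIso i x ≪≫ λ_ x) (by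
      intro x y t
      change f ◁ g ◁ t ≫ (α_ _ _ _).inv ≫ i.hom ▷ y ≫ (λ_ y).hom =
        ((α_ _ _ _).inv ≫ i.hom ▷ x ≫ (λ_ x).hom) ≫ t
      simp only [Category.assoc]
      rw [← leftUnitor_naturality, ← whisker_exchange_assoc,
        ← associator_inv_naturality_right_assoc]))).isEquivalence_functor

lemma isEquivalence_postcomp {a b : A} {f : a ⟶ b} (hf : IsEquiv f) (c : A) :
    (postcomp c f).IsEquivalence := by
  obtain ⟨g, ⟨i⟩, ⟨j⟩⟩ := hf
  exact (CategoryTheory.Equivalence.mk (postcomp c f) (postcomp c g)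
    (NatIso.ofComponents (fun x => (ρ_ x).symm ≪≫ whiskerLeftIso x i.symm ≪≫ (α_ _ _ _).symm) (by
      intro x y t
      change t ≫ (ρ_ y).inv ≫ y ◁ i.inv ≫ (α_ _ _ _).inv =
        ((ρ_ x).inv ≫ x ◁ i.inv ≫ (α_ _ _ _).inv) ≫ t ▷ f ▷ g
      simp only [Category.assoc]
      rw [← associator_inv_naturality_left, whisker_exchange_assoc,
        rightUnitor_inv_naturality_assoc]))
    (NatIso.ofComponents (fun x => α_ _ _ _ ≪≫ whiskerLeftIso x j ≪≫ ρ_ x) (by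
      intro x y t
      change t ▷ g ▷ f ≫ (α_ _ _ _).hom ≫ y ◁ j.hom ≫ (ρ_ y).hom =
        ((α_ _ _ _).hom ≫ x ◁ j.hom ≫ (ρ_ x).hom) ≫ t
      simp only [Category.assoc]
      rw [← rightUnitor_naturality, whisker_exchange_assoc,
        associator_naturality_left_assoc]))).isEquivalence_functor

end IsEquiv

/-- A pseudofunctor is a local equivalence when it is an equivalence on hom-categories. -/
def IsLocEquiv (F : A ⥤ᵖ B) : Prop := ∀ a b, (F.mapFunctor a b).IsEquivalence

lemma IsLocEquiv.isEquiv {F : A ⥤ᵖ B} (hF : IsLocEquiv F) {a b : A} {f : a ⟶ b}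
    (hf : IsEquiv (F.map f)) : IsEquiv f := by
  obtain ⟨g', ⟨i⟩, ⟨j⟩⟩ := hf
  have := hF b a; have := hF a a; have := hF b b
  let g := (F.mapFunctor b a).objPreimage g'
  let e : F.map g ≅ g' := (F.mapFunctor b a).objObjPreimageIso g'
  exact ⟨g, ⟨(F.mapFunctor a a).preimageIso
      (F.mapComp f g ≪≫ whiskerLeftIso _ e ≪≫ i ≪≫ (F.mapId a).symm)⟩,
    ⟨(F.mapFunctor b b).preimageIso
      (F.mapComp g f ≪≫ whiskerRightIso e _ ≪≫ j ≪≫ (F.mapId b).symm)⟩⟩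

lemma IsLocEquiv.exists_map {F : A ⥤ᵖ B} (hF : IsLocEquiv F) {a b : A} (f : F.obj a ⟶ F.obj b) :
    ∃ g : a ⟶ b, Nonempty (F.map g ≅ f) := by
  have := hF a b
  exact ⟨(F.mapFunctor a b).objPreimage f, ⟨(F.mapFunctor a b).objObjPreimageIso f⟩⟩

lemma isLocEquiv_incl (P : B → Prop) : IsLocEquiv (FullSub.incl P) := fun _ _ =>
  { faithful := ⟨fun h => InducedBicategory.hom₂_ext h⟩
    full := ⟨fun t => ⟨⟨t⟩, rfl⟩⟩
    essSurj := ⟨fun f => ⟨InducedBicategory.mkHom f, ⟨Iso.refl _⟩⟩⟩ }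

lemma isUniv_of_isEquiv {R : B ⥤ᵖ A} (hR : IsLocEquiv R) {a : A} {b : B} {η : a ⟶ R.obj b}
    (hη : IsEquiv η) : IsUniv R η := fun c => by
  have := hR b c
  have := hη.isEquivalence_precomp (R.obj c)
  exact Functor.isEquivalence_of_iso
    (Iso.refl _ : R.mapFunctor b c ⋙ precomp (R.obj c) η ≅ post R η c)

lemma IsUniv.isEquivalence_mapFunctor {R : B ⥤ᵖ A} {a : A} {b : B} {η : a ⟶ R.obj b}
    (hη : IsUniv R η) (h : IsEquiv η) (c : B) : (R.mapFunctor b c).IsEquivalence := by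
  have := h.isEquivalence_precomp (R.obj c)
  have : (R.mapFunctor b c ⋙ precomp (R.obj c) η).IsEquivalence := hη c
  exact Functor.isEquivalence_of_comp_right _ (precomp (R.obj c) η)

/-- Two universal arrows from the same object are related by an equivalence. -/
lemma IsUniv.isEquiv_of_iso {R : B ⥤ᵖ A} {a : A} {b b' : B} {η : a ⟶ R.obj b} {η' : a ⟶ R.obj b'}
    (hη : IsUniv R η) (hη' : IsUniv R η') {f : b ⟶ b'} (e : η ≫ R.map f ≅ η') : IsEquiv f := by
  obtain ⟨g, ⟨e'⟩⟩ := hη'.exists_lift η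
  obtain ⟨i, -⟩ := hη.exists_iso (f := f ≫ g) (g := 𝟙 b)
    (whiskerLeftIso η (R.mapComp f g) ≪≫ (α_ _ _ _).symm ≪≫ whiskerRightIso e _ ≪≫ e' ≪≫
      (ρ_ η).symm ≪≫ whiskerLeftIso η (R.mapId b).symm)
  obtain ⟨j, -⟩ := hη'.exists_iso (f := g ≫ f) (g := 𝟙 b')
    (whiskerLeftIso η' (R.mapComp g f) ≪≫ (α_ _ _ _).symm ≪≫ whiskerRightIso e' _ ≪≫ e ≪≫
      (ρ_ η').symm ≪≫ whiskerLeftIso η' (R.mapId b').symm)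
  exact ⟨g, ⟨i⟩, ⟨j⟩⟩

lemma nonempty_fullSub_equivalence {P : B → Prop} {x y : FullSub P} (e : x.1 ≌ y.1) :
    Nonempty (x ≌ y) := by
  have h : IsEquiv ((FullSub.incl P).map (InducedBicategory.mkHom e.hom : x ⟶ y)) :=
    IsEquiv.of_equivalence e
  exact ((isLocEquiv_incl P).isEquiv h).nonempty_equivalence

/-- A pseudofunctor factor of an ambient universal arrow through a biequivalence. -/
lemma IsUniv.of_comp {C : Type*} [Bicategory C] {S : C ⥤ᵖ B} (hS : IsBiequivalence S)
    {R : B ⥤ᵖ A} {a : A} {c : C} {η : a ⟶ R.obj (S.obj c)} (hη : IsUniv (S.comp R) η) :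
    IsUniv R η := by
  have key (c' : C) : (post R η (S.obj c')).IsEquivalence := by
    have := hS.isEquivalence_mapFunctor c c'
    have : (S.mapFunctor c c' ⋙ post R η (S.obj c')).IsEquivalence := hη c'
    exact Functor.isEquivalence_of_comp_left (S.mapFunctor c c') _
  intro b
  obtain ⟨c', ⟨e⟩⟩ := hS.exists_equivalence b
  have h := IsEquiv.of_equivalence e
  have := key c'
  have := h.isEquivalence_postcomp (S.obj c)
  have := (h.map R).isEquivalence_postcomp a
  have : (postcomp (S.obj c) e.hom ⋙ post R η b).IsEquivalence :=
    Functor.isEquivalence_of_iso (F := post R η (S.obj c') ⋙ postcomp a (R.map e.hom))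
      (NatIso.ofComponents (fun f => α_ _ _ _ ≪≫ whiskerLeftIso η (R.mapComp f e.hom).symm) (by
        intro f g t
        change (η ◁ R.map₂ t) ▷ R.map e.hom ≫ (α_ _ _ _).hom ≫ η ◁ (R.mapComp _ _).inv =
          ((α_ _ _ _).hom ≫ η ◁ (R.mapComp _ _).inv) ≫ η ◁ R.map₂ (t ▷ e.hom)
        simp [← whiskerLeft_comp]))
  exact Functor.isEquivalence_of_comp_left (postcomp (S.obj c) e.hom) _

section

variable {L : A ⥤ᵖ B} {R : B ⥤ᵖ A} (σ : Biadjunction L R) (h : ∀ a, IsEquiv (σ.unit.app a))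

include h

lemma Biadjunction.isLocEquiv_left : IsLocEquiv L := fun a b => by
  have h₁ : (post R (σ.unit.app a) (L.obj b)).IsEquivalence := σ.isUniv a _
  have := (h b).isEquivalence_postcomp a
  have : (L.mapFunctor a b ⋙ post R (σ.unit.app a) (L.obj b)).IsEquivalence :=
    Functor.isEquivalence_of_iso (F := postcomp a (σ.unit.app b))
      (NatIso.ofComponents (fun f => σ.unit.naturality f) (by
        intro f g t
        exact σ.unit.naturality_naturality t))
  exact Functor.isEquivalence_of_comp_right _ (post R (σ.unit.app a) (L.obj b))

lemma Biadjunction.isBiequivalence_left (hL : ∀ b, ∃ a, Nonempty (L.obj a ≌ b)) :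
    IsBiequivalence L := ⟨σ.isLocEquiv_left h, hL⟩

lemma Biadjunction.isBiequivalence_right (hL : ∀ b, ∃ a, Nonempty (L.obj a ≌ b)) :
    IsBiequivalence R where
  isEquivalence_mapFunctor b b' := by
    obtain ⟨a, ⟨e⟩⟩ := hL b
    have he := IsEquiv.of_equivalence e
    have := (σ.isUniv a).isEquivalence_mapFunctor (h a) b'
    have := he.isEquivalence_precomp b'
    have := (he.map R).isEquivalence_precomp (R.obj b')
    have : (R.mapFunctor b b' ⋙ precomp (R.obj b') (R.map e.hom)).IsEquivalence :=
      Functor.isEquivalence_of_iso (F := precomp b' e.hom ⋙ R.mapFunctor (L.obj a) b')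
        (NatIso.ofComponents (fun f => R.mapComp e.hom f) (by
          intro f g t
          change R.map₂ (e.hom ◁ t) ≫ (R.mapComp e.hom g).hom =
            (R.mapComp e.hom f).hom ≫ R.map e.hom ◁ R.map₂ t
          simp))
    exact Functor.isEquivalence_of_comp_right _ (precomp (R.obj b') (R.map e.hom))
  exists_equivalence a := ⟨L.obj a, by
    obtain ⟨g, hg, -⟩ := (h a).exists_inv
    exact hg.nonempty_equivalence⟩

end

end

section

variable {A : Type*} [Bicategory A] {B : Type*} [Bicategory B] {C : Type*} [Bicategory C]

/-- A pseudonatural transformation from `H` to the composite of `F` and `R`, unbundled. -/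
structure TransTo (H : A ⥤ᵖ C) (F : A ⥤ᵖ B) (R : B ⥤ᵖ C) where
  app (a : A) : H.obj a ⟶ R.obj (F.obj a)
  nat {a b : A} (f : a ⟶ b) : H.map f ≫ app b ≅ app a ≫ R.map (F.map f)
  nat_map₂ {a b : A} {f g : a ⟶ b} (θ : f ⟶ g) :
    H.map₂ θ ▷ app b ≫ (nat g).hom = (nat f).hom ≫ app a ◁ R.map₂ (F.map₂ θ)
  nat_id (a : A) : (nat (𝟙 a)).hom ≫ app a ◁ (R.map₂ (F.mapId a).hom ≫ (R.mapId _).hom) =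
    (H.mapId a).hom ▷ app a ≫ (λ_ _).hom ≫ (ρ_ _).inv
  nat_comp {a b c : A} (f : a ⟶ b) (g : b ⟶ c) :
    (nat (f ≫ g)).hom ≫ app a ◁ (R.map₂ (F.mapComp f g).hom ≫ (R.mapComp _ _).hom) =
      (H.mapComp f g).hom ▷ app c ≫ (α_ _ _ _).hom ≫ H.map f ◁ (nat g).hom ≫ (α_ _ _ _).inv ≫
        (nat f).hom ▷ R.map (F.map g) ≫ (α_ _ _ _).hom

namespace TransTo

/-- The unbundling of a pseudonatural transformation. -/
@[simps]
def ofTrans {H : A ⥤ᵖ C} {F : A ⥤ᵖ B} {R : B ⥤ᵖ C} (α : H ⟶ F.comp R) : TransTo H F R where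
  app := α.app
  nat := α.naturality
  nat_map₂ := α.naturality_naturality
  nat_id := α.naturality_id
  nat_comp := α.naturality_comp

/-- The bundling of a pseudonatural transformation. -/
@[simps]
def toTrans {H : A ⥤ᵖ C} {F : A ⥤ᵖ B} {R : B ⥤ᵖ C} (α : TransTo H F R) : H ⟶ F.comp R where
  app := α.app
  naturality := α.nat
  naturality_naturality := α.nat_map₂
  naturality_id := α.nat_id
  naturality_comp := α.nat_comp

variable {H : A ⥤ᵖ C} {F G : A ⥤ᵖ B} {R : B ⥤ᵖ C} (α : TransTo H F R)

/-- The pseudonaturality of `α`, whiskered with `R x`. -/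
def left {a b : A} (f : a ⟶ b) {c : B} (x : F.obj b ⟶ c) :
    α.app a ≫ R.map (F.map f ≫ x) ≅ H.map f ≫ α.app b ≫ R.map x :=
  whiskerLeftIso (α.app a) (R.mapComp (F.map f) x) ≪≫ (α_ _ _ _).symm ≪≫
    whiskerRightIso (α.nat f).symm (R.map x) ≪≫ α_ _ _ _

lemma left_nat {a b : A} (f : a ⟶ b) {c : B} {x y : F.obj b ⟶ c} (ξ : x ⟶ y) :
    α.app a ◁ R.map₂ (F.map f ◁ ξ) ≫ (α.left f y).hom =
      (α.left f x).hom ≫ H.map f ◁ α.app b ◁ R.map₂ ξ := by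
  simp only [left, Iso.trans_hom, whiskerLeftIso_hom, Iso.symm_hom, whiskerRightIso_hom,
    Category.assoc, Pseudofunctor.map₂_whisker_left, whiskerLeft_comp]
  rw [← associator_naturality_right, ← whisker_exchange_assoc,
    ← associator_inv_naturality_right_assoc]
  simp

lemma left_map₂ {a b : A} {f g : a ⟶ b} (θ : f ⟶ g) {c : B} (x : F.obj b ⟶ c) :
    α.app a ◁ R.map₂ (F.map₂ θ ▷ x) ≫ (α.left g x).hom =
      (α.left f x).hom ≫ H.map₂ θ ▷ (α.app b ≫ R.map x) := by
  have h : α.app a ◁ R.map₂ (F.map₂ θ) ≫ (α.nat g).inv = (α.nat f).inv ≫ H.map₂ θ ▷ α.app b := by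
    rw [Iso.comp_inv_eq, Category.assoc, α.nat_map₂, Iso.inv_hom_id_assoc]
  simp only [left, Iso.trans_hom, whiskerLeftIso_hom, Iso.symm_hom, whiskerRightIso_hom,
    Category.assoc, Pseudofunctor.map₂_whisker_right, whiskerLeft_comp]
  rw [← associator_naturality_left, ← comp_whiskerRight_assoc, ← h]
  simp

lemma left_id {a : A} {c : B} (x : F.obj a ⟶ c) :
    (α.left (𝟙 a) x).hom = α.app a ◁ R.map₂ ((F.mapId a).hom ▷ x ≫ (λ_ x).hom) ≫ (λ_ _).inv ≫
      (H.mapId a).inv ▷ (α.app a ≫ R.map x) := by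
  have h : (α.nat (𝟙 a)).inv = α.app a ◁ (R.map₂ (F.mapId a).hom ≫ (R.mapId _).hom) ≫
      (ρ_ _).hom ≫ (λ_ _).inv ≫ (H.mapId a).inv ▷ α.app a := by
    have := α.nat_id a
    rw [← cancel_epi (α.nat (𝟙 a)).hom, Iso.hom_inv_id, reassoc_of% this]
    simp
  simp [left, h]

lemma left_comp {a b c : A} (f : a ⟶ b) (g : b ⟶ c) {d : B} (x : F.obj c ⟶ d) :
    (α.left (f ≫ g) x).hom = α.app a ◁ R.map₂ ((F.mapComp f g).hom ▷ x ≫ (α_ _ _ _).hom) ≫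
      (α.left f (F.map g ≫ x)).hom ≫ H.map f ◁ (α.left g x).hom ≫ (α_ _ _ _).inv ≫
        (H.mapComp f g).inv ▷ (α.app c ≫ R.map x) := by
  have h : (α.nat (f ≫ g)).inv = α.app a ◁ (R.map₂ (F.mapComp f g).hom ≫ (R.mapComp _ _).hom) ≫
      (α_ _ _ _).inv ≫ (α.nat f).inv ▷ R.map (F.map g) ≫ (α_ _ _ _).hom ≫ H.map f ◁ (α.nat g).inv ≫
        (α_ _ _ _).inv ≫ (H.mapComp f g).inv ▷ α.app c := by
    have := α.nat_comp f g
    rw [← cancel_epi (α.nat (f ≫ g)).hom, Iso.hom_inv_id, reassoc_of% this]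
    simp
  simp only [left, Iso.trans_hom, whiskerLeftIso_hom, Iso.symm_hom, whiskerRightIso_hom,
    Category.assoc, h]
  simp
  rw [← associator_naturality_right_assoc, ← whisker_exchange_assoc,
    ← associator_inv_naturality_right_assoc]
  simp

/-- Factorisation of a 1-cell into a composite through `α` and `ν`. -/
def right {a : A} {b c : B} {x : F.obj a ⟶ b} {k : H.obj a ⟶ R.obj b} (ν : α.app a ≫ R.map x ≅ k)
    (y : b ⟶ c) : α.app a ≫ R.map (x ≫ y) ≅ k ≫ R.map y :=
  whiskerLeftIso (α.app a) (R.mapComp x y) ≪≫ (α_ _ _ _).symm ≪≫ whiskerRightIso ν (R.map y)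

lemma right_nat {a : A} {b c : B} {x : F.obj a ⟶ b} {k : H.obj a ⟶ R.obj b}
    (ν : α.app a ≫ R.map x ≅ k) {y y' : b ⟶ c} (ξ : y ⟶ y') :
    α.app a ◁ R.map₂ (x ◁ ξ) ≫ (α.right ν y').hom = (α.right ν y).hom ≫ k ◁ R.map₂ ξ := by
  simp only [right, Iso.trans_hom, whiskerLeftIso_hom, Iso.symm_hom, whiskerRightIso_hom,
    Category.assoc, Pseudofunctor.map₂_whisker_left, whiskerLeft_comp, whiskerLeft_inv_hom_assoc]
  rw [← whisker_exchange, ← associator_inv_naturality_right_assoc]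

lemma right_id {a : A} {b : B} {x : F.obj a ⟶ b} {k : H.obj a ⟶ R.obj b}
    (ν : α.app a ≫ R.map x ≅ k) :
    (α.right ν (𝟙 b)).hom = α.app a ◁ R.map₂ (ρ_ x).hom ≫ ν.hom ≫ (ρ_ _).inv ≫
      k ◁ (R.mapId b).inv := by
  have : α.app a ◁ (R.mapComp x (𝟙 b)).hom ≫ (α_ _ _ _).inv ≫ (α.app a ≫ R.map x) ◁ (R.mapId b).hom
      = α.app a ◁ R.map₂ (ρ_ x).hom ≫ (ρ_ _).inv := by
    simp
  rw [rightUnitor_inv_naturality_assoc, ← whisker_exchange, ← reassoc_of% this]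
  simp [right]

lemma map₂_associator_inv_mapComp {b₁ b₂ b₃ b₄ : B} (x : b₁ ⟶ b₂) (y : b₂ ⟶ b₃) (z : b₃ ⟶ b₄) :
    R.map₂ (α_ x y z).inv ≫ (R.mapComp (x ≫ y) z).hom ≫ (R.mapComp x y).hom ▷ R.map z =
      (R.mapComp x (y ≫ z)).hom ≫ R.map x ◁ (R.mapComp y z).hom ≫ (α_ _ _ _).inv := by
  have h : R.map₂ (α_ x y z).hom ≫ R.map₂ (α_ x y z).inv = 𝟙 _ := by
    rw [← PrelaxFunctor.map₂_comp]; simp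
  rw [← cancel_epi (R.map₂ (α_ x y z).hom), reassoc_of% h]
  simp

lemma right_comp {a : A} {b c d : B} {x : F.obj a ⟶ b} {k : H.obj a ⟶ R.obj b}
    (ν : α.app a ≫ R.map x ≅ k) (y : b ⟶ c) (z : c ⟶ d) :
    (α.right ν (y ≫ z)).hom = α.app a ◁ R.map₂ (α_ _ _ _).inv ≫ (α.right (α.right ν y) z).hom ≫
      (α_ _ _ _).hom ≫ k ◁ (R.mapComp y z).inv := by
  have h : ν.hom ▷ R.map (y ≫ z) = (α.app a ≫ R.map x) ◁ (R.mapComp y z).hom ≫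
      ν.hom ▷ (R.map y ≫ R.map z) ≫ k ◁ (R.mapComp y z).inv := by
    rw [← whisker_exchange]
    simp
  have h' := congrArg (α.app a ◁ ·) (map₂_associator_inv_mapComp (R := R) x y z)
  simp only [whiskerLeft_comp] at h'
  simp only [right, Iso.trans_hom, whiskerLeftIso_hom, Iso.symm_hom, whiskerRightIso_hom,
    Category.assoc, comp_whiskerRight, whisker_assoc,
    Iso.inv_hom_id_assoc]
  rw [reassoc_of% h', h]
  simp

lemma right_left {a b : A} (f : a ⟶ b) {c d : B} {x : F.obj b ⟶ c} {k : H.obj b ⟶ R.obj c}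
    (ν : α.app b ≫ R.map x ≅ k) (y : c ⟶ d) :
    (α.left f (x ≫ y)).hom ≫ H.map f ◁ (α.right ν y).hom = α.app a ◁ R.map₂ (α_ _ _ _).inv ≫
      (α.right (α.left f x ≪≫ whiskerLeftIso _ ν) y).hom ≫ (α_ _ _ _).hom := by
  have h := congrArg (α.app a ◁ ·) (map₂_associator_inv_mapComp (R := R) (F.map f) x y)
  simp only [whiskerLeft_comp] at h
  simp only [left, right, Iso.trans_hom, whiskerLeftIso_hom, Iso.symm_hom, whiskerRightIso_hom,
    Category.assoc, comp_whiskerRight, whisker_assoc, whiskerLeft_comp,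
    Iso.inv_hom_id_assoc]
  rw [reassoc_of% h, ← associator_naturality_right_assoc, ← whisker_exchange_assoc,
    ← associator_inv_naturality_right_assoc]
  simp

lemma right_map₂ {a : A} {b c : B} {x x' : F.obj a ⟶ b} {k k' : H.obj a ⟶ R.obj b}
    (ν : α.app a ≫ R.map x ≅ k) (ν' : α.app a ≫ R.map x' ≅ k') (ξ : x ⟶ x') (ζ : k ⟶ k')
    (h : α.app a ◁ R.map₂ ξ ≫ ν'.hom = ν.hom ≫ ζ) (y : b ⟶ c) :
    α.app a ◁ R.map₂ (ξ ▷ y) ≫ (α.right ν' y).hom = (α.right ν y).hom ≫ ζ ▷ R.map y := by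
  simp only [right, Iso.trans_hom, whiskerLeftIso_hom, Iso.symm_hom, whiskerRightIso_hom,
    Category.assoc, Pseudofunctor.map₂_whisker_right, whiskerLeft_comp, ← comp_whiskerRight, ← h]
  simp

/-- A pseudonatural transformation out of a pointwise universal one. -/
lemma exists_trans (hα : ∀ a, IsUniv R (α.app a)) (β : TransTo H G R) :
    ∃ (t : F ⟶ G) (ν : ∀ a, α.app a ≫ R.map (t.app a) ≅ β.app a), ∀ {a b : A} (f : a ⟶ b),
      α.app a ◁ R.map₂ (t.naturality f).hom ≫ (α.right (ν a) (G.map f)).hom =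
        (α.left f (t.app b)).hom ≫ H.map f ◁ (ν b).hom ≫ (β.nat f).hom := by
  choose t ν' using fun a => (hα a).exists_lift (β.app a)
  let ν a := (ν' a).some
  have key {a b : A} (f : a ⟶ b) : ∃ e : F.map f ≫ t b ≅ t a ≫ G.map f,
      α.app a ◁ R.map₂ e.hom ≫ (α.right (ν a) (G.map f)).hom =
        (α.left f (t b)).hom ≫ H.map f ◁ (ν b).hom ≫ (β.nat f).hom := by
    obtain ⟨e, he⟩ := (hα a).exists_iso (α.left f (t b) ≪≫ whiskerLeftIso _ (ν b) ≪≫ β.nat f ≪≫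
      (α.right (ν a) (G.map f)).symm)
    exact ⟨e, by rw [he]; simp⟩
  choose n hn using @key
  refine ⟨⟨t, n, ?_, ?_, ?_⟩, ν, hn⟩
  · intro a b f g θ
    refine (hα a).ext ((cancel_mono (α.right (ν a) (G.map g)).hom).1 ?_)
    rw [PrelaxFunctor.map₂_comp, PrelaxFunctor.map₂_comp, whiskerLeft_comp, whiskerLeft_comp,
      Category.assoc, Category.assoc, hn, right_nat, reassoc_of% (hn f), reassoc_of% @left_map₂,
      ← whisker_exchange_assoc, β.nat_map₂]
  · intro a
    refine (hα a).ext ((cancel_mono (α.right (ν a) _).hom).1 ?_)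
    rw [PrelaxFunctor.map₂_comp, PrelaxFunctor.map₂_comp, whiskerLeft_comp, whiskerLeft_comp,
      Category.assoc, Category.assoc, right_nat, reassoc_of% (hn (𝟙 a)), right_id, left_id]
    have h : (β.nat (𝟙 a)).hom ≫ β.app a ◁ R.map₂ (G.mapId a).hom = (H.mapId a).hom ▷ β.app a ≫
        (λ_ _).hom ≫ (ρ_ _).inv ≫ β.app a ◁ (R.mapId _).inv := by
      rw [← reassoc_of% (β.nat_id a)]
      simp
    simp only [Category.assoc]
    rw [h, ← whisker_exchange_assoc]
    have e : α.app a ◁ R.map₂ ((λ_ (t a)).hom ≫ (ρ_ (t a)).inv) ≫ α.app a ◁ R.map₂ (ρ_ (t a)).hom =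
        α.app a ◁ R.map₂ (λ_ (t a)).hom := by
      rw [← whiskerLeft_comp, ← PrelaxFunctor.map₂_comp]
      simp
    rw [reassoc_of% e]
    simp
  · intro a b c f g
    refine (hα a).ext ((cancel_mono (α.right (ν a) _).hom).1 ?_)
    simp only [PrelaxFunctor.map₂_comp, whiskerLeft_comp, Category.assoc]
    rw [right_nat, reassoc_of% (hn (f ≫ g)), right_comp, left_comp]
    have h : (β.nat (f ≫ g)).hom ≫ β.app a ◁ R.map₂ (G.mapComp f g).hom =
        ((H.mapComp f g).hom ▷ β.app c ≫ (α_ _ _ _).hom ≫ H.map f ◁ (β.nat g).hom ≫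
          (α_ _ _ _).inv ≫ (β.nat f).hom ▷ R.map (G.map g) ≫ (α_ _ _ _).hom) ≫
            β.app a ◁ (R.mapComp _ _).inv := by
      rw [← β.nat_comp f g]
      simp
    have h₁ := α.right_map₂ (α.left f (t b) ≪≫ whiskerLeftIso (H.map f) (ν b))
      (α.right (ν a) (G.map f)) (n f).hom (β.nat f).hom ((hn f).trans (by simp)) (G.map g)
    have h₂ := α.right_left f (ν b) (G.map g)
    have h₃ := congrArg (H.map f ◁ ·) (hn g)
    simp only [whiskerLeft_comp] at h₃
    have h₄ : α.app a ◁ R.map₂ (α_ _ _ _).inv ≫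
      (α.right (α.left f (t b) ≪≫ whiskerLeftIso (H.map f) (ν b)) (G.map g)).hom =
        (α.left f (t b ≫ G.map g)).hom ≫ H.map f ◁ (α.right (ν b) (G.map g)).hom ≫
          (α_ _ _ _).inv := by
      rw [reassoc_of% h₂]
      simp
    have h₅ : α.app a ◁ R.map₂ (α_ (t a) (G.map f) (G.map g)).hom ≫
        α.app a ◁ R.map₂ (α_ (t a) (G.map f) (G.map g)).inv = 𝟙 _ := by
      rw [← whiskerLeft_comp, ← PrelaxFunctor.map₂_comp]
      simp
    rw [reassoc_of% h₅, reassoc_of% h₁, reassoc_of% h₄, reassoc_of% @left_nat, reassoc_of% h₃]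
    simp only [Category.assoc]
    rw [h, ← whisker_exchange_assoc]
    simp

/-- A pseudonatural transformation, as one into a composite with the identity. -/
@[simps]
def ofId {F G : A ⥤ᵖ B} (t : F ⟶ G) : TransTo F G (Pseudofunctor.id B) where
  app := t.app
  nat := t.naturality
  nat_map₂ := t.naturality_naturality
  nat_id a := by
    change (t.naturality (𝟙 a)).hom ≫ t.app a ◁ ((G.mapId a).hom ≫ 𝟙 _) = _
    rw [Category.comp_id]
    exact t.naturality_id a
  nat_comp {a b c} f g := by
    change (t.naturality (f ≫ g)).hom ≫ t.app a ◁ ((G.mapComp f g).hom ≫ 𝟙 _) = _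
    rw [Category.comp_id]
    exact t.naturality_comp f g

end TransTo

lemma isLocEquiv_id : IsLocEquiv (Pseudofunctor.id B) := fun a b =>
  inferInstanceAs (𝟭 (a ⟶ b)).IsEquivalence

/-- The right inverse of a pointwise equivalence. -/
lemma exists_right_inverse {F G : A ⥤ᵖ B} (t : F ⟶ G) (ht : ∀ a, IsEquiv (t.app a)) :
    ∃ s : G ⟶ F, Nonempty (t ≫ s ≅ 𝟙 F) ∧ ∀ a, IsEquiv (s.app a) := by
  obtain ⟨s, ν, h⟩ := (TransTo.ofId t).exists_trans
    (fun a => isUniv_of_isEquiv isLocEquiv_id (ht a)) (TransTo.ofId (𝟙 F))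
  let ν' (a : A) : t.app a ≫ s.app a ≅ 𝟙 (F.obj a) := ν a
  refine ⟨s, ⟨Pseudofunctor.StrongTrans.isoMk ν' fun {a b} f => ?_⟩, fun a => ?_⟩
  · have := h f
    change F.map f ◁ (ν' b).hom ≫ (ρ_ (F.map f)).hom ≫ (λ_ (F.map f)).inv =
      ((α_ _ _ _).inv ≫ (t.naturality f).hom ▷ s.app b ≫ (α_ _ _ _).hom ≫ t.app a ◁
        (s.naturality f).hom ≫ (α_ _ _ _).inv) ≫ (ν' a).hom ▷ F.map f
    have h' : t.app a ◁ (s.naturality f).hom ≫ t.app a ◁ 𝟙 _ ≫ (α_ _ _ _).inv ≫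
        (ν' a).hom ▷ F.map f = (t.app a ◁ 𝟙 _ ≫ (α_ _ _ _).inv ≫ (t.naturality f).inv ▷ s.app b ≫
          (α_ _ _ _).hom) ≫ F.map f ◁ (ν' b).hom ≫ (ρ_ (F.map f)).hom ≫ (λ_ (F.map f)).inv := this
    simp only [whiskerLeft_id, Category.id_comp, Category.assoc] at h'
    simp only [Category.assoc]
    rw [h']
    simp
  · obtain ⟨g, hg, ⟨i⟩, ⟨j⟩⟩ := (ht a).exists_inv
    exact hg.of_iso ((ρ_ g).symm ≪≫ whiskerLeftIso g (ν' a).symm ≪≫ (α_ _ _ _).symm ≪≫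
      whiskerRightIso j _ ≪≫ λ_ _)

/-- Pointwise equivalences of pseudofunctors are equivalences. -/
theorem nonempty_equivalence_of_pointwise {F G : A ⥤ᵖ B} (t : F ⟶ G)
    (ht : ∀ a, IsEquiv (t.app a)) : Nonempty (F ≌ G) := by
  obtain ⟨s, ⟨i⟩, hs⟩ := exists_right_inverse t ht
  obtain ⟨r, ⟨j⟩, -⟩ := exists_right_inverse s hs
  have e : t ≅ r := (ρ_ t).symm ≪≫ whiskerLeftIso t j.symm ≪≫ (α_ _ _ _).symm ≪≫
    whiskerRightIso i r ≪≫ λ_ r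
  exact IsEquiv.nonempty_equivalence ⟨s, ⟨i⟩, ⟨whiskerLeftIso s e ≪≫ j⟩⟩

lemma isEquiv_app {F G : A ⥤ᵖ B} (e : F ≌ G) (a : A) : IsEquiv (e.hom.app a) := by
  have key {K : A ⥤ᵖ B} {s t : K ⟶ K} (i : s ≅ t) : Nonempty (s.app a ≅ t.app a) :=
    ⟨⟨i.hom.as.app a, i.inv.as.app a, congrArg (fun m => m.as.app a) i.hom_inv_id,
      congrArg (fun m => m.as.app a) i.inv_hom_id⟩⟩
  exact ⟨e.inv.app a, key e.unit.symm, key e.counit⟩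

/-- Local equivalences can be cancelled from the right. -/
theorem nonempty_equivalence_of_comp {F G : A ⥤ᵖ B} {R : B ⥤ᵖ C} (hR : IsLocEquiv R)
    (e : F.comp R ≌ G.comp R) : Nonempty (F ≌ G) := by
  obtain ⟨t, ν, -⟩ := (TransTo.ofTrans (𝟙 (F.comp R))).exists_trans
    (fun a => isUniv_of_isEquiv hR (IsEquiv.id _)) (TransTo.ofTrans e.hom)
  exact nonempty_equivalence_of_pointwise t fun a => hR.isEquiv
    ((isEquiv_app e a).of_iso ((ν a).symm ≪≫ λ_ (R.map (t.app a))))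

variable {Z : Type*} [Bicategory Z]

/-- Precomposition of a pseudonatural transformation with a pseudofunctor. -/
def whiskL (K : Z ⥤ᵖ A) {F G : A ⥤ᵖ B} (t : F ⟶ G) : K.comp F ⟶ K.comp G where
  app z := t.app (K.obj z)
  naturality f := t.naturality (K.map f)
  naturality_naturality θ := t.naturality_naturality (K.map₂ θ)
  naturality_id z := by
    change (t.naturality (K.map (𝟙 z))).hom ≫ t.app (K.obj z) ◁
      (G.map₂ (K.mapId z).hom ≫ (G.mapId _).hom) =
        (F.map₂ (K.mapId z).hom ≫ (F.mapId _).hom) ▷ t.app (K.obj z) ≫ (λ_ _).hom ≫ (ρ_ _).inv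
    rw [whiskerLeft_comp, ← t.naturality_naturality_assoc, t.naturality_id, comp_whiskerRight,
      Category.assoc]
  naturality_comp {x y z} f g := by
    change (t.naturality (K.map (f ≫ g))).hom ≫ t.app (K.obj x) ◁
      (G.map₂ (K.mapComp f g).hom ≫ (G.mapComp _ _).hom) =
        (F.map₂ (K.mapComp f g).hom ≫ (F.mapComp _ _).hom) ▷ t.app (K.obj z) ≫ (α_ _ _ _).hom ≫
          F.map (K.map f) ◁ (t.naturality (K.map g)).hom ≫ (α_ _ _ _).inv ≫
            (t.naturality (K.map f)).hom ▷ G.map (K.map g) ≫ (α_ _ _ _).hom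
    rw [whiskerLeft_comp, ← t.naturality_naturality_assoc, t.naturality_comp, comp_whiskerRight,
      Category.assoc]

set_option maxHeartbeats 1000000 in
lemma whiskR_comp {F G : A ⥤ᵖ B} (t : F ⟶ G) (R : B ⥤ᵖ C) {a b c : A} (f : a ⟶ b) (g : b ⟶ c) :
    ((R.mapComp (F.map (f ≫ g)) (t.app c)).inv ≫ R.map₂ (t.naturality (f ≫ g)).hom ≫
      (R.mapComp (t.app a) (G.map (f ≫ g))).hom) ≫ R.map (t.app a) ◁
        (R.map₂ (G.mapComp f g).hom ≫ (R.mapComp _ _).hom) =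
    (R.map₂ (F.mapComp f g).hom ≫ (R.mapComp _ _).hom) ▷ R.map (t.app c) ≫ (α_ _ _ _).hom ≫
      R.map (F.map f) ◁ ((R.mapComp (F.map g) (t.app c)).inv ≫ R.map₂ (t.naturality g).hom ≫
        (R.mapComp (t.app b) (G.map g)).hom) ≫ (α_ _ _ _).inv ≫
          ((R.mapComp (F.map f) (t.app b)).inv ≫ R.map₂ (t.naturality f).hom ≫
            (R.mapComp (t.app a) (G.map f)).hom) ▷ R.map (G.map g) ≫ (α_ _ _ _).hom := by
  have h := congrArg R.map₂ (t.naturality_comp f g)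
  simp only [PrelaxFunctor.map₂_comp, Pseudofunctor.map₂_whisker_left,
    Pseudofunctor.map₂_whisker_right, Category.assoc] at h ⊢
  have e : (R.mapComp (F.map f) (t.app b ≫ G.map g)).inv ≫ R.map₂ (α_ _ _ _).inv ≫
      (R.mapComp (F.map f ≫ t.app b) (G.map g)).hom = R.map (F.map f) ◁ (R.mapComp _ _).hom ≫
        (α_ _ _ _).inv ≫ (R.mapComp _ _).inv ▷ R.map (G.map g) := by
    rw [Iso.inv_comp_eq, ← cancel_mono ((R.mapComp (F.map f) (t.app b)).hom ▷ R.map (G.map g))]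
    simpa using TransTo.map₂_associator_inv_mapComp (R := R) (F.map f) (t.app b) (G.map g)
  rw [← cancel_epi (R.mapComp (F.map (f ≫ g)) (t.app c)).hom]
  have h' := h =≫ ((R.mapComp (t.app a) (G.map f ≫ G.map g)).hom ≫
    R.map (t.app a) ◁ (R.mapComp _ _).hom)
  simpa [reassoc_of% e] using h'

/-- Postcomposition of a pseudonatural transformation with a pseudofunctor. -/
def whiskR {F G : A ⥤ᵖ B} (t : F ⟶ G) (R : B ⥤ᵖ C) : F.comp R ⟶ G.comp R where
  app a := R.map (t.app a)
  naturality {a b} f := (R.mapComp (F.map f) (t.app b)).symm ≪≫ R.map₂Iso (t.naturality f) ≪≫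
    R.mapComp (t.app a) (G.map f)
  naturality_naturality {a b f g} θ := by
    change R.map₂ (F.map₂ θ) ▷ R.map (t.app b) ≫ (R.mapComp (F.map g) (t.app b)).inv ≫
      R.map₂ (t.naturality g).hom ≫ (R.mapComp (t.app a) (G.map g)).hom =
        ((R.mapComp (F.map f) (t.app b)).inv ≫ R.map₂ (t.naturality f).hom ≫
          (R.mapComp (t.app a) (G.map f)).hom) ≫ R.map (t.app a) ◁ R.map₂ (G.map₂ θ)
    have h := congrArg R.map₂ (t.naturality_naturality θ)
    simp only [PrelaxFunctor.map₂_comp, Pseudofunctor.map₂_whisker_left,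
      Pseudofunctor.map₂_whisker_right, Category.assoc] at h ⊢
    rw [← cancel_epi (R.mapComp (F.map f) (t.app b)).hom,
      ← cancel_mono (R.mapComp (t.app a) (G.map g)).inv]
    simpa using h
  naturality_id a := by
    change ((R.mapComp (F.map (𝟙 a)) (t.app a)).inv ≫ R.map₂ (t.naturality (𝟙 a)).hom ≫
      (R.mapComp (t.app a) (G.map (𝟙 a))).hom) ≫ R.map (t.app a) ◁ (R.map₂ (G.mapId a).hom ≫
        (R.mapId _).hom) = (R.map₂ (F.mapId a).hom ≫ (R.mapId _).hom) ▷ R.map (t.app a) ≫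
          (λ_ _).hom ≫ (ρ_ _).inv
    have h := congrArg R.map₂ (t.naturality_id a)
    simp only [PrelaxFunctor.map₂_comp, Pseudofunctor.map₂_whisker_left,
      Pseudofunctor.map₂_whisker_right, Category.assoc] at h ⊢
    rw [← cancel_epi (R.mapComp (F.map (𝟙 a)) (t.app a)).hom]
    have e : R.map₂ (ρ_ (t.app a)).inv = (ρ_ _).inv ≫ R.map (t.app a) ◁ (R.mapId _).inv ≫
        (R.mapComp (t.app a) (𝟙 _)).inv := by
      have : R.map₂ (ρ_ (t.app a)).hom ≫ R.map₂ (ρ_ (t.app a)).inv = 𝟙 _ := by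
        rw [← PrelaxFunctor.map₂_comp]; simp
      rw [← cancel_epi (R.map₂ (ρ_ (t.app a)).hom), this]
      simp
    have h' := h =≫ ((R.mapComp (t.app a) (𝟙 _)).hom ≫ R.map (t.app a) ◁ (R.mapId _).hom)
    simpa [e] using h'
  naturality_comp f g := whiskR_comp t R f g

lemma mk_congr (P : PrelaxFunctor A B) (i i') (c c') (p₁ p₂ p₃ p₄ p₅ q₁ q₂ q₃ q₄ q₅) (hi : i = i')
    (hc : ∀ (x y z : A) (f : x ⟶ y) (g : y ⟶ z), c f g = c' f g) :
    Pseudofunctor.mk P i c p₁ p₂ p₃ p₄ p₅ = Pseudofunctor.mk P i' c' q₁ q₂ q₃ q₄ q₅ := by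
  subst hi
  obtain rfl : @c = @c' := by
    funext x y z f g
    exact hc x y z f g
  rfl

lemma comp_assoc {D : Type*} [Bicategory D] (F : A ⥤ᵖ B) (G : B ⥤ᵖ C) (H : C ⥤ᵖ D) :
    (F.comp G).comp H = F.comp (G.comp H) := by
  refine mk_congr _ _ _ _ _ _ _ _ _ _ _ _ _ _ _ ?_ ?_
  · funext a
    ext
    change H.map₂ (G.map₂ (F.mapId a).hom ≫ (G.mapId _).hom) ≫ (H.mapId _).hom =
      H.map₂ (G.map₂ (F.mapId a).hom) ≫ H.map₂ (G.mapId _).hom ≫ (H.mapId _).hom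
    simp
  · intro a b c f g
    ext
    change H.map₂ (G.map₂ (F.mapComp f g).hom ≫ (G.mapComp _ _).hom) ≫ (H.mapComp _ _).hom =
      H.map₂ (G.map₂ (F.mapComp f g).hom) ≫ H.map₂ (G.mapComp _ _).hom ≫ (H.mapComp _ _).hom
    simp

lemma id_comp_eq (F : A ⥤ᵖ B) : (Pseudofunctor.id A).comp F = F := by
  refine mk_congr _ _ _ _ _ _ _ _ _ _ _ _ _ _ _ ?_ ?_
  · funext a
    ext
    exact (congrArg (· ≫ _) (F.map₂_id _)).trans (Category.id_comp _)
  · intro a b c f g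
    ext
    exact (congrArg (· ≫ _) (F.map₂_id _)).trans (Category.id_comp _)

lemma comp_id_eq (F : A ⥤ᵖ B) : F.comp (Pseudofunctor.id B) = F := by
  refine mk_congr _ _ _ _ _ _ _ _ _ _ _ _ _ _ _ ?_ ?_
  · funext a
    ext
    exact Category.comp_id _
  · intro a b c f g
    ext
    exact Category.comp_id _

lemma lift_comp_incl {P : B → Prop} (F : A ⥤ᵖ B) (h : ∀ a, P (F.obj a)) :
    (FullSub.lift F h).comp (FullSub.incl P) = F := by
  refine mk_congr _ _ _ _ _ _ _ _ _ _ _ _ _ _ _ ?_ ?_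
  · funext a
    ext
    exact Category.comp_id _
  · intro a b c f g
    ext
    exact Category.comp_id _

lemma nonempty_whiskL (K : Z ⥤ᵖ A) {F G : A ⥤ᵖ B} (e : F ≌ G) : Nonempty (K.comp F ≌ K.comp G) :=
  nonempty_equivalence_of_pointwise (whiskL K e.hom) fun z => isEquiv_app e (K.obj z)

lemma nonempty_whiskR {F G : A ⥤ᵖ B} (e : F ≌ G) (R : B ⥤ᵖ C) : Nonempty (F.comp R ≌ G.comp R) :=
  nonempty_equivalence_of_pointwise (whiskR e.hom R) fun a => (isEquiv_app e a).map R

end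

section

variable {A : Type*} [Bicategory A] {B : Type*} [Bicategory B] {C : Type*} [Bicategory C]
  {L : A ⥤ᵖ B} {R : B ⥤ᵖ A} {S : B ⥤ᵖ C} {I : C ⥤ᵖ B}

lemma IsUniv.comp {a : A} {b : B} {c : C} {η : a ⟶ R.obj b} {θ : b ⟶ I.obj c} (hη : IsUniv R η)
    (hθ : IsUniv I θ) : IsUniv (I.comp R) (η ≫ R.map θ) := fun c' => by
  have := hθ c'
  have := hη (I.obj c')
  exact Functor.isEquivalence_of_iso (F := post I θ c' ⋙ post R η (I.obj c'))
    (G := post (I.comp R) (η ≫ R.map θ) c')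
    (NatIso.ofComponents (fun f => whiskerLeftIso η (R.mapComp θ (I.map f)) ≪≫ (α_ _ _ _).symm) (by
      intro f g t
      change η ◁ R.map₂ (θ ◁ I.map₂ t) ≫ η ◁ (R.mapComp θ (I.map g)).hom ≫ (α_ _ _ _).inv =
        (η ◁ (R.mapComp θ (I.map f)).hom ≫ (α_ _ _ _).inv) ≫ (η ≫ R.map θ) ◁ R.map₂ (I.map₂ t)
      simp))

lemma whisker_aux {a b c : A} {f f' : a ⟶ b} {t : b ⟶ c} {d : A} {t' : a ⟶ d}
    {g₁ g₂ g₃ g₄ : d ⟶ c} {n : f ≫ t ⟶ t' ≫ g₁} {n' : f' ≫ t ⟶ t' ≫ g₂} {x : f ⟶ f'} {x' : g₁ ⟶ g₂}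
    (y : g₂ ⟶ g₃) (z : g₃ ⟶ g₄) (h : x ▷ t ≫ n' = n ≫ t' ◁ x') :
    n ≫ t' ◁ ((x' ≫ y) ≫ z) = x ▷ t ≫ n' ≫ t' ◁ (y ≫ z) := by
  rw [Category.assoc, whiskerLeft_comp, reassoc_of% h]

/-- The whiskering of a unit with a pseudofunctor. -/
def whiskUnit (L : A ⥤ᵖ B) (t : Pseudofunctor.id B ⟶ S.comp I) : L ⟶ (L.comp S).comp I where
  app a := t.app (L.obj a)
  naturality f := t.naturality (L.map f)
  naturality_naturality θ := t.naturality_naturality (L.map₂ θ)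
  naturality_id a := by
    have h := t.naturality_id (L.obj a)
    have h' := t.naturality_naturality (L.mapId a).hom
    change (t.naturality (L.map (𝟙 a))).hom ≫ t.app (L.obj a) ◁
      (I.map₂ (S.map₂ (L.mapId a).hom ≫ (S.mapId _).hom) ≫ (I.mapId _).hom) =
        (L.mapId a).hom ▷ t.app (L.obj a) ≫ (λ_ _).hom ≫ (ρ_ _).inv
    change (t.naturality (𝟙 (L.obj a))).hom ≫ t.app (L.obj a) ◁
      (I.map₂ (S.mapId _).hom ≫ (I.mapId _).hom) =
        𝟙 (𝟙 (L.obj a)) ▷ t.app (L.obj a) ≫ (λ_ _).hom ≫ (ρ_ _).inv at h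
    change (L.mapId a).hom ▷ t.app (L.obj a) ≫ (t.naturality (𝟙 (L.obj a))).hom =
      (t.naturality (L.map (𝟙 a))).hom ≫ t.app (L.obj a) ◁ I.map₂ (S.map₂ (L.mapId a).hom) at h'
    rw [PrelaxFunctor.map₂_comp]
    refine (whisker_aux _ _ h').trans ((congrArg (_ ≫ ·) h).trans ?_)
    exact congrArg (_ ≫ ·) ((congrArg (· ≫ _) (id_whiskerRight _ _)).trans (Category.id_comp _))
  naturality_comp {a b c} f g := by
    have h := t.naturality_comp (L.map f) (L.map g)
    have h' := t.naturality_naturality (L.mapComp f g).hom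
    change (t.naturality (L.map (f ≫ g))).hom ≫ t.app (L.obj a) ◁
      (I.map₂ (S.map₂ (L.mapComp f g).hom ≫ (S.mapComp _ _).hom) ≫ (I.mapComp _ _).hom) =
        (L.mapComp f g).hom ▷ t.app (L.obj c) ≫ (α_ _ _ _).hom ≫ L.map f ◁
          (t.naturality (L.map g)).hom ≫ (α_ _ _ _).inv ≫ (t.naturality (L.map f)).hom ▷ _ ≫
            (α_ _ _ _).hom
    change (t.naturality (L.map f ≫ L.map g)).hom ≫ t.app (L.obj a) ◁
      (I.map₂ (S.mapComp _ _).hom ≫ (I.mapComp _ _).hom) =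
        𝟙 (L.map f ≫ L.map g) ▷ t.app (L.obj c) ≫ (α_ _ _ _).hom ≫ L.map f ◁
          (t.naturality (L.map g)).hom ≫ (α_ _ _ _).inv ≫ (t.naturality (L.map f)).hom ▷ _ ≫
            (α_ _ _ _).hom at h
    change (L.mapComp f g).hom ▷ t.app (L.obj c) ≫ (t.naturality (L.map f ≫ L.map g)).hom =
      (t.naturality (L.map (f ≫ g))).hom ≫ t.app (L.obj a) ◁ I.map₂ (S.map₂ (L.mapComp f g).hom)
        at h'
    rw [PrelaxFunctor.map₂_comp]
    refine (whisker_aux _ _ h').trans ((congrArg (_ ≫ ·) h).trans ?_)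
    exact congrArg (_ ≫ ·) ((congrArg (· ≫ _) (id_whiskerRight _ _)).trans (Category.id_comp _))

/-- Reassociation of the target of a pseudonatural transformation. -/
def reassocTarget {H : A ⥤ᵖ A} {F : A ⥤ᵖ C} (t : H ⟶ (F.comp I).comp R) : H ⟶ F.comp (I.comp R) where
  app := t.app
  naturality := t.naturality
  naturality_naturality := t.naturality_naturality
  naturality_id a := by
    have h := t.naturality_id a
    change _ ≫ _ ◁ (R.map₂ (I.map₂ (F.mapId a).hom ≫ (I.mapId _).hom) ≫ (R.mapId _).hom) = _ at h
    change _ ≫ _ ◁ (R.map₂ (I.map₂ (F.mapId a).hom) ≫ R.map₂ (I.mapId _).hom ≫ (R.mapId _).hom) = _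
    rwa [PrelaxFunctor.map₂_comp, Category.assoc] at h
  naturality_comp f g := by
    have h := t.naturality_comp f g
    change _ ≫ _ ◁ (R.map₂ (I.map₂ (F.mapComp f g).hom ≫ (I.mapComp _ _).hom) ≫
      (R.mapComp _ _).hom) = _ at h
    change _ ≫ _ ◁ (R.map₂ (I.map₂ (F.mapComp f g).hom) ≫ R.map₂ (I.mapComp _ _).hom ≫
      (R.mapComp _ _).hom) = _
    rwa [PrelaxFunctor.map₂_comp, Category.assoc] at h

/-- The composite of two biadjunctions. -/
def Biadjunction.comp (σ : Biadjunction L R) (τ : Biadjunction S I) :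
    Biadjunction (L.comp S) (I.comp R) where
  unit := reassocTarget (σ.unit ≫ whiskR (whiskUnit L τ.unit) R)
  isEquivalence_transpose a c := ((σ.isUniv a).comp (τ.isUniv (L.obj a))) c

/-- The restriction of a biadjunction to a full sub-bicategory containing the image of the right
adjoint. -/
def Biadjunction.restrict (σ : Biadjunction L R) {P : A → Prop} (h : ∀ b, P (R.obj b)) :
    Biadjunction ((FullSub.incl P).comp L) (FullSub.lift R h) where
  unit :=
    { app a := InducedBicategory.mkHom (σ.unit.app a.1)
      naturality f := InducedBicategory.isoMk (σ.unit.naturality f.hom)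
      naturality_naturality θ := InducedBicategory.hom₂_ext (σ.unit.naturality_naturality θ.hom)
      naturality_id a := InducedBicategory.hom₂_ext (by
        have h := σ.unit.naturality_id a.1
        change _ ≫ _ ◁ (R.map₂ (L.mapId a.1).hom ≫ (R.mapId _).hom) = _ at h
        change _ ≫ _ ◁ (R.map₂ (L.map₂ (𝟙 _) ≫ (L.mapId a.1).hom) ≫ (R.mapId _).hom) = _
        rw [PrelaxFunctor.map₂_id, Category.id_comp]
        exact h)
      naturality_comp f g := InducedBicategory.hom₂_ext (by
        have h := σ.unit.naturality_comp f.hom g.hom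
        change _ ≫ _ ◁ (R.map₂ (L.mapComp f.hom g.hom).hom ≫ (R.mapComp _ _).hom) = _ at h
        change _ ≫ _ ◁ (R.map₂ (L.map₂ (𝟙 _) ≫ (L.mapComp f.hom g.hom).hom) ≫
          (R.mapComp _ _).hom) = _
        rw [PrelaxFunctor.map₂_id, Category.id_comp]
        exact h) }
  isEquivalence_transpose a c := by
    have h₁ := isLocEquiv_incl P a ((FullSub.lift R h).obj c)
    let T : (L.obj a.1 ⟶ c) ⥤ (a ⟶ (FullSub.lift R h).obj c) :=
      post (FullSub.lift R h) (InducedBicategory.mkHom (σ.unit.app a.1)) c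
    have h₂ : (T ⋙ (FullSub.incl P).mapFunctor a ((FullSub.lift R h).obj c)).IsEquivalence :=
      σ.isUniv a.1 c
    exact @Functor.isEquivalence_of_comp_right _ _ _ _ _ _ T
      ((FullSub.incl P).mapFunctor a ((FullSub.lift R h).obj c)) h₁ h₂

/-- If the right adjoint of a biadjunction corestricts to a biequivalence onto a full
sub-bicategory, the inclusion of the latter has a left biadjoint. -/
def Biadjunction.reflection (σ : Biadjunction L R) {P : A → Prop} (h : ∀ b, P (R.obj b))
    (hR : IsBiequivalence (FullSub.lift R h)) :
    Biadjunction (L.comp (FullSub.lift R h)) (FullSub.incl P) where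
  unit :=
    { app := σ.unit.app
      naturality := σ.unit.naturality
      naturality_naturality := σ.unit.naturality_naturality
      naturality_id a := by
        have h := σ.unit.naturality_id a
        change _ ≫ _ ◁ (R.map₂ (L.mapId a).hom ≫ (R.mapId _).hom) = _ at h
        change _ ≫ _ ◁ ((R.map₂ (L.mapId a).hom ≫ (R.mapId _).hom) ≫ 𝟙 _) = _
        rw [Category.comp_id]
        exact h
      naturality_comp f g := by
        have h := σ.unit.naturality_comp f g
        change _ ≫ _ ◁ (R.map₂ (L.mapComp f g).hom ≫ (R.mapComp _ _).hom) = _ at h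
        change _ ≫ _ ◁ ((R.map₂ (L.mapComp f g).hom ≫ (R.mapComp _ _).hom) ≫ 𝟙 _) = _
        rw [Category.comp_id]
        exact h }
  isEquivalence_transpose a c := by
    have h₁ : IsUniv ((FullSub.lift R h).comp (FullSub.incl P)) (σ.unit.app a) := σ.isUniv a
    exact h₁.of_comp hR c

end

section

variable {A : Type*} [Bicategory A] {B : Type*} [Bicategory B] {C : Type*} [Bicategory C]

lemma nonempty_symm {x y : A} (e : x ≌ y) : Nonempty (y ≌ x) :=
  let ⟨_, hg, _⟩ := (IsEquiv.of_equivalence e).exists_inv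
  hg.nonempty_equivalence

lemma nonempty_trans {x y z : A} (e : x ≌ y) (e' : y ≌ z) : Nonempty (x ≌ z) :=
  ((IsEquiv.of_equivalence e).comp (IsEquiv.of_equivalence e')).nonempty_equivalence

lemma Biadjunction.nonempty_comp_equivalence_id {L : A ⥤ᵖ B} {R : B ⥤ᵖ A} (σ : Biadjunction L R)
    (h : ∀ a, IsEquiv (σ.unit.app a)) : Nonempty (L.comp R ≌ Pseudofunctor.id A) := by
  obtain ⟨e⟩ := nonempty_equivalence_of_pointwise σ.unit h
  obtain ⟨g, hg, -⟩ := (IsEquiv.of_equivalence e).exists_inv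
  exact hg.nonempty_equivalence

lemma Biadjunction.exists_counit_equivalence {L : A ⥤ᵖ B} {R : B ⥤ᵖ A} (σ : Biadjunction L R)
    (h : ∀ a, IsEquiv (σ.unit.app a)) (hR : IsLocEquiv R) (b : B) :
    Nonempty (L.obj (R.obj b) ≌ b) := by
  obtain ⟨g, hg, -⟩ := (h (R.obj b)).exists_inv
  obtain ⟨f, ⟨i⟩⟩ := hR.exists_map (a := L.obj (R.obj b)) (b := b) g
  exact (hR.isEquiv (hg.of_iso i.symm)).nonempty_equivalence

/-- The square of biadjunctions obtained from a biadjoint biequivalence `L ⊣ R`, a biadjunction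
`S ⊣ I` and a full sub-bicategory on which the composite biadjunction is a biequivalence. -/
theorem square {L : A ⥤ᵖ B} {R : B ⥤ᵖ A} {S : B ⥤ᵖ C} {I : C ⥤ᵖ B} (σ : Biadjunction L R)
    (τ : Biadjunction S I) (hσ : ∀ a, IsEquiv (σ.unit.app a)) (hR : IsLocEquiv R) {P : A → Prop}
    (hP : ∀ c, P ((I.comp R).obj c))
    (hη : ∀ a, P a → IsEquiv (R.map (τ.unit.app (L.obj a))))
    (hε : ∀ c, Nonempty (S.obj (I.obj c) ≌ c)) :
    ∃ sG : A ⥤ᵖ FullSub P, Nonempty (Biadjunction sG (FullSub.incl P)) ∧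
      (Nonempty (Biadjunction (((FullSub.incl P).comp L).comp S) (FullSub.lift (I.comp R) hP)) ∧
        IsBiequivalence (((FullSub.incl P).comp L).comp S) ∧
        IsBiequivalence (FullSub.lift (I.comp R) hP)) ∧
      Nonempty ((FullSub.lift (I.comp R) hP).comp (FullSub.incl P) ≌ I.comp R) ∧
      Nonempty ((((FullSub.incl P).comp L).comp S).comp I ≌ (FullSub.incl P).comp L) ∧
      Nonempty (sG.comp (((FullSub.incl P).comp L).comp S) ≌ L.comp S) ∧
      Nonempty (S.comp (FullSub.lift (I.comp R) hP) ≌ R.comp sG) := by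
  let τ' := σ.comp τ
  obtain ⟨ρ, hρ⟩ : ∃ ρ : Biadjunction (((FullSub.incl P).comp L).comp S)
      (FullSub.lift (I.comp R) hP), ∀ a, IsEquiv (ρ.unit.app a) := by
    rw [comp_assoc]
    refine ⟨τ'.restrict hP, fun a => (isLocEquiv_incl P).isEquiv ?_⟩
    have h : IsEquiv (σ.unit.app a.1 ≫ R.map (τ.unit.app (L.obj a.1))) := (hσ a.1).comp (hη a.1 a.2)
    exact h
  have hL (c : C) : ∃ a, Nonempty ((((FullSub.incl P).comp L).comp S).obj a ≌ c) := by
    obtain ⟨e⟩ := σ.exists_counit_equivalence hσ hR (I.obj c)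
    obtain ⟨e'⟩ := hε c
    exact ⟨⟨_, hP c⟩, (((IsEquiv.of_equivalence e).map S).comp
      (IsEquiv.of_equivalence e')).nonempty_equivalence⟩
  have hr := ρ.isBiequivalence_right hρ hL
  have hr' : IsLocEquiv (FullSub.lift (I.comp R) hP) := hr.isEquivalence_mapFunctor
  obtain ⟨u⟩ := ρ.nonempty_comp_equivalence_id hρ
  obtain ⟨w⟩ := σ.nonempty_comp_equivalence_id hσ
  refine ⟨(L.comp S).comp (FullSub.lift (I.comp R) hP), ⟨τ'.reflection hP hr⟩,
    ⟨⟨ρ⟩, ρ.isBiequivalence_left hρ hL, hr⟩, ?_, ?_, ?_, ?_⟩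
  · rw [lift_comp_incl]
    exact ⟨Bicategory.Equivalence.id _⟩
  · obtain ⟨e₁⟩ := nonempty_whiskR u (FullSub.incl P)
    obtain ⟨e₂⟩ := nonempty_whiskL (FullSub.incl P) w
    obtain ⟨e₂'⟩ := nonempty_symm e₂
    rw [comp_assoc, lift_comp_incl, id_comp_eq] at e₁
    rw [comp_id_eq] at e₂'
    obtain ⟨e₃⟩ := nonempty_trans e₁ e₂'
    exact nonempty_equivalence_of_comp hR (by
      rw [comp_assoc _ I R, comp_assoc _ L R]
      exact e₃)
  · obtain ⟨e₁⟩ := nonempty_whiskL ((L.comp S).comp (FullSub.lift (I.comp R) hP)) u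
    rw [comp_id_eq, ← comp_assoc] at e₁
    exact nonempty_equivalence_of_comp hr' e₁
  · obtain ⟨e₁⟩ := nonempty_whiskL R w
    rw [comp_id_eq] at e₁
    obtain ⟨e₂⟩ : Nonempty (R.comp L ≌ Pseudofunctor.id B) := nonempty_equivalence_of_comp hR (by
      rw [comp_assoc, id_comp_eq]
      exact e₁)
    obtain ⟨e₃⟩ := nonempty_whiskR e₂ (S.comp (FullSub.lift (I.comp R) hP))
    rw [id_comp_eq, comp_assoc] at e₃
    obtain ⟨e₄⟩ := nonempty_symm e₃
    rw [comp_assoc L S]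
    exact ⟨e₄⟩

end

namespace Slice

variable {B : Type*} [Bicategory B] {W : FibrationClass B} {b : B} {p q : Slice W b}

lemma exists_inverse (F : p ⟶ q) (g : q.total ⟶ p.total) (hg : W.cart q.proj p.proj g)
    (j : g ≫ F.hom ≅ 𝟙 q.total) : ∃ G : q ⟶ p, G.hom = g ∧ Nonempty (G ≫ F ≅ 𝟙 q) := by
  refine ⟨⟨g, whiskerLeftIso g F.iso.symm ≪≫ (α_ _ _ _).symm ≪≫ whiskerRightIso j q.proj ≪≫
    λ_ q.proj, hg⟩, rfl, ⟨isoMk j ?_⟩⟩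
  simp

/-- A 1-cell of the slice is an equivalence when the underlying 1-cell is one, with a quasi-inverse
preserving cartesian arrows. -/
lemma isEquiv_of_hom (F : p ⟶ q) (g : q.total ⟶ p.total) (hg : W.cart q.proj p.proj g)
    (i : F.hom ≫ g ≅ 𝟙 p.total) (j : g ≫ F.hom ≅ 𝟙 q.total) : IsEquiv F := by
  obtain ⟨G, rfl, ⟨j'⟩⟩ := exists_inverse F g hg j
  obtain ⟨H, -, ⟨i'⟩⟩ := exists_inverse G F.hom F.cart i
  have e : H ≅ F := (ρ_ H).symm ≪≫ whiskerLeftIso H j'.symm ≪≫ (α_ _ _ _).symm ≪≫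
    whiskerRightIso i' F ≪≫ λ_ F
  exact ⟨G, ⟨whiskerRightIso e.symm G ≪≫ i'⟩, ⟨j'⟩⟩

end Slice

lemma isEquivalence_post_incl {A : Type*} [Bicategory A] {B : Type*} [Bicategory B]
    {R : B ⥤ᵖ A} {P : B → Prop} {a : A} {b c : FullSub P} {η : a ⟶ R.obj b.1}
    (h : (post R η c.1).IsEquivalence) :
    (post ((FullSub.incl P).comp R) (show a ⟶ ((FullSub.incl P).comp R).obj b from η)
      c).IsEquivalence :=
  @Functor.isEquivalence_trans _ _ _ _ _ _ ((FullSub.incl P).mapFunctor b c) (post R η c.1)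
    (isLocEquiv_incl P b c) h

end Bicat

namespace Fib

noncomputable section

open Pseudofunctor StrongTrans Category
open scoped CoGrothendieck

variable {K : Type u} [Category.{v} K]

section

variable {E E' E'' : IndCat.{v, u, v', u'} K}

abbrev ob {X : K} (a : E.fibre X) : ∫ᶜ E := ⟨X, a⟩

def ar {X Y : K} (f : Y ⟶ X) {a : E.fibre Y} {b : E.fibre X} (m : a ⟶ (E.res f).obj b) :
    ob a ⟶ ob b := ⟨f, m⟩

@[simp] lemma ar_base {X Y : K} (f : Y ⟶ X) {a : E.fibre Y} {b : E.fibre X}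
    (m : a ⟶ (E.res f).obj b) : (ar f m).base = f := rfl

@[simp] lemma id_base (A : ∫ᶜ E) : CoGrothendieck.Hom.base (𝟙 A) = 𝟙 A.base := rfl

lemma base_congr {A B : ∫ᶜ E} {m n : A ⟶ B} (h : m = n) : m.base = n.base := h ▸ rfl

@[simp] lemma comp_base {A B C : ∫ᶜ E} (u : A ⟶ B) (w : B ⟶ C) :
    (u ≫ w).base = u.base ≫ w.base := rfl

lemma ar_inj {X Y : K} {f : Y ⟶ X} {a : E.fibre Y} {b : E.fibre X}
    {m n : a ⟶ (E.res f).obj b} (h : ar f m = ar f n) : m = n := by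
  have : HEq (ar f m).fiber (ar f n).fiber := by rw [h]
  exact eq_of_heq this

def vpart {A B : ∫ᶜ E} (u : A ⟶ B) : A.fiber ⟶ (E.res u.base).obj B.fiber := u.fiber

lemma ar_vpart {A B : ∫ᶜ E} (u : A ⟶ B) : ar u.base (vpart u) = u := rfl

lemma exists_ar {X Y : K} {f : Y ⟶ X} {a : E.fibre Y} {b : E.fibre X} (u : ob a ⟶ ob b)
    (h : u.base = f) : ∃ m, ar f m = u := by
  subst h
  exact ⟨_, ar_vpart u⟩

def overOf {X Y : K} (f : Y ⟶ X) {a : E.fibre Y} {b : E.fibre X} (u : ob a ⟶ ob b)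
    (h : u.base = f) : a ⟶ (E.res f).obj b := (exists_ar u h).choose

@[simp] lemma ar_overOf {X Y : K} (f : Y ⟶ X) {a : E.fibre Y} {b : E.fibre X} (u : ob a ⟶ ob b)
    (h : u.base = f) : ar f (overOf f u h) = u := (exists_ar u h).choose_spec

lemma ar_comp {X Y Z : K} (f : Y ⟶ X) (g : Z ⟶ Y) (k : Z ⟶ X) (hk : g ≫ f = k)
    {a : E.fibre Z} {b : E.fibre Y} {c : E.fibre X} (n : a ⟶ (E.res g).obj b)
    (m : b ⟶ (E.res f).obj c) : ar g n ≫ ar f m =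
      ar k (n ≫ (E.res g).map m ≫ (E.resComp f g k hk).inv.app c) := by
  subst hk
  rw [resComp_rfl]
  rfl

def ve {X : K} {a b : E.fibre X} (m : a ⟶ b) : ob a ⟶ ob b :=
  ar (𝟙 X) (m ≫ (E.resId X).inv.app b)

@[simp] lemma ve_base {X : K} {a b : E.fibre X} (m : a ⟶ b) : (ve m).base = 𝟙 X := rfl

@[simp] lemma ve_id {X : K} (a : E.fibre X) : ve (𝟙 a) = 𝟙 (ob a) :=
  (CoGrothendieck.ι E X).map_id a

@[simp] lemma ve_comp {X : K} {a b c : E.fibre X} (m : a ⟶ b) (n : b ⟶ c) :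
    ve (m ≫ n) = ve m ≫ ve n :=
  (CoGrothendieck.ι E X).map_comp m n

@[simp] lemma ve_comp_assoc {X : K} {a b c : E.fibre X} (m : a ⟶ b) (n : b ⟶ c) {Z : ∫ᶜ E}
    (k : ob c ⟶ Z) : ve (m ≫ n) ≫ k = ve m ≫ ve n ≫ k := by
  rw [ve_comp, assoc]

lemma ve_inj {X : K} {a b : E.fibre X} {m n : a ⟶ b} (h : ve m = ve n) : m = n := by
  have := ar_inj h
  rwa [cancel_mono] at this

lemma exists_ve {X : K} {a b : E.fibre X} (u : ob a ⟶ ob b) (h : u.base = 𝟙 X) :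
    ∃ m, ve m = u := by
  obtain ⟨m, rfl⟩ := exists_ar u h
  exact ⟨m ≫ (E.resId X).hom.app b, by simp [ve]⟩

def vert {X : K} {a b : E.fibre X} (u : ob a ⟶ ob b) (h : u.base = 𝟙 X) : a ⟶ b :=
  (exists_ve u h).choose

@[simp] lemma ve_vert {X : K} {a b : E.fibre X} (u : ob a ⟶ ob b) (h : u.base = 𝟙 X) :
    ve (vert u h) = u := (exists_ve u h).choose_spec

instance {X : K} {a b : E.fibre X} (m : a ⟶ b) [IsIso m] : IsIso (ve m) := by
  exact inferInstanceAs (IsIso ((CoGrothendieck.ι E X).map m))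

/-- The cartesian arrow over `f` with codomain `b`. -/
def ca {X Y : K} (f : Y ⟶ X) (b : E.fibre X) : ob ((E.res f).obj b) ⟶ ob b := ar f (𝟙 _)

@[simp] lemma ca_base {X Y : K} (f : Y ⟶ X) (b : E.fibre X) : (ca f b).base = f := rfl

lemma ar_eq {X Y : K} (f : Y ⟶ X) {a : E.fibre Y} {b : E.fibre X} (m : a ⟶ (E.res f).obj b) :
    ar f m = ve m ≫ ca f b := by
  rw [ca, ve, ar_comp f (𝟙 Y) f (id_comp f)]
  congr 1
  have h' := E.resComp_id_left f (id_comp f) b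
  have h'' : (E.resComp f (𝟙 Y) f (id_comp f)).hom.app b ≫
    (E.resComp f (𝟙 Y) f (id_comp f)).inv.app b = 𝟙 _ := Iso.hom_inv_id_app _ _
  rw [h'] at h''
  rw [CategoryTheory.Functor.map_id, assoc, id_comp, h'', comp_id]

abbrev Car {A B : ∫ᶜ E} (u : A ⟶ B) : Prop := IsCart (CoGrothendieck.forget E) u

lemma Car.exists_lift {A B C : ∫ᶜ E} {u : A ⟶ B} (hu : Car u) (w : C ⟶ B)
    (h : C.base ⟶ A.base) (hh : h ≫ u.base = w.base) : ∃ k : C ⟶ A, k.base = h ∧ k ≫ u = w :=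
  ((isCart_iff _ _).1 hu w h hh).exists

lemma Car.hom_ext {A B C : ∫ᶜ E} {u : A ⟶ B} (hu : Car u) {k k' : C ⟶ A}
    (h : k.base = k'.base) (h' : k ≫ u = k' ≫ u) : k = k' := IsCart.ext hu h h'

/-- The lift of an arrow through a cartesian arrow. -/
def Car.lift {A B C : ∫ᶜ E} {u : A ⟶ B} (hu : Car u) (w : C ⟶ B)
    (h : C.base ⟶ A.base) (hh : h ≫ u.base = w.base) : C ⟶ A := (hu.exists_lift w h hh).choose

@[simp] lemma Car.lift_base {A B C : ∫ᶜ E} {u : A ⟶ B} (hu : Car u) (w : C ⟶ B)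
    (h : C.base ⟶ A.base) (hh : h ≫ u.base = w.base) : (hu.lift w h hh).base = h :=
  (hu.exists_lift w h hh).choose_spec.1

@[simp] lemma Car.lift_comp {A B C : ∫ᶜ E} {u : A ⟶ B} (hu : Car u) (w : C ⟶ B)
    (h : C.base ⟶ A.base) (hh : h ≫ u.base = w.base) : hu.lift w h hh ≫ u = w :=
  (hu.exists_lift w h hh).choose_spec.2

lemma Car.of_comp {A B C : ∫ᶜ E} {u : A ⟶ B} {w : B ⟶ C} (hw : Car w) (h : Car (u ≫ w)) :
    Car u := by
  refine (isCart_iff _ _).2 fun Z g t ht => ?_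
  obtain ⟨k, hk, hk'⟩ := h.exists_lift (g ≫ w) t (by
    have ht : t ≫ u.base = g.base := ht
    exact (assoc _ _ _).symm.trans (congrArg (· ≫ _) ht))
  refine ⟨k, ⟨hk, hw.hom_ext ?_ (by simpa using hk')⟩, ?_⟩
  · rw [comp_base, hk]; exact ht
  · rintro l ⟨hl, rfl⟩
    exact h.hom_ext (hl.trans hk.symm) (by simpa using hk'.symm)

lemma Car.isIso {A B : ∫ᶜ E} {u : A ⟶ B} (hu : Car u) [IsIso u.base] : IsIso u := by
  obtain ⟨k, hk, hk'⟩ := hu.exists_lift (𝟙 B) (inv u.base) (by simp)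
  exact ⟨k, hu.hom_ext (by simp [hk]) (by simp [hk']), hk'⟩

lemma Car.isIso_of_base {A B : ∫ᶜ E} {u : A ⟶ B} (hu : Car u) (h : IsIso u.base) : IsIso u :=
  hu.isIso

lemma car_ca {X Y : K} (f : Y ⟶ X) (b : E.fibre X) : Car (ca f b) :=
  CoGrothendieck.isStronglyCartesian_homCartesianLift b f

lemma isIso_base {A B : ∫ᶜ E} (u : A ⟶ B) [IsIso u] : IsIso u.base :=
  inferInstanceAs (IsIso ((CoGrothendieck.forget E).map u))

lemma isIso_of_ve {X : K} {a b : E.fibre X} {m : a ⟶ b} (h : IsIso (ve m)) : IsIso m := by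
  have h₁ : (inv (ve m)).base = 𝟙 X := by
    have := base_congr (IsIso.hom_inv_id (ve m))
    exact (id_comp _).symm.trans this
  refine ⟨vert _ h₁, ve_inj ?_, ve_inj ?_⟩ <;> simp

lemma car_ve_iff {X : K} {a b : E.fibre X} {m : a ⟶ b} : Car (ve m) ↔ IsIso m := by
  constructor
  · intro h
    exact isIso_of_ve (h.isIso_of_base (inferInstanceAs (IsIso (𝟙 X))))
  · intro h
    exact isCart_of_isIso _ _

lemma car_ar_iff {X Y : K} {f : Y ⟶ X} {a : E.fibre Y} {b : E.fibre X}
    {m : a ⟶ (E.res f).obj b} : Car (ar f m) ↔ IsIso m := by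
  rw [ar_eq]
  exact ⟨fun h => car_ve_iff.1 ((car_ca f b).of_comp h),
    fun h => (car_ve_iff.2 h).comp (car_ca f b)⟩

lemma car_of_isIso {A B : ∫ᶜ E} (u : A ⟶ B) [IsIso u] : Car u := isCart_of_isIso _ _

lemma res_map {X Y : K} (f : Y ⟶ X) {a b : E.fibre X} (m : a ⟶ b) :
    ve ((E.res f).map m) ≫ ca f b = ca f a ≫ ve m := by
  rw [← ar_eq]
  rw [ca, ve, ar_comp (𝟙 X) f f (comp_id f)]
  congr 1
  have h' := E.resComp_id_right f (comp_id f) b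
  have h'' : (E.resComp (𝟙 X) f f (comp_id f)).hom.app b ≫
    (E.resComp (𝟙 X) f f (comp_id f)).inv.app b = 𝟙 _ := Iso.hom_inv_id_app _ _
  rw [h'] at h''
  rw [Functor.map_comp, assoc, id_comp, h'', comp_id]

lemma resComp_cl {X Y Z : K} (f : Y ⟶ X) (g : Z ⟶ Y) (k : Z ⟶ X) (hk : g ≫ f = k)
    (a : E.fibre X) : ve ((E.resComp f g k hk).hom.app a) ≫ ca g ((E.res f).obj a) ≫
      ca f a = ca k a := by
  rw [← reassoc_of% ar_eq]
  rw [ca, ar_comp f g k hk, CategoryTheory.Functor.map_id, id_comp, Iso.hom_inv_id_app]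
  rfl

lemma resId_cl {X : K} (a : E.fibre X) : ve ((E.resId X).inv.app a) ≫ ca (𝟙 X) a = 𝟙 _ := by
  rw [← ar_eq]
  rfl

end

section

variable {E E' E'' : IndCat.{v, u, v', u'} K}

/-- The functor between Grothendieck constructions induced by an indexed functor. -/
abbrev tot (F : E ⟶ E') : ∫ᶜ E ⥤ ∫ᶜ E' where
  obj A := ob ((StrongTrans.comp F A.base).obj A.fiber)
  map u := ar u.base ((StrongTrans.comp F _).map (vpart u) ≫ (StrongTrans.nat F u.base).hom.app _)
  map_id A := (CoGrothendieck.map F).map_id A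
  map_comp u w := (CoGrothendieck.map F).map_comp u w

lemma tot_ar (F : E ⟶ E') {X Y : K} (f : Y ⟶ X) {a : E.fibre Y} {b : E.fibre X}
    (m : a ⟶ (E.res f).obj b) : (tot F).map (ar f m) =
      ar f ((StrongTrans.comp F Y).map m ≫ (StrongTrans.nat F f).hom.app b) := rfl

@[simp] lemma tot_base (F : E ⟶ E') {A B : ∫ᶜ E} (u : A ⟶ B) :
    ((tot F).map u).base = u.base := rfl

lemma tot_ve (F : E ⟶ E') {X : K} {a b : E.fibre X} (m : a ⟶ b) : (tot F).map (ve m) =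
    ve ((StrongTrans.comp F X).map m) := by
  have h := nat_id_inv F X b
  have h' : (StrongTrans.nat F (𝟙 X)).inv.app b ≫ (StrongTrans.nat F (𝟙 X)).hom.app b = 𝟙 _ :=
    Iso.inv_hom_id_app _ _
  rw [ve, tot_ar, Functor.map_comp, ← h]
  simp only [assoc]
  rw [h']
  exact congrArg (fun t => ar (𝟙 X) ((StrongTrans.comp F X).map m ≫ t)) (comp_id _)

lemma tot_cl (F : E ⟶ E') {X Y : K} (f : Y ⟶ X) (a : E.fibre X) : (tot F).map (ca f a) =
    ar f ((StrongTrans.nat F f).hom.app a) := by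
  rw [ca, tot_ar, CategoryTheory.Functor.map_id, id_comp]

lemma Car.tot {A B : ∫ᶜ E} {u : A ⟶ B} (hu : Car u) (F : E ⟶ E') : Car ((tot F).map u) := by
  rw [← ar_vpart u] at hu ⊢
  have := car_ar_iff.1 hu
  rw [tot_ar, car_ar_iff]
  infer_instance

lemma tot_id {A B : ∫ᶜ E} (u : A ⟶ B) : (tot (𝟙 E)).map u = u :=
  CoGrothendieck.map_id_map u

lemma tot_comp (F : E ⟶ E') (G : E' ⟶ E'') {A B : ∫ᶜ E} (u : A ⟶ B) :
    (tot (F ≫ G)).map u = (tot G).map ((tot F).map u) := by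
  have h := comp_nat_app F G u.base B.fiber
  have h' := (StrongTrans.comp G A.base).map_comp ((StrongTrans.comp F A.base).map (vpart u))
    ((StrongTrans.nat F u.base).hom.app B.fiber)
  exact congrArg (ar u.base) ((congrArg (_ ≫ ·) h).trans
    ((congrArg (· ≫ _) h').trans (assoc _ _ _)).symm)

/-- An indexed natural transformation as a family of vertical arrows. -/
def vAt {F G : E ⟶ E'} (α : F ⟶ G) (A : ∫ᶜ E) : (tot F).obj A ⟶ (tot G).obj A :=
  ve ((StrongTrans.Hom.comp α A.base).app A.fiber)

@[simp] lemma vAt_base {F G : E ⟶ E'} (α : F ⟶ G) (A : ∫ᶜ E) : (vAt α A).base = 𝟙 A.base := rfl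

lemma vAt_nat {F G : E ⟶ E'} (α : F ⟶ G) {A B : ∫ᶜ E} (u : A ⟶ B) :
    (tot F).map u ≫ vAt α B = vAt α A ≫ (tot G).map u := by
  suffices h : ∀ {X Y : K} (f : Y ⟶ X) {a : E.fibre Y} {b : E.fibre X}
      (m : a ⟶ (E.res f).obj b), (tot F).map (ar f m) ≫ vAt α (ob b) =
        vAt α (ob a) ≫ (tot G).map (ar f m) from h u.base (vpart u)
  intro X Y f a b m
  have h₁ : ∀ (H : E ⟶ E'), (tot H).map (ar f m) = ve ((StrongTrans.comp H Y).map m ≫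
      (StrongTrans.nat H f).hom.app b) ≫ ca f ((StrongTrans.comp H X).obj b) := fun H => by
    rw [tot_ar, ar_eq]
  rw [h₁, h₁, assoc]
  have h₂ := res_map f ((StrongTrans.Hom.comp α X).app b)
  have h₃ := StrongTrans.Hom.nat α f b
  have h₄ := (StrongTrans.Hom.comp α Y).naturality m
  refine (congrArg (_ ≫ ·) h₂.symm).trans ?_
  rw [← ve_comp_assoc, assoc, ← h₃, reassoc_of% h₄]
  rw [ve_comp_assoc]
  rfl

lemma vAt_ext {F G : E ⟶ E'} {α β : F ⟶ G} (h : ∀ A, vAt α A = vAt β A) : α = β :=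
  hom₂_ext fun X a => ve_inj (h (ob a))

@[simp] lemma vAt_id (F : E ⟶ E') (A : ∫ᶜ E) : vAt (𝟙 F) A = 𝟙 _ := ve_id _

@[simp] lemma vAt_comp {F G H : E ⟶ E'} (α : F ⟶ G) (β : G ⟶ H) (A : ∫ᶜ E) :
    vAt (α ≫ β) A = vAt α A ≫ vAt β A := ve_comp _ _

lemma vAt_whiskerLeft (F : E ⟶ E') {G H : E' ⟶ E''} (α : G ⟶ H) (A : ∫ᶜ E) :
    vAt (F ◁ α) A = vAt α ((tot F).obj A) := rfl

lemma vAt_whiskerRight {F G : E ⟶ E'} (α : F ⟶ G) (H : E' ⟶ E'') (A : ∫ᶜ E) :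
    vAt (α ▷ H) A = (tot H).map (vAt α A) := (tot_ve H _).symm

/-- A natural family of vertical arrows as an indexed natural transformation. -/
def ofV {F G : E ⟶ E'} (t : ∀ A, (tot F).obj A ⟶ (tot G).obj A)
    (ht : ∀ A, (t A).base = 𝟙 A.base)
    (nat : ∀ {A B : ∫ᶜ E} (u : A ⟶ B), (tot F).map u ≫ t B = t A ≫ (tot G).map u) : F ⟶ G :=
  mkMod (fun _ => { app := fun a => vert (t (ob a)) (ht (ob a))
                    naturality := fun a b m => ve_inj (by
                      rw [ve_comp, ve_comp, ← tot_ve, ← tot_ve]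
                      have := nat (ve m)
                      have h₁ := ve_vert (t (ob a)) (ht (ob a))
                      have h₂ := ve_vert (t (ob b)) (ht (ob b))
                      exact (congrArg (_ ≫ ·) h₂).trans (this.trans (congrArg (· ≫ _) h₁.symm))) })
    (fun {X Y} f a => by
      have h := nat (ca f a)
      have h₁ := ve_vert (t (ob a)) (ht (ob a))
      have h₂ := ve_vert (t (ob ((E.res f).obj a))) (ht (ob ((E.res f).obj a)))
      rw [tot_cl, tot_cl, ar_eq, ar_eq] at h
      refine ve_inj ((car_ca f ((StrongTrans.comp G X).obj a)).hom_ext rfl ?_)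
      rw [ve_comp, ve_comp, assoc, assoc]
      refine (congrArg (· ≫ _) h₂).trans (h.symm.trans ?_)
      rw [assoc]
      refine congrArg (_ ≫ ·) (Eq.trans ?_ (res_map f _).symm)
      exact congrArg (_ ≫ ·) h₁.symm)

@[simp] lemma vAt_ofV {F G : E ⟶ E'} (t : ∀ A, (tot F).obj A ⟶ (tot G).obj A)
    (ht : ∀ A, (t A).base = 𝟙 A.base)
    (nat : ∀ {A B : ∫ᶜ E} (u : A ⟶ B), (tot F).map u ≫ t B = t A ≫ (tot G).map u) (A : ∫ᶜ E) :
    vAt (ofV t ht nat) A = t A := ve_vert (t A) (ht A)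

lemma base_inv {A B : ∫ᶜ E} {u : A ⟶ B} {w : B ⟶ A} (h : w ≫ u = 𝟙 _) {f : B.base ⟶ A.base}
    (hf : u.base ≫ f = 𝟙 _) : w.base = f := by
  have := base_congr h
  simp only [comp_base, id_base] at this
  rw [← comp_id w.base, ← hf, reassoc_of% this]

/-- A natural family of vertical isomorphisms as an invertible indexed natural transformation. -/
def isoOfV {F G : E ⟶ E'} (t : ∀ A, (tot F).obj A ⟶ (tot G).obj A)
    (ht : ∀ A, (t A).base = 𝟙 A.base) (hi : ∀ A, IsIso (t A))
    (nat : ∀ {A B : ∫ᶜ E} (u : A ⟶ B), (tot F).map u ≫ t B = t A ≫ (tot G).map u) : F ≅ G where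
  hom := ofV t ht nat
  inv := ofV (fun A => inv (t A)) (fun A => base_inv (IsIso.inv_hom_id (t A)) (by
    rw [ht]; exact comp_id _)) (fun {A B} u => by
      rw [IsIso.comp_inv_eq, assoc, IsIso.eq_inv_comp, nat])
  hom_inv_id := vAt_ext fun A => by simp
  inv_hom_id := vAt_ext fun A => by simp

instance {F G : E ⟶ E'} (α : F ⟶ G) [IsIso α] (A : ∫ᶜ E) : IsIso (vAt α A) :=
  ⟨vAt (inv α) A, by rw [← vAt_comp, IsIso.hom_inv_id, vAt_id],
    by rw [← vAt_comp, IsIso.inv_hom_id, vAt_id]⟩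

/-- An indexed functor, constructed from its action on the arrows of the Grothendieck
construction. -/
structure TotData (E E' : IndCat.{v, u, v', u'} K) where
  obj {X : K} (a : E.fibre X) : E'.fibre X
  map {A B : ∫ᶜ E} (u : A ⟶ B) : ob (obj A.fiber) ⟶ ob (obj B.fiber)
  base {A B : ∫ᶜ E} (u : A ⟶ B) : (map u).base = u.base
  map_id (A : ∫ᶜ E) : map (𝟙 A) = 𝟙 _
  map_comp {A B C : ∫ᶜ E} (u : A ⟶ B) (w : B ⟶ C) : map (u ≫ w) = map u ≫ map w
  car {A B : ∫ᶜ E} (u : A ⟶ B) (hu : Car u) : Car (map u)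

namespace TotData

attribute [simp] base map_id map_comp

variable (T : TotData E E')

def vmap {X : K} {a b : E.fibre X} (m : a ⟶ b) : T.obj a ⟶ T.obj b :=
  vert (T.map (A := ob a) (B := ob b) (ve m)) (T.base (ve m))

lemma ve_vmap {X : K} {a b : E.fibre X} (m : a ⟶ b) : ve (T.vmap m) = T.map (ve m) :=
  ve_vert _ _

/-- The components of the indexed functor. -/
def app (X : K) : E.fibre X ⥤ E'.fibre X where
  obj a := T.obj a
  map m := T.vmap m
  map_id a := ve_inj (by rw [ve_vmap, ve_id, ve_id, map_id])
  map_comp m n := ve_inj (by rw [ve_comp, ve_vmap, ve_vmap, ve_vmap, ve_comp, map_comp])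

lemma ve_app_map (X : K) {a b : E.fibre X} (m : a ⟶ b) :
    ve ((T.app X).map m) = T.map (ve m) := T.ve_vmap m

/-- The component of the pseudonaturality constraint. -/
def natHom {X Y : K} (f : Y ⟶ X) (a : E.fibre X) :
    T.obj ((E.res f).obj a) ⟶ (E'.res f).obj (T.obj a) :=
  overOf f (T.map (ca f a)) (T.base (ca f a))

lemma natHom_ca {X Y : K} (f : Y ⟶ X) (a : E.fibre X) :
    ve (T.natHom f a) ≫ ca f (T.obj a) = T.map (ca f a) := by
  rw [← ar_eq]
  exact ar_overOf f _ (T.base (ca f a))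

lemma isIso_natHom {X Y : K} (f : Y ⟶ X) (a : E.fibre X) : IsIso (T.natHom f a) := by
  rw [← car_ar_iff, ar_eq, natHom_ca]
  exact T.car _ (car_ca _ _)

/-- The pseudonaturality constraints of the indexed functor. -/
def nat {X Y : K} (f : Y ⟶ X) : E.res f ⋙ T.app Y ≅ T.app X ⋙ E'.res f :=
  NatIso.ofComponents (fun a =>
    @asIso _ _ _ _ (T.natHom f a) (T.isIso_natHom f a)) (fun {a b} m => by
      apply ve_inj
      refine (car_ca f (T.obj b)).hom_ext rfl ?_
      have h₂ := T.ve_app_map Y ((E.res f).map m)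
      have h₃ := T.ve_app_map X m
      have h₄ := congrArg T.map (res_map f m)
      rw [map_comp, map_comp] at h₄
      simp only [ve_comp]
      refine (assoc _ _ _).trans ((congrArg (_ ≫ ·) (T.natHom_ca f b)).trans ?_)
      refine (congrArg (· ≫ _) h₂).trans (h₄.trans ?_)
      refine Eq.trans ?_ (assoc _ _ _).symm
      refine Eq.trans ?_ (congrArg (_ ≫ ·) (res_map f ((T.app X).map m))).symm
      refine Eq.trans ?_ ((reassoc_of% (T.natHom_ca f a)) _).symm
      exact congrArg (_ ≫ ·) h₃.symm)

lemma ar_nat {X Y : K} (f : Y ⟶ X) (a : E.fibre X) :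
    ve ((T.nat f).hom.app a) ≫ ca f (T.obj a) = T.map (ca f a) :=
  T.natHom_ca f a

/-- The indexed functor. -/
def toTrans : E ⟶ E' :=
  mkTrans T.app T.nat
    (fun X a => by
      have h₁ := T.ar_nat (𝟙 X) a
      have h₂ : ve ((E'.resId X).hom.app (T.obj a)) = ca (𝟙 X) (T.obj a) := by
        rw [← id_comp (ca (𝟙 X) (T.obj a)), ← ve_id, ← Iso.hom_inv_id_app, ve_comp,
          assoc, resId_cl, comp_id]
      have h₃ : ve ((E.resId X).hom.app a) = ca (𝟙 X) a := by
        rw [← id_comp (ca (𝟙 X) a), ← ve_id, ← Iso.hom_inv_id_app, ve_comp,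
          assoc, resId_cl, comp_id]
      apply ve_inj
      rw [ve_comp, ve_app_map, h₃]
      exact (congrArg (_ ≫ ·) h₂).trans h₁)
    (fun {X Y Z} f g k hk a => by
      apply ve_inj
      refine Car.hom_ext ((car_ca g ((E'.res f).obj (T.obj a))).comp (car_ca f (T.obj a)))
        rfl ?_
      have h₁ := resComp_cl f g k hk (T.obj a)
      have h₂ := congrArg T.map (resComp_cl f g k hk a)
      have h₃ := res_map g ((T.nat f).hom.app a)
      have h₄ := T.ar_nat f a
      have h₅ := T.ar_nat g ((E.res f).obj a)
      have h₆ := T.ar_nat k a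
      have h₇ := T.ve_app_map Z ((E.resComp f g k hk).hom.app a)
      rw [map_comp, map_comp] at h₂
      simp only [ve_comp]
      refine (assoc _ _ _).trans ?_
      refine (congrArg (_ ≫ ·) h₁).trans (h₆.trans (h₂.symm.trans ?_))
      refine Eq.trans ?_ (assoc _ _ _).symm
      refine (congrArg (· ≫ _) h₇.symm).trans ?_
      refine congrArg (_ ≫ ·) ?_
      refine Eq.trans ?_ (assoc _ _ _).symm
      refine Eq.trans ?_ (congrArg (_ ≫ ·) ((reassoc_of% h₃) _)).symm
      refine Eq.trans ?_ (assoc _ _ _)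
      refine Eq.trans ?_ (congrArg (· ≫ _) h₅).symm
      exact congrArg (_ ≫ ·) h₄.symm)

lemma tot_map {A B : ∫ᶜ E} (u : A ⟶ B) : (tot T.toTrans).map u = T.map u := by
  have h : u = ve (vpart u) ≫ ca u.base B.fiber := (ar_vpart u).symm.trans (ar_eq _ _)
  have h₁ := T.ve_app_map A.base (vpart u)
  have h₂ := T.ar_nat u.base B.fiber
  refine (congrArg (tot T.toTrans).map h).trans (Eq.trans ?_ (congrArg T.map h).symm)
  rw [Functor.map_comp, T.map_comp, tot_ve, tot_cl, ar_eq]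
  exact (congrArg (· ≫ _) h₁).trans (congrArg (_ ≫ ·) h₂)

end TotData

end

section

variable {E : IndCat.{v, u, v', u'} K}

/-- Arrows can be glued along `S`, uniquely. -/
structure GlueHom (E : IndCat.{v, u, v', u'} K) {X : K} (S : Sieve X) : Prop where
  sep {a b : E.fibre X} (m n : a ⟶ b)
    (h : ∀ ⦃Y : K⦄ (f : Y ⟶ X), S f → ca f a ≫ ve m = ca f a ≫ ve n) : m = n
  glue {a b : E.fibre X} (μ : ∀ ⦃Y : K⦄ (f : Y ⟶ X), S f → (ob ((E.res f).obj a) ⟶ ob b))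
    (hμ : ∀ ⦃Y : K⦄ (f : Y ⟶ X) (hf : S f), (μ f hf).base = f)
    (hc : ∀ ⦃Y Z : K⦄ (f : Y ⟶ X) (hf : S f) (g : Z ⟶ X) (hg : S g)
      (k : ob ((E.res g).obj a) ⟶ ob ((E.res f).obj a)), k ≫ ca f a = ca g a →
        k ≫ μ f hf = μ g hg) :
    ∃ m : a ⟶ b, ∀ ⦃Y : K⦄ (f : Y ⟶ X) (hf : S f), ca f a ≫ ve m = μ f hf

/-- A descent datum along a sieve. -/
structure DD (E : IndCat.{v, u, v', u'} K) {X : K} (S : Sieve X) where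
  obj ⦃Y : K⦄ (f : Y ⟶ X) (hf : S f) : E.fibre Y
  tr ⦃Y Z : K⦄ (f : Y ⟶ X) (hf : S f) (g : Z ⟶ X) (hg : S g) (h : Z ⟶ Y) (e : h ≫ f = g) :
    ob (obj g hg) ⟶ ob (obj f hf)
  base ⦃Y Z : K⦄ (f : Y ⟶ X) (hf : S f) (g : Z ⟶ X) (hg : S g) (h : Z ⟶ Y) (e : h ≫ f = g) :
    (tr f hf g hg h e).base = h
  car ⦃Y Z : K⦄ (f : Y ⟶ X) (hf : S f) (g : Z ⟶ X) (hg : S g) (h : Z ⟶ Y) (e : h ≫ f = g) :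
    Car (tr f hf g hg h e)
  comp ⦃Y Z W : K⦄ (f : Y ⟶ X) (hf : S f) (g : Z ⟶ X) (hg : S g) (k : W ⟶ X) (hk : S k)
    (h : Z ⟶ Y) (e : h ≫ f = g) (h' : W ⟶ Z) (e' : h' ≫ g = k) (h'' : W ⟶ Y)
    (e'' : h'' ≫ f = k) (c : h' ≫ h = h'') :
    tr g hg k hk h' e' ≫ tr f hf g hg h e = tr f hf k hk h'' e''

attribute [simp] DD.base

/-- A family of cartesian arrows exhibiting an object as the gluing of a descent datum. -/
structure DD.Glued {X : K} {S : Sieve X} (d : DD E S) (a : E.fibre X) where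
  arr ⦃Y : K⦄ (f : Y ⟶ X) (hf : S f) : ob (d.obj f hf) ⟶ ob a
  base ⦃Y : K⦄ (f : Y ⟶ X) (hf : S f) : (arr f hf).base = f
  car ⦃Y : K⦄ (f : Y ⟶ X) (hf : S f) : Car (arr f hf)
  comp ⦃Y Z : K⦄ (f : Y ⟶ X) (hf : S f) (g : Z ⟶ X) (hg : S g) (h : Z ⟶ Y) (e : h ≫ f = g) :
    d.tr f hf g hg h e ≫ arr f hf = arr g hg

attribute [simp] DD.Glued.base DD.Glued.comp

/-- A descent datum is effective. -/
def DD.Effective {X : K} {S : Sieve X} (d : DD E S) : Prop := ∃ a, Nonempty (d.Glued a)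

end

section

variable {E : IndCat.{v, u, v', u'} K} {X : K} {S : Sieve X}

/-- An element of a sieve, as an index of the associated family. -/
abbrev idx ⦃Y : K⦄ (f : Y ⟶ X) (hf : S f) : S.arrows.category := ⟨Over.mk f, hf⟩

/-- The functor to Mathlib's descent data. -/
abbrev toDD (E : IndCat.{v, u, v', u'} K) (S : Sieve X) :=
  E.toDescentData (fun f : S.arrows.category => f.obj.hom)

lemma ofObj_hom_ca (M : E.fibre X) {Y Z W : K} (q : Y ⟶ X) (i : Z ⟶ X) (j : W ⟶ X) (f : Y ⟶ Z)
    (g : Y ⟶ W) (hf : f ≫ i = q) (hg : g ≫ j = q) :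
    ve ((E.resComp i f q hf).inv.app M ≫ (E.resComp j g q hg).hom.app M) ≫
      ca g ((E.res j).obj M) ≫ ca j M = ca f ((E.res i).obj M) ≫ ca i M := by
  rw [ve_comp_assoc, resComp_cl, ← resComp_cl i f q hf, ← ve_comp_assoc]
  rw [Iso.inv_hom_id_app, ve_id]
  exact id_comp _

lemma comm_iff (M N : E.fibre X) (m : ∀ i : S.arrows.category,
      (E.res i.obj.hom).obj M ⟶ (E.res i.obj.hom).obj N) :
    (∀ ⦃Y : K⦄ (q : Y ⟶ X) ⦃i j : S.arrows.category⦄ (f : Y ⟶ i.obj.left) (g : Y ⟶ j.obj.left)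
      (hf : f ≫ i.obj.hom = q) (hg : g ≫ j.obj.hom = q),
      (E.res f).map (m i) ≫ (E.resComp i.obj.hom f q hf).inv.app N ≫
        (E.resComp j.obj.hom g q hg).hom.app N =
      ((E.resComp i.obj.hom f q hf).inv.app M ≫
        (E.resComp j.obj.hom g q hg).hom.app M) ≫ (E.res g).map (m j)) ↔
    ∀ ⦃Y Z : K⦄ (f : Y ⟶ X) (hf : S f) (g : Z ⟶ X) (hg : S g)
      (k : ob ((E.res g).obj M) ⟶ ob ((E.res f).obj M)), k ≫ ca f M = ca g M →
        k ≫ ve (m (idx f hf)) ≫ ca f N = ve (m (idx g hg)) ≫ ca g N := by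
  have key : ∀ ⦃Y : K⦄ (q : Y ⟶ X) ⦃i j : S.arrows.category⦄ (f : Y ⟶ i.obj.left)
      (g : Y ⟶ j.obj.left) (hf : f ≫ i.obj.hom = q) (hg : g ≫ j.obj.hom = q),
      (E.res f).map (m i) ≫ (E.resComp i.obj.hom f q hf).inv.app N ≫
        (E.resComp j.obj.hom g q hg).hom.app N =
      ((E.resComp i.obj.hom f q hf).inv.app M ≫
        (E.resComp j.obj.hom g q hg).hom.app M) ≫ (E.res g).map (m j) ↔
      ca f ((E.res i.obj.hom).obj M) ≫ ve (m i) ≫ ca i.obj.hom N =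
        ve ((E.resComp i.obj.hom f q hf).inv.app M ≫
          (E.resComp j.obj.hom g q hg).hom.app M) ≫
            ca g ((E.res j.obj.hom).obj M) ≫ ve (m j) ≫ ca j.obj.hom N := by
    intro Y q i j f g hf hg
    have h₁ : ve ((E.res f).map (m i) ≫ (E.resComp i.obj.hom f q hf).inv.app N ≫
        (E.resComp j.obj.hom g q hg).hom.app N) ≫ ca g ((E.res j.obj.hom).obj N) ≫
          ca j.obj.hom N = ca f ((E.res i.obj.hom).obj M) ≫ ve (m i) ≫ ca i.obj.hom N := by
      rw [ve_comp_assoc]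
      refine (congrArg (_ ≫ ·) (ofObj_hom_ca N q i.obj.hom j.obj.hom f g hf hg)).trans ?_
      rw [reassoc_of% res_map]
    have h₂ : ve (((E.resComp i.obj.hom f q hf).inv.app M ≫
        (E.resComp j.obj.hom g q hg).hom.app M) ≫ (E.res g).map (m j)) ≫
          ca g ((E.res j.obj.hom).obj N) ≫ ca j.obj.hom N =
        ve ((E.resComp i.obj.hom f q hf).inv.app M ≫
          (E.resComp j.obj.hom g q hg).hom.app M) ≫
            ca g ((E.res j.obj.hom).obj M) ≫ ve (m j) ≫ ca j.obj.hom N := by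
      rw [ve_comp_assoc]
      refine congrArg (_ ≫ ·) ?_
      refine (assoc _ _ _).symm.trans ((congrArg (· ≫ _) (res_map g (m j))).trans ?_)
      exact assoc _ _ _
    constructor
    · intro h
      rw [← h₁, ← h₂]
      exact congrArg (fun t => ve t ≫ _) h
    · intro h
      refine ve_inj (Car.hom_ext ((car_ca g ((E.res j.obj.hom).obj N)).comp
        (car_ca j.obj.hom N)) rfl ?_)
      exact h₁.trans (h.trans h₂.symm)
  constructor
  · intro H Y Z f hf g hg k hk
    have hb : k.base ≫ f = g := base_congr hk
    have h := (key g (i := idx g hg) (j := idx f hf) (𝟙 Z) k.base (id_comp g) hb).1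
      (H g (i := idx g hg) (j := idx f hf) (𝟙 Z) k.base (id_comp g) hb)
    have e : ve ((E.resComp g (𝟙 Z) g (id_comp g)).inv.app M ≫
        (E.resComp f k.base g hb).hom.app M) ≫ ca k.base ((E.res f).obj M) =
          ca (𝟙 Z) ((E.res g).obj M) ≫ k := by
      refine (car_ca f M).hom_ext (by simp) ?_
      rw [assoc, assoc, hk]
      exact ofObj_hom_ca M g g f (𝟙 Z) k.base (id_comp g) hb
    have h' := h.trans ((reassoc_of% e) _)
    have : IsIso (ca (𝟙 Z) ((E.res g).obj M)) :=
      (car_ca (𝟙 Z) ((E.res g).obj M)).isIso_of_base (inferInstanceAs (IsIso (𝟙 Z)))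
    exact ((cancel_epi (ca (𝟙 Z) ((E.res g).obj M))).1 h').symm
  · intro H Y q i j f g hf hg
    rw [key]
    have hq : S q := hf ▸ S.downward_closed i.property f
    have h₁ := H i.obj.hom i.property q hq
      (ve ((E.resComp i.obj.hom f q hf).hom.app M) ≫ ca f ((E.res i.obj.hom).obj M))
      ((assoc _ _ _).trans (resComp_cl i.obj.hom f q hf M))
    have h₂ := H j.obj.hom j.property q hq
      (ve ((E.resComp j.obj.hom g q hg).hom.app M) ≫ ca g ((E.res j.obj.hom).obj M))
      ((assoc _ _ _).trans (resComp_cl j.obj.hom g q hg M))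
    rw [← cancel_epi (ve ((E.resComp i.obj.hom f q hf).hom.app M)), ← ve_comp_assoc,
      Iso.hom_inv_id_app_assoc]
    simp only [assoc] at h₁ h₂
    exact h₁.trans h₂.symm

lemma glueHom_iff : GlueHom E S ↔ ∀ M N : E.fibre X,
    Function.Bijective ((toDD E S).map : (M ⟶ N) → _) := by
  constructor
  · intro H M N
    constructor
    · intro m n h
      refine H.sep m n fun Y f hf => ?_
      rw [← res_map, ← res_map]
      have := congrArg (fun t => t.hom (idx f hf)) h
      exact congrArg (fun t => ve t ≫ ca f N) this
    · intro φ
      have hc := (comm_iff M N φ.hom).1 φ.comm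
      obtain ⟨m, hm⟩ := H.glue (fun Y f hf => ve (φ.hom (idx f hf)) ≫ ca f N)
        (fun Y f hf => id_comp _) hc
      refine ⟨m, DescentData.hom_ext fun i => ?_⟩
      refine ve_inj ((car_ca i.obj.hom N).hom_ext rfl ?_)
      exact (res_map i.obj.hom m).trans (hm i.obj.hom i.property)
  · intro H
    constructor
    · intro a b m n h
      refine (H a b).1 (DescentData.hom_ext fun i => ve_inj ?_)
      refine (car_ca i.obj.hom b).hom_ext rfl ?_
      exact (res_map i.obj.hom m).trans ((h _ i.property).trans (res_map i.obj.hom n).symm)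
    · intro a b μ hμ hc
      let m : ∀ i : S.arrows.category, (E.res i.obj.hom).obj a ⟶ (E.res i.obj.hom).obj b :=
        fun i => overOf i.obj.hom (μ _ i.property) (hμ _ i.property)
      have hm : ∀ i, ve (m i) ≫ ca i.obj.hom b = μ _ i.property := fun i => by
        rw [← ar_eq]; exact ar_overOf _ _ _
      obtain ⟨n, hn⟩ := (H a b).2 ⟨m, (comm_iff a b m).2 (fun Y Z f hf g hg k hk => by
        refine (congrArg (_ ≫ ·) (hm (idx f hf))).trans ?_
        exact (hc f hf g hg k hk).trans (hm (idx g hg)).symm)⟩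
      refine ⟨n, fun Y f hf => ?_⟩
      rw [← res_map]
      have := congrArg (fun t => t.hom (idx f hf)) hn
      exact (congrArg (fun t => ve t ≫ ca f b) this).trans (hm _)

end

section

variable {E : IndCat.{v, u, v', u'} K} {X : K} {S : Sieve X}

/-- The restriction of an arrow between restrictions. -/
abbrev pull {X₁ X₂ Y Z : K} {M₁ : E.fibre X₁} {M₂ : E.fibre X₂} {f₁ : Y ⟶ X₁} {f₂ : Y ⟶ X₂}
    (φ : (E.res f₁).obj M₁ ⟶ (E.res f₂).obj M₂) (g : Z ⟶ Y) (k₁ : Z ⟶ X₁) (k₂ : Z ⟶ X₂)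
    (h₁ : g ≫ f₁ = k₁) (h₂ : g ≫ f₂ = k₂) : (E.res k₁).obj M₁ ⟶ (E.res k₂).obj M₂ :=
  (E.resComp f₁ g k₁ h₁).hom.app M₁ ≫ (E.res g).map φ ≫ (E.resComp f₂ g k₂ h₂).inv.app M₂

lemma pull_ca {X₁ X₂ Y Z : K} {M₁ : E.fibre X₁} {M₂ : E.fibre X₂} {f₁ : Y ⟶ X₁} {f₂ : Y ⟶ X₂}
    (φ : (E.res f₁).obj M₁ ⟶ (E.res f₂).obj M₂) (g : Z ⟶ Y) (k₁ : Z ⟶ X₁) (k₂ : Z ⟶ X₂)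
    (h₁ : g ≫ f₁ = k₁) (h₂ : g ≫ f₂ = k₂) :
    ve (pull φ g k₁ k₂ h₁ h₂) ≫ ca k₂ M₂ =
      ve ((E.resComp f₁ g k₁ h₁).hom.app M₁) ≫ ca g ((E.res f₁).obj M₁) ≫ ve φ ≫ ca f₂ M₂ := by
  have h' : ve ((E.resComp f₂ g k₂ h₂).inv.app M₂) ≫ ca k₂ M₂ =
      ca g ((E.res f₂).obj M₂) ≫ ca f₂ M₂ := by
    rw [← resComp_cl f₂ g k₂ h₂, ← ve_comp_assoc, Iso.inv_hom_id_app, ve_id]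
    exact id_comp _
  rw [pull, ve_comp_assoc, ve_comp_assoc]
  refine congrArg (_ ≫ ·) ?_
  refine (congrArg (_ ≫ ·) h').trans ?_
  rw [reassoc_of% res_map]

namespace DD

def comparison (d : DD E S) {Y Z W : K} (q : Y ⟶ X) (i : Z ⟶ X) (hi : S i)
    (j : W ⟶ X) (hj : S j) (f : Y ⟶ Z) (g : Y ⟶ W) (hf : f ≫ i = q) (hg : g ≫ j = q) :
    (E.res f).obj (d.obj i hi) ⟶ (E.res g).obj (d.obj j hj) :=
  have hq : S q := hf ▸ S.downward_closed hi f
  have h : 𝟙 Y ≫ (d.tr i hi q hq f hf).base = (ca f (d.obj i hi)).base := by simp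
  vert ((car_ca g (d.obj j hj)).lift (Car.lift (d.car i hi q hq f hf) (ca f (d.obj i hi)) (𝟙 Y) h ≫
    d.tr j hj q hq g hg) (𝟙 Y) (by simp)) (by simp)

lemma comparison_ca (d : DD E S) {Y Z W : K} (q : Y ⟶ X) (i : Z ⟶ X) (hi : S i)
    (j : W ⟶ X) (hj : S j) (f : Y ⟶ Z) (g : Y ⟶ W) (hf : f ≫ i = q) (hg : g ≫ j = q)
    (hq : S q) (t : ob (d.obj q hq) ⟶ ob ((E.res f).obj (d.obj i hi)))
    (ht : t ≫ ca f (d.obj i hi) = d.tr i hi q hq f hf) (hb : t.base = 𝟙 Y) :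
    t ≫ ve (d.comparison q i hi j hj f g hf hg) ≫ ca g (d.obj j hj) = d.tr j hj q hq g hg := by
  rw [comparison, ve_vert, Car.lift_comp, ← assoc]
  refine (congrArg (· ≫ _) ?_).trans (id_comp _)
  refine (d.car i hi q hq f hf).hom_ext ?_ ?_
  · rw [comp_base, hb]
    exact (id_comp _).trans (Car.lift_base _ _ _ _)
  · exact (assoc _ _ _).trans ((congrArg (t ≫ ·) (Car.lift_comp _ _ _ _)).trans
      (ht.trans (id_comp _).symm))

lemma comparison_ext (d : DD E S) {Y Z W : K} {q : Y ⟶ X} {i : Z ⟶ X} {hi : S i}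
    {j : W ⟶ X} {hj : S j} {f : Y ⟶ Z} {g : Y ⟶ W} (hf : f ≫ i = q) (hg : g ≫ j = q) (hq : S q)
    {m : (E.res f).obj (d.obj i hi) ⟶ (E.res g).obj (d.obj j hj)}
    (h : ∀ (t : ob (d.obj q hq) ⟶ ob ((E.res f).obj (d.obj i hi))), t.base = 𝟙 Y →
      t ≫ ca f (d.obj i hi) = d.tr i hi q hq f hf →
      t ≫ ve m ≫ ca g (d.obj j hj) = d.tr j hj q hq g hg) :
    m = d.comparison q i hi j hj f g hf hg := by
  obtain ⟨t, ht, ht'⟩ := (car_ca f (d.obj i hi)).exists_lift (d.tr i hi q hq f hf) (𝟙 Y) (by simp)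
  have hc : Car t := (car_ca f (d.obj i hi)).of_comp (by rw [ht']; exact d.car _ _ _ _ _ _)
  have : IsIso t := hc.isIso_of_base (by rw [ht]; exact inferInstanceAs (IsIso (𝟙 Y)))
  refine ve_inj ((car_ca g (d.obj j hj)).hom_ext rfl ((cancel_epi t).1 ?_))
  rw [h t ht ht', comparison_ca _ _ _ _ _ _ _ _ _ _ _ t ht' ht]

/-- A descent datum, as a descent datum in the sense of Mathlib. -/
def toDescentData (d : DD E S) :
    E.DescentData (fun f : S.arrows.category => f.obj.hom) where
  obj i := d.obj i.obj.hom i.property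
  hom Y q i j f g hf hg := d.comparison q i.obj.hom i.property j.obj.hom j.property f g hf hg
  pullHom_hom Z Y g q q' hq i j f₁ f₂ hf₁ hf₂ k₁ k₂ hk₁ hk₂ := by
    have hq₁ : S q := hf₁ ▸ S.downward_closed i.property f₁
    have hq₂ : S q' := hq ▸ S.downward_closed hq₁ g
    refine d.comparison_ext _ _ hq₂ fun t ht ht' => ?_
    refine (congrArg (_ ≫ ·) (pull_ca (d.comparison q i.obj.hom i.property j.obj.hom j.property
      f₁ f₂ hf₁ hf₂) g k₁ k₂ hk₁ hk₂)).trans ?_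
    obtain ⟨r, hr, hr'⟩ := (car_ca f₁ (d.obj i.obj.hom i.property)).exists_lift
      (d.tr i.obj.hom i.property q hq₁ f₁ hf₁) (𝟙 Y) (by simp)
    have h₁ := d.comparison_ca q i.obj.hom i.property j.obj.hom j.property f₁ f₂ hf₁ hf₂ hq₁ r hr'
      hr
    have h₂ : t ≫ ve ((E.resComp f₁ g k₁ hk₁).hom.app (d.obj i.obj.hom i.property)) ≫
        ca g ((E.res f₁).obj (d.obj i.obj.hom i.property)) = d.tr q hq₁ q' hq₂ g hq ≫ r := by
      refine (car_ca f₁ (d.obj i.obj.hom i.property)).hom_ext (by simp [ht, hr]) ?_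
      rw [assoc, assoc, assoc, resComp_cl, ht', hr']
      exact (d.comp _ _ _ _ _ _ _ _ _ _ _ _ hk₁).symm
    have h₃ := (reassoc_of% h₂) (ve (d.comparison q i.obj.hom i.property j.obj.hom j.property
      f₁ f₂ hf₁ hf₂) ≫ ca f₂ (d.obj j.obj.hom j.property))
    refine h₃.trans ((congrArg (_ ≫ ·) h₁).trans ?_)
    exact d.comp _ _ _ _ _ _ _ _ _ _ _ _ hk₂
  hom_self Y q i g hg := by
    have hq : S q := hg ▸ S.downward_closed i.property g
    refine (d.comparison_ext _ _ hq fun t ht ht' => ?_).symm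
    exact (congrArg (fun r => t ≫ r ≫ _) (ve_id _)).trans
      ((congrArg (_ ≫ ·) (id_comp _)).trans ht')
  hom_comp Y q i j k f₁ f₂ f₃ h₁ h₂ h₃ := by
    have hq : S q := h₁ ▸ S.downward_closed i.property f₁
    refine d.comparison_ext _ _ hq fun t ht ht' => ?_
    have h := d.comparison_ca q i.obj.hom i.property j.obj.hom j.property f₁ f₂ h₁ h₂ hq t ht' ht
    have h' := d.comparison_ca q j.obj.hom j.property k.obj.hom k.property f₂ f₃ h₂ h₃ hq
      (t ≫ ve (d.comparison q i.obj.hom i.property j.obj.hom j.property f₁ f₂ h₁ h₂))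
      (by rw [assoc, h]) (by simp [ht])
    exact (congrArg (_ ≫ ·) (ve_comp_assoc _ _ _)).trans ((assoc _ _ _).symm.trans h')

def dhom (D : E.DescentData (fun f : S.arrows.category => f.obj.hom)) ⦃Y Z W : K⦄ (q : Y ⟶ X)
    (i : Z ⟶ X) (hi : S i) (j : W ⟶ X) (hj : S j) (f : Y ⟶ Z) (g : Y ⟶ W) (hf : f ≫ i = q)
    (hg : g ≫ j = q) : (E.res f).obj (D.obj (idx i hi)) ⟶ (E.res g).obj (D.obj (idx j hj)) :=
  D.hom q (i₁ := idx i hi) (i₂ := idx j hj) f g hf hg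

section

variable (D : E.DescentData (fun f : S.arrows.category => f.obj.hom))

lemma dhom_comp ⦃Y Z W V : K⦄ (q : Y ⟶ X) (i : Z ⟶ X) (hi : S i) (j : W ⟶ X) (hj : S j)
    (k : V ⟶ X) (hk : S k) (f : Y ⟶ Z) (g : Y ⟶ W) (h : Y ⟶ V) (hf : f ≫ i = q)
    (hg : g ≫ j = q) (hh : h ≫ k = q) :
    dhom D q i hi j hj f g hf hg ≫ dhom D q j hj k hk g h hg hh = dhom D q i hi k hk f h hf hh :=
  D.hom_comp q (i₁ := idx i hi) (i₂ := idx j hj) (i₃ := idx k hk) f g h hf hg hh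

lemma dhom_self ⦃Y Z : K⦄ (q : Y ⟶ X) (i : Z ⟶ X) (hi : S i) (f : Y ⟶ Z) (hf : f ≫ i = q) :
    dhom D q i hi i hi f f hf hf = 𝟙 _ :=
  D.hom_self q (i := idx i hi) f hf

instance ⦃Y Z W : K⦄ (q : Y ⟶ X) (i : Z ⟶ X) (hi : S i) (j : W ⟶ X) (hj : S j) (f : Y ⟶ Z)
    (g : Y ⟶ W) (hf : f ≫ i = q) (hg : g ≫ j = q) : IsIso (dhom D q i hi j hj f g hf hg) :=
  ⟨dhom D q j hj i hi g f hg hf, by rw [dhom_comp, dhom_self], by rw [dhom_comp, dhom_self]⟩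

lemma pull_dhom ⦃Y Z W V : K⦄ (q : Y ⟶ X) (i : Z ⟶ X) (hi : S i) (j : W ⟶ X) (hj : S j)
    (f : Y ⟶ Z) (g : Y ⟶ W) (hf : f ≫ i = q) (hg : g ≫ j = q) (h : V ⟶ Y) (q' : V ⟶ X)
    (hq : h ≫ q = q') (f' : V ⟶ Z) (g' : V ⟶ W) (e : h ≫ f = f') (e' : h ≫ g = g') :
    pull (dhom D q i hi j hj f g hf hg) h f' g' e e' = dhom D q' i hi j hj f' g'
      (by rw [← e, assoc, hf, hq]) (by rw [← e', assoc, hg, hq]) :=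
  D.pullHom_hom h q q' hq (i₁ := idx i hi) (i₂ := idx j hj) f g hf hg f' g' e e'

end

/-- A descent datum in the sense of Mathlib, as a descent datum. -/
def ofDescentData (D : E.DescentData (fun f : S.arrows.category => f.obj.hom)) : DD E S where
  obj Y f hf := D.obj (idx f hf)
  tr Y Z f hf g hg h e := ar h ((E.resId Z).inv.app (D.obj (idx g hg)) ≫
    dhom D g g hg f hf (𝟙 Z) h (id_comp g) e)
  base _ _ _ _ _ _ _ _ := rfl
  car Y Z f hf g hg h e := car_ar_iff.2 IsIso.comp_isIso
  comp Y Z W f hf g hg k hk h e h' e' h'' e'' c := by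
    have h₁ := pull_ca (dhom D g g hg f hf (𝟙 Z) h (id_comp g) e) h' h' h''
      (comp_id _) c
    rw [pull_dhom _ _ _ _ _ _ _ _ _ _ _ k e'] at h₁
    have h₄ := E.resComp_id_right h' (comp_id h') (D.obj (idx g hg))
    rw [ar_eq, ar_eq, ar_eq, ← dhom_comp D k k hk g hg f hf (𝟙 W) h' h'' (id_comp k) e',
      ve_comp, ve_comp, ve_comp, ve_comp]
    simp only [assoc]
    refine congrArg (fun t => _ ≫ _ ≫ t) (Eq.trans ?_ h₁.symm)
    refine ((reassoc_of% res_map) h' _ _).symm.trans ?_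
    exact congrArg (fun t => ve t ≫ _) h₄.symm

lemma comparison_ofDescentData (D : E.DescentData (fun f : S.arrows.category => f.obj.hom))
    {Y Z W : K} (q : Y ⟶ X) (i : Z ⟶ X) (hi : S i) (j : W ⟶ X) (hj : S j) (f : Y ⟶ Z) (g : Y ⟶ W)
    (hf : f ≫ i = q) (hg : g ≫ j = q) : (ofDescentData D).comparison q i hi j hj f g hf hg =
      dhom D q i hi j hj f g hf hg := by
  have hq : S q := hf ▸ S.downward_closed hi f
  refine ((ofDescentData D).comparison_ext hf hg hq fun t ht ht' => ?_).symm
  have e : t = ve ((E.resId Y).inv.app (D.obj (idx q hq)) ≫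
      dhom D q q hq i hi (𝟙 Y) f (id_comp q) hf) := by
    refine (car_ca f (D.obj (idx i hi))).hom_ext ht (ht'.trans ?_)
    exact ar_eq _ _
  rw [e]
  refine (ve_comp_assoc _ _ _).symm.trans ?_
  refine (congrArg (fun t => ve t ≫ _) ((assoc _ _ _).trans (congrArg (_ ≫ ·)
    (dhom_comp D q q hq i hi j hj (𝟙 Y) f g (id_comp q) hf hg)))).trans ?_
  exact (ar_eq _ _).symm

lemma toDescentData_ofDescentData (D : E.DescentData (fun f : S.arrows.category => f.obj.hom)) :
    (ofDescentData D).toDescentData = D := by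
  have h : ∀ ⦃Y : K⦄ (q : Y ⟶ X) ⦃i₁ i₂ : S.arrows.category⦄ (f₁ : Y ⟶ i₁.obj.left)
      (f₂ : Y ⟶ i₂.obj.left) (hf₁ : f₁ ≫ i₁.obj.hom = q) (hf₂ : f₂ ≫ i₂.obj.hom = q),
      (ofDescentData D).comparison q i₁.obj.hom i₁.property i₂.obj.hom i₂.property f₁ f₂ hf₁ hf₂ =
        D.hom q f₁ f₂ hf₁ hf₂ := fun Y q i₁ i₂ f₁ f₂ hf₁ hf₂ =>
    comparison_ofDescentData D q i₁.obj.hom i₁.property i₂.obj.hom i₂.property f₁ f₂ hf₁ hf₂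
  cases D
  unfold toDescentData
  congr
  funext Y q i j f g hf hg
  exact h q f g hf hg

lemma exists_trivialization (d : DD E S) {Y Z : K} (i : Z ⟶ X) (hi : S i) (q : Y ⟶ X) (hq : S q)
    (f : Y ⟶ Z) (hf : f ≫ i = q) : ∃ t : ob (d.obj q hq) ⟶ ob ((E.res f).obj (d.obj i hi)),
      t.base = 𝟙 Y ∧ t ≫ ca f (d.obj i hi) = d.tr i hi q hq f hf ∧ IsIso t := by
  obtain ⟨t, ht, ht'⟩ := (car_ca f (d.obj i hi)).exists_lift (d.tr i hi q hq f hf) (𝟙 Y) (by simp)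
  have hc : Car t := (car_ca f (d.obj i hi)).of_comp (by rw [ht']; exact d.car _ _ _ _ _ _)
  exact ⟨t, ht, ht', hc.isIso_of_base (by rw [ht]; exact inferInstanceAs (IsIso (𝟙 Y)))⟩

lemma comm_comparison_iff (d : DD E S) (a : E.fibre X) (ψ : ∀ ⦃Y : K⦄ (f : Y ⟶ X) (hf : S f),
      d.obj f hf ⟶ (E.res f).obj a) :
    (∀ ⦃Y Z W : K⦄ (q : Y ⟶ X) (i : Z ⟶ X) (hi : S i) (j : W ⟶ X) (hj : S j) (f : Y ⟶ Z)
      (g : Y ⟶ W) (hf : f ≫ i = q) (hg : g ≫ j = q),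
      (E.res f).map (ψ i hi) ≫ (E.resComp i f q hf).inv.app a ≫ (E.resComp j g q hg).hom.app a =
        d.comparison q i hi j hj f g hf hg ≫ (E.res g).map (ψ j hj)) ↔
    ∀ ⦃Y Z : K⦄ (f : Y ⟶ X) (hf : S f) (g : Z ⟶ X) (hg : S g) (h : Z ⟶ Y) (e : h ≫ f = g),
      d.tr f hf g hg h e ≫ ve (ψ f hf) ≫ ca f a = ve (ψ g hg) ≫ ca g a := by
  have key : ∀ ⦃Y Z W : K⦄ (q : Y ⟶ X) (hq : S q) (i : Z ⟶ X) (hi : S i) (j : W ⟶ X) (hj : S j)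
      (f : Y ⟶ Z) (g : Y ⟶ W) (hf : f ≫ i = q) (hg : g ≫ j = q),
      (E.res f).map (ψ i hi) ≫ (E.resComp i f q hf).inv.app a ≫ (E.resComp j g q hg).hom.app a =
        d.comparison q i hi j hj f g hf hg ≫ (E.res g).map (ψ j hj) ↔
      d.tr i hi q hq f hf ≫ ve (ψ i hi) ≫ ca i a = d.tr j hj q hq g hg ≫ ve (ψ j hj) ≫ ca j a := by
    intro Y Z W q hq i hi j hj f g hf hg
    obtain ⟨t, ht, ht', hti⟩ := d.exists_trivialization i hi q hq f hf
    have h₁ : ve ((E.res f).map (ψ i hi) ≫ (E.resComp i f q hf).inv.app a ≫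
        (E.resComp j g q hg).hom.app a) ≫ ca g ((E.res j).obj a) ≫ ca j a =
          ca f (d.obj i hi) ≫ ve (ψ i hi) ≫ ca i a := by
      rw [ve_comp_assoc]
      refine (congrArg (_ ≫ ·) (ofObj_hom_ca a q i j f g hf hg)).trans ?_
      rw [reassoc_of% res_map]
    have h₂ : ve (d.comparison q i hi j hj f g hf hg ≫ (E.res g).map (ψ j hj)) ≫
        ca g ((E.res j).obj a) ≫ ca j a =
          ve (d.comparison q i hi j hj f g hf hg) ≫ ca g (d.obj j hj) ≫ ve (ψ j hj) ≫ ca j a := by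
      rw [ve_comp_assoc, reassoc_of% res_map]
    have h₃ := d.comparison_ca q i hi j hj f g hf hg hq t ht' ht
    have h₄ : (E.res f).map (ψ i hi) ≫ (E.resComp i f q hf).inv.app a ≫
        (E.resComp j g q hg).hom.app a =
        d.comparison q i hi j hj f g hf hg ≫ (E.res g).map (ψ j hj) ↔
        t ≫ ca f (d.obj i hi) ≫ ve (ψ i hi) ≫ ca i a = t ≫
          ve (d.comparison q i hi j hj f g hf hg) ≫ ca g (d.obj j hj) ≫ ve (ψ j hj) ≫ ca j a := by
      constructor
      · intro h
        rw [← h₁, ← h₂]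
        exact congrArg (fun s => t ≫ ve s ≫ _) h
      · intro h
        refine ve_inj (Car.hom_ext ((car_ca g ((E.res j).obj a)).comp (car_ca j a)) rfl ?_)
        exact h₁.trans (((cancel_epi t).1 h).trans h₂.symm)
    rw [h₄, ← ht', ← h₃]
    simp only [assoc]
  constructor
  · intro H Y Z f hf g hg h e
    have h₁ := (key g hg g hg f hf (𝟙 Z) h (id_comp g) e).1 (H g g hg f hf (𝟙 Z) h _ _)
    have h₂ : d.tr g hg g hg (𝟙 Z) (id_comp g) = 𝟙 _ := by
      refine (d.car g hg g hg (𝟙 Z) (id_comp g)).hom_ext (by simp) ?_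
      rw [d.comp g hg g hg g hg _ _ _ _ (𝟙 Z) (id_comp g) (id_comp _)]
      simp
    rw [h₂, id_comp] at h₁
    exact h₁.symm
  · intro H Y Z W q i hi j hj f g hf hg
    have hq : S q := hf ▸ S.downward_closed hi f
    rw [key q hq, H, H]

lemma effective_iff (d : DD E S) :
    d.Effective ↔ ∃ a, Nonempty (d.toDescentData ≅ (toDD E S).obj a) := by
  constructor
  · rintro ⟨a, ⟨γ⟩⟩
    let ψ : ∀ ⦃Y : K⦄ (f : Y ⟶ X) (hf : S f), d.obj f hf ⟶ (E.res f).obj a :=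
      fun Y f hf => overOf f (γ.arr f hf) (γ.base f hf)
    have hψ : ∀ ⦃Y : K⦄ (f : Y ⟶ X) (hf : S f), ve (ψ f hf) ≫ ca f a = γ.arr f hf :=
      fun Y f hf => by rw [← ar_eq]; exact ar_overOf _ _ _
    have hi : ∀ ⦃Y : K⦄ (f : Y ⟶ X) (hf : S f), IsIso (ψ f hf) := fun Y f hf => by
      rw [← car_ve_iff]
      exact (car_ca f a).of_comp (by rw [hψ]; exact γ.car f hf)
    have h := (d.comm_comparison_iff a ψ).2 fun Y Z f hf g hg h e => by
      rw [hψ, hψ, γ.comp]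
    exact ⟨a, ⟨DescentData.isoMk (fun i => @asIso _ _ _ _ (ψ i.obj.hom i.property) (hi _ _))
      (fun Y q i₁ i₂ f₁ f₂ hf₁ hf₂ => h q _ _ _ _ _ _ _ _)⟩⟩
  · rintro ⟨a, ⟨e⟩⟩
    let ψ : ∀ ⦃Y : K⦄ (f : Y ⟶ X) (hf : S f), d.obj f hf ⟶ (E.res f).obj a :=
      fun Y f hf => e.hom.hom (idx f hf)
    have hi : ∀ ⦃Y : K⦄ (f : Y ⟶ X) (hf : S f), IsIso (ψ f hf) := fun Y f hf =>
      ⟨e.inv.hom (idx f hf), congrArg (fun t => t.hom (idx f hf)) e.hom_inv_id,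
        congrArg (fun t => t.hom (idx f hf)) e.inv_hom_id⟩
    have h := (d.comm_comparison_iff a ψ).1 fun Y Z W q i hi j hj f g hf hg =>
      e.hom.comm q (i₁ := idx i hi) (i₂ := idx j hj) f g hf hg
    exact ⟨a, ⟨fun Y f hf => ve (ψ f hf) ≫ ca f a, fun Y f hf => id_comp _,
      fun Y f hf => (car_ve_iff.2 (hi f hf)).comp (car_ca f a), h⟩⟩

end DD

lemma isStack_iff {J : GrothendieckTopology K} : E.IsStack J ↔
    ∀ ⦃X : K⦄ (S : Sieve X), S ∈ J X → GlueHom E S ∧ ∀ d : DD E S, d.Effective := by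
  have h : ∀ ⦃X : K⦄ (S : Sieve X), (GlueHom E S ∧ ∀ d : DD E S, d.Effective) ↔
      E.IsStackFor S.arrows := by
    intro X S
    rw [isStackFor_iff, glueHom_iff]
    constructor
    · rintro ⟨h₁, h₂⟩
      have : (toDD E S).Full := ⟨fun {M N} => (h₁ M N).2⟩
      have : (toDD E S).Faithful := ⟨fun {M N} => (h₁ M N).1⟩
      have : (toDD E S).EssSurj := ⟨fun D => by
        obtain ⟨a, ⟨e⟩⟩ := (DD.effective_iff _).1 (h₂ (DD.ofDescentData D))
        rw [DD.toDescentData_ofDescentData] at e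
        exact ⟨a, ⟨e.symm⟩⟩⟩
      exact {}
    · intro H
      refine ⟨fun M N => ⟨(toDD E S).map_injective, (toDD E S).map_surjective⟩, fun d => ?_⟩
      rw [DD.effective_iff]
      exact ⟨_, ⟨((toDD E S).objObjPreimageIso d.toDescentData).symm⟩⟩
  constructor
  · intro H X S hS
    exact (h S).2 (E.isStackFor' S hS)
  · intro H
    exact IsStack.of_isStackFor fun X S hS => (h S).1 (H S hS)

end

section

section

variable {J : GrothendieckTopology K}

/-- A property of the arrows into `X` holds locally when it holds on a covering sieve. -/
def Loc (J : GrothendieckTopology K) {X : K} (p : ∀ ⦃Y : K⦄, (Y ⟶ X) → Prop) : Prop :=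
  ∃ S ∈ J X, ∀ ⦃Y : K⦄ (f : Y ⟶ X), S f → p f

namespace Loc

variable {X : K} {p q : ∀ ⦃Y : K⦄, (Y ⟶ X) → Prop}

lemma of_sieve {S : Sieve X} (hS : S ∈ J X) : Loc J (fun _ f => S f) := ⟨S, hS, fun _ _ h => h⟩

lemma of_forall (h : ∀ ⦃Y : K⦄ (f : Y ⟶ X), p f) : Loc J p := ⟨⊤, J.top_mem X, fun _ f _ => h f⟩

lemma mono (hp : Loc J p) (h : ∀ ⦃Y : K⦄ (f : Y ⟶ X), p f → q f) : Loc J q :=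
  hp.imp fun _ hS => ⟨hS.1, fun _ f hf => h f (hS.2 f hf)⟩

lemma and (hp : Loc J p) (hq : Loc J q) : Loc J (fun _ f => p f ∧ q f) := by
  obtain ⟨S, hS, h⟩ := hp
  obtain ⟨T, hT, h'⟩ := hq
  exact ⟨S ⊓ T, J.intersection_covering hS hT, fun _ f hf => ⟨h f hf.1, h' f hf.2⟩⟩

lemma pull (hp : Loc J p) {Y : K} (f : Y ⟶ X) : Loc J (fun _ g => p (g ≫ f)) := by
  obtain ⟨S, hS, h⟩ := hp
  exact ⟨S.pullback f, J.pullback_stable f hS, fun _ g hg => h _ hg⟩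

lemma bind (hp : Loc J p) (h : ∀ ⦃Y : K⦄ (f : Y ⟶ X), p f → Loc J (fun _ g => q (g ≫ f))) :
    Loc J q := by
  obtain ⟨S, hS, h'⟩ := hp
  choose T hT hq using fun (Y : K) (f : Y ⟶ X) (hf : S f) => h f (h' f hf)
  refine ⟨Sieve.bind S (fun Y f hf => T Y f hf), J.bind_covering hS fun Y f hf => hT Y f hf, ?_⟩
  rintro Z _ ⟨Y, g, f, hf, hg, rfl⟩
  exact hq Y f hf g hg

lemma sieve_mem (hp : Loc J p) {S : Sieve X} (h : ∀ ⦃Y : K⦄ (f : Y ⟶ X), p f → S f) :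
    S ∈ J X := by
  obtain ⟨T, hT, h'⟩ := hp
  exact J.superset_covering (fun _ f hf => h f (h' f hf)) hT

end Loc

variable {E E' : IndCat.{v, u, v', u'} K}

lemma Car.trans {A B C : ∫ᶜ E} {u : A ⟶ B} {w : B ⟶ C} (hu : Car u) (hw : Car w) :
    Car (u ≫ w) := IsCart.comp hu hw

lemma Car.exists_desc {A A' B : ∫ᶜ E} {t : A ⟶ B} {t' : A' ⟶ B} (ht : Car t) (ht' : Car t')
    (h : A'.base ⟶ A.base) (hh : h ≫ t.base = t'.base) :
    ∃ k : A' ⟶ A, k.base = h ∧ Car k ∧ k ≫ t = t' := by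
  obtain ⟨k, hk, hk'⟩ := ht.exists_lift t' h hh
  exact ⟨k, hk, ht.of_comp (by rwa [hk']), hk'⟩

/-- Two arrows of the Grothendieck construction agree locally. -/
def LocEq (J : GrothendieckTopology K) {A B : ∫ᶜ E} (m n : A ⟶ B) : Prop :=
  m.base = n.base ∧ Loc J (fun _ f => ca f A.fiber ≫ m = ca f A.fiber ≫ n)

namespace LocEq

variable {A B C : ∫ᶜ E}

lemma refl (m : A ⟶ B) : LocEq J m m := ⟨rfl, Loc.of_forall fun _ _ => rfl⟩

lemma of_eq {m n : A ⟶ B} (h : m = n) : LocEq J m n := h ▸ refl m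

lemma comp_left {m n : B ⟶ C} (h : LocEq J m n) (k : A ⟶ B) : LocEq J (k ≫ m) (k ≫ n) := by
  refine ⟨by rw [comp_base, comp_base, h.1], (h.2.pull k.base).mono fun Y f hf => ?_⟩
  obtain ⟨l, -, hl⟩ := (car_ca (f ≫ k.base) B.fiber).exists_lift (ca f A.fiber ≫ k) (𝟙 Y)
    (id_comp _)
  rw [← reassoc_of% hl, ← reassoc_of% hl]
  exact congrArg (l ≫ ·) hf

lemma of_comp_car {m n : A ⟶ B} {k : B ⟶ C} (hk : Car k) (hb : m.base = n.base)
    (h : LocEq J (m ≫ k) (n ≫ k)) : LocEq J m n :=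
  ⟨hb, h.2.mono fun _ f hf => hk.hom_ext (by simp [hb]) (by simpa using hf)⟩

lemma of_loc {m n : A ⟶ B} (hb : m.base = n.base) (h : Loc J (fun (Y : K) (f : Y ⟶ A.base) =>
    ∃ (a : E.fibre Y) (t : ob a ⟶ A), t.base = f ∧ Car t ∧ LocEq J (t ≫ m) (t ≫ n))) :
    LocEq J m n := by
  refine ⟨hb, h.bind fun Y f hf => ?_⟩
  obtain ⟨a, t, ht, hc, he⟩ := hf
  refine he.2.mono fun Z g hg => ?_
  obtain ⟨l, -, hl⟩ := ((car_ca g a).trans hc).exists_lift (ca (g ≫ f) A.fiber) (𝟙 Z)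
    ((id_comp _).trans (by rw [comp_base, ht]; rfl))
  rw [← hl]
  simp only [assoc]
  exact congrArg (l ≫ ·) hg

lemma tot {m n : A ⟶ B} (h : LocEq J m n) (F : E ⟶ E') :
    LocEq J ((Fib.tot F).map m) ((Fib.tot F).map n) :=
  of_loc h.1 (h.2.mono fun _ f hf => ⟨_, (Fib.tot F).map (ca f A.fiber), rfl, (car_ca _ _).tot F,
    of_eq (by rw [← Functor.map_comp, ← Functor.map_comp, hf])⟩)

end LocEq

variable (J E) in
/-- An elementary form of the condition for prestacks. -/
def IsPre : Prop := ∀ ⦃X : K⦄ (S : Sieve X), S ∈ J X → GlueHom E S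

lemma isPre_of_isStack (h : E.IsStack J) : IsPre J E := fun _ S hS => (isStack_iff.1 h S hS).1

lemma DD.exists_arr {X : K} {S : Sieve X} {Ch : ∀ ⦃Y : K⦄, (Y ⟶ X) → Sort w}
    (hS : ∀ ⦃Y : K⦄ (f : Y ⟶ X), S f ↔ Nonempty (Ch f))
    (obj : ∀ ⦃Y : K⦄ ⦃f : Y ⟶ X⦄, Ch f → E.fibre Y)
    (T : ∀ ⦃Y Z : K⦄ ⦃f : Y ⟶ X⦄ ⦃g : Z ⟶ X⦄ (c : Ch f) (c' : Ch g) (h : Z ⟶ Y), h ≫ f = g →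
      (ob (obj c') ⟶ ob (obj c)))
    (hb : ∀ ⦃Y Z : K⦄ ⦃f : Y ⟶ X⦄ ⦃g : Z ⟶ X⦄ (c : Ch f) (c' : Ch g) (h : Z ⟶ Y) (e : h ≫ f = g),
      (T c c' h e).base = h)
    (hc : ∀ ⦃Y Z : K⦄ ⦃f : Y ⟶ X⦄ ⦃g : Z ⟶ X⦄ (c : Ch f) (c' : Ch g) (h : Z ⟶ Y) (e : h ≫ f = g),
      Car (T c c' h e))
    (comp : ∀ ⦃Y Z W : K⦄ ⦃f : Y ⟶ X⦄ ⦃g : Z ⟶ X⦄ ⦃k : W ⟶ X⦄ (c : Ch f) (c' : Ch g) (c'' : Ch k)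
      (h : Z ⟶ Y) (e : h ≫ f = g) (h' : W ⟶ Z) (e' : h' ≫ g = k) (h'' : W ⟶ Y) (e'' : h'' ≫ f = k),
      h' ≫ h = h'' → T c' c'' h' e' ≫ T c c' h e = T c c'' h'' e'')
    (eff : ∀ d : DD E S, d.Effective) :
    ∃ (a : E.fibre X) (arr : ∀ ⦃Y : K⦄ ⦃f : Y ⟶ X⦄ (c : Ch f), ob (obj c) ⟶ ob a),
      (∀ ⦃Y : K⦄ ⦃f : Y ⟶ X⦄ (c : Ch f), (arr c).base = f) ∧
      (∀ ⦃Y : K⦄ ⦃f : Y ⟶ X⦄ (c : Ch f), Car (arr c)) ∧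
      ∀ ⦃Y Z : K⦄ ⦃f : Y ⟶ X⦄ ⦃g : Z ⟶ X⦄ (c : Ch f) (c' : Ch g) (h : Z ⟶ Y) (e : h ≫ f = g),
        T c c' h e ≫ arr c = arr c' := by
  let ch : ∀ ⦃Y : K⦄ (f : Y ⟶ X), S f → Ch f := fun Y f hf => ((hS f).1 hf).some
  have mem : ∀ ⦃Y : K⦄ ⦃f : Y ⟶ X⦄, Ch f → S f := fun Y f c => (hS f).2 ⟨c⟩
  obtain ⟨a, ⟨γ⟩⟩ := eff
    { obj := fun Y f hf => obj (ch f hf)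
      tr := fun Y Z f hf g hg h e => T (ch f hf) (ch g hg) h e
      base := fun Y Z f hf g hg h e => hb _ _ _ _
      car := fun Y Z f hf g hg h e => hc _ _ _ _
      comp := fun Y Z W f hf g hg k hk h e h' e' h'' e'' c => comp _ _ _ _ _ _ _ _ _ c }
  refine ⟨a, fun Y f c => T (ch f (mem c)) c (𝟙 Y) (id_comp f) ≫ γ.arr f (mem c),
    fun Y f c => ?_, fun Y f c => ?_, fun Y Z f g c c' h e => ?_⟩
  · rw [comp_base, hb, γ.base, id_comp]
  · exact (hc _ _ _ _).comp (γ.car f _)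
  · have h₁ := γ.comp f (mem c) g (mem c') h e
    refine (assoc _ _ _).symm.trans (Eq.trans ?_ ((congrArg (_ ≫ ·) h₁).symm.trans rfl).symm)
    refine Eq.trans ?_ (assoc _ _ _)
    refine congrArg (· ≫ _) ?_
    exact (comp _ _ _ _ _ _ _ h e (comp_id _)).trans
      (comp _ _ _ _ _ _ _ h e (id_comp _)).symm

section

variable (hE : IsPre J E)

include hE

lemma LocEq.eq {A B : ∫ᶜ E} {m n : A ⟶ B} (h : LocEq J m n) : m = n := by
  obtain ⟨k, hk, hk'⟩ := (car_ca m.base B.fiber).exists_lift m (𝟙 _) (id_comp _)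
  obtain ⟨l, hl, hl'⟩ := (car_ca m.base B.fiber).exists_lift n (𝟙 _)
    ((id_comp _).trans h.1)
  obtain ⟨k, rfl⟩ := exists_ve k hk
  obtain ⟨l, rfl⟩ := exists_ve l hl
  have hkl : LocEq J (ve k) (ve l) :=
    LocEq.of_comp_car (car_ca m.base B.fiber) rfl (by rw [hk', hl']; exact h)
  obtain ⟨S, hS, hS'⟩ := hkl.2
  rw [← hk', ← hl', (hE S hS).sep k l hS']

lemma IsPre.ext {A B : ∫ᶜ E} {m n : A ⟶ B} (hb : m.base = n.base)
    (h : Loc J (fun (Y : K) (f : Y ⟶ A.base) =>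
      ∃ (a : E.fibre Y) (t : ob a ⟶ A), t.base = f ∧ Car t ∧ t ≫ m = t ≫ n)) : m = n :=
  (LocEq.of_loc hb (h.mono fun _ _ ⟨a, t, h₁, h₂, h₃⟩ => ⟨a, t, h₁, h₂, LocEq.of_eq h₃⟩)).eq hE

lemma IsPre.glue {A B : ∫ᶜ E} (f : A.base ⟶ B.base) {I : ∀ ⦃Y : K⦄, (Y ⟶ A.base) → Sort w}
    (obj : ∀ ⦃Y : K⦄ ⦃g : Y ⟶ A.base⦄, I g → E.fibre Y)
    (t : ∀ ⦃Y : K⦄ ⦃g : Y ⟶ A.base⦄ (i : I g), ob (obj i) ⟶ A)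
    (m : ∀ ⦃Y : K⦄ ⦃g : Y ⟶ A.base⦄ (i : I g), ob (obj i) ⟶ B)
    (ht : ∀ ⦃Y : K⦄ ⦃g : Y ⟶ A.base⦄ (i : I g), (t i).base = g)
    (hc : ∀ ⦃Y : K⦄ ⦃g : Y ⟶ A.base⦄ (i : I g), Car (t i))
    (hm : ∀ ⦃Y : K⦄ ⦃g : Y ⟶ A.base⦄ (i : I g), (m i).base = g ≫ f)
    (compat : ∀ ⦃Y Z : K⦄ ⦃g : Y ⟶ A.base⦄ ⦃g' : Z ⟶ A.base⦄ (i : I g) (j : I g')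
      (l : ob (obj j) ⟶ ob (obj i)), l ≫ t i = t j → l ≫ m i = m j)
    (loc : Loc J (fun _ g => Nonempty (I g))) :
    ∃ u : A ⟶ B, u.base = f ∧ ∀ ⦃Y : K⦄ ⦃g : Y ⟶ A.base⦄ (i : I g), t i ≫ u = m i := by
  obtain ⟨S, hS, hI⟩ := loc
  let c : ∀ ⦃Y : K⦄ (g : Y ⟶ A.base), S g → I g := fun Y g hg => (hI g hg).some
  have h₁ : ∀ ⦃Y : K⦄ (g : Y ⟶ A.base) (hg : S g),
      ∃ κ : ob ((E.res g).obj A.fiber) ⟶ ob (obj (c g hg)), κ.base = 𝟙 Y ∧ Car κ ∧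
        κ ≫ t (c g hg) = ca g A.fiber := fun Y g hg => by
    refine (hc _).exists_desc (car_ca g A.fiber) (𝟙 Y) ?_
    rw [ht]
    exact id_comp _
  choose κ hκ hκc hκt using h₁
  have hκi : ∀ ⦃Y : K⦄ (g : Y ⟶ A.base) (hg : S g), IsIso (κ g hg) := fun Y g hg =>
    (hκc g hg).isIso_of_base (by rw [hκ]; exact inferInstanceAs (IsIso (𝟙 Y)))
  have h₂ : ∀ ⦃Y : K⦄ (g : Y ⟶ A.base) (hg : S g), ∃ μ : ob ((E.res g).obj A.fiber) ⟶
      ob ((E.res f).obj B.fiber), μ.base = g ∧ μ ≫ ca f B.fiber = κ g hg ≫ m (c g hg) :=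
    fun Y g hg => by
      refine (car_ca f B.fiber).exists_lift (κ g hg ≫ m (c g hg)) g ?_
      rw [comp_base, hκ, hm]
      exact (id_comp _).symm
  choose μ hμ hμm using h₂
  obtain ⟨n, hn⟩ := (hE S hS).glue μ hμ (fun Y Z g hg g' hg' k hk => by
    have hb : k.base ≫ g = g' := base_congr hk
    refine (car_ca f B.fiber).hom_ext ?_ ?_
    · rw [comp_base, hμ, hμ _ hg', hb]
    · have := compat (c g hg) (c g' hg') (inv (κ g' hg') ≫ k ≫ κ g hg) (by
        rw [assoc, assoc, hκt, hk, ← hκt g' hg', IsIso.inv_hom_id_assoc])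
      rw [assoc, hμm, hμm, ← this]
      simp)
  have hu : ∀ ⦃Y : K⦄ (g : Y ⟶ A.base) (hg : S g),
      t (c g hg) ≫ ve n ≫ ca f B.fiber = m (c g hg) := fun Y g hg => by
    rw [← cancel_epi (κ g hg), reassoc_of% hκt, ← hμm, ← hn]
    exact (assoc _ _ _).symm
  refine ⟨ve n ≫ ca f B.fiber, id_comp f, fun Y g i => ?_⟩
  refine IsPre.ext hE ?_ (((Loc.of_sieve hS).pull g).mono fun Z h hh => ?_)
  · rw [comp_base, ht, hm]
    exact congrArg (g ≫ ·) (id_comp f)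
  · obtain ⟨l, hl, hl', hl''⟩ := (hc i).exists_desc (hc (c (h ≫ g) hh)) h (by rw [ht, ht])
    refine ⟨_, l, hl, hl', ?_⟩
    rw [reassoc_of% hl'', compat i _ l hl'']
    exact hu _ hh

lemma IsPre.isIso {X : K} {a b : E.fibre X} (m : a ⟶ b)
    (h : Loc J (fun _ f => Car (ca f a ≫ ve m))) : IsIso m := by
  obtain ⟨S, hS, h⟩ := h
  have hb := glueHom_iff.1 (hE S hS)
  have : (toDD E S).Full := ⟨fun {M N} => (hb M N).2⟩
  have : (toDD E S).Faithful := ⟨fun {M N} => (hb M N).1⟩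
  have hi : ∀ i : S.arrows.category, IsIso (((toDD E S).map m).hom i) := fun i => by
    refine car_ve_iff.1 ((car_ca i.obj.hom b).of_comp (u := ve ((E.res i.obj.hom).map m)) ?_)
    rw [res_map]
    exact h _ i.property
  have : IsIso ((toDD E S).map m) :=
    (DescentData.isoMk (fun i => @asIso _ _ _ _ _ (hi i)) ((toDD E S).map m).comm).isIso_hom
  exact isIso_of_fully_faithful (toDD E S) m

lemma IsPre.car {A B : ∫ᶜ E} (u : A ⟶ B) (h : Loc J (fun (Y : K) (f : Y ⟶ A.base) =>
      ∃ (a : E.fibre Y) (t : ob a ⟶ A), t.base = f ∧ Car t ∧ Car (t ≫ u))) : Car u := by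
  rw [← ar_vpart u, car_ar_iff]
  refine hE.isIso _ (h.mono fun Y f ⟨a, t, h₁, h₂, h₃⟩ => ?_)
  obtain ⟨l, -, hl', hl⟩ := h₂.exists_desc (car_ca f A.fiber) (𝟙 Y)
    ((id_comp _).trans h₁)
  have h₄ : ca f A.fiber ≫ u = (ca f A.fiber ≫ ve (vpart u)) ≫ ca u.base B.fiber := by
    rw [assoc]
    exact congrArg (_ ≫ ·) ((ar_vpart u).symm.trans (ar_eq _ _))
  refine (car_ca u.base B.fiber).of_comp ?_
  rw [← h₄, ← hl, assoc]
  exact hl'.trans h₃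

/-- The restriction of a descent datum to a smaller sieve. -/
def DD.restrict {X : K} {S V : Sieve X} (d : DD E S) (h : V ≤ S) : DD E V where
  obj _ f hf := d.obj f (h f hf)
  tr _ _ f hf g hg k e := d.tr f (h f hf) g (h g hg) k e
  base _ _ _ _ _ _ _ _ := d.base _ _ _ _ _ _
  car _ _ _ _ _ _ _ _ := d.car _ _ _ _ _ _
  comp _ _ _ _ _ _ _ _ _ _ _ _ _ _ _ c := d.comp _ _ _ _ _ _ _ _ _ _ _ _ c

lemma DD.effective_of_restrict {X : K} {S V : Sieve X} (hV : V ∈ J X) (d : DD E S) (h : V ≤ S)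
    (eff : (d.restrict h).Effective) : d.Effective := by
  obtain ⟨a, ⟨γ⟩⟩ := eff
  have key : ∀ ⦃Y : K⦄ (f : Y ⟶ X) (hf : S f), ∃ u : ob (d.obj f hf) ⟶ ob a, u.base = f ∧
      ∀ ⦃Z : K⦄ (g : Z ⟶ X) (hg : V g) (k : Z ⟶ Y) (e : k ≫ f = g),
        d.tr f hf g (h g hg) k e ≫ u = γ.arr g hg := by
    intro Y f hf
    obtain ⟨u, hu, hu'⟩ := hE.glue (A := ob (d.obj f hf)) (B := ob a) f
      (I := fun Z k => PLift (V (k ≫ f))) (fun Z k i => d.obj (k ≫ f) (h _ i.down))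
      (fun Z k i => d.tr f hf _ _ k rfl) (fun Z k i => γ.arr (k ≫ f) i.down)
      (fun Z k i => d.base _ _ _ _ _ _) (fun Z k i => d.car _ _ _ _ _ _)
      (fun Z k i => γ.base _ _) (fun Z Z' k k' i j l hl => by
        have hb : l.base ≫ k = k' := by
          have := base_congr hl
          rw [comp_base, d.base, d.base] at this
          exact this
        have e : l.base ≫ k ≫ f = k' ≫ f := (assoc _ _ _).symm.trans (congrArg (· ≫ f) hb)
        have : l = d.tr (k ≫ f) (h _ i.down) (k' ≫ f) (h _ j.down) l.base e := by
          refine (d.car f hf _ (h _ i.down) k rfl).hom_ext (by rw [d.base]) ?_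
          rw [hl, d.comp _ _ _ _ _ _ _ _ _ _ k' rfl hb]
        rw [this]
        exact γ.comp _ _ _ _ _ _)
      (((Loc.of_sieve hV).pull f).mono fun Z k hk => ⟨⟨hk⟩⟩)
    refine ⟨u, hu, fun Z g hg k e => ?_⟩
    subst e
    exact hu' (g := k) ⟨hg⟩
  choose u hu hu' using key
  refine ⟨a, ⟨u, hu, fun Y f hf => ?_, fun Y Z f hf g hg k e => ?_⟩⟩
  · refine hE.car _ (((Loc.of_sieve hV).pull f).mono fun Z k hk => ?_)
    refine ⟨_, d.tr f hf (k ≫ f) (h _ hk) k rfl, d.base _ _ _ _ _ _, d.car _ _ _ _ _ _, ?_⟩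
    rw [hu' f hf _ hk]
    exact γ.car _ _
  · refine hE.ext ?_ (((Loc.of_sieve hV).pull g).mono fun Z l hl => ?_)
    · rw [comp_base, hu, hu, d.base, e]
    · refine ⟨_, d.tr g hg (l ≫ g) (h _ hl) l rfl, d.base _ _ _ _ _ _, d.car _ _ _ _ _ _, ?_⟩
      rw [hu' g hg _ hl, ← assoc, d.comp f hf g hg _ _ _ _ _ _ (l ≫ k)
        (by rw [assoc, e]) rfl, hu' f hf _ hl]

end

end

end

section

variable {J : GrothendieckTopology K}
  {E E' Q : IndCat.{v, u, v', u'} K}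

/-- A local equivalence of indexed categories: an indexed functor which is locally faithful,
locally full and locally essentially surjective. -/
structure LE (J : GrothendieckTopology K) (w : E ⟶ E') : Prop where
  inj ⦃A B : ∫ᶜ E⦄ (m n : A ⟶ B) (h : (tot w).map m = (tot w).map n) : LocEq J m n
  surj ⦃A B : ∫ᶜ E⦄ (φ : (tot w).obj A ⟶ (tot w).obj B) :
    Loc J (fun (Y : K) (f : Y ⟶ A.base) => ∃ n : ob ((E.res f).obj A.fiber) ⟶ B,
      (tot w).map n = (tot w).map (ca f A.fiber) ≫ φ)
  ess ⦃X : K⦄ (x : E'.fibre X) :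
    Loc J (fun (Y : K) (f : Y ⟶ X) => ∃ (e : E.fibre Y) (u : (tot w).obj (ob e) ⟶ ob x),
      u.base = f ∧ Car u)

lemma Car.lift_ca {A B : ∫ᶜ E} (t : A ⟶ B) {Y : K} (h : Y ⟶ A.base) :
    ∃ j : ob ((E.res h).obj A.fiber) ⟶ ob ((E.res (h ≫ t.base)).obj B.fiber),
      j ≫ ca (h ≫ t.base) B.fiber = ca h A.fiber ≫ t := by
  obtain ⟨j, -, hj⟩ := (car_ca (h ≫ t.base) B.fiber).exists_lift (ca h A.fiber ≫ t) (𝟙 Y)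
    (id_comp _)
  exact ⟨j, hj⟩

lemma Car.factor_ca {A B : ∫ᶜ E} (t : A ⟶ B) :
    ∃ i : A ⟶ ob ((E.res t.base).obj B.fiber), i.base = 𝟙 A.base ∧ i ≫ ca t.base B.fiber = t :=
  (car_ca t.base B.fiber).exists_lift t (𝟙 _) (id_comp _)

namespace LE

variable {w : E ⟶ E'} (hw : LE J w) (hQ : IsPre J Q) (F : E ⟶ Q)

include hw hQ in
lemma exists_ext {A B : ∫ᶜ E} (φ : (tot w).obj A ⟶ (tot w).obj B) :
    ∃ ψ : (tot F).obj A ⟶ (tot F).obj B, ψ.base = φ.base ∧ ∀ ⦃A' : ∫ᶜ E⦄ (t : A' ⟶ A) (n : A' ⟶ B),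
      (tot w).map n = (tot w).map t ≫ φ → (tot F).map t ≫ ψ = (tot F).map n := by
  have key : ∀ ⦃A' : ∫ᶜ E⦄ (n n' : A' ⟶ B), (tot w).map n = (tot w).map n' →
      (tot F).map n = (tot F).map n' := fun A' n n' h => ((hw.inj n n' h).tot F).eq hQ
  obtain ⟨ψ, hψ, h⟩ := hQ.glue (A := (tot F).obj A) (B := (tot F).obj B) φ.base
    (I := fun Y g => {n : ob ((E.res g).obj A.fiber) ⟶ B //
      (tot w).map n = (tot w).map (ca g A.fiber) ≫ φ})
    (fun Y g i => (StrongTrans.comp F Y).obj ((E.res g).obj A.fiber))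
    (fun Y g i => (tot F).map (ca g A.fiber)) (fun Y g i => (tot F).map i.1) (fun Y g i => rfl)
    (fun Y g i => (car_ca _ _).tot F) (fun Y g i => base_congr i.2)
    (fun Y Z g g' i j l hl => by
      have hb : l.base ≫ g = g' := base_congr hl
      obtain ⟨k, hk, hk'⟩ := (car_ca g A.fiber).exists_lift (ca g' A.fiber) l.base hb
      have hkl : (tot F).map k = l := ((car_ca g A.fiber).tot F).hom_ext hk (by
        rw [← Functor.map_comp, hk', hl])
      rw [← hkl, ← Functor.map_comp]
      refine key _ _ ?_
      rw [Functor.map_comp, i.2, j.2, ← hk', Functor.map_comp, assoc])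
    ((hw.surj φ).mono fun Y g ⟨n, hn⟩ => ⟨n, hn⟩)
  refine ⟨ψ, hψ, fun A' t n hn => hQ.ext ?_ (((hw.surj φ).pull t.base).mono fun Y g ⟨n', hn'⟩ => ?_)⟩
  · have := base_congr hn
    exact (congrArg (_ ≫ ·) hψ).trans this.symm
  · refine ⟨_, (tot F).map (ca g A'.fiber), rfl, (car_ca _ _).tot F, ?_⟩
    obtain ⟨j, hj⟩ := Car.lift_ca t g
    have h₁ : (tot F).map (ca (g ≫ t.base) A.fiber) ≫ ψ = (tot F).map n' := h ⟨n', hn'⟩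
    rw [← Functor.map_comp_assoc, ← hj, Functor.map_comp_assoc, h₁, ← Functor.map_comp,
      ← Functor.map_comp]
    refine key _ _ ?_
    rw [Functor.map_comp, hn', Functor.map_comp, hn, ← Functor.map_comp_assoc,
      ← Functor.map_comp_assoc, hj]

def ext {A B : ∫ᶜ E} (φ : (tot w).obj A ⟶ (tot w).obj B) :
    (tot F).obj A ⟶ (tot F).obj B :=
  (hw.exists_ext hQ F φ).choose

@[simp] lemma ext_base {A B : ∫ᶜ E} (φ : (tot w).obj A ⟶ (tot w).obj B) :
    (hw.ext hQ F φ).base = φ.base := (hw.exists_ext hQ F φ).choose_spec.1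

lemma map_ext {A' A B : ∫ᶜ E} (φ : (tot w).obj A ⟶ (tot w).obj B) (t : A' ⟶ A) (n : A' ⟶ B)
    (h : (tot w).map n = (tot w).map t ≫ φ) :
    (tot F).map t ≫ hw.ext hQ F φ = (tot F).map n :=
  (hw.exists_ext hQ F φ).choose_spec.2 t n h

lemma ext_map {A B : ∫ᶜ E} (n : A ⟶ B) : hw.ext hQ F ((tot w).map n) = (tot F).map n := by
  have := hw.map_ext hQ F ((tot w).map n) (𝟙 A) n (by
    rw [CategoryTheory.Functor.map_id, id_comp])
  rwa [CategoryTheory.Functor.map_id, id_comp] at this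

include hw hQ in
lemma hom_ext {A B : ∫ᶜ E} {y : ∫ᶜ Q} (φ : (tot w).obj A ⟶ (tot w).obj B)
    {m n : (tot F).obj A ⟶ y} (hb : m.base = n.base)
    (h : ∀ ⦃Y : K⦄ (g : Y ⟶ A.base) (l : ob ((E.res g).obj A.fiber) ⟶ B),
      (tot w).map l = (tot w).map (ca g A.fiber) ≫ φ →
        (tot F).map (ca g A.fiber) ≫ m = (tot F).map (ca g A.fiber) ≫ n) : m = n :=
  hQ.ext hb ((hw.surj φ).mono fun _ g ⟨l, hl⟩ =>
    ⟨_, (tot F).map (ca g A.fiber), rfl, (car_ca _ _).tot F, h g l hl⟩)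

lemma map_ext_comp {A' A B : ∫ᶜ E} (t : A' ⟶ A) (φ : (tot w).obj A ⟶ (tot w).obj B) :
    (tot F).map t ≫ hw.ext hQ F φ = hw.ext hQ F ((tot w).map t ≫ φ) := by
  refine hw.hom_ext hQ F ((tot w).map t ≫ φ) (by simp) fun Y g l hl => ?_
  rw [← Functor.map_comp_assoc, hw.map_ext hQ F φ _ l (by rw [hl, Functor.map_comp_assoc]),
    hw.map_ext hQ F _ _ l hl]

lemma ext_comp {A B C : ∫ᶜ E} (φ : (tot w).obj A ⟶ (tot w).obj B)
    (φ' : (tot w).obj B ⟶ (tot w).obj C) :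
    hw.ext hQ F φ ≫ hw.ext hQ F φ' = hw.ext hQ F (φ ≫ φ') := by
  refine hw.hom_ext hQ F φ (by simp) fun Y g l hl => ?_
  rw [← assoc, hw.map_ext hQ F φ _ l hl, map_ext_comp, map_ext_comp, hl, assoc]

lemma isIso_ext {A B : ∫ᶜ E} (φ : (tot w).obj A ⟶ (tot w).obj B) [IsIso φ] :
    IsIso (hw.ext hQ F φ) := by
  have h (A : ∫ᶜ E) : hw.ext hQ F (𝟙 ((tot w).obj A)) = 𝟙 _ := by
    rw [← CategoryTheory.Functor.map_id, ext_map, CategoryTheory.Functor.map_id]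
  exact ⟨hw.ext hQ F (inv φ), by rw [ext_comp, IsIso.hom_inv_id, h],
    by rw [ext_comp, IsIso.inv_hom_id, h]⟩

lemma car_ext {A B : ∫ᶜ E} (φ : (tot w).obj A ⟶ (tot w).obj B) (hφ : Car φ) :
    Car (hw.ext hQ F φ) := by
  obtain ⟨i, hi, hic, hi'⟩ := ((car_ca φ.base B.fiber).tot w).exists_desc hφ (𝟙 _)
    (id_comp _)
  have : IsIso i := hic.isIso_of_base (by rw [hi]; exact inferInstanceAs (IsIso (𝟙 A.base)))
  have hi₂ : i ≫ (tot w).map (ca φ.base B.fiber) = φ := hi'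
  have := hw.isIso_ext hQ F (A := A) (B := ob ((E.res φ.base).obj B.fiber)) i
  rw [← hi₂]
  have h := hw.ext_comp hQ F (A := A) (B := ob ((E.res φ.base).obj B.fiber)) i
    ((tot w).map (ca φ.base B.fiber))
  rw [← h, ext_map]
  exact Car.trans (car_of_isIso _) ((car_ca _ _).tot F)

section

variable {G H : E' ⟶ Q}

include hw hQ in
lemma whiskerLeft_injective {α β : G ⟶ H} (h : w ◁ α = w ◁ β) : α = β := by
  refine vAt_ext fun x => hQ.ext rfl ((hw.ess x.fiber).mono fun Y f ⟨e, u, hu, hc⟩ => ?_)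
  refine ⟨_, (tot G).map u, hu, hc.tot G, ?_⟩
  have h' : vAt α ((tot w).obj (ob e)) = vAt β ((tot w).obj (ob e)) :=
    congrArg (fun t => vAt t (ob e)) h
  exact (vAt_nat α u).trans ((congrArg (· ≫ _) h').trans (vAt_nat β u).symm)

/-- The components of an indexed natural transformation between composites. -/
def wAt (β : w ≫ G ⟶ w ≫ H) (A : ∫ᶜ E) :
    (tot G).obj ((tot w).obj A) ⟶ (tot H).obj ((tot w).obj A) := vAt β A

@[simp] lemma wAt_base (β : w ≫ G ⟶ w ≫ H) (A : ∫ᶜ E) : (wAt β A).base = 𝟙 A.base := rfl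

lemma wAt_nat (β : w ≫ G ⟶ w ≫ H) {A B : ∫ᶜ E} (n : A ⟶ B) :
    (tot G).map ((tot w).map n) ≫ wAt β B = wAt β A ≫ (tot H).map ((tot w).map n) := by
  have h := vAt_nat β n
  rw [tot_comp, tot_comp] at h
  exact h

include hw hQ in
lemma vAt_nat_ext (β : w ≫ G ⟶ w ≫ H) {A B : ∫ᶜ E} (φ : (tot w).obj A ⟶ (tot w).obj B) :
    (tot G).map φ ≫ wAt β B = wAt β A ≫ (tot H).map φ := by
  refine hQ.ext ?_ ((hw.surj φ).mono fun Y f ⟨n, hn⟩ => ?_)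
  · exact (comp_id φ.base).trans (id_comp φ.base).symm
  refine ⟨_, (tot G).map ((tot w).map (ca f A.fiber)), rfl, ((car_ca _ _).tot w).tot G, ?_⟩
  have h₁ := wAt_nat β n
  have h₂ := wAt_nat β (ca f A.fiber)
  have h₃ := congrArg (tot G).map hn
  have h₄ := congrArg (tot H).map hn
  rw [Functor.map_comp] at h₃ h₄
  rw [h₃, h₄, ← assoc (wAt β _), ← h₂] at h₁
  simpa only [assoc] using h₁

include hw hQ in
lemma whiskerLeft_surjective (β : w ≫ G ⟶ w ≫ H) : ∃ α : G ⟶ H, w ◁ α = β := by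
  have key : ∀ x : ∫ᶜ E', ∃ t : (tot G).obj x ⟶ (tot H).obj x, t.base = 𝟙 x.base ∧
      ∀ ⦃e : ∫ᶜ E⦄ (u : (tot w).obj e ⟶ x), Car u →
        (tot G).map u ≫ t = wAt β e ≫ (tot H).map u := by
    intro x
    obtain ⟨t, ht, h⟩ := hQ.glue (A := (tot G).obj x) (B := (tot H).obj x) (𝟙 _)
      (I := fun Y g => Σ e : E.fibre Y, {u : (tot w).obj (ob e) ⟶ x // u.base = g ∧ Car u})
      (fun Y g i => (StrongTrans.comp G Y).obj ((StrongTrans.comp w Y).obj i.1))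
      (fun Y g i => (tot G).map i.2.1) (fun Y g i => wAt β (ob i.1) ≫ (tot H).map i.2.1)
      (fun Y g i => i.2.2.1) (fun Y g i => i.2.2.2.tot G)
      (fun Y g i => (id_comp _).trans (i.2.2.1.trans (comp_id _).symm))
      (fun Y Z g g' i j l hl => by
        have hb : l.base ≫ i.2.1.base = j.2.1.base := base_congr hl
        obtain ⟨v, hv, hv'⟩ := i.2.2.2.exists_lift j.2.1 l.base hb
        have hvl : (tot G).map v = l := (i.2.2.2.tot G).hom_ext hv (by
          rw [← Functor.map_comp, hv', hl])
        have h₁ := hw.vAt_nat_ext hQ β (A := ob j.1) (B := ob i.1) v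
        rw [← hvl, ← hv', Functor.map_comp]
        rw [reassoc_of% h₁])
      ((hw.ess x.fiber).mono fun Y g ⟨e, u, hu⟩ => ⟨e, u, hu⟩)
    exact ⟨t, ht, fun e u hu => h (g := u.base) ⟨e.fiber, u, rfl, hu⟩⟩
  choose t ht h using key
  have nat : ∀ {A B : ∫ᶜ E'} (u : A ⟶ B), (tot G).map u ≫ t B = t A ≫ (tot H).map u := by
    intro A B u
    refine hQ.ext ?_ (((hw.ess A.fiber).and ((hw.ess B.fiber).pull u.base)).mono
      fun Y f ⟨⟨e, s, hs, hsc⟩, ⟨e', s', hs', hsc'⟩⟩ => ?_)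
    · rw [comp_base, comp_base, ht, ht]
      exact (comp_id u.base).trans (id_comp u.base).symm
    refine ⟨_, (tot G).map s, hs, hsc.tot G, ?_⟩
    obtain ⟨z, -, hz⟩ := hsc'.exists_lift (s ≫ u) (𝟙 Y) ((id_comp _).trans (by
      rw [hs', comp_base, hs]))
    have h₁ := hw.vAt_nat_ext hQ β (A := ob e) (B := ob e') z
    have h₂ := h A (e := ob e) s hsc
    have h₃ := h B (e := ob e') s' hsc'
    rw [← Functor.map_comp_assoc, ← hz, Functor.map_comp_assoc, h₃]
    have h₄ := congrArg (tot H).map hz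
    rw [Functor.map_comp, Functor.map_comp] at h₄
    rw [reassoc_of% h₁, reassoc_of% h₂]
    exact congrArg (_ ≫ ·) h₄
  refine ⟨ofV t ht nat, vAt_ext fun e => ?_⟩
  refine (vAt_whiskerLeft w (ofV t ht nat) e).trans ((vAt_ofV t ht nat _).trans ?_)
  have h₁ := h ((tot w).obj e) (𝟙 ((tot w).obj e)) (car_of_isIso _)
  rw [CategoryTheory.Functor.map_id, CategoryTheory.Functor.map_id, id_comp] at h₁
  exact h₁.trans (comp_id _)

end

end LE

end

section

variable {J : GrothendieckTopology K}
  {E E' Q : IndCat.{v, u, v', u'} K}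

namespace LE

variable {w : E ⟶ E'} (hw : LE J w) (hQ : Q.IsStack J) (F : E ⟶ Q)

variable (w) in
/-- A chart at `f` of an object `x`: a cartesian arrow over `f` from an object in the image
of `w`. -/
structure Chart {X : K} (x : E'.fibre X) {Y : K} (f : Y ⟶ X) where
  pt : E.fibre Y
  arr : (tot w).obj (ob pt) ⟶ ob x
  base : arr.base = f
  car : Car arr

include hw in
lemma loc_chart {X : K} (x : E'.fibre X) :
    Loc J (fun (Y : K) (f : Y ⟶ X) => Nonempty (Chart w x f)) :=
  (hw.ess x).mono fun _ _ ⟨e, u, hu, hc⟩ => ⟨⟨e, u, hu, hc⟩⟩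

lemma Chart.exists_lift {X : K} {x : E'.fibre X} {Y Z : K} {f : Y ⟶ X} {g : Z ⟶ X}
    (c : Chart w x f) (c' : Chart w x g) (h : Z ⟶ Y) (e : h ≫ f = g) :
    ∃ k : (tot w).obj (ob c'.pt) ⟶ (tot w).obj (ob c.pt), k.base = h ∧ Car k ∧
      k ≫ c.arr = c'.arr :=
  c.car.exists_desc c'.car h (by rw [c.base, c'.base]; exact e)

def Chart.lift {X : K} {x : E'.fibre X} {Y Z : K} {f : Y ⟶ X} {g : Z ⟶ X}
    (c : Chart w x f) (c' : Chart w x g) (h : Z ⟶ Y) (e : h ≫ f = g) :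
    (tot w).obj (ob c'.pt) ⟶ (tot w).obj (ob c.pt) := (c.exists_lift c' h e).choose

section

variable {X : K} {x : E'.fibre X} {Y Z : K} {f : Y ⟶ X} {g : Z ⟶ X}
    (c : Chart w x f) (c' : Chart w x g) (h : Z ⟶ Y) (e : h ≫ f = g)

@[simp] lemma Chart.lift_base : (c.lift c' h e).base = h := (c.exists_lift c' h e).choose_spec.1

lemma Chart.car_lift : Car (c.lift c' h e) := (c.exists_lift c' h e).choose_spec.2.1

@[simp] lemma Chart.lift_arr : c.lift c' h e ≫ c.arr = c'.arr :=
  (c.exists_lift c' h e).choose_spec.2.2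

@[simp] lemma Chart.lift_arr_assoc {Z : ∫ᶜ E'} (k : ob x ⟶ Z) :
    c.lift c' h e ≫ c.arr ≫ k = c'.arr ≫ k := by
  rw [← assoc, lift_arr]

lemma Chart.eq_lift (k : (tot w).obj (ob c'.pt) ⟶ (tot w).obj (ob c.pt)) (hk : k ≫ c.arr = c'.arr)
    (hb : k.base = h) : k = c.lift c' h e :=
  c.car.hom_ext (by rw [hb, c.lift_base]) (by rw [hk, lift_arr])

end

include hw hQ in
lemma exists_obj {X : K} (x : E'.fibre X) :
    ∃ (y : Q.fibre X) (arr : ∀ ⦃Y : K⦄ ⦃f : Y ⟶ X⦄ (c : Chart w x f),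
      (tot F).obj (ob c.pt) ⟶ ob y),
      (∀ ⦃Y : K⦄ ⦃f : Y ⟶ X⦄ (c : Chart w x f), (arr c).base = f) ∧
      (∀ ⦃Y : K⦄ ⦃f : Y ⟶ X⦄ (c : Chart w x f), Car (arr c)) ∧
      ∀ ⦃Y Z : K⦄ ⦃f : Y ⟶ X⦄ ⦃g : Z ⟶ X⦄ (c : Chart w x f) (c' : Chart w x g) (h : Z ⟶ Y)
        (e : h ≫ f = g), hw.ext (isPre_of_isStack hQ) F (c.lift c' h e) ≫ arr c = arr c' := by
  let S : Sieve X :=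
    { arrows := fun Y f => Nonempty (Chart w x f)
      downward_closed := by
        rintro Y Z f ⟨c⟩ g
        refine ⟨⟨_, (tot w).map (ca g c.pt) ≫ c.arr, ?_, ((car_ca _ _).tot w).trans c.car⟩⟩
        rw [comp_base, c.base]
        rfl }
  exact DD.exists_arr (S := S) (Ch := fun Y f => Chart w x f) (fun _ _ => Iff.rfl)
    (fun Y f c => (StrongTrans.comp F Y).obj c.pt)
    (fun Y Z f g c c' h e => hw.ext (isPre_of_isStack hQ) F (c.lift c' h e))
    (fun Y Z f g c c' h e => by rw [ext_base, c.lift_base])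
    (fun Y Z f g c c' h e => hw.car_ext _ F _ (c.car_lift c' h e))
    (fun Y Z W f g k c c' c'' h e h' e' h'' e'' he => by
      refine (hw.ext_comp _ F _ _).trans (congrArg _ ?_)
      refine c.eq_lift c'' h'' e'' _ ?_ ?_
      · rw [assoc, c.lift_arr, c'.lift_arr]
      · rw [comp_base, c.lift_base, c'.lift_base, he])
    ((isStack_iff.1 hQ S ((hw.loc_chart x).sieve_mem fun _ _ h => h)).2)

def extObj {X : K} (x : E'.fibre X) : Q.fibre X := (hw.exists_obj hQ F x).choose

/-- The cartesian arrow induced by a chart. -/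
def extArr {X : K} {x : E'.fibre X} {Y : K} {f : Y ⟶ X} (c : Chart w x f) :
    (tot F).obj (ob c.pt) ⟶ ob (hw.extObj hQ F x) := (hw.exists_obj hQ F x).choose_spec.choose c

@[simp] lemma extArr_base {X : K} {x : E'.fibre X} {Y : K} {f : Y ⟶ X} (c : Chart w x f) :
    (hw.extArr hQ F c).base = f := (hw.exists_obj hQ F x).choose_spec.choose_spec.1 c

lemma car_extArr {X : K} {x : E'.fibre X} {Y : K} {f : Y ⟶ X} (c : Chart w x f) :
    Car (hw.extArr hQ F c) := (hw.exists_obj hQ F x).choose_spec.choose_spec.2.1 c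

lemma ext_extArr {X : K} {x : E'.fibre X} {Y Z : K} {f : Y ⟶ X} {g : Z ⟶ X}
    (c : Chart w x f) (c' : Chart w x g) (k : (tot w).obj (ob c'.pt) ⟶ (tot w).obj (ob c.pt))
    (hk : k ≫ c.arr = c'.arr) :
    hw.ext (isPre_of_isStack hQ) F k ≫ hw.extArr hQ F c = hw.extArr hQ F c' := by
  have e : k.base ≫ f = g := by
    have := base_congr hk
    rwa [comp_base, c.base, c'.base] at this
  rw [c.eq_lift c' k.base e k hk rfl]
  exact (hw.exists_obj hQ F x).choose_spec.choose_spec.2.2 c c' _ e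

/-- The restriction of a chart. -/
def Chart.res {X : K} {x : E'.fibre X} {Y : K} {f : Y ⟶ X} (c : Chart w x f) {Z : K} (g : Z ⟶ Y)
    (k : Z ⟶ X) (hk : g ≫ f = k) : Chart w x k where
  pt := (E.res g).obj c.pt
  arr := (tot w).map (ca g c.pt) ≫ c.arr
  base := by rw [comp_base, c.base]; exact hk
  car := ((car_ca _ _).tot w).trans c.car

lemma ext_extArr_eq {X : K} {x : E'.fibre X} {Y Z W : K} {f : Y ⟶ X} {g : Z ⟶ X}
    (c : Chart w x f) (c' : Chart w x g) {e : E.fibre W}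
    (p : (tot w).obj (ob e) ⟶ (tot w).obj (ob c.pt))
    (q : (tot w).obj (ob e) ⟶ (tot w).obj (ob c'.pt)) (h : p ≫ c.arr = q ≫ c'.arr) :
    hw.ext (isPre_of_isStack hQ) F p ≫ hw.extArr hQ F c =
      hw.ext (isPre_of_isStack hQ) F q ≫ hw.extArr hQ F c' := by
  have hb : p.base ≫ f = q.base ≫ g := by
    have := base_congr h
    rwa [comp_base, comp_base, c.base, c'.base] at this
  let d := c.res p.base _ rfl
  let d' := c'.res q.base _ hb.symm
  obtain ⟨i, hi, hi'⟩ : ∃ i : (tot w).obj (ob e) ⟶ (tot w).obj (ob d.pt), i.base = 𝟙 W ∧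
      i ≫ (tot w).map (ca p.base c.pt) = p :=
    ((car_ca p.base c.pt).tot w).exists_lift p (𝟙 W) (id_comp _)
  obtain ⟨j, hj, hj'⟩ : ∃ j : (tot w).obj (ob e) ⟶ (tot w).obj (ob d'.pt), j.base = 𝟙 W ∧
      j ≫ (tot w).map (ca q.base c'.pt) = q :=
    ((car_ca q.base c'.pt).tot w).exists_lift q (𝟙 W) (id_comp _)
  have h₁ := d'.lift_arr d (𝟙 W) (id_comp _)
  have h₂ : i ≫ d'.lift d (𝟙 W) (id_comp _) = j := by
    refine d'.car.hom_ext ?_ ?_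
    · rw [comp_base, hi, hj, d'.lift_base]
      exact id_comp _
    · rw [assoc, h₁]
      change i ≫ (tot w).map (ca p.base c.pt) ≫ c.arr = j ≫ (tot w).map (ca q.base c'.pt) ≫ c'.arr
      rw [reassoc_of% hi', reassoc_of% hj', h]
  have h₃ := hw.ext_extArr hQ F d' d _ h₁
  have h₄ := hw.ext_extArr hQ F c d ((tot w).map (ca p.base c.pt)) rfl
  have h₅ := hw.ext_extArr hQ F c' d' ((tot w).map (ca q.base c'.pt)) rfl
  have h₆ := hw.ext_comp (isPre_of_isStack hQ) F (A := ob e) i ((tot w).map (ca p.base c.pt))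
  have h₇ := hw.ext_comp (isPre_of_isStack hQ) F (A := ob e) j ((tot w).map (ca q.base c'.pt))
  have h₈ := hw.ext_comp (isPre_of_isStack hQ) F (A := ob e) i
    (d'.lift d (𝟙 W) (id_comp _))
  rw [hi'] at h₆
  rw [hj'] at h₇
  rw [h₂] at h₈
  rw [← h₆, ← h₇, assoc, assoc, h₄, h₅, ← h₃, ← h₈, assoc]

/-- A chart of an arrow. -/
structure HomChart {x x' : ∫ᶜ E'} (ψ : x' ⟶ x) {Y : K} (f : Y ⟶ x'.base) where
  dom : Chart w x'.fiber f
  cod : Chart w x.fiber (f ≫ ψ.base)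
  arr : (tot w).obj (ob dom.pt) ⟶ (tot w).obj (ob cod.pt)
  comm : arr ≫ cod.arr = dom.arr ≫ ψ

lemma exists_homChart {x x' : ∫ᶜ E'} (ψ : x' ⟶ x) {Y : K} {f : Y ⟶ x'.base}
    (c : Chart w x'.fiber f) (c' : Chart w x.fiber (f ≫ ψ.base)) :
    ∃ t : HomChart (w := w) ψ f, t.dom = c ∧ t.cod = c' := by
  obtain ⟨k, hk, hk'⟩ := c'.car.exists_lift (c.arr ≫ ψ) (𝟙 Y) (by
    rw [c'.base, comp_base, c.base]; exact id_comp _)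
  exact ⟨⟨c, c', k, hk'⟩, rfl, rfl⟩

include hw in
lemma loc_homChart {x x' : ∫ᶜ E'} (ψ : x' ⟶ x) :
    Loc J (fun (Y : K) (f : Y ⟶ x'.base) => Nonempty (HomChart (w := w) ψ f)) :=
  ((hw.loc_chart x'.fiber).and ((hw.loc_chart x.fiber).pull ψ.base)).mono fun _ _ ⟨⟨c⟩, ⟨c'⟩⟩ =>
    ⟨(exists_homChart ψ c c').choose⟩

include hw hQ in
lemma exists_hom {x x' : ∫ᶜ E'} (ψ : x' ⟶ x) :
    ∃ χ : ob (hw.extObj hQ F x'.fiber) ⟶ ob (hw.extObj hQ F x.fiber), χ.base = ψ.base ∧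
      ∀ ⦃Y Z : K⦄ ⦃f : Y ⟶ x'.base⦄ ⦃g : Z ⟶ x.base⦄ (c : Chart w x'.fiber f)
        (c' : Chart w x.fiber g) (k : (tot w).obj (ob c.pt) ⟶ (tot w).obj (ob c'.pt)),
        k ≫ c'.arr = c.arr ≫ ψ → hw.extArr hQ F c ≫ χ =
          hw.ext (isPre_of_isStack hQ) F k ≫ hw.extArr hQ F c' := by
  have hQ' := isPre_of_isStack hQ
  obtain ⟨χ, hχ, h⟩ := hQ'.glue (A := ob (hw.extObj hQ F x'.fiber))
    (B := ob (hw.extObj hQ F x.fiber)) ψ.base (I := fun Y g => HomChart (w := w) ψ g)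
    (fun Y g i => (StrongTrans.comp F Y).obj i.dom.pt)
    (fun Y g i => hw.extArr hQ F i.dom) (fun Y g i => hw.ext hQ' F i.arr ≫ hw.extArr hQ F i.cod)
    (fun Y g i => hw.extArr_base hQ F i.dom) (fun Y g i => hw.car_extArr hQ F i.dom)
    (fun Y g i => by
      have := base_congr i.comm
      rw [comp_base, i.cod.base, comp_base, i.dom.base] at this
      rw [comp_base, ext_base, extArr_base]
      exact this)
    (fun Y Z g g' i j l hl => by
      have hb : l.base ≫ g = g' := by
        have := base_congr hl
        rwa [comp_base, extArr_base, extArr_base] at this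
      have hl' : l = hw.ext hQ' F (i.dom.lift j.dom l.base hb) := by
        refine (hw.car_extArr hQ F i.dom).hom_ext ?_ ?_
        · rw [ext_base, i.dom.lift_base]
        · rw [hl, hw.ext_extArr hQ F i.dom j.dom _ (i.dom.lift_arr _ _ _)]
      rw [hl', reassoc_of% @ext_comp]
      refine hw.ext_extArr_eq hQ F i.cod j.cod _ _ ?_
      rw [assoc, i.comm, j.comm, i.dom.lift_arr_assoc])
    (hw.loc_homChart ψ)
  refine ⟨χ, hχ, fun Y Z f g c c' k hk => ?_⟩
  have e : k.base ≫ g = f ≫ ψ.base := by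
    have := base_congr hk
    rwa [comp_base, c'.base, comp_base, c.base] at this
  obtain ⟨t, rfl, ht⟩ := exists_homChart ψ c (c'.res k.base _ e)
  rw [h t]
  refine hw.ext_extArr_eq hQ F t.cod c' _ _ ?_
  rw [t.comm, hk]

def extHom {x x' : ∫ᶜ E'} (ψ : x' ⟶ x) :
    ob (hw.extObj hQ F x'.fiber) ⟶ ob (hw.extObj hQ F x.fiber) := (hw.exists_hom hQ F ψ).choose

@[simp] lemma extHom_base {x x' : ∫ᶜ E'} (ψ : x' ⟶ x) : (hw.extHom hQ F ψ).base = ψ.base :=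
  (hw.exists_hom hQ F ψ).choose_spec.1

lemma extArr_extHom {x x' : ∫ᶜ E'} (ψ : x' ⟶ x) {Y Z : K} {f : Y ⟶ x'.base} {g : Z ⟶ x.base}
    (c : Chart w x'.fiber f) (c' : Chart w x.fiber g)
    (k : (tot w).obj (ob c.pt) ⟶ (tot w).obj (ob c'.pt)) (hk : k ≫ c'.arr = c.arr ≫ ψ) :
    hw.extArr hQ F c ≫ hw.extHom hQ F ψ =
      hw.ext (isPre_of_isStack hQ) F k ≫ hw.extArr hQ F c' :=
  (hw.exists_hom hQ F ψ).choose_spec.2 c c' k hk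

include hw hQ in
lemma extHom_ext {x : ∫ᶜ E'} {y : ∫ᶜ Q} {m n : ob (hw.extObj hQ F x.fiber) ⟶ y}
    (hb : m.base = n.base) (h : Loc J (fun (Y : K) (f : Y ⟶ x.base) =>
      ∃ c : Chart w x.fiber f, hw.extArr hQ F c ≫ m = hw.extArr hQ F c ≫ n)) : m = n :=
  (isPre_of_isStack hQ).ext hb (h.mono fun _ _ ⟨c, hc⟩ =>
    ⟨_, hw.extArr hQ F c, hw.extArr_base hQ F c, hw.car_extArr hQ F c, hc⟩)

def extend : TotData E' Q where
  obj x := hw.extObj hQ F x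
  map ψ := hw.extHom hQ F ψ
  base ψ := hw.extHom_base hQ F ψ
  map_id x := by
    refine hw.extHom_ext hQ F (hw.extHom_base hQ F _) ((hw.loc_chart x.fiber).mono fun Y f ⟨c⟩ => ?_)
    refine ⟨c, ?_⟩
    rw [hw.extArr_extHom hQ F (𝟙 x) c c (𝟙 _) ((id_comp _).trans (comp_id _).symm)]
    rw [hw.ext_extArr hQ F c c (𝟙 _) (id_comp _), comp_id]
  map_comp {x x' x''} ψ φ := by
    refine hw.extHom_ext hQ F (by simp) ((((hw.loc_chart x.fiber).and
      ((hw.loc_chart x'.fiber).pull ψ.base)).and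
        ((hw.loc_chart x''.fiber).pull (ψ.base ≫ φ.base))).mono ?_)
    rintro Y f ⟨⟨⟨c⟩, ⟨c'⟩⟩, ⟨c''⟩⟩
    obtain ⟨k, hk⟩ : ∃ k : (tot w).obj (ob c.pt) ⟶ (tot w).obj (ob c'.pt),
        k ≫ c'.arr = c.arr ≫ ψ := by
      obtain ⟨t, rfl, rfl⟩ := exists_homChart ψ c c'
      exact ⟨t.arr, t.comm⟩
    obtain ⟨l, -, hl⟩ := c''.car.exists_lift (c'.arr ≫ φ) (𝟙 Y) (by
      rw [c''.base, comp_base, c'.base, assoc]; exact id_comp _)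
    refine ⟨c, ?_⟩
    rw [hw.extArr_extHom hQ F (ψ ≫ φ) c c'' (k ≫ l) (by
      rw [assoc, hl, reassoc_of% hk]), ← assoc (hw.extArr hQ F c),
      hw.extArr_extHom hQ F ψ c c' k hk, assoc, hw.extArr_extHom hQ F φ c' c'' l hl,
      reassoc_of% @ext_comp]
  car {x x'} ψ hψ := by
    refine (isPre_of_isStack hQ).car _ ((hw.loc_homChart ψ).mono fun Y f ⟨t⟩ => ?_)
    refine ⟨_, hw.extArr hQ F t.dom, hw.extArr_base hQ F t.dom, hw.car_extArr hQ F t.dom, ?_⟩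
    rw [hw.extArr_extHom hQ F ψ t.dom t.cod t.arr t.comm]
    refine (hw.car_ext _ F _ ?_).trans (hw.car_extArr hQ F _)
    exact t.cod.car.of_comp (by rw [t.comm]; exact t.dom.car.trans hψ)

/-- The tautological chart. -/
def Chart.self {X : K} (e : E.fibre X) : Chart w ((StrongTrans.comp w X).obj e) (𝟙 X) :=
  ⟨e, 𝟙 _, rfl, car_of_isIso _⟩

include hw hQ in
lemma exists_extension : ∃ G : E' ⟶ Q, Nonempty (w ≫ G ≅ F) := by
  let T := hw.extend hQ F
  let t : ∀ A : ∫ᶜ E, (tot F).obj A ⟶ (tot (w ≫ T.toTrans)).obj A := fun A =>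
    hw.extArr hQ F (Chart.self A.fiber)
  have ht : ∀ A, (t A).base = 𝟙 A.base := fun A => hw.extArr_base hQ F (Chart.self A.fiber)
  refine ⟨T.toTrans, ⟨(isoOfV t ht (fun A => ?_) fun {A B} u => ?_).symm⟩⟩
  · exact (hw.car_extArr hQ F (Chart.self A.fiber)).isIso_of_base
      (by rw [extArr_base]; exact inferInstanceAs (IsIso (𝟙 A.base)))
  · have h₁ := hw.extArr_extHom hQ F ((tot w).map u) (Chart.self A.fiber) (Chart.self B.fiber)
      ((tot w).map u) ((comp_id _).trans (id_comp _).symm)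
    have h₂ := T.tot_map ((tot w).map u)
    have h₃ := hw.ext_map (isPre_of_isStack hQ) F u
    have h₄ := tot_comp w T.toTrans u
    exact (congrArg (· ≫ _) h₃).symm.trans (h₁.symm.trans (congrArg (t A ≫ ·) (h₄.trans h₂).symm))

include hw hQ in
lemma isEquivalence_precomp : (precomp Q w).IsEquivalence where
  faithful := ⟨fun h => hw.whiskerLeft_injective (isPre_of_isStack hQ) h⟩
  full := ⟨fun β => hw.whiskerLeft_surjective (isPre_of_isStack hQ) β⟩
  essSurj := ⟨fun F => hw.exists_extension hQ F⟩

include hw in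
lemma isUniv (hE' : E'.IsStack J) :
    IsUniv (stIncl J) (a := E) (b := (⟨E', hE'⟩ : St.{v, u, v', u'} J)) w := fun c => by
  let b : St.{v, u, v', u'} J := ⟨E', hE'⟩
  exact @Functor.isEquivalence_trans _ _ _ _ _ _ ((stIncl J).mapFunctor b c)
    (precomp ((stIncl J).obj c) w)
    (isLocEquiv_incl (fun A : IndCat.{v, u, v', u'} K => A.IsStack J) b c)
    (hw.isEquivalence_precomp c.2)

end LE

end

section

/-- The total objects of a family of types of objects. -/
structure Pt {K : Type u} (Obj : K → Type u') where
  base : K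
  fib : Obj base

/-- A category fibred over `K`, given by its objects over each object of `K`, its total category,
and a cleavage. -/
structure Cleaved (K : Type u) [Category.{v} K] where
  Obj : K → Type u'
  cat : Category.{v'} (Pt Obj)
  base {x y : Pt Obj} (m : x ⟶ y) : x.1 ⟶ y.1
  base_id (x : Pt Obj) : base (𝟙 x) = 𝟙 x.1
  base_comp {x y z : Pt Obj} (m : x ⟶ y) (n : y ⟶ z) : base (m ≫ n) = base m ≫ base n
  res {X Y : K} (f : Y ⟶ X) (b : Obj X) : Obj Y
  ca {X Y : K} (f : Y ⟶ X) (b : Obj X) : (⟨Y, res f b⟩ : Pt Obj) ⟶ ⟨X, b⟩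
  base_ca {X Y : K} (f : Y ⟶ X) (b : Obj X) : base (ca f b) = f
  exists_lift {c : Pt Obj} {X Y : K} (f : Y ⟶ X) (b : Obj X) (m : c ⟶ ⟨X, b⟩)
    (g : c.1 ⟶ Y) (h : g ≫ f = base m) :
    ∃ k : c ⟶ ⟨Y, res f b⟩, base k = g ∧ k ≫ ca f b = m
  hom_ext {c : Pt Obj} {X Y : K} (f : Y ⟶ X) (b : Obj X) {k k' : c ⟶ ⟨Y, res f b⟩}
    (h : base k = base k') (h' : k ≫ ca f b = k' ≫ ca f b) : k = k'

namespace Cleaved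

attribute [instance] Cleaved.cat

attribute [simp] base_id base_comp base_ca

variable (T : Cleaved.{v, u, v', u'} K)

abbrev pt {X : K} (a : T.Obj X) : Pt T.Obj := ⟨X, a⟩

/-- The lift of an arrow through a cartesian arrow. -/
def lift {c : Pt T.Obj} {X Y : K} (f : Y ⟶ X) (b : T.Obj X) (m : c ⟶ T.pt b)
    (g : c.1 ⟶ Y) (h : g ≫ f = T.base m) : c ⟶ T.pt (T.res f b) :=
  (T.exists_lift f b m g h).choose

variable {T}

@[simp] lemma base_lift {c : Pt T.Obj} {X Y : K} (f : Y ⟶ X) (b : T.Obj X) (m : c ⟶ T.pt b)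
    (g : c.1 ⟶ Y) (h : g ≫ f = T.base m) : T.base (T.lift f b m g h) = g :=
  (T.exists_lift f b m g h).choose_spec.1

@[simp] lemma lift_ca {c : Pt T.Obj} {X Y : K} (f : Y ⟶ X) (b : T.Obj X)
    (m : c ⟶ T.pt b) (g : c.1 ⟶ Y) (h : g ≫ f = T.base m) : T.lift f b m g h ≫ T.ca f b = m :=
  (T.exists_lift f b m g h).choose_spec.2

@[simp] lemma lift_ca_assoc {c d : Pt T.Obj} {X Y : K} (f : Y ⟶ X) (b : T.Obj X)
    (m : c ⟶ T.pt b) (g : c.1 ⟶ Y) (h : g ≫ f = T.base m) (k : T.pt b ⟶ d) :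
    T.lift f b m g h ≫ T.ca f b ≫ k = m ≫ k := by
  rw [← assoc, lift_ca]

lemma lift_ca₂ {c : Pt T.Obj} {X Y Z : K} (f : Y ⟶ X) (g : Z ⟶ Y) (b : T.Obj X)
    (m : c ⟶ T.pt b) (h : c.1 ⟶ Z) (h' : c.1 ⟶ Y) (e' : h' ≫ f = T.base m)
    (e'' : h ≫ g = T.base (T.lift f b m h' e')) :
    T.lift g (T.res f b) (T.lift f b m h' e') h e'' ≫ T.ca g (T.res f b) ≫ T.ca f b = m :=
  ((reassoc_of% (lift_ca g (T.res f b) (T.lift f b m h' e') h e'')) _).trans (lift_ca f b m h' e')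

/-- Arrows of a fibre. -/
@[ext]
structure VHom {X : K} (a b : T.Obj X) where
  hom : T.pt a ⟶ T.pt b
  w : T.base hom = 𝟙 X

attribute [simp] VHom.w

instance (X : K) : Category.{v'} (T.Obj X) where
  Hom a b := VHom a b
  id a := ⟨𝟙 _, T.base_id _⟩
  comp m n := ⟨m.hom ≫ n.hom, by simp⟩
  id_comp _ := VHom.ext (id_comp _)
  comp_id _ := VHom.ext (comp_id _)
  assoc _ _ _ := VHom.ext (assoc _ _ _)

@[ext] lemma vhom_ext {X : K} {a b : T.Obj X} {m n : a ⟶ b} (h : m.hom = n.hom) : m = n :=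
  VHom.ext h

@[simp] lemma id_hom {X : K} (a : T.Obj X) : VHom.hom (𝟙 a) = 𝟙 (T.pt a) := rfl
@[simp] lemma comp_hom {X : K} {a b c : T.Obj X} (m : a ⟶ b) (n : b ⟶ c) :
    VHom.hom (m ≫ n) = m.hom ≫ n.hom := rfl

lemma vhom_ext_ca {X Y : K} {f : Y ⟶ X} {a : T.Obj Y} {b : T.Obj X} {m n : a ⟶ T.res f b}
    (h : m.hom ≫ T.ca f b = n.hom ≫ T.ca f b) : m = n :=
  vhom_ext (T.hom_ext f b (by rw [m.w, n.w]) h)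

/-- Restriction along `f`. -/
abbrev rs {X Y : K} (f : Y ⟶ X) : T.Obj X ⥤ T.Obj Y where
  obj b := T.res f b
  map {a b} m := ⟨T.lift f b (T.ca f a ≫ m.hom) (𝟙 Y) (by simp), base_lift _ _ _ _ _⟩
  map_id a := vhom_ext_ca (by simp)
  map_comp m n := vhom_ext_ca (by simp [lift_ca_assoc])

lemma rs_map_ca {X Y : K} (f : Y ⟶ X) {a b : T.Obj X} (m : a ⟶ b) :
    ((rs f).map m).hom ≫ T.ca f b = T.ca f a ≫ m.hom := lift_ca f b _ _ (by simp)

/-- The unit constraint. -/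
def rsId (X : K) : rs (T := T) (𝟙 X) ≅ 𝟭 (T.Obj X) :=
  NatIso.ofComponents (fun a =>
    { hom := ⟨T.ca (𝟙 X) a, T.base_ca _ _⟩
      inv := ⟨T.lift (𝟙 X) a (𝟙 _) (𝟙 X) (by simp), base_lift _ _ _ _ _⟩
      hom_inv_id := vhom_ext_ca (by simp)
      inv_hom_id := vhom_ext (by simp) })
    (fun m => vhom_ext (rs_map_ca _ m))

lemma rsId_inv {X : K} (a : T.Obj X) : ((rsId X).inv.app a).hom ≫ T.ca (𝟙 X) a = 𝟙 _ :=
  lift_ca (𝟙 X) a (𝟙 _) (𝟙 X) (by simp)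

lemma vhom_ext_ca₂ {X Y Z : K} {f : Y ⟶ X} {g : Z ⟶ Y} {a : T.Obj Z} {b : T.Obj X}
    {m n : a ⟶ T.res g (T.res f b)}
    (h : m.hom ≫ T.ca g _ ≫ T.ca f b = n.hom ≫ T.ca g _ ≫ T.ca f b) : m = n :=
  vhom_ext_ca (T.hom_ext _ _ (by simp) (by simpa using h))

def compHom {X Y Z : K} (f : Y ⟶ X) (g : Z ⟶ Y) (k : Z ⟶ X) (hk : g ≫ f = k)
    (a : T.Obj X) : T.res k a ⟶ T.res g (T.res f a) :=
  ⟨T.lift g _ (T.lift f a (T.ca k a) g (by simp [hk])) (𝟙 Z) (by simp), base_lift _ _ _ _ _⟩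

/-- The inverse of the comparison. -/
def compInv {X Y Z : K} (f : Y ⟶ X) (g : Z ⟶ Y) (k : Z ⟶ X) (hk : g ≫ f = k)
    (a : T.Obj X) : T.res g (T.res f a) ⟶ T.res k a :=
  ⟨T.lift k a (T.ca g _ ≫ T.ca f a) (𝟙 Z) (by simp [hk]), base_lift _ _ _ _ _⟩

lemma compHom_ca {X Y Z : K} (f : Y ⟶ X) (g : Z ⟶ Y) (k : Z ⟶ X) (hk : g ≫ f = k)
    (a : T.Obj X) : (compHom f g k hk a).hom ≫ T.ca g (T.res f a) ≫ T.ca f a = T.ca k a :=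
  lift_ca₂ f g a (T.ca k a) (𝟙 Z) g (by simp [hk]) (by simp)

lemma compInv_ca {X Y Z : K} (f : Y ⟶ X) (g : Z ⟶ Y) (k : Z ⟶ X) (hk : g ≫ f = k)
    (a : T.Obj X) : (compInv f g k hk a).hom ≫ T.ca k a = T.ca g (T.res f a) ≫ T.ca f a :=
  lift_ca k a _ _ (by simp [hk])

/-- The composition constraint. -/
def rsComp {X Y Z : K} (f : Y ⟶ X) (g : Z ⟶ Y) (k : Z ⟶ X) (hk : g ≫ f = k) :
    rs (T := T) k ≅ rs f ⋙ rs g :=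
  NatIso.ofComponents (fun a =>
    { hom := compHom f g k hk a
      inv := compInv f g k hk a
      hom_inv_id := vhom_ext_ca (by
        refine (assoc _ _ _).trans ((congrArg (_ ≫ ·) (compInv_ca f g k hk a)).trans ?_)
        exact (compHom_ca f g k hk a).trans (id_comp _).symm)
      inv_hom_id := vhom_ext_ca₂ (by
        refine (assoc _ _ _).trans ((congrArg (_ ≫ ·) (compHom_ca f g k hk a)).trans ?_)
        exact (compInv_ca f g k hk a).trans (id_comp _).symm) })
    (fun {a b} m => vhom_ext_ca₂ (by
      have h₁ := rs_map_ca g ((rs f).map m)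
      have h₂ := rs_map_ca f m
      have h₃ := rs_map_ca k m
      refine (assoc _ _ _).trans ((congrArg (_ ≫ ·) (compHom_ca f g k hk b)).trans ?_)
      refine h₃.trans (Eq.symm ?_)
      refine (assoc _ _ _).trans ((congrArg (_ ≫ ·) ((reassoc_of% h₁) _)).trans ?_)
      refine (congrArg (fun t => _ ≫ _ ≫ t) h₂).trans ?_
      refine (congrArg (_ ≫ ·) (assoc _ _ _).symm).trans ?_
      refine (assoc _ _ _).symm.trans ?_
      exact congrArg (· ≫ _) (compHom_ca f g k hk a)))

lemma rsComp_hom {X Y Z : K} (f : Y ⟶ X) (g : Z ⟶ Y) (k : Z ⟶ X) (hk : g ≫ f = k)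
    (a : T.Obj X) : ((rsComp f g k hk).hom.app a).hom ≫ T.ca g (T.res f a) ≫ T.ca f a =
      T.ca k a := compHom_ca f g k hk a

lemma comp_ca {X Y Z : K} (g : Z ⟶ Y) (f : Y ⟶ X) {a : T.Obj Z} {b : T.Obj Y} {c : T.Obj X}
    (m : a ⟶ T.res g b) (n : b ⟶ T.res f c) :
    VHom.hom (m ≫ (rs g).map n ≫ (rsComp f g (g ≫ f) rfl).inv.app c) ≫ T.ca (g ≫ f) c =
      (m.hom ≫ T.ca g b) ≫ n.hom ≫ T.ca f c := by
  have h₁ := rs_map_ca g n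
  have h₂ := compInv_ca f g (g ≫ f) rfl c
  refine (assoc _ _ _).trans (Eq.trans ?_ (assoc _ _ _).symm)
  refine congrArg (_ ≫ ·) ((assoc _ _ _).trans ?_)
  exact (congrArg (_ ≫ ·) h₂).trans ((reassoc_of% h₁) _)

variable (T)

/-- The indexed category of fibres of a fibred category. -/
def ind : IndCat.{v, u, v', u'} K :=
  mkInd T.Obj rs rsId rsComp
    (fun {X Y} f h a => vhom_ext_ca₂ (by
      rw [rsComp_hom]
      exact (((reassoc_of% (rsId_inv ((rs f).obj a))) _)).symm))
    (fun {X Y} f h a => vhom_ext_ca₂ (by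
      rw [rsComp_hom]
      refine Eq.symm (((reassoc_of% (rs_map_ca f ((rsId X).inv.app a))) _).trans ?_)
      refine (congrArg (_ ≫ ·) (rsId_inv a)).trans (comp_id _)))
    (fun {X Y Z W} f g h gf hg k h₁ h₂ h₃ h₄ a => vhom_ext_ca₂ (T.hom_ext _ _ (by simp) (by
      have e₁ := rsComp_hom gf h k h₃ a
      have e₂ := rsComp_hom f g gf h₁ a
      have e₃ := rsComp_hom f hg k h₄ a
      have e₄ := rsComp_hom g h hg h₂ ((rs f).obj a)
      have e₅ := rs_map_ca h ((rsComp f g gf h₁).hom.app a)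
      simp only [comp_hom, assoc]
      refine (congrArg (_ ≫ ·) ((reassoc_of% e₅) _)).trans ?_
      refine (congrArg (fun t => _ ≫ _ ≫ t) e₂).trans (e₁.trans ?_)
      refine Eq.symm ((congrArg (_ ≫ ·) ?_).trans e₃)
      exact (reassoc_of% e₄) _)))

def el {X : K} (a : T.Obj X) : T.ind.fibre X := a

def unel {X : K} (a : T.ind.fibre X) : T.Obj X := a

def arr {X Y : K} {a : T.Obj Y} {b : T.Obj X} (m : T.pt a ⟶ T.pt b) :
    ob (T.el a) ⟶ ob (T.el b) :=
  ar (E := T.ind) (T.base m) (VHom.mk (T.lift (T.base m) b m (𝟙 Y) (id_comp _))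
    (base_lift _ _ _ _ _))

def unarr {X Y : K} {a : T.Obj Y} {b : T.Obj X} (m : ob (T.el a) ⟶ ob (T.el b)) :
    T.pt a ⟶ T.pt b :=
  VHom.hom (T := T) (a := a) (b := T.res m.base b) (vpart m) ≫ T.ca m.base b

lemma unarr_base {X Y : K} {a : T.Obj Y} {b : T.Obj X} (m : ob (T.el a) ⟶ ob (T.el b)) :
    T.base (T.unarr m) = m.base := by
  refine (T.base_comp _ _).trans ?_
  refine (congrArg (· ≫ _) (VHom.w (T := T) (a := a) (b := T.res m.base b) (vpart m))).trans ?_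
  exact (id_comp _).trans (T.base_ca _ _)

lemma unarr_arr {X Y : K} {a : T.Obj Y} {b : T.Obj X} (m : T.pt a ⟶ T.pt b) :
    T.unarr (T.arr m) = m := lift_ca (T.base m) b m (𝟙 Y) (id_comp _)

lemma unarr_inj {X Y : K} {a : T.Obj Y} {b : T.Obj X} {m n : ob (T.el a) ⟶ ob (T.el b)}
    (h : T.unarr m = T.unarr n) : m = n := by
  have hb : m.base = n.base := by rw [← unarr_base, h, unarr_base]
  obtain ⟨m', hm⟩ := exists_ar m hb
  subst hm
  obtain ⟨n', hn⟩ := exists_ar n rfl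
  generalize n.base = f at *
  subst hn
  exact congrArg (ar f) (vhom_ext_ca h)

lemma arr_unarr {X Y : K} {a : T.Obj Y} {b : T.Obj X} (m : ob (T.el a) ⟶ ob (T.el b)) :
    T.arr (T.unarr m) = m := T.unarr_inj (T.unarr_arr _)

lemma unarr_id {X : K} (a : T.Obj X) : T.unarr (𝟙 (ob (T.el a))) = 𝟙 (T.pt a) := rsId_inv a

lemma unarr_comp {X Y Z : K} {a : T.Obj Z} {b : T.Obj Y} {c : T.Obj X}
    (m : ob (T.el a) ⟶ ob (T.el b)) (n : ob (T.el b) ⟶ ob (T.el c)) :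
    T.unarr (m ≫ n) = T.unarr m ≫ T.unarr n := by
  obtain ⟨m', hm⟩ := exists_ar m rfl
  obtain ⟨n', hn⟩ := exists_ar n rfl
  generalize m.base = g at *
  generalize n.base = f at *
  subst hm hn
  rw [ar_comp f g _ rfl]
  have h₄ : (T.ind.resComp f g (g ≫ f) rfl).inv.app (T.el c) =
    (rsComp (T := T) f g (g ≫ f) rfl).inv.app c :=
    congrArg (fun t : (rs (T := T) (g ≫ f) ≅ rs f ⋙ rs g) => t.inv.app c)
      (mkInd_resComp T.Obj rs rsId rsComp _ _ _ f g _ rfl)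
  rw [h₄]
  exact comp_ca g f (a := a) (b := b) (c := c) m' n'

@[simp] lemma arr_id {X : K} (a : T.Obj X) : T.arr (𝟙 (T.pt a)) = 𝟙 (ob (T.el a)) :=
  T.unarr_inj (by rw [unarr_arr, unarr_id])

lemma arr_comp {X Y Z : K} {a : T.Obj Z} {b : T.Obj Y} {c : T.Obj X}
    (m : T.pt a ⟶ T.pt b) (n : T.pt b ⟶ T.pt c) : T.arr (m ≫ n) = T.arr m ≫ T.arr n :=
  T.unarr_inj (by rw [unarr_arr, unarr_comp, unarr_arr, unarr_arr])

lemma car_arr_iff {X Y : K} {a : T.Obj Y} {b : T.Obj X} (m : T.pt a ⟶ T.pt b) :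
    Car (T.arr m) ↔ ∀ ⦃Z : K⦄ (c : T.Obj Z) (n : T.pt c ⟶ T.pt b) (h : Z ⟶ Y),
      h ≫ T.base m = T.base n → ∃! k : T.pt c ⟶ T.pt a, T.base k = h ∧ k ≫ m = n := by
  refine (isCart_iff _ _).trans ⟨fun H Z c n h hh => ?_, fun H Z n h hh => ?_⟩
  · obtain ⟨k, ⟨hk, hk'⟩, hk''⟩ := H (T.arr n) h hh
    obtain ⟨k, rfl⟩ : ∃ k', T.arr k' = k := ⟨_, T.arr_unarr k⟩
    refine ⟨k, ⟨hk, ?_⟩, ?_⟩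
    · rw [← T.unarr_arr (k ≫ m), arr_comp]
      exact (congrArg T.unarr hk').trans (T.unarr_arr n)
    · rintro l ⟨rfl, rfl⟩
      have := hk'' (T.arr l) ⟨rfl, (T.arr_comp _ _).symm⟩
      rw [← T.unarr_arr l, this, unarr_arr]
  · obtain ⟨k, ⟨hk, hk'⟩, hk''⟩ := H (T.unel Z.fiber) (T.unarr n) h
      (hh.trans (T.unarr_base n).symm)
    refine ⟨T.arr k, ⟨hk, ?_⟩, ?_⟩
    · exact (T.arr_comp k m).symm.trans ((congrArg T.arr hk').trans (T.arr_unarr n))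
    · rintro l ⟨hl, hl'⟩
      have h₁ := (T.unarr_comp (a := T.unel Z.fiber) l (T.arr m)).trans
        (congrArg (_ ≫ ·) (T.unarr_arr m))
      have h₂ := hk'' (T.unarr l) ⟨(T.unarr_base l).trans hl, h₁.symm.trans (congrArg T.unarr hl')⟩
      exact (T.arr_unarr l).symm.trans (congrArg T.arr h₂)

lemma car_arr_ca {X Y : K} (f : Y ⟶ X) (b : T.Obj X) : Car (T.arr (T.ca f b)) := by
  refine (T.car_arr_iff _).2 fun Z c n h hh => ?_
  rw [base_ca] at hh
  exact ⟨T.lift f b n h hh, ⟨base_lift _ _ _ _ _, lift_ca _ _ _ _ _⟩, fun k hk =>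
    T.hom_ext f b (by rw [hk.1, base_lift]) (by rw [hk.2, lift_ca])⟩

end Cleaved

end

section

variable {J : GrothendieckTopology K}
  {E : IndCat.{v, u, max u v w, max u v w w'} K}

variable (J E) in
/-- A descent datum along some covering sieve. -/
structure Datum (X : K) where
  S : Sieve X
  hS : S ∈ J X
  d : DD E S

namespace Datum

variable {X X₁ X₂ X₃ : K} (z : Datum J E X) (z₁ : Datum J E X₁) (z₂ : Datum J E X₂)
  (z₃ : Datum J E X₃)

/-- The charts of a descent datum. -/
abbrev Ch (Y : K) := {h : Y ⟶ X // z.S h}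

/-- The object of a descent datum on a chart. -/
abbrev at' {Y : K} (c : z.Ch Y) : E.fibre Y := z.d.obj c.1 c.2

/-- The restriction of a chart. -/
abbrev pull {Y Z : K} (c : z.Ch Y) (g : Z ⟶ Y) : z.Ch Z := ⟨g ≫ c.1, z.S.downward_closed c.2 g⟩

/-- The transition arrows of a descent datum. -/
abbrev tr {Y Z : K} (c : z.Ch Y) (c' : z.Ch Z) (g : Z ⟶ Y) (e : g ≫ c.1 = c'.1) :
    ob (z.at' c') ⟶ ob (z.at' c) :=
  z.d.tr c.1 c.2 c'.1 c'.2 g e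

variable {z}

lemma tr_base {Y Z : K} (c : z.Ch Y) (c' : z.Ch Z) (g : Z ⟶ Y) (e : g ≫ c.1 = c'.1) :
    (z.tr c c' g e).base = g := z.d.base _ _ _ _ _ _

lemma tr_car {Y Z : K} (c : z.Ch Y) (c' : z.Ch Z) (g : Z ⟶ Y) (e : g ≫ c.1 = c'.1) :
    Car (z.tr c c' g e) := z.d.car _ _ _ _ _ _

lemma tr_tr {Y Z W : K} (c : z.Ch Y) (c' : z.Ch Z) (c'' : z.Ch W) (g : Z ⟶ Y) (e : g ≫ c.1 = c'.1)
    (h : W ⟶ Z) (e' : h ≫ c'.1 = c''.1) (k : W ⟶ Y) (e'' : k ≫ c.1 = c''.1) (hk : h ≫ g = k) :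
    z.tr c' c'' h e' ≫ z.tr c c' g e = z.tr c c'' k e'' := z.d.comp _ _ _ _ _ _ _ _ _ _ _ _ hk

lemma tr_id {Y : K} (c : z.Ch Y) (e : 𝟙 Y ≫ c.1 = c.1) : z.tr c c (𝟙 Y) e = 𝟙 _ :=
  (tr_car c c (𝟙 Y) e).hom_ext (tr_base _ _ _ _)
    ((tr_tr c c c (𝟙 Y) e (𝟙 Y) e (𝟙 Y) e (comp_id _)).trans (id_comp _).symm)

end Datum

section

variable {X X₁ X₂ X₃ : K}

/-- Arrows between the objects on charts of two descent data. -/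
structure El (z : Datum J E X) (z₁ : Datum J E X₁) (Y : K) where
  src : z.Ch Y
  tgt : z₁.Ch Y
  hom : ob (z.at' src) ⟶ ob (z₁.at' tgt)
  base : hom.base = 𝟙 Y

namespace El

variable {z : Datum J E X} {z₁ : Datum J E X₁} {z₂ : Datum J E X₂} {z₃ : Datum J E X₃} {Y Z W : K}

attribute [simp] El.base

lemma exists_res (x : El z z₁ Y) (g : Z ⟶ Y) :
    ∃ m : ob (z.at' (z.pull x.src g)) ⟶ ob (z₁.at' (z₁.pull x.tgt g)), m.base = 𝟙 Z ∧
      m ≫ z₁.tr x.tgt (z₁.pull x.tgt g) g rfl = z.tr x.src (z.pull x.src g) g rfl ≫ x.hom :=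
  (Datum.tr_car x.tgt (z₁.pull x.tgt g) g rfl).exists_lift
    (z.tr x.src (z.pull x.src g) g rfl ≫ x.hom) (𝟙 Z) (by
      rw [comp_base, Datum.tr_base, Datum.tr_base, x.base]
      simp)

/-- The restriction of an arrow between charts. -/
abbrev res (x : El z z₁ Y) (g : Z ⟶ Y) : El z z₁ Z :=
  ⟨z.pull x.src g, z₁.pull x.tgt g, (x.exists_res g).choose, (x.exists_res g).choose_spec.1⟩

lemma res_hom (x : El z z₁ Y) (g : Z ⟶ Y) :
    (x.res g).hom ≫ z₁.tr x.tgt (x.res g).tgt g rfl = z.tr x.src (x.res g).src g rfl ≫ x.hom :=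
  (x.exists_res g).choose_spec.2

lemma eq_res (x : El z z₁ Y) (g : Z ⟶ Y) (y : El z z₁ Z) (e : g ≫ x.src.1 = y.src.1)
    (e₁ : g ≫ x.tgt.1 = y.tgt.1) (h : y.hom ≫ z₁.tr x.tgt y.tgt g e₁ = z.tr x.src y.src g e ≫ x.hom) :
    y = x.res g := by
  obtain ⟨s, t, m, hm⟩ := y
  obtain rfl : s = z.pull x.src g := Subtype.ext e.symm
  obtain rfl : t = z₁.pull x.tgt g := Subtype.ext e₁.symm
  obtain rfl : m = (x.res g).hom := (Datum.tr_car _ _ _ _).hom_ext (hm.trans (x.res g).base.symm)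
    (h.trans (x.res_hom g).symm)
  rfl

lemma ext' {x y : El z z₁ Y} (e : 𝟙 Y ≫ y.src.1 = x.src.1) (e₁ : 𝟙 Y ≫ y.tgt.1 = x.tgt.1)
    (h : x.hom ≫ z₁.tr y.tgt x.tgt (𝟙 Y) e₁ = z.tr y.src x.src (𝟙 Y) e ≫ y.hom) : x = y :=
  (eq_res y (𝟙 Y) x e e₁ h).trans (eq_res y (𝟙 Y) y (id_comp _) (id_comp _) (by
    rw [Datum.tr_id, Datum.tr_id, comp_id, id_comp])).symm

lemma res_res (x : El z z₁ Y) (g : Z ⟶ Y) (h : W ⟶ Z) : (x.res g).res h = x.res (h ≫ g) := by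
  refine eq_res _ _ _ (assoc _ _ _) (assoc _ _ _) ?_
  have h₁ := Datum.tr_tr x.tgt (x.res g).tgt ((x.res g).res h).tgt g rfl h rfl (h ≫ g)
    (assoc _ _ _) rfl
  have h₂ := Datum.tr_tr x.src (x.res g).src ((x.res g).res h).src g rfl h rfl (h ≫ g)
    (assoc _ _ _) rfl
  rw [← h₁, ← h₂, reassoc_of% @res_hom, res_hom, assoc]

/-- The composition of arrows between charts. -/
abbrev comp (x : El z z₁ Y) (y : El z₁ z₂ Y) (e : y.src.1 = x.tgt.1) : El z z₂ Y :=
  ⟨x.src, y.tgt, x.hom ≫ z₁.tr y.src x.tgt (𝟙 Y) ((id_comp _).trans e) ≫ y.hom, by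
    rw [comp_base, comp_base, x.base, y.base, Datum.tr_base, comp_id, comp_id]⟩

lemma comp_res (x : El z z₁ Y) (y : El z₁ z₂ Y) (e : y.src.1 = x.tgt.1) (g : Z ⟶ Y) :
    (x.comp y e).res g = (x.res g).comp (y.res g) (congrArg (g ≫ ·) e) := by
  refine (eq_res (x.comp y e) g _ rfl rfl ?_).symm
  have h₁ := res_hom x g
  have h₂ := res_hom y g
  have e' : g ≫ y.src.1 = (x.res g).tgt.1 := congrArg (g ≫ ·) e
  have h₃ := Datum.tr_tr y.src (y.res g).src (x.res g).tgt g rfl (𝟙 Z)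
    ((id_comp _).trans e') g e' (id_comp _)
  have h₄ := Datum.tr_tr y.src x.tgt (x.res g).tgt (𝟙 Y) ((id_comp _).trans e) g rfl g e'
    (comp_id _)
  refine (assoc _ _ _).trans ((congrArg (_ ≫ ·) (assoc _ _ _)).trans ?_)
  refine (congrArg (fun t => _ ≫ _ ≫ t) h₂).trans ?_
  refine (congrArg (_ ≫ ·) ((reassoc_of% (h₃.trans h₄.symm)) y.hom)).trans ?_
  exact (reassoc_of% h₁) _

lemma comp_assoc (x : El z z₁ Y) (y : El z₁ z₂ Y) (t : El z₂ z₃ Y) (e : y.src.1 = x.tgt.1)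
    (e' : t.src.1 = y.tgt.1) : (x.comp y e).comp t e' = x.comp (y.comp t e') e := by
  have h : ((x.comp y e).comp t e').hom = (x.comp (y.comp t e') e).hom := by
    simp only [assoc]
  exact ext' (id_comp _) (id_comp _) (by
    rw [h]
    exact (congrArg (_ ≫ ·) (Datum.tr_id _ _)).trans ((comp_id _).trans
      (((congrArg (· ≫ _) (Datum.tr_id _ _))).trans (id_comp _)).symm))

/-- The identity of a chart. -/
abbrev one (c : z.Ch Y) : El z z Y := ⟨c, c, 𝟙 _, rfl⟩

lemma one_res (c : z.Ch Y) (g : Z ⟶ Y) : (one c).res g = one (z.pull c g) :=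
  (eq_res (one c) g (one (z.pull c g)) rfl rfl
    ((id_comp _).trans (comp_id _).symm)).symm

lemma one_comp (c : z.Ch Y) (x : El z z₁ Y) (e : x.src.1 = c.1) : (one c).comp x e = x := by
  refine ext' ((id_comp _).trans e) (id_comp _) ?_
  exact (congrArg (_ ≫ ·) (Datum.tr_id _ _)).trans ((comp_id _).trans (id_comp _))

lemma comp_one (x : El z z₁ Y) (c : z₁.Ch Y) (e : c.1 = x.tgt.1) : x.comp (one c) e = x := by
  refine ext' (id_comp _) ((id_comp _).trans e.symm) ?_
  refine Eq.trans ?_ ((congrArg (· ≫ _) (Datum.tr_id _ _)).trans (id_comp _)).symm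
  have h := Datum.tr_tr x.tgt c x.tgt (𝟙 Y) ((id_comp _).trans e.symm) (𝟙 Y)
    ((id_comp _).trans e) (𝟙 Y) (id_comp _) (id_comp _)
  rw [Datum.tr_id] at h
  have h' : (x.comp (one c) e).hom = x.hom ≫ z₁.tr c x.tgt (𝟙 Y) ((id_comp _).trans e) :=
    congrArg (x.hom ≫ ·) (comp_id _)
  rw [h']
  refine (assoc _ _ _).trans ((congrArg (_ ≫ ·) h).trans (comp_id _))

/-- The inverse of an invertible arrow between charts. -/
abbrev inv (x : El z z₁ Y) (hx : IsIso x.hom) : El z₁ z Y :=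
  ⟨x.tgt, x.src, CategoryTheory.inv x.hom, base_inv (IsIso.inv_hom_id x.hom) (by
    rw [x.base]; exact comp_id _)⟩

lemma isIso_res (x : El z z₁ Y) (hx : IsIso x.hom) (g : Z ⟶ Y) : IsIso (x.res g).hom := by
  refine Car.isIso_of_base (Car.of_comp (Datum.tr_car x.tgt (x.res g).tgt g rfl) ?_) (by
    rw [El.base]; exact inferInstanceAs (IsIso (𝟙 Z)))
  rw [res_hom]
  exact (Datum.tr_car _ _ _ _).trans (car_of_isIso _)

lemma inv_res (x : El z z₁ Y) (hx : IsIso x.hom) (g : Z ⟶ Y) :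
    (x.inv hx).res g = (x.res g).inv (x.isIso_res hx g) := by
  have := x.isIso_res hx g
  refine (eq_res (x.inv hx) g ((x.res g).inv (x.isIso_res hx g)) rfl rfl ?_).symm
  change CategoryTheory.inv (x.res g).hom ≫ z.tr x.src (x.res g).src g rfl =
    z₁.tr x.tgt (x.res g).tgt g rfl ≫ CategoryTheory.inv x.hom
  rw [IsIso.inv_comp_eq, ← assoc, IsIso.eq_comp_inv, res_hom]

lemma inv_comp (x : El z z₁ Y) (hx : IsIso x.hom) (e) : (x.inv hx).comp x e = one x.tgt := by
  refine ext' (id_comp _) (id_comp _) ?_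
  have h : ((x.inv hx).comp x e).hom = 𝟙 _ :=
    (congrArg (fun t => _ ≫ t ≫ _) (Datum.tr_id _ _)).trans
      ((congrArg (_ ≫ ·) (id_comp _)).trans (IsIso.inv_hom_id x.hom))
  rw [h]
  refine (id_comp _).trans (comp_id _).symm

lemma comp_inv (x : El z z₁ Y) (hx : IsIso x.hom) (e) : x.comp (x.inv hx) e = one x.src := by
  refine ext' (id_comp _) (id_comp _) ?_
  have h : (x.comp (x.inv hx) e).hom = 𝟙 _ :=
    (congrArg (fun t => _ ≫ t ≫ _) (Datum.tr_id _ _)).trans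
      ((congrArg (_ ≫ ·) (id_comp _)).trans (IsIso.hom_inv_id x.hom))
  rw [h]
  refine (id_comp _).trans (comp_id _).symm

lemma comp_congr {x x' : El z z₁ Y} {y y' : El z₁ z₂ Y} (e : y.src.1 = x.tgt.1)
    (e' : y'.src.1 = x'.tgt.1) (hx : x = x') (hy : y = y') : x.comp y e = x'.comp y' e' := by
  subst hx hy; rfl

lemma comp_cancel {x x' : El z z₁ Y} {y : El z₁ z₂ Y} (hy : IsIso y.hom) (e : y.src.1 = x.tgt.1)
    (e' : y.src.1 = x'.tgt.1) (h : x.comp y e = x'.comp y e') : x = x' := by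
  have h₁ : ∀ (x : El z z₁ Y) (e : y.src.1 = x.tgt.1),
      (x.comp y e).comp (y.inv hy) rfl = x := fun x e => by
    rw [comp_assoc, comp_congr _ (y' := one y.src) e rfl (y.comp_inv hy rfl), comp_one]
  rw [← h₁ x e, ← h₁ x' e']
  exact comp_congr _ _ h rfl

lemma cancel_comp {x : El z z₁ Y} {y y' : El z₁ z₂ Y} (hx : IsIso x.hom) (e : y.src.1 = x.tgt.1)
    (e' : y'.src.1 = x.tgt.1) (h : x.comp y e = x.comp y' e') : y = y' := by
  have h₁ : ∀ (y : El z₁ z₂ Y) (e : y.src.1 = x.tgt.1),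
      (x.inv hx).comp (x.comp y e) rfl = y := fun y e => by
    rw [← comp_assoc _ _ _ rfl, comp_congr _ (x' := one x.tgt) e (x.inv_comp hx rfl) rfl, one_comp]
  rw [← h₁ y e, ← h₁ y' e']
  exact comp_congr _ _ rfl h

end El

end

section

variable {X X₁ X₂ X₃ : K}

@[ext]
structure ZHom (z : Datum J E X) (z₁ : Datum J E X₁) where
  base : X ⟶ X₁
  mem ⦃Y : K⦄ (x : El z z₁ Y) : Prop
  eq ⦃Y : K⦄ (x : El z z₁ Y) (hx : mem x) : x.src.1 ≫ base = x.tgt.1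
  res ⦃Y Z : K⦄ (x : El z z₁ Y) (hx : mem x) (g : Z ⟶ Y) : mem (x.res g)
  uniq ⦃Y : K⦄ (x y : El z z₁ Y) (hx : mem x) (hy : mem y) (e : x.src.1 = y.src.1) :
    Loc J (fun Z (g : Z ⟶ Y) => x.res g = y.res g)
  sat ⦃Y : K⦄ (x : El z z₁ Y) (e : x.src.1 ≫ base = x.tgt.1)
    (h : Loc J (fun Z (g : Z ⟶ Y) => mem (x.res g))) : mem x
  inh : Loc J (fun Y (h : Y ⟶ X) => ∃ x : El z z₁ Y, x.src.1 = h ∧ mem x)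

namespace ZHom

variable {z : Datum J E X} {z₁ : Datum J E X₁} {z₂ : Datum J E X₂} {z₃ : Datum J E X₃} {Y Z W : K}

lemma le_of_loc {P Q : ZHom z z₁} (hb : P.base = Q.base)
    (h : Loc J (fun Y (h : Y ⟶ X) => ∃ x : El z z₁ Y, x.src.1 = h ∧ P.mem x ∧ Q.mem x))
    (x : El z z₁ Y) (hx : P.mem x) : Q.mem x := by
  refine Q.sat x (by rw [← hb]; exact P.eq x hx) ((h.pull x.src.1).bind fun Z g ⟨y, hy, h₁, h₂⟩ => ?_)
  refine (P.uniq y (x.res g) h₁ (P.res x hx g) hy).mono fun W k hk => ?_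
  rw [← El.res_res, ← hk]
  exact Q.res y h₂ k

lemma ext_loc {P Q : ZHom z z₁} (hb : P.base = Q.base)
    (h : Loc J (fun Y (h : Y ⟶ X) => ∃ x : El z z₁ Y, x.src.1 = h ∧ P.mem x ∧ Q.mem x)) : P = Q := by
  refine ZHom.ext hb ?_
  funext Y x
  exact propext ⟨le_of_loc hb h x, le_of_loc hb.symm
    (h.mono fun _ _ ⟨x, h₁, h₂, h₃⟩ => ⟨x, h₁, h₃, h₂⟩) x⟩

def gen (f : X ⟶ X₁) (P : ∀ ⦃Y : K⦄, El z z₁ Y → Prop)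
    (eq : ∀ ⦃Y : K⦄ (x : El z z₁ Y), P x → x.src.1 ≫ f = x.tgt.1)
    (compat : ∀ ⦃Y Y' Z : K⦄ (x : El z z₁ Y) (y : El z z₁ Y') (_ : P x) (_ : P y) (g : Z ⟶ Y)
      (g' : Z ⟶ Y'), g ≫ x.src.1 = g' ≫ y.src.1 →
        Loc J (fun W (k : W ⟶ Z) => (x.res g).res k = (y.res g').res k))
    (inh : Loc J (fun Y (h : Y ⟶ X) => ∃ x : El z z₁ Y, x.src.1 = h ∧ P x)) : ZHom z z₁ where
  base := f
  mem Y x := x.src.1 ≫ f = x.tgt.1 ∧ Loc J (fun Z (g : Z ⟶ Y) =>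
    ∃ (Y' : K) (y : El z z₁ Y') (g' : Z ⟶ Y'), P y ∧ x.res g = y.res g')
  eq Y x hx := hx.1
  res Y Z x hx g := ⟨(assoc _ _ _).trans (congrArg (g ≫ ·) hx.1), (hx.2.pull g).mono
    fun W k ⟨Y', y, g', hy, h⟩ => ⟨Y', y, g', hy, (El.res_res _ _ _).trans h⟩⟩
  uniq Y x y hx hy e := (hx.2.and hy.2).bind fun Z g ⟨⟨Y', x', a, hx', h⟩, ⟨Y'', y', b, hy', h'⟩⟩ => by
    refine (compat x' y' hx' hy' a b ?_).mono fun W k hk => ?_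
    · have h₁ := congrArg (fun t => t.src.1) h
      have h₂ := congrArg (fun t => t.src.1) h'
      exact h₁.symm.trans ((congrArg (g ≫ ·) e).trans h₂)
    · rw [← El.res_res, ← El.res_res, h, h', hk]
  sat Y x e h := ⟨e, h.bind fun Z g hg => hg.2.mono fun W k ⟨Y', y, g', hy, h'⟩ =>
    ⟨Y', y, g', hy, (El.res_res _ _ _).symm.trans h'⟩⟩
  inh := inh.mono fun Y h ⟨x, hx, hP⟩ => ⟨x, hx, eq x hP, Loc.of_forall fun Z g => ⟨Y, x, g, hP, rfl⟩⟩

lemma mem_gen (f : X ⟶ X₁) (P : ∀ ⦃Y : K⦄, El z z₁ Y → Prop) (eq) (compat) (inh) (x : El z z₁ Y)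
    (hx : P x) : (gen f P eq compat inh).mem x :=
  ⟨eq x hx, Loc.of_forall fun _ g => ⟨Y, x, g, hx, rfl⟩⟩

def ofUnique (f : X ⟶ X₁) (P : ∀ ⦃Y : K⦄, El z z₁ Y → Prop)
    (eq : ∀ ⦃Y : K⦄ (x : El z z₁ Y), P x → x.src.1 ≫ f = x.tgt.1)
    (res : ∀ ⦃Y Z : K⦄ (x : El z z₁ Y), P x → ∀ g : Z ⟶ Y, P (x.res g))
    (uniq : ∀ ⦃Y : K⦄ (x y : El z z₁ Y), P x → P y → x.src.1 = y.src.1 → x = y)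
    (inh : ∀ ⦃Y : K⦄ (h : Y ⟶ X), z.S h → z₁.S (h ≫ f) → ∃ x : El z z₁ Y, x.src.1 = h ∧ P x) :
    ZHom z z₁ :=
  gen f P eq (fun Y Y' Z x y hx hy g g' h => Loc.of_forall fun W k => by
      rw [uniq _ _ (res x hx g) (res y hy g') h])
    (((Loc.of_sieve z.hS).and ((Loc.of_sieve z₁.hS).pull f)).mono fun Y h hh => inh h hh.1 hh.2)

lemma mem_ofUnique (f : X ⟶ X₁) (P : ∀ ⦃Y : K⦄, El z z₁ Y → Prop) (eq) (res) (uniq) (inh)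
    (x : El z z₁ Y) (hx : P x) : (ofUnique f P eq res uniq inh).mem x := mem_gen _ _ _ _ _ _ hx

/-- The identity of a descent datum. -/
def id (z : Datum J E X) : ZHom z z :=
  ofUnique (𝟙 X) (fun _ x => ∃ c, x = El.one c)
    (by rintro Y _ ⟨c, rfl⟩; exact comp_id _)
    (by rintro Y Z _ ⟨c, rfl⟩ g; exact ⟨_, El.one_res c g⟩)
    (by rintro Y _ _ ⟨c, rfl⟩ ⟨c', rfl⟩ h; rw [show c = c' from Subtype.ext h])
    (fun Y h hh _ => ⟨El.one ⟨h, hh⟩, rfl, _, rfl⟩)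

lemma one_mem_id (c : z.Ch Y) : (id z).mem (El.one c) := mem_ofUnique _ _ _ _ _ _ _ ⟨c, rfl⟩

lemma res_eq (P : ZHom z z₁) (x : El z z₁ Y) (y : El z z₁ Z) (hx : P.mem x) (hy : P.mem y)
    (g : W ⟶ Y) (g' : W ⟶ Z) (h : g ≫ x.src.1 = g' ≫ y.src.1) :
    Loc J (fun V (k : V ⟶ W) => (x.res g).res k = (y.res g').res k) :=
  P.uniq _ _ (P.res x hx g) (P.res y hy g') h

/-- The composition of arrows between descent data. -/
def comp (P : ZHom z z₁) (Q : ZHom z₁ z₂) : ZHom z z₂ :=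
  gen (P.base ≫ Q.base) (fun Y t => ∃ x y e, P.mem x ∧ Q.mem y ∧ t = El.comp x y e)
    (by
      rintro Y _ ⟨x, y, e, hx, hy, rfl⟩
      refine (assoc _ _ _).symm.trans ?_
      refine (congrArg (· ≫ _) ((P.eq x hx).trans e.symm)).trans (Q.eq y hy))
    (by
      rintro Y Y' Z _ _ ⟨x, y, e, hx, hy, rfl⟩ ⟨x', y', e', hx', hy', rfl⟩ g g' h
      have h : g ≫ x.src.1 = g' ≫ x'.src.1 := h
      have h' : g ≫ y.src.1 = g' ≫ y'.src.1 := by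
        rw [e, e', ← P.eq x hx, ← P.eq x' hx', reassoc_of% h]
      refine ((P.res_eq x x' hx hx' g g' h).and (Q.res_eq y y' hy hy' g g' h')).mono
        fun W k hk => ?_
      rw [El.comp_res, El.comp_res, El.comp_res, El.comp_res]
      exact El.comp_congr _ _ hk.1 hk.2)
    (P.inh.bind fun Y h ⟨x, hx, hP⟩ => (Q.inh.pull x.tgt.1).mono fun Z g ⟨y, hy, hQ⟩ =>
      ⟨(x.res g).comp y hy, congrArg (g ≫ ·) hx, x.res g, y, hy, P.res x hP g, hQ, rfl⟩)

lemma mem_comp {P : ZHom z z₁} {Q : ZHom z₁ z₂} (x : El z z₁ Y) (y : El z₁ z₂ Y) (hx : P.mem x)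
    (hy : Q.mem y) (e : y.src.1 = x.tgt.1) : (P.comp Q).mem (x.comp y e) :=
  mem_gen _ _ _ _ _ _ ⟨x, y, e, hx, hy, rfl⟩

lemma id_comp_eq (P : ZHom z z₁) : (id z).comp P = P :=
  ext_loc (id_comp _) (P.inh.mono fun Y h ⟨x, hx, hP⟩ => ⟨x, hx, by
    have := mem_comp (El.one x.src) x (one_mem_id x.src) hP rfl
    rwa [El.one_comp] at this, hP⟩)

lemma comp_id_eq (P : ZHom z z₁) : P.comp (id z₁) = P :=
  ext_loc (comp_id _) (P.inh.mono fun Y h ⟨x, hx, hP⟩ => ⟨x, hx, by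
    have := mem_comp x (El.one x.tgt) hP (one_mem_id x.tgt) rfl
    rwa [El.comp_one] at this, hP⟩)

lemma comp_assoc (P : ZHom z z₁) (Q : ZHom z₁ z₂) (R : ZHom z₂ z₃) :
    (P.comp Q).comp R = P.comp (Q.comp R) := by
  refine ext_loc (assoc _ _ _) (P.inh.bind fun Y h ⟨x, hx, hP⟩ =>
    (Q.inh.pull x.tgt.1).bind fun Z g ⟨y, hy, hQ⟩ => (R.inh.pull y.tgt.1).mono
      fun W k ⟨t, ht, hR⟩ => ⟨(((x.res g).res k).comp (y.res k) (congrArg (k ≫ ·) hy)).comp t ht,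
        congrArg (fun t => k ≫ g ≫ t) hx |>.trans (assoc _ _ _).symm, ?_, ?_⟩)
  · exact mem_comp _ _ (mem_comp _ _ (P.res _ (P.res _ hP g) k) (Q.res _ hQ k) _) hR _
  · rw [El.comp_assoc]
    exact mem_comp _ _ (P.res _ (P.res _ hP g) k) (mem_comp _ _ (Q.res _ hQ k) hR _) _

lemma comp_left_cancel {P : ZHom z₁ z₂} {Q Q' : ZHom z z₁}
    (hP : Loc J (fun Y (h : Y ⟶ X₁) => ∃ x : El z₁ z₂ Y, x.src.1 = h ∧ P.mem x ∧ IsIso x.hom))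
    (hb : Q.base = Q'.base) (h : Q.comp P = Q'.comp P) : Q = Q' := by
  refine ext_loc hb ((Q.inh.and Q'.inh).bind fun Y k ⟨⟨m, hm, hQ⟩, ⟨n, hn, hQ'⟩⟩ =>
    (hP.pull m.tgt.1).bind fun Z g ⟨x, hx, hP, hi⟩ => ?_)
  have e : n.tgt.1 = m.tgt.1 := by rw [← Q.eq m hQ, ← Q'.eq n hQ', hm, hn, hb]
  have h₁ := mem_comp (m.res g) x (Q.res m hQ g) hP hx
  have h₂ := mem_comp (n.res g) x (Q'.res n hQ' g) hP (hx.trans (congrArg (g ≫ ·) e.symm))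
  rw [← h] at h₂
  refine ((Q.comp P).uniq _ _ h₁ h₂ (congrArg (g ≫ ·) (hm.trans hn.symm))).mono fun W l hl => ?_
  rw [El.comp_res, El.comp_res] at hl
  have h₃ := El.comp_cancel (x.isIso_res hi l) _ _ hl
  refine ⟨(m.res g).res l, ?_, Q.res _ (Q.res _ hQ g) l, ?_⟩
  · exact (assoc _ _ _).symm.trans (congrArg (fun t => (l ≫ g) ≫ t) hm)
  · rw [h₃]
    exact Q'.res _ (Q'.res _ hQ' g) l

lemma exists_lift {P : ZHom z₁ z₂}
    (hP : Loc J (fun Y (h : Y ⟶ X₁) => ∃ x : El z₁ z₂ Y, x.src.1 = h ∧ P.mem x ∧ IsIso x.hom))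
    (Q : ZHom z z₂) (f : X ⟶ X₁) (hf : f ≫ P.base = Q.base) :
    ∃ R : ZHom z z₁, R.base = f ∧ R.comp P = Q := by
  let R : ZHom z z₁ := gen f (fun Y t => ∃ (y : El z z₂ Y) (x : El z₁ z₂ Y) (hi : IsIso x.hom)
      (e : x.tgt.1 = y.tgt.1), Q.mem y ∧ P.mem x ∧ y.src.1 ≫ f = x.src.1 ∧
        t = y.comp (x.inv hi) e)
    (by
      rintro Y _ ⟨y, x, hi, e, hy, hx, h, rfl⟩
      exact h)
    (by
      rintro Y Y' Z _ _ ⟨y, x, hi, e, hy, hx, h, rfl⟩ ⟨y', x', hi', e', hy', hx', h', rfl⟩ g g' hg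
      have hg : g ≫ y.src.1 = g' ≫ y'.src.1 := hg
      refine ((Q.res_eq y y' hy hy' g g' hg).and (P.res_eq x x' hx hx' g g' (by
        rw [← h, ← h', reassoc_of% hg]))).mono fun W k hk => ?_
      rw [El.comp_res, El.comp_res, El.comp_res, El.comp_res]
      refine El.comp_congr _ _ hk.1 ?_
      rw [El.inv_res, El.inv_res, El.inv_res, El.inv_res]
      congr 1
      exact hk.2)
    (Q.inh.bind fun Y h ⟨y, hy, hQ⟩ => (hP.pull (y.src.1 ≫ f)).mono fun Z g ⟨x, hx, hP, hi⟩ => by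
      have hx' : (g ≫ y.src.1) ≫ f = x.src.1 := (assoc _ _ _).trans hx.symm
      have e : x.tgt.1 = (y.res g).tgt.1 := by
        rw [← P.eq x hP, ← Q.eq _ (Q.res y hQ g), ← hx', ← hf, assoc]
      exact ⟨(y.res g).comp (x.inv hi) e, congrArg (g ≫ ·) hy, y.res g, x, hi, e, Q.res y hQ g, hP,
        hx', rfl⟩)
  refine ⟨R, rfl, ext_loc hf (Q.inh.bind fun Y h ⟨y, hy, hQ⟩ =>
    (hP.pull (y.src.1 ≫ f)).mono fun Z g ⟨x, hx, hP, hi⟩ => ?_)⟩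
  have hx' : (g ≫ y.src.1) ≫ f = x.src.1 := (assoc _ _ _).trans hx.symm
  have e : x.tgt.1 = (y.res g).tgt.1 := by
    rw [← P.eq x hP, ← Q.eq _ (Q.res y hQ g), ← hx', ← hf, assoc]
  have h₁ : R.mem ((y.res g).comp (x.inv hi) e) :=
    mem_gen _ _ _ _ _ _ ⟨y.res g, x, hi, e, Q.res y hQ g, hP, hx', rfl⟩
  have h₂ := mem_comp _ x h₁ hP rfl
  rw [El.comp_assoc _ _ _ _ rfl, El.comp_congr _ (y' := El.one x.tgt) e rfl (x.inv_comp hi rfl),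
    El.comp_one] at h₂
  exact ⟨y.res g, congrArg (g ≫ ·) hy, h₂, Q.res y hQ g⟩

end ZHom

end

end

section

namespace Cleaved

variable (T : Cleaved.{v, u, v', u'} K)

lemma unarr_ca {X Y : K} (f : Y ⟶ X) (b : T.Obj X) :
    T.unarr (a := T.res f b) (b := b) (Fib.ca f (T.el b)) = T.ca f b :=
  id_comp (T.ca f b)

lemma ca_eq {X Y : K} (f : Y ⟶ X) (b : T.Obj X) :
    (Fib.ca f (T.el b)) = T.arr (a := T.res f b) (b := b) (T.ca f b) :=
  (T.arr_unarr _).symm.trans (congrArg T.arr (T.unarr_ca f b))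

end Cleaved

section

variable {J : GrothendieckTopology K}
  {E : IndCat.{v, u, max u v w, max u v w w'} K} {X X₁ X₂ Y Z : K}

/-- The restriction of a descent datum. -/
abbrev Datum.res (f : Y ⟶ X) (z : Datum J E X) : Datum J E Y where
  S := z.S.pullback f
  hS := J.pullback_stable f z.hS
  d :=
    { obj := fun _ g hg => z.d.obj (g ≫ f) hg
      tr := fun _ _ g hg h hh k e => z.d.tr (g ≫ f) hg (h ≫ f) hh k (by rw [← assoc, e])
      base := fun _ _ _ _ _ _ _ _ => z.d.base _ _ _ _ _ _
      car := fun _ _ _ _ _ _ _ _ => z.d.car _ _ _ _ _ _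
      comp := fun _ _ _ _ _ _ _ _ _ _ _ _ _ _ _ c => z.d.comp _ _ _ _ _ _ _ _ _ _ _ _ c }

/-- The canonical arrows from the charts of a restriction. -/
abbrev El.can (f : Y ⟶ X) (z : Datum J E X) {Z : K} (c : (z.res f).Ch Z) : El (z.res f) z Z :=
  ⟨c, ⟨c.1 ≫ f, c.2⟩, 𝟙 _, rfl⟩

lemma El.can_res (f : Y ⟶ X) (z : Datum J E X) {Z W : K} (c : (z.res f).Ch Z) (g : W ⟶ Z) :
    (El.can f z c).res g = El.can f z ((z.res f).pull c g) :=
  (El.eq_res (El.can f z c) g (El.can f z ((z.res f).pull c g)) rfl (assoc _ _ _).symm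
    ((id_comp _).trans (comp_id _).symm)).symm

namespace ZHom

/-- The canonical arrow from a restriction. -/
def ca (f : Y ⟶ X) (z : Datum J E X) : ZHom (z.res f) z :=
  ofUnique f (fun _ x => ∃ c, x = El.can f z c)
    (by rintro Y _ ⟨c, rfl⟩; rfl)
    (by rintro Y Z _ ⟨c, rfl⟩ g; exact ⟨_, El.can_res f z c g⟩)
    (by rintro Y _ _ ⟨c, rfl⟩ ⟨c', rfl⟩ h; rw [show c = c' from Subtype.ext h])
    (fun Y h hh _ => ⟨El.can f z ⟨h, hh⟩, rfl, _, rfl⟩)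

lemma can_mem_ca (f : Y ⟶ X) (z : Datum J E X) (c : (z.res f).Ch Z) :
    (ca f z).mem (El.can f z c) := mem_ofUnique _ _ _ _ _ _ _ ⟨c, rfl⟩

lemma ca_loc_iso (f : Y ⟶ X) (z : Datum J E X) : Loc J (fun Z (h : Z ⟶ Y) =>
    ∃ x : El (z.res f) z Z, x.src.1 = h ∧ (ca f z).mem x ∧ IsIso x.hom) :=
  (Loc.of_sieve (z.res f).hS).mono fun _ h hh =>
    ⟨El.can f z ⟨h, hh⟩, rfl, can_mem_ca _ _ _, inferInstanceAs (IsIso (𝟙 _))⟩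

lemma mem_of_comp {z : Datum J E X} {z₁ : Datum J E X₁} {z₂ : Datum J E X₂} {R : ZHom z z₁}
    {P : ZHom z₁ z₂} (m : El z z₁ Y) (x : El z₁ z₂ Y) (hm : m.src.1 ≫ R.base = m.tgt.1)
    (hx : P.mem x) (hi : IsIso x.hom) (e : x.src.1 = m.tgt.1) (h : (R.comp P).mem (m.comp x e)) :
    R.mem m := by
  refine R.sat m hm ((R.inh.pull m.src.1).bind fun Z g ⟨y, hy, hR⟩ => ?_)
  have e' : (x.res g).src.1 = y.tgt.1 := by rw [← R.eq y hR, hy, assoc, hm, ← e]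
  have h₁ := mem_comp y (x.res g) hR (P.res x hx g) e'
  have h₂ := (R.comp P).res _ h g
  rw [El.comp_res] at h₂
  refine ((R.comp P).uniq _ _ h₁ h₂ hy).mono fun W l hl => ?_
  rw [El.comp_res, El.comp_res] at hl
  have h₃ := El.comp_cancel ((x.res g).isIso_res (x.isIso_res hi g) l) _ _ hl
  rw [← El.res_res, ← h₃]
  exact R.res y hR l

end ZHom

variable (J E) in
/-- The fibred category of descent data. -/
def datumCat : Cleaved.{v, u, max u v w, max u v w w'} K where
  Obj X := Datum J E X
  cat :=
    { Hom := fun a b => ZHom a.fib b.fib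
      id := fun a => ZHom.id a.fib
      comp := fun P Q => P.comp Q
      id_comp := ZHom.id_comp_eq
      comp_id := ZHom.comp_id_eq
      assoc := fun P Q R => P.comp_assoc Q R }
  base P := ZHom.base P
  base_id _ := rfl
  base_comp _ _ := rfl
  res f z := z.res f
  ca f z := ZHom.ca f z
  base_ca _ _ := rfl
  exists_lift f z m g h := ZHom.exists_lift (ZHom.ca_loc_iso f z) m g h
  hom_ext f z _ _ h h' := ZHom.comp_left_cancel (ZHom.ca_loc_iso f z) h h'

variable (J E) in
/-- The indexed category of descent data. -/
abbrev plus : IndCat.{v, u, max u v w, max u v w w'} K := (datumCat J E).ind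

/-- A descent datum, as an object of the indexed category. -/
abbrev pobj (z : Datum J E X) : ∫ᶜ (plus J E) := ob ((datumCat J E).el (X := X) z)

def parr {z : Datum J E X} {z₁ : Datum J E X₁} (P : ZHom z z₁) : pobj z ⟶ pobj z₁ :=
  (datumCat J E).arr (a := z) (b := z₁) P

def unparr {z : Datum J E X} {z₁ : Datum J E X₁} (m : pobj z ⟶ pobj z₁) :
    ZHom z z₁ :=
  (datumCat J E).unarr (a := z) (b := z₁) m

section

variable {z : Datum J E X} {z₁ : Datum J E X₁} {z₂ : Datum J E X₂}

@[simp] lemma parr_unparr (m : pobj z ⟶ pobj z₁) : parr (unparr m) = m :=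
  (datumCat J E).arr_unarr (a := z) (b := z₁) m

@[simp] lemma unparr_parr (P : ZHom z z₁) : unparr (parr P) = P :=
  (datumCat J E).unarr_arr (a := z) (b := z₁) P

lemma unparr_base (m : pobj z ⟶ pobj z₁) : (unparr m).base = m.base :=
  (datumCat J E).unarr_base (a := z) (b := z₁) m

lemma parr_comp (P : ZHom z z₁) (Q : ZHom z₁ z₂) : parr (P.comp Q) = parr P ≫ parr Q :=
  (datumCat J E).arr_comp (a := z) (b := z₁) (c := z₂) P Q

lemma unparr_comp (m : pobj z ⟶ pobj z₁) (n : pobj z₁ ⟶ pobj z₂) :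
    unparr (m ≫ n) = (unparr m).comp (unparr n) :=
  (datumCat J E).unarr_comp (a := z) (b := z₁) (c := z₂) m n

lemma parr_id : parr (ZHom.id z) = 𝟙 (pobj z) := (datumCat J E).arr_id z

lemma unparr_ca (f : Y ⟶ X) (z : Datum J E X) :
    unparr (z := z.res f) (z₁ := z) (ca f ((datumCat J E).el (X := X) z)) = ZHom.ca f z :=
  (datumCat J E).unarr_ca f z

lemma ca_eq_parr (f : Y ⟶ X) (z : Datum J E X) :
    ca f ((datumCat J E).el (X := X) z) = parr (ZHom.ca f z) :=
  (datumCat J E).ca_eq f z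

lemma car_parr {P : ZHom z z₁}
    (hP : Loc J (fun Y (h : Y ⟶ X) => ∃ x : El z z₁ Y, x.src.1 = h ∧ P.mem x ∧ IsIso x.hom)) :
    Car (parr P) := by
  refine ((datumCat J E).car_arr_iff (a := z) (b := z₁) P).2 fun Z c n h hh => ?_
  obtain ⟨R, hR, hR'⟩ := ZHom.exists_lift hP n h hh
  exact ⟨R, ⟨hR, hR'⟩, fun Q hQ => ZHom.comp_left_cancel hP (hQ.1.trans hR.symm)
    (hQ.2.trans hR'.symm)⟩

end

section

def tlift (a : E.fibre X) (f : Y ⟶ X) (g : Z ⟶ X) (h : Z ⟶ Y) (e : h ≫ f = g) :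
    ob ((E.res g).obj a) ⟶ ob ((E.res f).obj a) :=
  ((car_ca f a).exists_lift (ca g a) h e).choose

lemma tlift_base (a : E.fibre X) (f : Y ⟶ X) (g : Z ⟶ X) (h : Z ⟶ Y) (e : h ≫ f = g) :
    (tlift a f g h e).base = h := ((car_ca f a).exists_lift (ca g a) h e).choose_spec.1

lemma tlift_ca (a : E.fibre X) (f : Y ⟶ X) (g : Z ⟶ X) (h : Z ⟶ Y) (e : h ≫ f = g) :
    tlift a f g h e ≫ ca f a = ca g a := ((car_ca f a).exists_lift (ca g a) h e).choose_spec.2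

variable (J) in
/-- The descent datum associated with an object. -/
abbrev triv (a : E.fibre X) : Datum J E X where
  S := ⊤
  hS := J.top_mem X
  d :=
    { obj := fun _ f _ => (E.res f).obj a
      tr := fun _ _ f _ g _ h e => tlift a f g h e
      base := fun _ _ f _ g _ h e => tlift_base a f g h e
      car := fun _ _ f _ g _ h e => (car_ca f a).of_comp (by rw [tlift_ca]; exact car_ca g a)
      comp := fun _ _ _ f _ g _ k _ h e h' e' h'' e'' c => (car_ca f a).hom_ext (by
        rw [comp_base]
        exact (congrArg₂ (· ≫ ·) (tlift_base _ _ _ _ _) (tlift_base _ _ _ _ _)).trans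
          (c.trans (tlift_base _ _ _ _ _).symm)) (by
        rw [assoc, tlift_ca, tlift_ca, tlift_ca]) }

lemma triv_tr (a : E.fibre X) (c : (triv J a).Ch Y) (c' : (triv J a).Ch Z) (g : Z ⟶ Y)
    (e : g ≫ c.1 = c'.1) : (triv J a).tr c c' g e ≫ ca c.1 a = ca c'.1 a :=
  tlift_ca a c.1 c'.1 g e

/-- The class of arrows between charts induced by an arrow. -/
def TrivMem {A B : ∫ᶜ E} (u : A ⟶ B) ⦃Y : K⦄ (x : El (triv J A.fiber) (triv J B.fiber) Y) : Prop :=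
  x.src.1 ≫ u.base = x.tgt.1 ∧ x.hom ≫ ca x.tgt.1 B.fiber = ca x.src.1 A.fiber ≫ u

lemma TrivMem.res {A B : ∫ᶜ E} {u : A ⟶ B} {x : El (triv J A.fiber) (triv J B.fiber) Y}
    (hx : TrivMem u x) (g : Z ⟶ Y) : TrivMem u (x.res g) := by
  refine ⟨(assoc _ _ _).trans (congrArg (g ≫ ·) hx.1), ?_⟩
  have h₁ := triv_tr B.fiber x.tgt (x.res g).tgt g rfl
  have h₂ := triv_tr A.fiber x.src (x.res g).src g rfl
  have h₃ := El.res_hom x g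
  refine (congrArg (_ ≫ ·) h₁).symm.trans ((reassoc_of% h₃) _ |>.trans ?_)
  refine (congrArg (_ ≫ ·) hx.2).trans ((reassoc_of% h₂) _)

lemma TrivMem.uniq {A B : ∫ᶜ E} {u : A ⟶ B} {x y : El (triv J A.fiber) (triv J B.fiber) Y}
    (hx : TrivMem u x) (hy : TrivMem u y) (e : x.src.1 = y.src.1) : x = y := by
  have e' : x.tgt.1 = y.tgt.1 := hx.1.symm.trans ((congrArg (· ≫ _) e).trans hy.1)
  refine El.ext' ((id_comp _).trans e.symm) ((id_comp _).trans e'.symm)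
    ((car_ca y.tgt.1 B.fiber).hom_ext ?_ ?_)
  · rw [comp_base, comp_base, x.base, y.base, Datum.tr_base, Datum.tr_base]
  · rw [assoc, assoc, triv_tr, hx.2, hy.2, reassoc_of% @triv_tr]

def trivMap {A B : ∫ᶜ E} (u : A ⟶ B) : ZHom (triv J A.fiber) (triv J B.fiber) :=
  ZHom.ofUnique u.base (TrivMem u) (fun _ _ hx => hx.1) (fun _ _ _ hx g => hx.res g)
    (fun _ _ _ hx hy e => hx.uniq hy e) (fun Y h _ _ => by
      obtain ⟨m, hm, hm'⟩ := (car_ca (h ≫ u.base) B.fiber).exists_lift (ca h A.fiber ≫ u) (𝟙 Y)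
        (id_comp _)
      exact ⟨⟨⟨h, trivial⟩, ⟨h ≫ u.base, trivial⟩, m, hm⟩, rfl, rfl, hm'⟩)

lemma mem_trivMap {A B : ∫ᶜ E} {u : A ⟶ B} {x : El (triv J A.fiber) (triv J B.fiber) Y}
    (hx : TrivMem u x) : (trivMap u).mem x := ZHom.mem_ofUnique _ _ _ _ _ _ _ hx

lemma exists_trivMem {A B : ∫ᶜ E} (u : A ⟶ B) (h : Y ⟶ A.base) :
    ∃ x : El (triv J A.fiber) (triv J B.fiber) Y, x.src.1 = h ∧ TrivMem u x := by
  obtain ⟨m, hm, hm'⟩ := (car_ca (h ≫ u.base) B.fiber).exists_lift (ca h A.fiber ≫ u) (𝟙 Y)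
    (id_comp _)
  exact ⟨⟨⟨h, trivial⟩, ⟨h ≫ u.base, trivial⟩, m, hm⟩, rfl, rfl, hm'⟩

lemma trivMap_id (A : ∫ᶜ E) : trivMap (J := J) (𝟙 A) = ZHom.id (triv J A.fiber) :=
  ZHom.ext_loc rfl (Loc.of_forall fun _ h => ⟨El.one ⟨h, trivial⟩, rfl, mem_trivMap
    ⟨comp_id _, (id_comp _).trans (comp_id _).symm⟩, ZHom.one_mem_id _⟩)

lemma trivMap_comp {A B C : ∫ᶜ E} (u : A ⟶ B) (t : B ⟶ C) :
    trivMap (J := J) (u ≫ t) = (trivMap u).comp (trivMap t) := by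
  refine ZHom.ext_loc rfl (Loc.of_forall fun Y h => ?_)
  obtain ⟨x, hx, hxu⟩ := exists_trivMem (J := J) u h
  obtain ⟨y, hy, hyt⟩ := exists_trivMem (J := J) t x.tgt.1
  refine ⟨x.comp y hy, hx, mem_trivMap ⟨?_, ?_⟩,
    ZHom.mem_comp _ _ (mem_trivMap hxu) (mem_trivMap hyt) _⟩
  · rw [comp_base]
    exact (assoc _ _ _).symm.trans ((congrArg (· ≫ _) (hxu.1.trans hy.symm)).trans hyt.1)
  · rw [assoc, assoc, hyt.2, reassoc_of% @triv_tr, reassoc_of% hxu.2]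

lemma car_trivMap {A B : ∫ᶜ E} (u : A ⟶ B) (hu : Car u) : Car (parr (trivMap (J := J) u)) := by
  refine car_parr (Loc.of_forall fun Y h => ?_)
  obtain ⟨x, hx, hxu⟩ := exists_trivMem (J := J) u h
  refine ⟨x, hx, mem_trivMap hxu, Car.isIso_of_base ?_ (by
    rw [x.base]; exact inferInstanceAs (IsIso (𝟙 Y)))⟩
  refine (car_ca x.tgt.1 B.fiber).of_comp ?_
  rw [hxu.2]
  exact (car_ca _ _).trans hu

variable (J E) in
/-- The canonical indexed functor to the indexed category of descent data. -/
def toPlusData : TotData E (plus J E) where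
  obj {X} a := (datumCat J E).el (X := X) (triv J a)
  map u := parr (trivMap u)
  base _ := rfl
  map_id A := (congrArg parr (trivMap_id A)).trans parr_id
  map_comp u t := (congrArg parr (trivMap_comp u t)).trans (parr_comp _ _)
  car u hu := car_trivMap u hu

variable (J E) in
/-- The canonical indexed functor to the indexed category of descent data. -/
def toPlus : E ⟶ plus J E := (toPlusData J E).toTrans

lemma tot_toPlus {A B : ∫ᶜ E} (u : A ⟶ B) :
    (tot (toPlus J E)).map u = parr (trivMap u) := (toPlusData J E).tot_map u

end

end

end

section

section

variable {J : GrothendieckTopology K}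
  {E E' E'' : IndCat.{v, u, v', u'} K}

lemma exists_tot_ca (w : E ⟶ E') (A : ∫ᶜ E) {Y : K} (f : Y ⟶ A.base) :
    ∃ i : (tot w).obj (ob ((E.res f).obj A.fiber)) ⟶ ob ((E'.res f).obj ((tot w).obj A).fiber),
      i.base = 𝟙 Y ∧ i ≫ ca f ((tot w).obj A).fiber = (tot w).map (ca f A.fiber) :=
  Car.factor_ca ((tot w).map (ca f A.fiber))

namespace LE

lemma map_inj {w : E ⟶ E'} (hw : LE J w) (hE : IsPre J E) {A B : ∫ᶜ E} {m n : A ⟶ B}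
    (h : (tot w).map m = (tot w).map n) : m = n := (hw.inj m n h).eq hE

lemma exists_map {w : E ⟶ E'} (hw : LE J w) (hE : IsPre J E) (hE' : IsPre J E') {A B : ∫ᶜ E}
    (φ : (tot w).obj A ⟶ (tot w).obj B) : ∃ n, (tot w).map n = φ := by
  obtain ⟨ψ, hψ, h⟩ := hw.exists_ext hE (𝟙 E) φ
  refine ⟨ψ, hE'.ext hψ ((hw.surj φ).mono fun Y f ⟨n, hn⟩ => ?_)⟩
  refine ⟨_, (tot w).map (ca f A.fiber), rfl, (car_ca _ _).tot w, ?_⟩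
  have h₁ := h _ n hn
  rw [tot_id, tot_id] at h₁
  rw [← hn, ← h₁]
  exact ((tot w).map_comp _ _).symm

lemma isIso_of_map {w : E ⟶ E'} (hw : LE J w) (hE : IsPre J E) (hE' : IsPre J E') {A B : ∫ᶜ E}
    (n : A ⟶ B) (h : IsIso ((tot w).map n)) : IsIso n := by
  obtain ⟨l, hl⟩ := hw.exists_map hE hE' (inv ((tot w).map n))
  refine ⟨l, hw.map_inj hE ?_, hw.map_inj hE ?_⟩
  · rw [Functor.map_comp, hl, IsIso.hom_inv_id, CategoryTheory.Functor.map_id]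
  · rw [Functor.map_comp, hl, IsIso.inv_hom_id, CategoryTheory.Functor.map_id]

lemma car_of_map {w : E ⟶ E'} (hw : LE J w) (hE : IsPre J E) (hE' : IsPre J E') {A B : ∫ᶜ E}
    (n : A ⟶ B) (h : Car ((tot w).map n)) : Car n := by
  obtain ⟨i, hi, hn⟩ := Car.factor_ca n
  have h₁ : Car ((tot w).map i) := by
    refine ((car_ca n.base B.fiber).tot w).of_comp ?_
    rwa [← Functor.map_comp, hn]
  have h₂ : IsIso i := hw.isIso_of_map hE hE' i (h₁.isIso_of_base (by
    rw [show ((tot w).map i).base = 𝟙 A.base from hi]; exact inferInstanceAs (IsIso (𝟙 A.base))))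
  rw [← hn]
  exact (car_of_isIso i).trans (car_ca _ _)

lemma comp {w : E ⟶ E'} {w' : E' ⟶ E''} (hw : LE J w) (hw' : LE J w') : LE J (w ≫ w') where
  inj A B m n h := by
    rw [tot_comp, tot_comp] at h
    have h₁ := hw'.inj _ _ h
    refine LocEq.of_loc h₁.1 (h₁.2.mono fun Y f hf =>
      ⟨_, ca f A.fiber, rfl, car_ca f _, hw.inj _ _ ?_⟩)
    obtain ⟨i, -, hi⟩ := exists_tot_ca w A f
    rw [Functor.map_comp, Functor.map_comp, ← hi, assoc, assoc]
    exact congrArg (i ≫ ·) hf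
  surj A B φ := by
    refine (hw'.surj (A := (tot w).obj A) (B := (tot w).obj B) φ).bind fun Y f ⟨n, hn⟩ => ?_
    obtain ⟨i, -, hi⟩ := exists_tot_ca w A f
    refine (hw.surj (A := ob ((E.res f).obj A.fiber)) (B := B) (i ≫ n)).mono fun Z g ⟨l, hl⟩ => ?_
    obtain ⟨j, -, hj⟩ := ((car_ca g _).trans (car_ca f A.fiber)).exists_lift
      (ca (g ≫ f) A.fiber) (𝟙 Z) (id_comp _)
    have h₂ : (tot w).map (j ≫ l) = ((tot w).map j ≫ (tot w).map (ca g _) ≫ i) ≫ n := by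
      rw [Functor.map_comp, hl, assoc, assoc]
    have h₃ : ((tot w).map j ≫ (tot w).map (ca g _) ≫ i) ≫ ca f ((tot w).obj A).fiber =
        (tot w).map (ca (g ≫ f) A.fiber) := by
      rw [← hj, Functor.map_comp, Functor.map_comp, assoc, assoc]
      exact congrArg (fun t => (tot w).map j ≫ (tot w).map (ca g _) ≫ t) hi
    have h₄ : ∀ {C : ∫ᶜ E'} (t : C ⟶ ob ((E'.res f).obj ((tot w).obj A).fiber)),
        (tot w').map (t ≫ n) = (tot w').map (t ≫ ca f ((tot w).obj A).fiber) ≫ φ := fun t => by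
      rw [Functor.map_comp, Functor.map_comp, hn]
      exact (assoc _ _ _).symm
    refine ⟨j ≫ l, (tot_comp w w' _).trans ((congrArg (tot w').map h₂).trans ((h₄ _).trans ?_))⟩
    exact congrArg (· ≫ φ) ((congrArg (tot w').map h₃).trans (tot_comp w w' _).symm)
  ess X x := by
    refine (hw'.ess x).bind fun Y f ⟨e, u, hu, huc⟩ => ?_
    refine (hw.ess e).mono fun Z g ⟨e', t, ht, htc⟩ => ⟨e', (tot w').map t ≫ u, ?_, ?_⟩
    · exact (congrArg₂ (· ≫ ·) (show ((tot w').map t).base = g from ht) hu)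
    · exact (htc.tot w').trans huc

end LE

end

section

variable {J : GrothendieckTopology K}
  {E : IndCat.{v, u, max u v w, max u v w w'} K} {X X₁ X₂ Y Z : K}

section

variable (z : Datum J E X) (c : z.Ch Y)

/-- The class of arrows between charts of the inclusion of a chart. -/
def InclMem ⦃W : K⦄ (x : El (triv J (z.at' c)) z W) : Prop :=
  ∃ e : x.src.1 ≫ c.1 = x.tgt.1, x.hom ≫ z.tr c x.tgt x.src.1 e = ca x.src.1 (z.at' c)

variable {z c}

lemma InclMem.res {W : K} {x : El (triv J (z.at' c)) z W} (hx : InclMem z c x) (g : Z ⟶ W) :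
    InclMem z c (x.res g) := by
  obtain ⟨e, h⟩ := hx
  have e' : (g ≫ x.src.1) ≫ c.1 = (x.res g).tgt.1 :=
    (assoc _ _ _).trans (congrArg (g ≫ ·) e)
  refine ⟨e', ?_⟩
  have h₁ := Datum.tr_tr c x.tgt (x.res g).tgt x.src.1 e g rfl (g ≫ x.src.1) e' rfl
  have h₂ := triv_tr (z.at' c) x.src (x.res g).src g rfl
  have h₃ := El.res_hom x g
  refine (congrArg (_ ≫ ·) h₁).symm.trans (((reassoc_of% h₃) _).trans ?_)
  exact (congrArg (_ ≫ ·) h).trans h₂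

lemma InclMem.uniq {W : K} {x y : El (triv J (z.at' c)) z W} (hx : InclMem z c x)
    (hy : InclMem z c y) (e : x.src.1 = y.src.1) : x = y := by
  obtain ⟨ex, hx⟩ := hx
  obtain ⟨ey, hy⟩ := hy
  have e' : x.tgt.1 = y.tgt.1 := ex.symm.trans ((congrArg (· ≫ _) e).trans ey)
  refine El.ext' ((id_comp _).trans e.symm) ((id_comp _).trans e'.symm)
    ((Datum.tr_car c y.tgt y.src.1 ey).hom_ext ?_ ?_)
  · rw [comp_base, comp_base, x.base, y.base, Datum.tr_base, Datum.tr_base]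
  · rw [assoc, assoc, Datum.tr_tr c y.tgt x.tgt y.src.1 ey (𝟙 W) _ x.src.1 ex
      ((id_comp _).trans e.symm), hx, hy, triv_tr]

lemma exists_inclMem {W : K} (h : W ⟶ Y) :
    ∃ x : El (triv J (z.at' c)) z W, x.src.1 = h ∧ InclMem z c x := by
  obtain ⟨m, hm, hm'⟩ := (Datum.tr_car c (z.pull c h) h rfl).exists_lift (ca h (z.at' c)) (𝟙 W) (by
    rw [Datum.tr_base]; exact id_comp _)
  exact ⟨⟨⟨h, trivial⟩, z.pull c h, m, hm⟩, rfl, rfl, hm'⟩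

variable (z c) in
/-- The inclusion of a chart in a descent datum. -/
def incl : ZHom (triv J (z.at' c)) z :=
  ZHom.ofUnique c.1 (InclMem z c) (fun _ _ hx => hx.1) (fun _ _ _ hx g => hx.res g)
    (fun _ _ _ hx hy e => hx.uniq hy e) (fun _ h _ _ => exists_inclMem h)

lemma mem_incl {W : K} {x : El (triv J (z.at' c)) z W} (hx : InclMem z c x) : (incl z c).mem x :=
  ZHom.mem_ofUnique _ _ _ _ _ _ _ hx

lemma car_incl : Car (parr (incl z c)) := by
  refine car_parr (Loc.of_forall fun W h => ?_)
  obtain ⟨x, hx, hxu⟩ := exists_inclMem (c := c) h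
  refine ⟨x, hx, mem_incl hxu, Car.isIso_of_base ?_ (by
    rw [x.base]; exact inferInstanceAs (IsIso (𝟙 W)))⟩
  obtain ⟨e, h⟩ := hxu
  refine (Datum.tr_car c x.tgt x.src.1 e).of_comp ?_
  rw [h]
  exact car_ca _ _

lemma trivMap_incl {c' : z.Ch Z} (g : Z ⟶ Y) (e : g ≫ c.1 = c'.1) :
    (trivMap (z.tr c c' g e)).comp (incl z c) = incl z c' := by
  have hb : (z.tr c c' g e).base = g := Datum.tr_base _ _ _ _
  refine ZHom.ext_loc ((congrArg (· ≫ c.1) hb).trans e) (Loc.of_forall fun W h => ?_)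
  obtain ⟨x, hx, hxu⟩ := exists_trivMem (J := J) (z.tr c c' g e) h
  obtain ⟨y, hy, hyt⟩ := exists_inclMem (z := z) (c := c) x.tgt.1
  refine ⟨x.comp y hy, hx, ZHom.mem_comp _ _ (mem_trivMap hxu) (mem_incl hyt) _, mem_incl ?_⟩
  obtain ⟨e₁, h₁⟩ := hyt
  obtain ⟨e₂, h₂⟩ := hxu
  have e₃ : x.src.1 ≫ g = y.src.1 := by rw [← hb, e₂, hy]
  have e₄ : x.src.1 ≫ c'.1 = y.tgt.1 := by rw [← e, reassoc_of% e₃, e₁]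
  refine ⟨e₄, (Datum.tr_car c c' g e).hom_ext ?_ ?_⟩
  · rw [comp_base, El.base, Datum.tr_base]
    exact id_comp _
  · have h₃ := Datum.tr_tr c c' y.tgt g e x.src.1 e₄ y.src.1 e₁ e₃
    refine (assoc _ _ _).trans ((congrArg (_ ≫ ·) h₃).trans ?_)
    rw [assoc, assoc, h₁, triv_tr]
    exact h₂

end

variable (J E) in
lemma le_toPlus : LE J (toPlus J E) where
  inj A B m n h := by
    rw [tot_toPlus, tot_toPlus] at h
    have h : trivMap (J := J) m = trivMap n :=
      (unparr_parr _).symm.trans ((congrArg unparr h).trans (unparr_parr _))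
    refine ⟨congrArg ZHom.base h, ?_⟩
    obtain ⟨x, hx, hxm⟩ := exists_trivMem (J := J) m (𝟙 _)
    obtain ⟨y, hy, hyn⟩ := exists_trivMem (J := J) n (𝟙 _)
    refine ((trivMap m).uniq x y (mem_trivMap hxm) (h ▸ mem_trivMap hyn) (hx.trans hy.symm)).mono
      fun Z g hg => ?_
    have e : (x.res g).src.1 = g := (congrArg (g ≫ ·) hx).trans (comp_id g)
    have h₁ := hyn.res g
    rw [← hg] at h₁
    exact e ▸ (hxm.res g).2.symm.trans h₁.2
  surj A B φ := by
    let P : ZHom (triv J A.fiber) (triv J B.fiber) := unparr φ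
    refine P.inh.mono fun Y h ⟨x, hx, hP⟩ => ?_
    subst hx
    refine ⟨x.hom ≫ ca x.tgt.1 B.fiber, ?_⟩
    rw [tot_toPlus, tot_toPlus]
    refine Eq.trans (congrArg parr ?_) ((parr_comp _ P).trans (congrArg (_ ≫ ·) (parr_unparr φ)))
    refine ZHom.ext_loc ((congrArg (· ≫ x.tgt.1) x.base).trans
      ((id_comp _).trans (P.eq x hP).symm)) (Loc.of_forall fun W k => ?_)
    obtain ⟨t, ht, htu⟩ := exists_trivMem (J := J) (ca x.src.1 A.fiber) k
    have e₁ : (x.res k).src.1 = t.tgt.1 := by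
      rw [← htu.1, ht]; rfl
    refine ⟨t.comp (x.res k) e₁, ht, mem_trivMap ?_,
      ZHom.mem_comp _ _ (mem_trivMap htu) (P.res x hP k) _⟩
    subst ht
    refine ⟨?_, ?_⟩
    · rw [comp_base, x.base]
      exact congrArg (t.src.1 ≫ ·) (id_comp _)
    · have h₁ := triv_tr B.fiber x.tgt (x.res t.src.1).tgt t.src.1 rfl
      have h₂ := El.res_hom x t.src.1
      have e₂ : 𝟙 W ≫ (x.res t.src.1).src.1 = t.tgt.1 := (id_comp _).trans e₁
      have h₃ : (t.hom ≫ (triv J A.fiber).tr (x.res t.src.1).src t.tgt (𝟙 W) e₂) ≫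
          (triv J A.fiber).tr x.src (x.res t.src.1).src t.src.1 rfl =
            ca t.src.1 ((triv J A.fiber).at' x.src) := by
        refine (car_ca x.src.1 A.fiber).hom_ext ?_ ?_
        · rw [comp_base, comp_base, t.base, Datum.tr_base, Datum.tr_base]
          refine (congrArg (· ≫ _) (id_comp _)).trans (id_comp _)
        · rw [assoc, assoc, triv_tr, triv_tr]
          exact htu.2
      refine (congrArg (· ≫ _) (assoc _ _ _).symm).trans ?_
      refine (assoc _ _ _).trans ((congrArg (fun s => _ ≫ _ ≫ s) h₁).symm.trans ?_)
      refine (congrArg (_ ≫ ·) ((reassoc_of% h₂) _)).trans ?_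
      exact (assoc _ _ _).symm.trans (((congrArg (· ≫ _) h₃)).trans rfl)
  ess X x := by
    let z : Datum J E X := (datumCat J E).unel x
    exact (Loc.of_sieve z.hS).mono fun Y f hf =>
      ⟨z.at' ⟨f, hf⟩, parr (incl z ⟨f, hf⟩), rfl, car_incl⟩

end

end

section

section

variable {J : GrothendieckTopology K}
  {E : IndCat.{v, u, max u v w, max u v w w'} K} {X X₁ X₂ Y Z W : K}

namespace El

variable {z : Datum J E X} {z₁ : Datum J E X₁}

abbrev push (f : Y ⟶ X) (y : El (z.res f) z₁ W) : El z z₁ W :=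
  ⟨⟨y.src.1 ≫ f, y.src.2⟩, y.tgt, y.hom, y.base⟩

lemma push_res (f : Y ⟶ X) (y : El (z.res f) z₁ W) (g : Z ⟶ W) :
    (y.push f).res g = (y.res g).push f :=
  (eq_res (y.push f) g ((y.res g).push f) (assoc _ _ _).symm rfl (res_hom y g)).symm

lemma can_comp_push (f : Y ⟶ X) (y : El (z.res f) z₁ W) (e) :
    (can f z y.src).comp (y.push f) e = y := by
  refine ext' (id_comp _) (id_comp _) ?_
  have h₁ : ((can f z y.src).comp (y.push f) e).hom = y.hom :=
    (id_comp _).trans ((congrArg (· ≫ _) (Datum.tr_id _ _)).trans (id_comp _))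
  rw [h₁]
  refine (congrArg (_ ≫ ·) (Datum.tr_id _ _)).trans ((comp_id _).trans ?_)
  exact ((congrArg (· ≫ _) (Datum.tr_id _ _)).trans (id_comp _)).symm

end El

namespace ZHom

variable {z : Datum J E X} {z₁ : Datum J E X₁}

lemma hom_ext_of_loc {P Q : ZHom z z₁} (hb : P.base = Q.base) {p : ∀ ⦃Y : K⦄, (Y ⟶ X) → Prop}
    (hp : Loc J p) (h : ∀ ⦃Y : K⦄ (f : Y ⟶ X), p f → (ZHom.ca f z).comp P = (ZHom.ca f z).comp Q) :
    P = Q := by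
  refine ext_loc hb ((hp.and ((Loc.of_sieve z.hS).and (P.inh.and Q.inh))).bind
    fun Y f ⟨hf, hz, ⟨x, hx, hP⟩, ⟨y, hy, hQ⟩⟩ => ?_)
  have hc : z.S (𝟙 Y ≫ f) := by rwa [id_comp]
  have ex : x.src.1 = 𝟙 Y ≫ f := hx.trans (id_comp _).symm
  have ey : y.src.1 = 𝟙 Y ≫ f := hy.trans (id_comp _).symm
  have h₁ := mem_comp (El.can f z ⟨𝟙 Y, hc⟩) x (can_mem_ca f z _) hP ex
  have h₂ := mem_comp (El.can f z ⟨𝟙 Y, hc⟩) y (can_mem_ca f z _) hQ ey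
  rw [← h f hf] at h₂
  refine (((ZHom.ca f z).comp P).uniq _ _ h₁ h₂ rfl).mono fun W g hg => ?_
  rw [El.comp_res, El.comp_res] at hg
  have h₃ := El.cancel_comp (El.isIso_res _ (inferInstanceAs (IsIso (𝟙 _))) g) _ _ hg
  refine ⟨x.res g, congrArg (g ≫ ·) hx, P.res x hP g, ?_⟩
  rw [h₃]
  exact Q.res y hQ g

lemma exists_push {f : Y ⟶ X} {q : W ⟶ X} {M : ZHom (z.res f) z₁} {N : ZHom (z.res q) z₁}
    (k : ZHom (z.res q) (z.res f)) (hk : k.comp (ZHom.ca f z) = ZHom.ca q z) (hN : k.comp M = N)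
    (y : El (z.res f) z₁ W) (hy : M.mem y) (hb : k.base = y.src.1) (e : y.src.1 ≫ f = q) :
    ∃ y' : El (z.res q) z₁ W, y'.src.1 = 𝟙 W ∧ N.mem y' ∧ y'.push q = y.push f := by
  subst e
  have hc : z.S (𝟙 W ≫ y.src.1 ≫ f) := by rw [id_comp]; exact y.src.2
  let m : El (z.res (y.src.1 ≫ f)) (z.res f) W := ⟨⟨𝟙 W, hc⟩, y.src,
    z.tr ⟨y.src.1 ≫ f, y.src.2⟩ ⟨𝟙 W ≫ y.src.1 ≫ f, hc⟩ (𝟙 W) rfl, Datum.tr_base _ _ _ _⟩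
  have hm : k.mem m := by
    refine mem_of_comp (P := ZHom.ca f z) m (El.can f z y.src)
      ((id_comp _).trans hb) (can_mem_ca f z _) (inferInstanceAs (IsIso (𝟙 _))) rfl ?_
    have h₁ : m.comp (El.can f z y.src) rfl = El.can _ z ⟨𝟙 W, hc⟩ := by
      refine El.ext' (id_comp _) ((id_comp _).trans (id_comp _)) ?_
      have h₂ := Datum.tr_tr (z := z) ⟨𝟙 W ≫ y.src.1 ≫ f, hc⟩ ⟨y.src.1 ≫ f, y.src.2⟩
        ⟨𝟙 W ≫ y.src.1 ≫ f, hc⟩ (𝟙 W) ((id_comp _).trans (id_comp _)) (𝟙 W) rfl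
        (𝟙 W) (id_comp _) (id_comp _)
      have h₃ : (m.comp (El.can f z y.src) rfl).hom = m.hom :=
        (congrArg (_ ≫ ·) (comp_id _)).trans
          ((congrArg (_ ≫ ·) (Datum.tr_id _ _)).trans (comp_id _))
      rw [h₃]
      exact h₂.trans (comp_id _).symm
    rw [h₁, hk]
    exact can_mem_ca _ _ _
  refine ⟨m.comp y rfl, rfl, ?_, ?_⟩
  · rw [← hN]
    exact mem_comp _ _ hm hy _
  · refine El.ext' rfl (id_comp _) ?_
    have h₃ : ((m.comp y rfl).push (y.src.1 ≫ f)).hom = m.hom ≫ y.hom :=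
      congrArg (_ ≫ ·) ((congrArg (· ≫ _) (Datum.tr_id _ _)).trans (id_comp _))
    exact (congrArg (_ ≫ ·) (Datum.tr_id _ _)).trans ((comp_id _).trans h₃)

end ZHom

variable (J E) in
lemma isPre_plus : IsPre J (plus J E) := fun X S hS => by
  refine ⟨fun {a b} m n h => ?_, fun {a b} μ hμ hc => ?_⟩
  · refine ve_inj ?_
    let z : Datum J E X := (datumCat J E).unel a
    let z₁ : Datum J E X := (datumCat J E).unel b
    have h₁ : unparr (z := z) (z₁ := z₁) (ve m) = unparr (z := z) (z₁ := z₁) (ve n) := by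
      refine ZHom.hom_ext_of_loc ((unparr_base (z := z) (z₁ := z₁) (ve m)).trans
        (unparr_base (z := z) (z₁ := z₁) (ve n)).symm) (Loc.of_sieve hS) fun Y f hf => ?_
      rw [← unparr_ca]
      exact (unparr_comp (z₁ := z) (z₂ := z₁) _ _).symm.trans ((congrArg unparr (h f hf)).trans
        (unparr_comp (z₁ := z) (z₂ := z₁) _ _))
    exact (parr_unparr (z := z) (z₁ := z₁) _).symm.trans ((congrArg parr h₁).trans
      (parr_unparr (z := z) (z₁ := z₁) _))
  · let z : Datum J E X := (datumCat J E).unel a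
    let z₁ : Datum J E X := (datumCat J E).unel b
    let M : ∀ ⦃Y : K⦄ (f : Y ⟶ X), S f → ZHom (z.res f) z₁ := fun Y f hf =>
      unparr (z := z.res f) (z₁ := z₁) (μ f hf)
    have hM : ∀ ⦃Y : K⦄ (f : Y ⟶ X) (hf : S f), (M f hf).base = f := fun Y f hf =>
      (unparr_base _).trans (hμ f hf)
    have key : ∀ ⦃Y W : K⦄ (f : Y ⟶ X) (hf : S f) (q : W ⟶ X) (hq : S q) (y : El (z.res f) z₁ W),
        (M f hf).mem y → y.src.1 ≫ f = q →
        ∃ y' : El (z.res q) z₁ W, y'.src.1 = 𝟙 W ∧ (M q hq).mem y' ∧ y'.push q = y.push f := by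
      intro Y W f hf q hq y hy e
      obtain ⟨k, hk, hk'⟩ := (car_ca f a).exists_lift (ca q a) y.src.1 e
      refine ZHom.exists_push (unparr (z := z.res q) (z₁ := z.res f) k) ?_ ?_ y hy
        ((unparr_base _).trans hk) e
      · rw [← unparr_ca, ← unparr_ca]
        exact (unparr_comp (z := z.res q) (z₁ := z.res f) (z₂ := z) _ _).symm.trans
          (congrArg unparr hk')
      · exact (unparr_comp (z := z.res q) (z₁ := z.res f) (z₂ := z₁) _ _).symm.trans
          (congrArg unparr (hc f hf q hq k hk'))
    let P : ∀ ⦃W : K⦄, El z z₁ W → Prop := fun W t => ∃ (Y : K) (f : Y ⟶ X) (hf : S f)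
      (y : El (z.res f) z₁ W), (M f hf).mem y ∧ t = y.push f
    let R : ZHom z z₁ := ZHom.gen (𝟙 X) P
      (by
        rintro W _ ⟨Y, f, hf, y, hy, rfl⟩
        exact (comp_id _).trans ((congrArg (_ ≫ ·) (hM f hf).symm).trans ((M f hf).eq y hy)))
      (by
        rintro W W' V _ _ ⟨Y, f, hf, y, hy, rfl⟩ ⟨Y', f', hf', y', hy', rfl⟩ g g' hg
        have hq : S ((g ≫ y.src.1) ≫ f) := S.downward_closed hf _
        obtain ⟨t, ht, hm, e⟩ := key f hf _ hq (y.res g) ((M f hf).res y hy g) rfl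
        obtain ⟨t', ht', hm', e'⟩ := key f' hf' _ hq (y'.res g') ((M f' hf').res y' hy' g')
          ((assoc _ _ _).trans (hg.symm.trans (assoc _ _ _).symm))
        refine ((M _ hq).uniq t t' hm hm' (ht.trans ht'.symm)).mono fun L k hk => ?_
        refine (congrArg (fun s => s.res k) ((El.push_res f y g).trans e.symm)).trans (Eq.trans ?_
          (congrArg (fun s => s.res k) ((El.push_res f' y' g').trans e'.symm)).symm)
        exact (El.push_res _ t k).trans ((congrArg (El.push _) hk).trans (El.push_res _ t' k).symm))
      ((Loc.of_sieve hS).bind fun Y f hf => (M f hf).inh.mono fun W h ⟨y, hy, hm⟩ =>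
        ⟨y.push f, congrArg (· ≫ f) hy, Y, f, hf, y, hm, rfl⟩)
    have hR : ∀ ⦃Y : K⦄ (f : Y ⟶ X) (hf : S f), (ZHom.ca f z).comp R = M f hf := fun Y f hf =>
      ZHom.ext_loc ((comp_id f).trans (hM f hf).symm) ((M f hf).inh.mono
        fun W h ⟨y, hy, hm⟩ => ⟨(El.can f z y.src).comp (y.push f) rfl, hy,
          ZHom.mem_comp _ _ (ZHom.can_mem_ca f z _)
            (ZHom.mem_gen _ _ _ _ _ _ ⟨Y, f, hf, y, hm, rfl⟩) _, by
          rw [El.can_comp_push]; exact hm⟩)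
    refine ⟨vert (parr R) rfl, fun Y f hf => ?_⟩
    refine (congrArg (_ ≫ ·) (ve_vert (parr R) rfl)).trans ?_
    refine (congrArg (· ≫ _) (ca_eq_parr f z)).trans ?_
    exact (parr_comp _ _).symm.trans ((congrArg parr (hR f hf)).trans (parr_unparr _))

lemma isStack_plus (hE : IsPre J E) : (plus J E).IsStack J := by
  refine isStack_iff.2 fun X S hS => ⟨isPre_plus J E S hS, fun d => ?_⟩
  have hw := le_toPlus J E
  have hP := isPre_plus J E
  let V : Sieve X :=
    { arrows := fun Y h => S h ∧ ∀ hh : S h, ∃ (e : E.fibre Y)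
        (u : (tot (toPlus J E)).obj (ob e) ⟶ ob (d.obj h hh)), u.base = 𝟙 Y ∧ Car u
      downward_closed := fun {Y Z} f ⟨hf, h⟩ g => ⟨S.downward_closed hf g, fun hh => by
        obtain ⟨e, u, hu, hu'⟩ := h hf
        obtain ⟨k, hk, hk', -⟩ := (d.car f hf _ hh g rfl).exists_desc
          (((car_ca g e).tot (toPlus J E)).trans hu') (𝟙 Z) (by
            rw [d.base]
            refine (id_comp _).trans (Eq.trans ?_ (congrArg (g ≫ ·) hu).symm)
            exact (comp_id g).symm)
        exact ⟨_, k, hk, hk'⟩⟩ }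
  have hVS : V ≤ S := fun Y f hf => hf.1
  have hV : V ∈ J X := by
    refine ((Loc.of_sieve hS).bind (q := fun Z h => V h) fun Y f hf =>
      (hw.ess (d.obj f hf)).mono fun Z g ⟨e, u, hu, hu'⟩ => ⟨S.downward_closed hf g, fun hh => ?_⟩
      ).sieve_mem fun Y f hf => hf
    obtain ⟨k, hk, hk', -⟩ := (d.car f hf _ hh g rfl).exists_desc hu' (𝟙 Z) (by
      rw [d.base]
      exact (id_comp _).trans hu.symm)
    exact ⟨_, k, hk, hk'⟩
  choose e u hu hc using fun (Y : K) (h : Y ⟶ X) (hh : V h) => hh.2 (hVS _ hh)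
  have hi : ∀ (Y : K) (h : Y ⟶ X) (hh : V h), IsIso (u Y h hh) := fun Y h hh =>
    (hc Y h hh).isIso_of_base (by rw [hu]; exact inferInstanceAs (IsIso (𝟙 Y)))
  have ht : ∀ ⦃Y Z : K⦄ (f : Y ⟶ X) (hf : V f) (g : Z ⟶ X) (hg : V g) (k : Z ⟶ Y)
      (hk : k ≫ f = g), ∃ t : ob (e Z g hg) ⟶ ob (e Y f hf),
        (tot (toPlus J E)).map t = u Z g hg ≫ d.tr f (hVS _ hf) g (hVS _ hg) k hk ≫ inv (u Y f hf) :=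
    fun Y Z f hf g hg k hk => hw.exists_map hE hP _
  choose t ht using ht
  have htc : ∀ ⦃Y Z : K⦄ (f : Y ⟶ X) (hf : V f) (g : Z ⟶ X) (hg : V g) (k : Z ⟶ Y)
      (hk : k ≫ f = g), (tot (toPlus J E)).map (t f hf g hg k hk) ≫ u Y f hf =
        u Z g hg ≫ d.tr f (hVS _ hf) g (hVS _ hg) k hk := fun Y Z f hf g hg k hk => by
    rw [ht, assoc, assoc, IsIso.inv_hom_id, comp_id]
  have htb : ∀ ⦃Y Z : K⦄ (f : Y ⟶ X) (hf : V f) (g : Z ⟶ X) (hg : V g) (k : Z ⟶ Y)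
      (hk : k ≫ f = g), (t f hf g hg k hk).base = k := fun Y Z f hf g hg k hk => by
    have := base_congr (htc f hf g hg k hk)
    rw [comp_base, comp_base, hu, hu, d.base] at this
    exact (comp_id _).symm.trans (this.trans (id_comp _))
  let z : Datum J E X :=
    { S := V
      hS := hV
      d :=
        { obj := fun Y h hh => e Y h hh
          tr := t
          base := htb
          car := fun Y Z f hf g hg k hk => hw.car_of_map hE hP _ (by
            rw [ht]
            exact (hc _ _ _).trans ((d.car _ _ _ _ _ _).trans (car_of_isIso _)))
          comp := fun Y Z L f hf g hg k hk h e h' e' h'' e'' c => hw.map_inj hE (by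
            rw [← cancel_mono (u Y f hf), Functor.map_comp, assoc, htc, htc,
              reassoc_of% (htc g hg k hk h' e'), d.comp _ _ _ _ _ _ _ _ _ _ _ _ c]) } }
  have hb : ∀ (Y : K) (h : Y ⟶ X) (hh : V h), (inv (u Y h hh)).base = 𝟙 Y := fun Y h hh =>
    base_inv (IsIso.inv_hom_id (u Y h hh)) (by rw [hu]; exact comp_id _)
  have hi' : ∀ (Y : K) (h : Y ⟶ X) (hh : V h), Car (inv (u Y h hh)) := fun Y h hh =>
    car_of_isIso _
  have hv : ∀ ⦃Y Z : K⦄ (f : Y ⟶ X) (hf : V f) (g : Z ⟶ X) (hg : V g) (k : Z ⟶ Y)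
      (hk : k ≫ f = g), d.tr f (hVS _ hf) g (hVS _ hg) k hk ≫ inv (u Y f hf) =
        inv (u Z g hg) ≫ (tot (toPlus J E)).map (t f hf g hg k hk) := fun Y Z f hf g hg k hk => by
    rw [ht, IsIso.inv_hom_id_assoc]
  have hz : ∀ ⦃Y Z : K⦄ (f : Y ⟶ X) (hf : V f) (g : Z ⟶ X) (hg : V g) (k : Z ⟶ Y)
      (hk : k ≫ f = g), (tot (toPlus J E)).map (t f hf g hg k hk) ≫ parr (incl z ⟨f, hf⟩) =
        parr (incl z ⟨g, hg⟩) := fun Y Z f hf g hg k hk => by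
    rw [tot_toPlus]
    exact (parr_comp _ _).symm.trans (congrArg parr (trivMap_incl (z := z) (c := ⟨f, hf⟩)
      (c' := ⟨g, hg⟩) k hk))
  refine DD.effective_of_restrict hP hV d hVS ⟨(datumCat J E).el z, ⟨⟨
    fun Y h hh => @inv _ _ _ _ (u Y h hh) (hi Y h hh) ≫ parr (incl z ⟨h, hh⟩),
    fun Y h hh => (congrArg (· ≫ h) (hb Y h hh)).trans (id_comp h),
    fun Y h hh => (hi' Y h hh).trans car_incl, fun Y Z f hf g hg h e => ?_⟩⟩⟩
  refine (assoc _ _ _).symm.trans ((congrArg (· ≫ _) (hv f hf g hg h e)).trans ?_)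
  exact (assoc _ _ _).trans (congrArg (_ ≫ ·) (hz f hf g hg h e))

variable (J) in
lemma exists_le (E : IndCat.{v, u, max u v w, max u v w w'} K) :
    ∃ (E' : IndCat.{v, u, max u v w, max u v w w'} K) (w : E ⟶ E'), E'.IsStack J ∧ LE J w :=
  ⟨plus J (plus J E), toPlus J E ≫ toPlus J (plus J E), isStack_plus (isPre_plus J E),
    (le_toPlus J E).comp (le_toPlus J (plus J E))⟩

end

end

section

variable {J : GrothendieckTopology K}
  {E E' : IndCat.{v, u, v', u'} K}

lemma isStack_trivial (E : IndCat.{v, u, v', u'} K) :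
    E.IsStack (GrothendieckTopology.trivial K) := by
  refine isStack_iff.2 fun X S hS => ?_
  obtain rfl : S = ⊤ := GrothendieckTopology.trivial_covering.1 hS
  have hi (a : E.fibre X) : IsIso (ca (𝟙 X) a) :=
    (car_ca (𝟙 X) a).isIso_of_base (inferInstanceAs (IsIso (𝟙 X)))
  refine ⟨⟨fun {a b} m n h => ve_inj ?_, fun {a b} μ hμ hc => ?_⟩, fun d => ?_⟩
  · have := hi a
    rw [← cancel_epi (ca (𝟙 X) a), h _ trivial]
  · have := hi a
    have hb : (inv (ca (𝟙 X) a) ≫ μ (𝟙 X) trivial).base = 𝟙 X := by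
      rw [comp_base, hμ, base_inv (IsIso.inv_hom_id (ca (𝟙 X) a)) (id_comp (𝟙 X))]
      exact comp_id _
    refine ⟨vert _ hb, fun Y f hf => ?_⟩
    rw [ve_vert, ← assoc]
    exact hc _ _ _ _ _ (by simp)
  · exact ⟨d.obj (𝟙 X) trivial, ⟨fun Y f hf => d.tr _ _ _ _ f (comp_id f),
      fun Y f hf => d.base _ _ _ _ _ _, fun Y f hf => d.car _ _ _ _ _ _,
      fun Y Z f hf g hg h e => d.comp _ _ _ _ _ _ _ _ _ _ _ _ e⟩⟩

lemma LE.isEquiv {w : E ⟶ E'} (hw : LE J w) (hE : E.IsStack J) (hE' : E'.IsStack J) :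
    IsEquiv w := by
  let a : St.{v, u, v', u'} J := ⟨E, hE⟩
  let b : St.{v, u, v', u'} J := ⟨E', hE'⟩
  let f : a ⟶ b := InducedBicategory.mkHom w
  have h : IsUniv (stIncl J) (a := E) (b := a) (𝟙 E) :=
    isUniv_of_isEquiv (isLocEquiv_incl _) (IsEquiv.id E)
  have h₁ : IsEquiv f := h.isEquiv_of_iso (hw.isUniv hE') (λ_ w)
  exact h₁.map (stIncl J)

lemma isEquiv_of_tot (w : E ⟶ E')
    (inj : ∀ ⦃A B : ∫ᶜ E⦄ (m n : A ⟶ B), (tot w).map m = (tot w).map n → m = n)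
    (surj : ∀ ⦃A B : ∫ᶜ E⦄ (φ : (tot w).obj A ⟶ (tot w).obj B), ∃ n, (tot w).map n = φ)
    (ess : ∀ ⦃X : K⦄ (x : E'.fibre X), ∃ (e : E.fibre X) (u : (tot w).obj (ob e) ⟶ ob x),
      u.base = 𝟙 X ∧ Car u) : IsEquiv w := by
  refine LE.isEquiv (J := GrothendieckTopology.trivial K) ⟨fun A B m n h => LocEq.of_eq (inj m n h),
    fun A B φ => ?_, fun X x => ?_⟩ (isStack_trivial E) (isStack_trivial E')
  · obtain ⟨n, hn⟩ := surj φ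
    exact Loc.of_forall fun Y f => ⟨ca f A.fiber ≫ n, by
      rw [Functor.map_comp, hn]⟩
  · obtain ⟨e, u, hu, hu'⟩ := ess x
    exact Loc.of_forall fun Y f => ⟨(E.res f).obj e, (tot w).map (ca f e) ≫ u,
      (congrArg (f ≫ ·) hu).trans (comp_id f), ((car_ca f e).tot w).trans hu'⟩

lemma exists_iso_of_comp_iso {w : E ⟶ E'} {g : E' ⟶ E} (i : w ≫ g ≅ 𝟙 E) :
    ∃ t : ∀ A : ∫ᶜ E, (tot g).obj ((tot w).obj A) ≅ A, (∀ A, (t A).hom.base = 𝟙 _) ∧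
      ∀ ⦃A B : ∫ᶜ E⦄ (m : A ⟶ B), (tot g).map ((tot w).map m) ≫ (t B).hom = (t A).hom ≫ m := by
  have hi : ∀ A, IsIso (vAt i.hom A) := fun A => inferInstance
  refine ⟨fun A => @asIso _ _ _ _ (vAt i.hom A) (hi A), fun A => rfl, fun A B m => ?_⟩
  have := vAt_nat i.hom m
  rw [tot_comp, tot_id] at this
  exact this

lemma tot_inj_of_isEquiv {w : E ⟶ E'} (hw : IsEquiv w) {A B : ∫ᶜ E} {m n : A ⟶ B}
    (h : (tot w).map m = (tot w).map n) : m = n := by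
  obtain ⟨g, ⟨i⟩, -⟩ := hw
  obtain ⟨t, -, ht⟩ := exists_iso_of_comp_iso i
  rw [← cancel_epi (t A).hom, ← ht, ← ht, h]

lemma exists_tot_of_isEquiv {w : E ⟶ E'} (hw : IsEquiv w) {A B : ∫ᶜ E}
    (φ : (tot w).obj A ⟶ (tot w).obj B) : ∃ n, (tot w).map n = φ := by
  obtain ⟨g, hg, ⟨i⟩, -⟩ := hw.exists_inv
  obtain ⟨t, -, ht⟩ := exists_iso_of_comp_iso i
  refine ⟨(t A).inv ≫ (tot g).map φ ≫ (t B).hom, tot_inj_of_isEquiv hg ?_⟩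
  rw [← cancel_mono (t B).hom, ht, Iso.hom_inv_id_assoc]

lemma exists_fibre_of_isEquiv {w : E ⟶ E'} (hw : IsEquiv w) {X : K} (x : E'.fibre X) :
    ∃ (e : E.fibre X) (u : (tot w).obj (ob e) ⟶ ob x), u.base = 𝟙 X ∧ IsIso u := by
  obtain ⟨g, -, ⟨j⟩⟩ := hw
  obtain ⟨t, ht, -⟩ := exists_iso_of_comp_iso j
  exact ⟨(StrongTrans.comp g X).obj x, (t (ob x)).hom, ht (ob x), inferInstance⟩

lemma LE.of_isEquiv {w : E ⟶ E'} (hw : IsEquiv w) : LE J w where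
  inj _ _ m n h := LocEq.of_eq (tot_inj_of_isEquiv hw h)
  surj A B φ := by
    obtain ⟨n, hn⟩ := exists_tot_of_isEquiv hw φ
    exact Loc.of_forall fun Y f => ⟨ca f A.fiber ≫ n, by
      rw [Functor.map_comp, hn]⟩
  ess X x := by
    obtain ⟨e, u, hu, hu'⟩ := exists_fibre_of_isEquiv hw x
    exact Loc.of_forall fun Y f => ⟨(E.res f).obj e, (tot w).map (ca f e) ≫ u,
      (congrArg (f ≫ ·) hu).trans (comp_id f),
      ((car_ca f e).tot w).trans (car_of_isIso u)⟩

end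

section

/-- Stackification: the universal arrow of an indexed category to a stack. -/
def stUniv (J : GrothendieckTopology K) :
    UnivData (stIncl.{v, u, max u v w, max u v w w'} J) where
  obj E := ⟨(exists_le.{v, u, w, w'} J E).choose,
    (exists_le.{v, u, w, w'} J E).choose_spec.choose_spec.1⟩
  η E := (exists_le.{v, u, w, w'} J E).choose_spec.choose
  univ E := (exists_le.{v, u, w, w'} J E).choose_spec.choose_spec.2.isUniv _

lemma exists_stackification (J : GrothendieckTopology K) :
    ∃ (s : IndCat.{v, u, max u v w, max u v w w'} K ⥤ᵖ St J) (σ : Biadjunction s (stIncl J)),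
      ∀ E, LE J (σ.unit.app E) :=
  ⟨_, (stUniv.{v, u, w, w'} J).biadjunction, fun E =>
    (exists_le.{v, u, w, w'} J E).choose_spec.choose_spec.2⟩

end

section

variable {E E' D D' : IndCat.{v, u, v', u'} K}

abbrev HC (p : E ⟶ D) {A B : ∫ᶜ E} (u : A ⟶ B) : Prop := IsCart (tot p) u

variable {p : E ⟶ D} {A B C : ∫ᶜ E}

lemma HC.exists_lift {u : A ⟶ B} (hu : HC p u) (g : C ⟶ B) (t : (tot p).obj C ⟶ (tot p).obj A)
    (h : t ≫ (tot p).map u = (tot p).map g) : ∃ k : C ⟶ A, (tot p).map k = t ∧ k ≫ u = g :=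
  ((isCart_iff _ _).1 hu g t h).exists

lemma HC.hom_ext {u : A ⟶ B} (hu : HC p u) {k k' : C ⟶ A}
    (h : (tot p).map k = (tot p).map k') (h' : k ≫ u = k' ≫ u) : k = k' := IsCart.ext hu h h'

lemma HC.of_comp {u : A ⟶ B} {w : B ⟶ C} (hw : HC p w) (h : HC p (u ≫ w)) : HC p u := by
  refine (isCart_iff _ _).2 fun Z g t ht => ?_
  obtain ⟨k, hk, hk'⟩ := h.exists_lift (g ≫ w) t (by
    rw [Functor.map_comp, Functor.map_comp, ← ht, assoc])
  refine ⟨k, ⟨hk, hw.hom_ext ?_ (by simpa using hk')⟩, ?_⟩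
  · rw [Functor.map_comp, hk, ht]
  · rintro l ⟨hl, rfl⟩
    exact h.hom_ext (hl.trans hk.symm) (by simpa using hk'.symm)

lemma HC.trans {u : A ⟶ B} {w : B ⟶ C} (hu : HC p u) (hw : HC p w) : HC p (u ≫ w) := hu.comp hw

variable (p) in
lemma Car.hc {u : A ⟶ B} (hu : Car u) : HC p u := by
  refine (isCart_iff _ _).2 fun Z g t ht => ?_
  obtain ⟨k, hk, hk'⟩ := hu.exists_lift g t.base (base_congr ht)
  refine ⟨k, ⟨(hu.tot p).hom_ext hk ?_, hk'⟩, ?_⟩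
  · rw [← Functor.map_comp, hk', ht]
  · rintro l ⟨hl, hl'⟩
    exact hu.hom_ext ((base_congr hl).trans hk.symm) (hl'.trans hk'.symm)

lemma HC.car {u : A ⟶ B} (hu : HC p u) (h : Car ((tot p).map u)) : Car u := by
  refine (isCart_iff _ _).2 fun Z g t ht => ?_
  obtain ⟨t', ht', ht''⟩ := h.exists_lift ((tot p).map g) t ht
  obtain ⟨k, hk, hk'⟩ := hu.exists_lift g t' ht''
  refine ⟨k, ⟨(base_congr hk).trans ht', hk'⟩, ?_⟩
  rintro l ⟨hl, hl'⟩
  refine hu.hom_ext (h.hom_ext ?_ ?_) (hl'.trans hk'.symm)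
  · exact hl.trans (ht'.symm.trans (base_congr hk).symm)
  · rw [← Functor.map_comp, ← Functor.map_comp, hl', hk']

lemma HC.isIso {u : A ⟶ B} (hu : HC p u) (h : IsIso ((tot p).map u)) : IsIso u :=
  (hu.car (car_of_isIso _)).isIso_of_base (isIso_base ((tot p).map u))

lemma hc_of_isIso (u : A ⟶ B) [IsIso u] : HC p u := isCart_of_isIso _ _

lemma isCart_of_hc {X : K} {a e : E.fibre X} {f : a ⟶ e} (h : HC p (ve f)) :
    IsCart (StrongTrans.comp p X) f := by
  refine (isCart_iff _ _).2 fun z g t ht => ?_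
  obtain ⟨k, hk, hk'⟩ := h.exists_lift (ve g) (ve t) (by
    rw [tot_ve, tot_ve, ← ve_comp]
    exact congrArg ve ht)
  have hb : k.base = 𝟙 X := base_congr hk
  obtain ⟨k, rfl⟩ := exists_ve k hb
  refine ⟨k, ⟨ve_inj ((tot_ve p k).symm.trans hk), ve_inj ((ve_comp _ _).trans hk')⟩, ?_⟩
  rintro l ⟨hl, hl'⟩
  refine ve_inj (h.hom_ext ?_ ((ve_comp _ _).symm.trans ((congrArg ve hl').trans hk'.symm)))
  exact (tot_ve p l).trans ((congrArg ve hl).trans hk.symm)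

lemma hc_ve (hp : IsIndexedFibration p) {X : K} {a e : E.fibre X} {f : a ⟶ e}
    (hf : IsCart (StrongTrans.comp p X) f) : HC p (ve f) := by
  refine (isCart_iff _ _).2 fun Z g t ht => ?_
  have hb : t.base = g.base := (comp_id _).symm.trans (base_congr ht)
  obtain ⟨g', hg, hg'⟩ := (car_ca g.base e).exists_lift g (𝟙 _) (id_comp _)
  obtain ⟨g', rfl⟩ := exists_ve g' hg
  obtain ⟨t', ht₁, ht₂⟩ := ((car_ca g.base a).tot p).exists_lift t (𝟙 _)
    ((id_comp _).trans hb.symm)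
  obtain ⟨t', rfl⟩ := exists_ve t' ht₁
  have hc := hp.isCart_res g.base f hf
  have h₁ := res_map g.base f
  obtain ⟨k, ⟨hk, hk'⟩, hu⟩ := (isCart_iff _ _).1 hc g' t' (ve_inj (by
    refine ((car_ca g.base e).tot p).hom_ext rfl ?_
    rw [ve_comp, assoc, ← tot_ve, ← tot_ve]
    have h₂ : (tot p).map (ve ((E.res g.base).map f)) ≫ (tot p).map (ca g.base e) =
        (tot p).map (ca g.base a) ≫ (tot p).map (ve f) := by
      rw [← Functor.map_comp, ← Functor.map_comp, h₁]
    refine (congrArg (_ ≫ ·) h₂).trans ?_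
    exact ((reassoc_of% ht₂) _).trans (ht.trans
      ((congrArg (tot p).map hg').symm.trans (Functor.map_comp _ _ _)))))
  refine ⟨ve k ≫ ca g.base a, ⟨?_, ?_⟩, ?_⟩
  · rw [Functor.map_comp, tot_ve, hk]
    exact ht₂
  · refine (assoc _ _ _).trans ((congrArg (ve k ≫ ·) h₁.symm).trans ?_)
    refine (assoc _ _ _).symm.trans (Eq.trans ?_ hg')
    exact congrArg (· ≫ _) ((ve_comp _ _).symm.trans (congrArg ve hk'))
  · rintro l ⟨hl, hl'⟩
    have hlb : l.base = g.base := (base_congr hl).trans hb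
    obtain ⟨l', hl₁, rfl⟩ := (car_ca g.base a).exists_lift l (𝟙 _)
      ((id_comp _).trans hlb.symm)
    obtain ⟨l', rfl⟩ := exists_ve l' hl₁
    rw [hu l' ⟨ve_inj ?_, ve_inj ?_⟩]
    · refine ((car_ca g.base a).tot p).hom_ext rfl ?_
      rw [← tot_ve, ← Functor.map_comp, hl]
      exact ht₂.symm
    · refine (car_ca g.base e).hom_ext rfl ?_
      refine ((congrArg (· ≫ _) (ve_comp _ _)).trans (assoc _ _ _)).trans ?_
      refine (congrArg (ve l' ≫ ·) h₁).trans ((assoc _ _ _).symm.trans ?_)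
      exact hl'.trans hg'.symm

lemma isIndexedFibration_of_hc (h₁ : ∀ X, IsFibration (StrongTrans.comp p X))
    (h₂ : ∀ ⦃X : K⦄ ⦃a e : E.fibre X⦄ (f : a ⟶ e), IsCart (StrongTrans.comp p X) f → HC p (ve f)) :
    IsIndexedFibration p where
  isFibration := h₁
  isCart_res y a e f hf := isCart_of_hc (((car_ca y e).hc p).of_comp (by
    rw [res_map]
    exact ((car_ca y a).hc p).trans (h₂ f hf)))

lemma preservesCart_of_hc {q : E' ⟶ D'} {F : E ⟶ E'} (hp : IsIndexedFibration p)
    (h : ∀ ⦃A B : ∫ᶜ E⦄ (u : A ⟶ B), HC p u → HC q ((tot F).map u)) : PreservesCart p q F :=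
  fun X a e f hf => isCart_of_hc (by
    rw [← tot_ve]
    exact h _ (hc_ve hp hf))

lemma PreservesCart.hc {q : E' ⟶ D'} {F : E ⟶ E'} (h : PreservesCart p q F)
    (hq : IsIndexedFibration q) {u : A ⟶ B} (hu : HC p u) : HC q ((tot F).map u) := by
  obtain ⟨i, hi, hi'⟩ := Car.factor_ca u
  obtain ⟨i, rfl⟩ := exists_ve i hi
  have h₁ : HC p (ve i) := ((car_ca u.base B.fiber).hc p).of_comp (by rwa [hi'])
  rw [← hi', Functor.map_comp, tot_ve]
  exact (hc_ve hq (h _ i (isCart_of_hc h₁))).trans (((car_ca _ _).tot F).hc q)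

lemma exists_hc (hp : IsIndexedFibration p) {C : ∫ᶜ D} {B : ∫ᶜ E} (t : C ⟶ (tot p).obj B) :
    ∃ (a : E.fibre C.base) (i : C ⟶ (tot p).obj (ob a)) (g : ob a ⟶ B), i.base = 𝟙 _ ∧ IsIso i ∧
      HC p g ∧ i ≫ (tot p).map g = t := by
  obtain ⟨t', ht, ht'⟩ := ((car_ca t.base B.fiber).tot p).exists_lift t (𝟙 _) (id_comp _)
  obtain ⟨t', rfl⟩ := exists_ve t' ht
  obtain ⟨a, θ, f, hf, hw⟩ := hp.isFibration C.base ((E.res t.base).obj B.fiber) C.fiber t'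
  refine ⟨a, ve θ.hom, ve f ≫ ca t.base B.fiber, rfl,
    (car_ve_iff.2 inferInstance).isIso_of_base (inferInstanceAs (IsIso (𝟙 _))),
    (hc_ve hp hf).trans ((car_ca _ _).hc p), ?_⟩
  rw [Functor.map_comp, tot_ve, ← ve_comp_assoc, hw]
  exact ht'

end

section

variable {J : GrothendieckTopology K}
  {E E' E'' D D' D'' : IndCat.{v, u, v', u'} K}

variable (J) in
/-- A property of arrows to `A` holds for sufficiently many cartesian arrows. -/
def LocAt (A : ∫ᶜ E) (P : ∀ ⦃Y : K⦄ ⦃a : E.fibre Y⦄, (ob a ⟶ A) → Prop) : Prop :=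
  Loc J (fun (Y : K) (f : Y ⟶ A.base) =>
    ∃ (a : E.fibre Y) (r : ob a ⟶ A), r.base = f ∧ Car r ∧ P r)

namespace LocAt

variable {A B : ∫ᶜ E} {P Q : ∀ ⦃Y : K⦄ ⦃a : E.fibre Y⦄, (ob a ⟶ A) → Prop}

lemma of_ca (h : Loc J (fun _ f => P (ca f A.fiber))) : LocAt J A P :=
  h.mono fun _ f hf => ⟨_, ca f A.fiber, rfl, car_ca _ _, hf⟩

lemma bind (hP : LocAt J A P) (h : ∀ ⦃Y : K⦄ ⦃a : E.fibre Y⦄ (r : ob a ⟶ A), Car r → P r →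
    LocAt J (ob a) (fun _ _ r' => Q (r' ≫ r))) : LocAt J A Q :=
  Loc.bind hP (by
    rintro Y f ⟨a, r, rfl, hr, hP⟩
    exact (h r hr hP).mono fun Z g ⟨a', r', hg, hr', hQ⟩ =>
      ⟨a', r' ≫ r, by rw [comp_base, hg], hr'.trans hr, hQ⟩)

lemma mono (hP : LocAt J A P) (h : ∀ ⦃Y : K⦄ ⦃a : E.fibre Y⦄ (r : ob a ⟶ A), Car r → P r → Q r) :
    LocAt J A Q :=
  Loc.mono hP fun _ _ ⟨a, r, h₁, h₂, h₃⟩ => ⟨a, r, h₁, h₂, h r h₂ h₃⟩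

lemma tot (F : E ⟶ E') {R : ∀ ⦃Y : K⦄ ⦃a : E'.fibre Y⦄, (ob a ⟶ (tot F).obj A) → Prop}
    (hP : LocAt J A P) (h : ∀ ⦃Y : K⦄ ⦃a : E.fibre Y⦄ (r : ob a ⟶ A), Car r → P r →
      R ((Fib.tot F).map r)) : LocAt J ((Fib.tot F).obj A) R :=
  Loc.mono hP fun Y _ ⟨a, r, h₁, h₂, h₃⟩ =>
    ⟨(StrongTrans.comp F Y).obj a, (Fib.tot F).map r, h₁, h₂.tot F, h r h₂ h₃⟩

lemma comap (F : E ⟶ E') {R : ∀ ⦃Y : K⦄ ⦃a : E'.fibre Y⦄, (ob a ⟶ (Fib.tot F).obj A) → Prop}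
    (hR : LocAt J ((Fib.tot F).obj A) R)
    (h : ∀ ⦃Y : K⦄ ⦃a a' : E'.fibre Y⦄ (k : ob a' ⟶ ob a) (r : ob a ⟶ (Fib.tot F).obj A), R r →
      R (k ≫ r)) :
    LocAt J A (fun _ _ r => R ((Fib.tot F).map r)) := by
  refine of_ca (Loc.mono hR ?_)
  rintro Y f ⟨a, r, hf, hr, hR⟩
  obtain ⟨k, -, hk⟩ := hr.exists_lift ((Fib.tot F).map (ca f A.fiber)) (𝟙 Y) (by
    rw [hf]
    exact id_comp f)
  rw [← hk]
  exact h k r hR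

lemma pull (hP : LocAt J A P) {C : ∫ᶜ E} (t : C ⟶ A) :
    LocAt J C (fun Y c s => ∃ (a : E.fibre Y) (r : ob a ⟶ A) (l : ob c ⟶ ob a),
      Car r ∧ P r ∧ l.base = 𝟙 Y ∧ l ≫ r = s ≫ t) := by
  refine of_ca ((Loc.pull hP t.base).mono ?_)
  rintro Y f ⟨a, r, hf, hr, hR⟩
  obtain ⟨l, hl, hl'⟩ := hr.exists_lift (ca f C.fiber ≫ t) (𝟙 Y) (by
    rw [hf]
    exact id_comp _)
  exact ⟨a, r, l, hr, hR, hl, hl'⟩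

end LocAt

lemma base_eq_of_tot (F : E ⟶ E') {A B : ∫ᶜ E} {m n : A ⟶ B} (h : (tot F).map m = (tot F).map n) :
    m.base = n.base := by
  have := base_congr h
  exact this

lemma isIso_tot (F : E ⟶ E') {A B : ∫ᶜ E} {m : A ⟶ B} (h : IsIso m) : IsIso ((tot F).map m) :=
  Functor.map_isIso _ _

lemma LocEq.locAt {A B : ∫ᶜ E} {m n : A ⟶ B} (h : LocEq J m n) :
    LocAt J A (fun _ _ r => r ≫ m = r ≫ n) := LocAt.of_ca h.2

lemma IsPre.eq_of_locAt (hE : IsPre J E) {A B : ∫ᶜ E} {m n : A ⟶ B} (hb : m.base = n.base)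
    (h : LocAt J A (fun _ _ r => r ≫ m = r ≫ n)) : m = n := hE.ext hb h

lemma LE.locAt_map {w : E ⟶ E'} (hw : LE J w) {A B : ∫ᶜ E} (φ : (tot w).obj A ⟶ (tot w).obj B) :
    LocAt J A (fun _ a r => ∃ n : ob a ⟶ B, (tot w).map n = (tot w).map r ≫ φ) :=
  LocAt.of_ca (hw.surj φ)

lemma LE.locAt {w : E ⟶ E'} (hw : LE J w) {C : ∫ᶜ E'}
    {P : ∀ ⦃Y : K⦄ ⦃a : E'.fibre Y⦄, (ob a ⟶ C) → Prop}
    (h : ∀ ⦃Y : K⦄ ⦃c : E.fibre Y⦄ (r : (tot w).obj (ob c) ⟶ C), Car r →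
      LocAt J (ob c) (fun _ _ r' => P ((tot w).map r' ≫ r))) : LocAt J C P :=
  LocAt.bind (P := fun Y a _ => ∃ c : E.fibre Y, (StrongTrans.comp w Y).obj c = a)
    ((hw.ess C.fiber).mono fun _ _ ⟨e, r, hf, hr⟩ => ⟨_, r, hf, hr, e, rfl⟩) (by
      rintro Y _ r hr ⟨c, rfl⟩
      exact (h r hr).tot w fun Z z r' hr' h' => h')

/-- A square of indexed functors commuting up to isomorphism, on Grothendieck constructions. -/
structure Square (w : E ⟶ E') (q : E' ⟶ D') (p : E ⟶ D) (k : D ⟶ D') where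
  iso (A : ∫ᶜ E) : (tot q).obj ((tot w).obj A) ≅ (tot k).obj ((tot p).obj A)
  base (A : ∫ᶜ E) : (iso A).hom.base = 𝟙 _
  nat {A B : ∫ᶜ E} (m : A ⟶ B) :
    (tot q).map ((tot w).map m) ≫ (iso B).hom = (iso A).hom ≫ (tot k).map ((tot p).map m)

lemma Square.nat_assoc {w : E ⟶ E'} {q : E' ⟶ D'} {p : E ⟶ D} {k : D ⟶ D'} (sq : Square w q p k)
    {A B : ∫ᶜ E} (m : A ⟶ B) {Z : ∫ᶜ D'} (h : (tot k).obj ((tot p).obj B) ⟶ Z) :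
    (tot q).map ((tot w).map m) ≫ (sq.iso B).hom ≫ h =
      (sq.iso A).hom ≫ (tot k).map ((tot p).map m) ≫ h := by
  rw [← assoc, sq.nat, assoc]

/-- The square underlying an isomorphism of composites. -/
def Square.of {w : E ⟶ E'} {q : E' ⟶ D'} {p : E ⟶ D} {k : D ⟶ D'}
    (e : w ≫ q ≅ p ≫ k) : Square w q p k :=
  have hi : ∀ A, IsIso (vAt e.hom A) := fun A => inferInstance
  { iso A := @asIso _ _ _ _ (vAt e.hom A) (hi A)
    base A := rfl
    nat m := by
      have := vAt_nat e.hom m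
      rw [tot_comp, tot_comp] at this
      exact this }

lemma HC.congr {X : IndCat.{v, u, v', u'} K} {r : D' ⟶ X} {w : E ⟶ E'} {q : E' ⟶ D'} {p : E ⟶ D}
    {k : D ⟶ D'} (sq : Square w q p k) {A B : ∫ᶜ E} {u : A ⟶ B}
    (h : HC r ((tot k).map ((tot p).map u))) : HC r ((tot q).map ((tot w).map u)) := by
  rw [(Iso.eq_comp_inv _).2 (sq.nat u)]
  exact ((hc_of_isIso _).trans h).trans (hc_of_isIso _)

section

variable (hE' : IsPre J E') (hD' : IsPre J D') {q : E' ⟶ D'}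

include hE' hD'

lemma hc_of_locAt {A B : ∫ᶜ E'} {u : A ⟶ B}
    (uniq : ∀ ⦃C : ∫ᶜ E'⦄ (k k' : C ⟶ A), (tot q).map k = (tot q).map k' → k ≫ u = k' ≫ u →
      LocAt J C (fun _ _ r => r ≫ k = r ≫ k'))
    (ex : ∀ ⦃C : ∫ᶜ E'⦄ (g : C ⟶ B) (t : (tot q).obj C ⟶ (tot q).obj A),
      t ≫ (tot q).map u = (tot q).map g → LocAt J C (fun _ c r => ∃ k : ob c ⟶ A,
        (tot q).map k = (tot q).map r ≫ t ∧ k ≫ u = r ≫ g)) : HC q u := by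
  have uniq' : ∀ ⦃C : ∫ᶜ E'⦄ (k k' : C ⟶ A), (tot q).map k = (tot q).map k' → k ≫ u = k' ≫ u →
      k = k' := fun C k k' h h' =>
    hE'.eq_of_locAt (base_eq_of_tot q h) (uniq k k' h h')
  refine (isCart_iff _ _).2 fun C g t ht => ?_
  have hloc := ex g t ht
  obtain ⟨k, hk, hk'⟩ := hE'.glue (A := C) (B := A) t.base
    (I := fun Y f => {x : Σ c : E'.fibre Y, (ob c ⟶ C) × (ob c ⟶ A) // x.2.1.base = f ∧ Car x.2.1 ∧
      (tot q).map x.2.2 = (tot q).map x.2.1 ≫ t ∧ x.2.2 ≫ u = x.2.1 ≫ g})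
    (fun _ _ i => i.1.1) (fun _ _ i => i.1.2.1) (fun _ _ i => i.1.2.2) (fun _ _ i => i.2.1)
    (fun _ _ i => i.2.2.1) (fun Y f i => by
      have := base_congr i.2.2.2.1
      rw [comp_base] at this
      exact this.trans (congrArg (· ≫ t.base) i.2.1))
    (fun Y Z f f' i j l hl => by
      refine uniq' _ _ ?_ ?_
      · rw [Functor.map_comp, i.2.2.2.1, j.2.2.2.1, ← hl, Functor.map_comp, assoc]
      · rw [assoc, i.2.2.2.2, j.2.2.2.2, ← hl, assoc])
    (Loc.mono hloc fun Y f ⟨c, r, hf, hr, k, h₁, h₂⟩ => ⟨⟨⟨c, r, k⟩, hf, hr, h₁, h₂⟩⟩)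
  have h₁ : (tot q).map k = t := hD'.eq_of_locAt hk (hloc.tot q fun Y c r hr h => by
    obtain ⟨l, h₁, h₂⟩ := h
    rw [← Functor.map_comp, hk' ⟨⟨c, r, l⟩, rfl, hr, h₁, h₂⟩, h₁])
  have h₂ : k ≫ u = g := hE'.eq_of_locAt (by
      have := base_congr ht
      rw [comp_base] at this ⊢
      rw [hk]
      exact this) (hloc.mono fun Y c r hr h => by
    obtain ⟨l, h₁, h₂⟩ := h
    rw [← assoc, hk' ⟨⟨c, r, l⟩, rfl, hr, h₁, h₂⟩, h₂])
  exact ⟨k, ⟨h₁, h₂⟩, fun l ⟨h₃, h₄⟩ => uniq' l k (h₃.trans h₁.symm) (h₄.trans h₂.symm)⟩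

lemma hc_of_locAt_dom {A B : ∫ᶜ E'} {u : A ⟶ B} (h : LocAt J A (fun _ _ r => HC q (r ≫ u))) :
    HC q u := by
  refine hc_of_locAt hE' hD' (fun C k k' h₁ h₂ => ?_) (fun C g t ht => ?_)
  · refine (h.pull k).mono ?_
    rintro Y c s hs ⟨a, r, l, hr, hu, hl, hl'⟩
    have hb : k.base = k'.base := base_eq_of_tot q h₁
    obtain ⟨m, hm, hm'⟩ := hr.exists_lift (s ≫ k') l.base (by
      rw [← comp_base, hl', comp_base, comp_base, hb])
    have : l = m := hu.hom_ext ((hr.tot q).hom_ext hm.symm (by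
      rw [← Functor.map_comp, ← Functor.map_comp, hl', hm', Functor.map_comp, Functor.map_comp,
        h₁])) (by rw [reassoc_of% hl', reassoc_of% hm', h₂])
    rw [← hl', ← hm', this]
  · have hb : t.base ≫ u.base = g.base := base_congr ht
    refine LocAt.of_ca ((Loc.pull h t.base).mono ?_)
    rintro Y f ⟨a, r, hf, hr, hu⟩
    obtain ⟨l, hl, hl'⟩ := (hr.tot q).exists_lift ((tot q).map (ca f C.fiber) ≫ t) (𝟙 Y) (by
      refine (id_comp _).trans ?_
      exact hf)
    obtain ⟨k, hk, hk'⟩ := hu.exists_lift (ca f C.fiber ≫ g) l (by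
      rw [Functor.map_comp, reassoc_of% hl', ht, Functor.map_comp])
    exact ⟨k ≫ r, by rw [Functor.map_comp, hk, hl'], by rw [assoc, hk']⟩

end

section

variable (hE' : IsPre J E') (hD' : IsPre J D') {w : E ⟶ E'} {q : E' ⟶ D'} {p : E ⟶ D} {k : D ⟶ D'}
  (hw : LE J w) (hk : LE J k) (sq : Square w q p k)

include hE' hD' hw hk sq

lemma HC.tot_of_le {A B : ∫ᶜ E} {u : A ⟶ B} (hu : HC p u) : HC q ((tot w).map u) := by
  refine hc_of_locAt hE' hD' (fun C m m' h₁ h₂ => ?_) (fun C g t ht => ?_)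
  · refine hw.locAt fun Y c r hr => ?_
    refine (hw.locAt_map (r ≫ m)).bind ?_
    rintro Y₁ c₁ r₁ - ⟨n, hn⟩
    refine (hw.locAt_map ((tot w).map r₁ ≫ r ≫ m')).bind ?_
    rintro Y₂ c₂ r₂ - ⟨n', hn'⟩
    have e : (tot w).map ((r₂ ≫ n) ≫ u) = (tot w).map (n' ≫ u) := by
      rw [Functor.map_comp, Functor.map_comp, Functor.map_comp, hn, hn']
      simp -proj only [assoc, h₂]
    have e' : (tot k).map ((tot p).map (r₂ ≫ n)) = (tot k).map ((tot p).map n') := by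
      rw [← cancel_epi (sq.iso _).hom, ← sq.nat, ← sq.nat]
      simp -proj only [Functor.map_comp, hn, hn', h₁]
    refine (hw.inj _ _ e).locAt.bind fun Y₃ c₃ r₃ _ h₃ => ?_
    have e'' : LocEq J ((tot p).map (r₃ ≫ r₂ ≫ n)) ((tot p).map (r₃ ≫ n')) := by
      rw [Functor.map_comp, Functor.map_comp (tot p) r₃]
      exact (hk.inj _ _ e').comp_left _
    have e₄ := LocAt.comap p (R := fun _ _ r => r ≫ (tot p).map (r₃ ≫ r₂ ≫ n) =
      r ≫ (tot p).map (r₃ ≫ n')) e''.locAt (fun Z a a' l r h => by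
        rw [assoc, assoc, h])
    refine e₄.mono fun Y₄ c₄ r₄ _ h₄ => ?_
    have h₅ : r₄ ≫ r₃ ≫ r₂ ≫ n = r₄ ≫ r₃ ≫ n' := hu.hom_ext
      (by rw [Functor.map_comp, h₄, ← Functor.map_comp]) (by simp -proj only [assoc] at h₃ ⊢; rw [h₃])
    have h₆ := congrArg (tot w).map h₅
    simp -proj only [Functor.map_comp, hn, hn'] at h₆
    simpa -proj only [Functor.map_comp, assoc] using h₆
  · refine hw.locAt fun Y c r hr => ?_
    refine (hw.locAt_map (r ≫ g)).bind ?_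
    rintro Y₁ c₁ r₁ - ⟨m, hm⟩
    let t' : (tot k).obj ((tot p).obj (ob c₁)) ⟶ (tot k).obj ((tot p).obj A) :=
      (sq.iso _).inv ≫ (tot q).map ((tot w).map r₁ ≫ r) ≫ t ≫ (sq.iso _).hom
    have h₂ := LocAt.comap p (R := fun Y a x => ∃ n : ob a ⟶ (tot p).obj A,
      (tot k).map n = (tot k).map x ≫ t') (hk.locAt_map t') (fun Z a a' l x ⟨n, hn⟩ =>
        ⟨l ≫ n, by rw [Functor.map_comp, hn, Functor.map_comp, assoc]⟩)
    refine h₂.bind ?_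
    rintro Y₂ c₂ r₂ - ⟨n, hn⟩
    have e : (tot k).map (n ≫ (tot p).map u) = (tot k).map ((tot p).map (r₂ ≫ m)) := by
      rw [← cancel_epi (sq.iso _).hom, ← sq.nat, Functor.map_comp, hn]
      simp -proj only [t', assoc]
      rw [← sq.nat_assoc, Iso.hom_inv_id_assoc, ← sq.nat, reassoc_of% ht]
      simp -proj only [Functor.map_comp, assoc, hm]
    have e₃ := LocAt.comap p (R := fun _ _ x => x ≫ n ≫ (tot p).map u =
      x ≫ (tot p).map (r₂ ≫ m)) (hk.inj _ _ e).locAt (fun Z a a' l r h => by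
        rw [assoc, h, assoc])
    refine e₃.mono fun Y₃ c₃ r₃ _ h₃ => ?_
    obtain ⟨x, hx, hx'⟩ := hu.exists_lift (r₃ ≫ r₂ ≫ m) ((tot p).map r₃ ≫ n) (by
      rw [assoc, h₃, ← Functor.map_comp])
    refine ⟨(tot w).map x, ?_, ?_⟩
    · rw [← cancel_mono (sq.iso _).hom, sq.nat, hx, Functor.map_comp, hn]
      simp -proj only [t', Functor.map_comp, assoc]
      rw [← sq.nat_assoc, ← sq.nat_assoc, Iso.hom_inv_id_assoc]
    · rw [← Functor.map_comp, hx']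
      simp -proj only [Functor.map_comp, hm, assoc]

lemma hc_tot_of_le (hp : IsIndexedFibration p) {F : E' ⟶ E''} {r : E'' ⟶ D''} (hE'' : IsPre J E'')
    (hD'' : IsPre J D'')
    (h : ∀ ⦃A B : ∫ᶜ E⦄ (g : A ⟶ B), HC p g → HC r ((tot F).map ((tot w).map g)))
    {A B : ∫ᶜ E'} {u : A ⟶ B} (hu : HC q u) : HC r ((tot F).map u) := by
  refine hc_of_locAt_dom hE'' hD'' ?_
  have h₁ : LocAt J A (fun Y a s => HC r ((tot F).map (s ≫ u))) := by
    refine hw.locAt fun Y a x hx => ?_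
    have h₁ := Loc.pull (hw.ess B.fiber) (x ≫ u).base
    have h₂ : LocAt J (ob a) (fun Z c s => ∃ (b : E.fibre Z)
        (y : (tot w).obj (ob b) ⟶ B) (l : (tot w).obj (ob c) ⟶ (tot w).obj (ob b)), Car y ∧
        l ≫ y = (tot w).map s ≫ x ≫ u) :=
      LocAt.of_ca (h₁.mono (by
        rintro Z f ⟨b, y, hf, hy⟩
        obtain ⟨l, -, hl⟩ := hy.exists_lift ((tot w).map (ca f a) ≫ x ≫ u) (𝟙 Z) (by
          rw [hf]
          exact id_comp _)
        exact ⟨b, y, l, hy, hl⟩))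
    refine h₂.bind ?_
    rintro Y₁ a₁ r₁ hr₁ ⟨b, y, v, hy, hv⟩
    refine (hw.locAt_map v).mono ?_
    rintro Y₂ a₂ r₂ hr₂ ⟨n, hn⟩
    have e : ((tot w).map (r₂ ≫ r₁) ≫ x) ≫ u = (tot w).map n ≫ y := by
      rw [Functor.map_comp, hn, assoc, assoc, assoc, hv]
    have hwn : HC q ((tot w).map n) := (hy.hc q).of_comp (by
      rw [← e]
      exact (((((hr₂.trans hr₁).tot w).trans hx).hc q).trans hu))
    obtain ⟨a', i, g, -, hi', hg, hig⟩ := exists_hc hp ((tot p).map n)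
    obtain ⟨z, hz, hz'⟩ := hg.exists_lift n i hig
    have hwz : HC q ((tot w).map z) := (hg.tot_of_le hE' hD' hw hk sq).of_comp (by
      rw [← Functor.map_comp, hz']
      exact hwn)
    have : IsIso ((tot w).map z) := hwz.isIso (by
      have hk' : IsIso ((tot k).map i) := isIso_tot k hi'
      have e := sq.nat z
      rw [← Iso.eq_comp_inv, hz] at e
      rw [e]
      exact @IsIso.comp_isIso _ _ _ _ _ _ _ (@IsIso.comp_isIso _ _ _ _ _ _ _ inferInstance hk')
        inferInstance)
    rw [e, ← hz', Functor.map_comp, Functor.map_comp, Functor.map_comp]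
    have := isIso_tot F this
    exact ((hc_of_isIso _).trans (h g hg)).trans ((hy.tot F).hc r)
  exact h₁.tot F fun Y a s _ hs => by rwa [← Functor.map_comp]

end

lemma exists_hc_of_loc (hE' : E'.IsStack J) (hD' : IsPre J D') {q : E' ⟶ D'} {U : ∫ᶜ D'}
    {e : ∫ᶜ E'} (t : U ⟶ (tot q).obj e)
    (h : Loc J (fun (Y : K) (f : Y ⟶ U.base) => ∃ (b : E'.fibre Y) (g : ob b ⟶ e)
      (j : (tot q).obj (ob b) ⟶ U), j.base = f ∧ Car j ∧ HC q g ∧ (tot q).map g = j ≫ t)) :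
    ∃ (a : E'.fibre U.base) (i : (tot q).obj (ob a) ⟶ U) (g : ob a ⟶ e), i.base = 𝟙 _ ∧ IsIso i ∧
      HC q g ∧ (tot q).map g = i ≫ t := by
  have hp := isPre_of_isStack hE'
  let Ch : ∀ ⦃Y : K⦄, (Y ⟶ U.base) → Type _ := fun Y f =>
    {x : Σ b : E'.fibre Y, (ob b ⟶ e) × ((tot q).obj (ob b) ⟶ U) //
      x.2.2.base = f ∧ Car x.2.2 ∧ HC q x.2.1 ∧ (tot q).map x.2.1 = x.2.2 ≫ t}
  have loc : Loc J (fun Y f => Nonempty (Ch f)) :=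
    h.mono fun Y f ⟨b, g, j, h₁, h₂, h₃, h₄⟩ => ⟨⟨⟨b, g, j⟩, h₁, h₂, h₃, h₄⟩⟩
  let S : Sieve U.base :=
    { arrows := fun Y f => Nonempty (Ch f)
      downward_closed := by
        rintro Y Z f ⟨⟨⟨b, g, j⟩, h₁, h₂, h₃, h₄⟩⟩ k
        exact ⟨⟨⟨(E'.res k).obj b, ca k b ≫ g, (tot q).map (ca k b) ≫ j⟩,
          congrArg (k ≫ ·) h₁, ((car_ca k b).tot q).trans h₂, ((car_ca k b).hc q).trans h₃, by
            rw [Functor.map_comp, h₄, assoc]⟩⟩ }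
  have hS : S ∈ J U.base := loc.sieve_mem fun _ _ h => h
  have hT : ∀ ⦃Y Z : K⦄ ⦃f : Y ⟶ U.base⦄ ⦃f' : Z ⟶ U.base⦄ (c : Ch f) (c' : Ch f') (h : Z ⟶ Y),
      h ≫ f = f' → ∃ T : ob c'.1.1 ⟶ ob c.1.1, T.base = h ∧ Car T ∧
        T ≫ c.1.2.1 = c'.1.2.1 ∧ (tot q).map T ≫ c.1.2.2 = c'.1.2.2 := by
    rintro Y Z f f' ⟨⟨b, g, j⟩, h₁, h₂, h₃, h₄⟩ ⟨⟨b', g', j'⟩, h₁', h₂', h₃', h₄'⟩ h hh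
    obtain ⟨k, hk, hk'⟩ := h₂.exists_lift j' h (by
      rw [h₁, h₁']
      exact hh)
    have hkc : Car k := h₂.of_comp (by rwa [hk'])
    obtain ⟨T, hT, hT'⟩ := h₃.exists_lift g' k (by
      rw [h₄, reassoc_of% hk', h₄'])
    have hTc : HC q T := h₃.of_comp (by rwa [hT'])
    refine ⟨T, ?_, hTc.car (by rwa [hT]), hT', by rw [hT, hk']⟩
    have := base_congr hT
    exact this.trans hk
  choose T hTb hTc hTg hTj using hT
  have uniq : ∀ ⦃Y Z : K⦄ ⦃f : Y ⟶ U.base⦄ ⦃f' : Z ⟶ U.base⦄ (c : Ch f) (c' : Ch f')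
      (l l' : ob c'.1.1 ⟶ ob c.1.1), l.base = l'.base → l ≫ c.1.2.1 = l' ≫ c.1.2.1 →
      (tot q).map l ≫ c.1.2.2 = (tot q).map l' ≫ c.1.2.2 → l = l' := fun Y Z f f' c c' l l' h₁ h₂ h₃ =>
    c.2.2.2.1.hom_ext (c.2.2.1.hom_ext h₁ h₃) h₂
  obtain ⟨a, arr, hab, hac, ha⟩ := DD.exists_arr (E := E') (S := S) (Ch := Ch) (fun Y f => Iff.rfl)
    (fun Y f c => c.1.1) T hTb hTc
    (fun Y Z W f g k c c' c'' h e h' e' h'' e'' hh => uniq c c'' _ _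
      (by rw [comp_base, hTb, hTb, hTb, hh])
      (by rw [assoc, hTg, hTg, hTg])
      (by rw [Functor.map_comp, assoc, hTj, hTj, hTj])) ((isStack_iff.1 hE' S hS).2)
  obtain ⟨G, hG, hG'⟩ := hp.glue (A := ob a) (B := e) t.base (I := Ch)
    (fun Y f c => c.1.1) (fun Y f c => arr c) (fun Y f c => c.1.2.1) (fun _ _ c => hab c)
    (fun _ _ c => hac c) (fun Y f c => by
      have := base_congr c.2.2.2.2
      rw [comp_base, c.2.1] at this
      exact this)
    (fun Y Z f f' i j l hl => by
      have hb : l.base ≫ f = f' := by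
        have := base_congr hl
        rwa [comp_base, hab, hab] at this
      have : l = T i j l.base hb := (hac i).hom_ext (hTb i j _ hb).symm (hl.trans (ha i j _ hb).symm)
      rw [this, hTg]) loc
  obtain ⟨I, hI, hI'⟩ := hD'.glue (A := (tot q).obj (ob a)) (B := U) (𝟙 _) (I := Ch)
    (fun Y f c => (StrongTrans.comp q Y).obj c.1.1) (fun Y f c => (tot q).map (arr c))
    (fun Y f c => c.1.2.2) (fun _ _ c => hab c)
    (fun _ _ c => (hac c).tot q) (fun Y f c => c.2.1.trans (comp_id f).symm)
    (fun Y Z f f' i j l hl => by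
      have hb : l.base ≫ f = f' := by
        have := base_congr hl
        rw [comp_base, tot_base, tot_base, hab, hab] at this
        exact this
      have : l = (tot q).map (T i j l.base hb) := ((hac i).tot q).hom_ext (hTb i j _ hb).symm
        (hl.trans (by rw [← Functor.map_comp, ha i j _ hb]))
      rw [this, hTj]) loc
  have hIc : Car I := hD'.car I (loc.mono fun Y f ⟨c⟩ => ⟨_, (tot q).map (arr c), hab c,
    (hac c).tot q, by
      rw [hI']
      exact c.2.2.1⟩)
  refine ⟨a, I, G, hI, hIc.isIso_of_base (by rw [hI]; exact inferInstanceAs (IsIso (𝟙 U.base))),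
    hc_of_locAt_dom hp hD' (loc.mono fun Y f ⟨c⟩ => ⟨_, arr c, hab c, hac c, by
      beta_reduce
      rw [hG']
      exact c.2.2.2.1⟩), ?_⟩
  refine hD'.eq_of_locAt ?_ (loc.mono fun Y f ⟨c⟩ => ⟨_, (tot q).map (arr c), hab c,
    (hac c).tot q, ?_⟩)
  · rw [comp_base, hI]
    exact hG.trans (id_comp _).symm
  · beta_reduce
    rw [← Functor.map_comp, hG', c.2.2.2.2, ← hI' c, assoc]

lemma exists_hc_of_le (hE' : E'.IsStack J) (hD' : IsPre J D') {w : E ⟶ E'} {q : E' ⟶ D'}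
    {p : E ⟶ D} {k : D ⟶ D'} (hw : LE J w) (hk : LE J k) (sq : Square w q p k)
    (hp : IsIndexedFibration p) {U : ∫ᶜ D'} {e : ∫ᶜ E'} (t : U ⟶ (tot q).obj e) :
    ∃ (a : E'.fibre U.base) (i : (tot q).obj (ob a) ⟶ U) (g : ob a ⟶ e), i.base = 𝟙 _ ∧ IsIso i ∧
      HC q g ∧ (tot q).map g = i ≫ t := by
  have hE := isPre_of_isStack hE'
  have h₁ : LocAt J U (fun Y _ r => ∃ (b : E'.fibre Y) (g : ob b ⟶ e)
      (j : (tot q).obj (ob b) ⟶ U), j.base = r.base ∧ Car j ∧ HC q g ∧ (tot q).map g = j ≫ t) := by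
    refine hk.locAt fun Y d r hr => ?_
    have h₂ : LocAt J (ob d) (fun Z d₁ r₁ => ∃ (c : E.fibre Z) (y : (tot w).obj (ob c) ⟶ e)
        (l : (tot k).obj (ob d₁) ⟶ (tot q).obj ((tot w).obj (ob c))), Car y ∧
        l ≫ (tot q).map y = (tot k).map r₁ ≫ r ≫ t) :=
      LocAt.of_ca ((Loc.pull (hw.ess e.fiber) (r ≫ t).base).mono (by
        rintro Z f ⟨c, y, hf, hy⟩
        obtain ⟨l, -, hl⟩ := (hy.tot q).exists_lift ((tot k).map (ca f d) ≫ r ≫ t) (𝟙 Z) (by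
          rw [tot_base, hf]
          exact id_comp _)
        exact ⟨c, y, l, hy, hl⟩))
    refine h₂.bind ?_
    rintro Y₁ d₁ r₁ hr₁ ⟨c, y, l, hy, hl⟩
    refine (hk.locAt_map (l ≫ (sq.iso _).hom)).mono ?_
    rintro Y₂ d₂ r₂ hr₂ ⟨n, hn⟩
    obtain ⟨a, i, g, hib, hi, hg, hig⟩ := exists_hc hp n
    have hib' : (inv i).base = 𝟙 Y₂ := base_inv (IsIso.inv_hom_id i)
      ((congrArg (· ≫ 𝟙 Y₂) hib).trans (id_comp _))
    have hg' := hg.tot_of_le hE hD' hw hk sq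
    refine ⟨(StrongTrans.comp w Y₂).obj a, (tot w).map g ≫ y,
      (sq.iso (ob a)).hom ≫ (tot k).map (inv i) ≫ (tot k).map (r₂ ≫ r₁) ≫ r, ?_, ?_,
      hg'.trans (hy.hc q), ?_⟩
    · rw [comp_base, comp_base, sq.base, tot_base, hib']
      exact (id_comp _).trans (id_comp _)
    · have := isIso_tot k (m := inv i) inferInstance
      exact (car_of_isIso _).trans ((car_of_isIso _).trans (((hr₂.trans hr₁).tot k).trans hr))
    · have e₁ : (tot k).map (r₂ ≫ r₁) ≫ r ≫ t =
          (tot k).map n ≫ (sq.iso _).inv ≫ (tot q).map y := by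
        rw [hn, Functor.map_comp, assoc, ← hl]
        simp -proj only [assoc, Iso.hom_inv_id_assoc]
      have e₂ : (tot q).map ((tot w).map g) =
          (sq.iso _).hom ≫ (tot k).map ((tot p).map g) ≫ (sq.iso _).inv := by
        rw [← assoc, Iso.eq_comp_inv, sq.nat]
      have e₃ : (tot p).map g = inv i ≫ n := by rw [IsIso.eq_inv_comp, hig]
      rw [Functor.map_comp, e₂, e₃, Functor.map_comp]
      simp -proj only [assoc, e₁]
  exact exists_hc_of_loc hE' hD' t (Loc.mono h₁ fun Y f ⟨_, r, hf, _, b, g, j, h₁, h₂⟩ =>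
    ⟨b, g, j, h₁.trans hf, h₂⟩)

lemma isIndexedFibration_of_exists_hc {p : E ⟶ D}
    (h : ∀ ⦃U : ∫ᶜ D⦄ ⦃e : ∫ᶜ E⦄ (t : U ⟶ (tot p).obj e), ∃ (a : E.fibre U.base)
      (i : (tot p).obj (ob a) ⟶ U) (g : ob a ⟶ e), i.base = 𝟙 _ ∧ IsIso i ∧ HC p g ∧
        (tot p).map g = i ≫ t) : IsIndexedFibration p := by
  have h' : ∀ ⦃X : K⦄ (e : E.fibre X) (b : D.fibre X) (t : b ⟶ (StrongTrans.comp p X).obj e),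
      ∃ (a : E.fibre X) (i : (StrongTrans.comp p X).obj a ⟶ b) (g : a ⟶ e), IsIso i ∧
        HC p (ve g) ∧ (StrongTrans.comp p X).map g = i ≫ t := by
    intro X e b t
    obtain ⟨a, i, g, hi, hi', hg, hg'⟩ := h (U := ob b) (e := ob e) (ve t)
    obtain ⟨i, rfl⟩ := exists_ve (E := D) (a := (StrongTrans.comp p X).obj a) (b := b) i hi
    have hb : g.base = 𝟙 X := by
      have := base_congr hg'
      exact this.trans (id_comp _)
    obtain ⟨g, rfl⟩ := exists_ve g hb
    exact ⟨a, i, g, isIso_of_ve hi', hg, ve_inj ((tot_ve p g).symm.trans (hg'.trans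
      (ve_comp i t).symm))⟩
  refine isIndexedFibration_of_hc (fun X e b t => ?_) (fun X a e f hf => ?_)
  · obtain ⟨a, i, g, hi, hg, hg'⟩ := h' e b t
    refine ⟨a, (asIso i).symm, g, isCart_of_hc hg, ?_⟩
    rw [hg']
    exact IsIso.inv_hom_id_assoc i t
  · obtain ⟨a', i, g, hi, hg, hg'⟩ := h' e _ ((StrongTrans.comp p X).map f)
    obtain ⟨k, ⟨hk, hk'⟩, -⟩ := (isCart_iff _ _).1 hf g i hg'.symm
    obtain ⟨l, ⟨hl, hl'⟩, -⟩ := (isCart_iff _ _).1 (isCart_of_hc hg) f (inv i) (by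
      rw [hg', IsIso.inv_hom_id_assoc])
    have hlk : l ≫ k = 𝟙 _ := hf.ext (by
      rw [Functor.map_comp, hl, hk, IsIso.inv_hom_id, CategoryTheory.Functor.map_id]) (by
      rw [assoc, hk', hl', id_comp])
    have hkl : k ≫ l = 𝟙 _ := (isCart_of_hc hg).ext (by
      rw [Functor.map_comp, hl, hk, IsIso.hom_inv_id, CategoryTheory.Functor.map_id]) (by
      rw [assoc, hl', hk', id_comp])
    have : IsIso l := ⟨k, hlk, hkl⟩
    rw [← hl', ve_comp]
    exact (hc_of_isIso _).trans hg

end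

section

variable {J : GrothendieckTopology K}

lemma preservesFibrations_of_le {s : IndCat.{v, u, v', u'} K ⥤ᵖ St.{v, u, v', u'} J}
    (σ : Biadjunction s (stIncl J)) (hσ : ∀ E, LE J (σ.unit.app E)) :
    PreservesFibrations (fibClass K) (fibClass K) (s.comp (stIncl J)) := by
  have hst : ∀ E, ((s.comp (stIncl J)).obj E).IsStack J := fun E => (s.obj E).2
  have hpre : ∀ E, IsPre J ((s.comp (stIncl J)).obj E) := fun E => isPre_of_isStack (hst E)
  have sq : ∀ {E D : IndCat.{v, u, v', u'} K} (p : E ⟶ D),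
      Square (σ.unit.app E) ((s.comp (stIncl J)).map p) p (σ.unit.app D) := fun p =>
    Square.of (σ.unit.naturality p).symm
  have hfib : ∀ {E D : IndCat.{v, u, v', u'} K} (p : E ⟶ D), IsIndexedFibration p →
      IsIndexedFibration ((s.comp (stIncl J)).map p) := fun p hp =>
    isIndexedFibration_of_exists_hc fun U e t =>
      exists_hc_of_le (hst _) (hpre _) (hσ _) (hσ _) (sq p) hp t
  refine ⟨hfib, fun {D p q} F => ?_⟩
  refine preservesCart_of_hc (hfib p.proj p.fib) fun A B u hu => ?_
  refine hc_tot_of_le (hpre _) (hpre _) (hσ _) (hσ _) (sq p.proj) p.fib (hpre _) (hpre _) ?_ hu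
  intro A B g hg
  exact ((PreservesCart.hc F.cart q.fib hg).tot_of_le (hpre _) (hpre _) (hσ _) (hσ _)
    (sq q.proj)).congr (sq F.hom)

lemma preservesCart_of_isEquiv {E E' D : IndCat.{v, u, v', u'} K} {p : E ⟶ D} {q : E' ⟶ D}
    (hp : IsIndexedFibration p) {F : E ⟶ E'} (hF : IsEquiv F) (e : F ≫ q ≅ p) :
    PreservesCart p q F :=
  preservesCart_of_hc hp fun _ _ _ hu =>
    hu.tot_of_le (isPre_of_isStack (isStack_trivial E')) (isPre_of_isStack (isStack_trivial D))
      (LE.of_isEquiv hF) (LE.of_isEquiv (IsEquiv.id D)) (Square.of (e ≪≫ (ρ_ p).symm))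

end

open FibOver Limits CategoricalPullback

section

lemma comp_cancel {C : Type*} [Category* C] {a b c d : C} (y : a ⟶ b) (z : b ⟶ c) {i : c ⟶ d}
    {n : d ⟶ c} (h : i ≫ n = 𝟙 c) : (y ≫ z ≫ i) ≫ n = y ≫ z := by
  simp [h]

section

variable {D D' : IndCat.{v, u, v', max u' v'} K}

section

variable (η : D ⟶ D') (q : FibOver D')

/-- The second projection of the pseudopullback. -/
def bSnd : bTotal η q ⟶ q.total :=
  mkTrans (A := bTotal η q) (B := q.total) (fun _ => CategoricalPullback.π₂ _ _)
    (fun _ => Iso.refl _)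
    (fun _ _ => id_comp _)
    (fun f g k hk x => (id_comp _).trans (Eq.symm
      ((congrArg (_ ≫ ·) ((id_comp _).trans (CategoryTheory.Functor.map_id _ _))).trans
        ((comp_id _).trans
          (congrArg Hom.snd (bTotal_resComp f g k hk x))))))

lemma bIso_nat {X Y : K} (f : Y ⟶ X) (x : bFib η q X) :
    ((bRes f).obj x).iso.hom ≫ (StrongTrans.nat (bSnd η q ≫ q.proj) f).hom.app x =
      (StrongTrans.nat (bProj η q ≫ η) f).hom.app x ≫ (D'.res f).map x.iso.hom := by
  have h₁ : (StrongTrans.nat (bSnd η q ≫ q.proj) f).hom.app x =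
      (StrongTrans.nat q.proj f).hom.app x.snd := by
    refine (StrongTrans.comp_nat_app (bSnd η q) q.proj f x).trans ?_
    exact (congrArg (· ≫ _) (CategoryTheory.Functor.map_id _ _)).trans (id_comp _)
  have h₂ : (StrongTrans.nat (bProj η q ≫ η) f).hom.app x = (StrongTrans.nat η f).hom.app x.fst := by
    refine (StrongTrans.comp_nat_app (bProj η q) η f x).trans ?_
    exact (congrArg (· ≫ _) (CategoryTheory.Functor.map_id _ _)).trans (id_comp _)
  have h₃ : (StrongTrans.nat q.proj f).inv.app x.snd ≫ (StrongTrans.nat q.proj f).hom.app x.snd =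
      𝟙 _ := Iso.inv_hom_id_app _ _
  rw [bRes_iso]
  exact (congrArg (_ ≫ ·) h₁).trans ((comp_cancel _ _ h₃).trans (congrArg (· ≫ _) h₂.symm))

/-- The square of the pseudopullback. -/
def bIso : bProj η q ≫ η ≅ bSnd η q ≫ q.proj :=
  mkModIso (F := bProj η q ≫ η) (G := bSnd η q ≫ q.proj)
    (fun X => NatIso.ofComponents (fun x => (x : bFib η q X).iso) (fun k => k.w))
    (fun f x => bIso_nat η q f x)

lemma preservesCart_bSnd : PreservesCart (bProj η q) q.proj (bSnd η q) :=
  fun X _ _ f hf => isCart_snd (q.fib.isFibration X) f hf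

end

variable {η : D ⟶ D'} {q : FibOver D'} {p : FibOver D}

lemma bObj_hom₂_ext {f g : p ⟶ bObj η q} {α β : f ⟶ g}
    (h : ∀ X a, Hom.snd ((StrongTrans.Hom.comp α.hom X).app a) =
      Hom.snd ((StrongTrans.Hom.comp β.hom X).app a)) : α = β := by
  refine Slice.hom₂_ext (hom₂_ext fun X a => CategoricalPullback.hom_ext ?_ (h X a))
  have h₁ : ∀ γ : f ⟶ g, Hom.fst ((StrongTrans.Hom.comp γ.hom X).app a) ≫
      (phi g X a).hom = (phi f X a).hom := fun γ =>
    congrArg (fun t : f.hom ≫ bProj η q ⟶ p.proj => (StrongTrans.Hom.comp t X).app a) γ.w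
  exact (cancel_mono (phi g X a).hom).1 ((h₁ α).trans (h₁ β).symm)

section

variable (G : p.total ⟶ q.total) (θ : p.proj ≫ η ≅ G ≫ q.proj)

/-- The functor to the pseudopullback induced by a square. -/
abbrev bLiftApp (X : K) : p.total.fibre X ⥤ bFib η q X where
  obj a := ⟨(pr p X).obj a, (StrongTrans.comp G X).obj a, (compIso θ X).app a⟩
  map k := ⟨(pr p X).map k, (StrongTrans.comp G X).map k, (compIso θ X).hom.naturality k⟩
  map_id _ := CategoricalPullback.hom_ext (CategoryTheory.Functor.map_id _ _)
    (CategoryTheory.Functor.map_id _ _)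
  map_comp _ _ := CategoricalPullback.hom_ext (Functor.map_comp _ _ _) (Functor.map_comp _ _ _)

lemma bLift_nat_w {X Y : K} (f : Y ⟶ X) (a : p.total.fibre X) :
    (StrongTrans.comp η Y).map ((StrongTrans.nat p.proj f).hom.app a) ≫
      ((bRes f).obj ((bLiftApp G θ X).obj a)).iso.hom =
    ((bLiftApp G θ Y).obj ((p.total.res f).obj a)).iso.hom ≫
      (pr q Y).map ((StrongTrans.nat G f).hom.app a) := by
  have h := StrongTrans.Hom.nat θ.hom f a
  rw [StrongTrans.comp_nat_app, StrongTrans.comp_nat_app] at h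
  have h₁' : (StrongTrans.nat q.proj f).inv.app ((StrongTrans.comp G X).obj a) ≫
    (StrongTrans.nat q.proj f).hom.app ((StrongTrans.comp G X).obj a) = 𝟙 _ := Iso.inv_hom_id_app _ _
  rw [bRes_iso]
  refine (cancel_mono ((StrongTrans.nat q.proj f).hom.app _)).1
    (Eq.trans ?_ ((assoc _ _ _).trans h).symm)
  exact (assoc _ _ _).trans ((congrArg (_ ≫ ·) (comp_cancel _ _ h₁')).trans
    (assoc _ _ _).symm)

/-- The indexed functor to a pseudopullback induced by a square. -/
def bLiftTrans : p.total ⟶ bTotal η q :=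
  mkTrans (A := p.total) (B := bTotal η q) (bLiftApp G θ)
    (fun f => NatIso.ofComponents (fun a => mkIso
      ((StrongTrans.nat p.proj f).app a) ((StrongTrans.nat G f).app a) (bLift_nat_w G θ f a))
      (fun k => CategoricalPullback.hom_ext ((StrongTrans.nat p.proj f).hom.naturality k)
        ((StrongTrans.nat G f).hom.naturality k)))
    (fun X a => CategoricalPullback.hom_ext (StrongTrans.nat_id p.proj X a)
      (StrongTrans.nat_id G X a))
    (fun f g k hk a => by
      have h := bTotal_resComp f g k hk ((bLiftApp G θ _).obj a)
      exact CategoricalPullback.hom_ext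
        ((congrArg (_ ≫ ·) (congrArg Hom.fst h)).trans
          (StrongTrans.nat_comp p.proj f g k hk a))
        ((congrArg (_ ≫ ·) (congrArg Hom.snd h)).trans
          (StrongTrans.nat_comp G f g k hk a)))

def bLift (hG : PreservesCart p.proj q.proj G) : p ⟶ bObj η q where
  hom := bLiftTrans G θ
  iso := mkModIso (F := bLiftTrans G θ ≫ bProj η q) (G := p.proj) (fun _ => Iso.refl _)
    (fun f a => by
      have h : (StrongTrans.nat (bLiftTrans G θ ≫ bProj η q) f).hom.app a =
          (StrongTrans.nat p.proj f).hom.app a :=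
        (StrongTrans.comp_nat_app (bLiftTrans G θ) (bProj η q) f a).trans (comp_id _)
      refine (id_comp _).trans (Eq.symm ?_)
      exact (congrArg (_ ≫ ·) (CategoryTheory.Functor.map_id (D.res f) _)).trans
        ((comp_id _).trans h))
  cart := fun X _ _ f hf => isCart_π₁ _ (hG X f hf)

end

lemma phi_hom_nat {p q : FibOver D} (F : p ⟶ q) {X Y : K} (f : Y ⟶ X) (a : p.total.fibre X) :
    (phi F Y ((p.total.res f).obj a)).hom ≫ (StrongTrans.nat p.proj f).hom.app a =
      ((pr q Y).map ((StrongTrans.nat F.hom f).hom.app a) ≫ (StrongTrans.nat q.proj f).hom.app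
        ((StrongTrans.comp F.hom X).obj a)) ≫ (D.res f).map (phi F X a).hom :=
  (StrongTrans.Hom.nat F.iso.hom f a).trans
    (congrArg (· ≫ _) (StrongTrans.comp_nat_app F.hom q.proj f a))

lemma square_nat {A B A' B' : IndCat.{v, u, v', u'} K} {F : A ⟶ B} {w' : B ⟶ B'} {w : A ⟶ A'}
    {F' : A' ⟶ B'} (N : F ≫ w' ≅ w ≫ F') {X Y : K} (f : Y ⟶ X) (a : A.fibre X) :
    (StrongTrans.Hom.comp N.hom Y).app ((A.res f).obj a) ≫
      (StrongTrans.comp F' Y).map ((StrongTrans.nat w f).hom.app a) ≫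
        (StrongTrans.nat F' f).hom.app ((StrongTrans.comp w X).obj a) =
    ((StrongTrans.comp w' Y).map ((StrongTrans.nat F f).hom.app a) ≫
      (StrongTrans.nat w' f).hom.app ((StrongTrans.comp F X).obj a)) ≫
        (B'.res f).map ((StrongTrans.Hom.comp N.hom X).app a) :=
  (congrArg (_ ≫ ·) (StrongTrans.comp_nat_app w F' f a).symm).trans
    ((StrongTrans.Hom.nat N.hom f a).trans
      (congrArg (· ≫ _) (StrongTrans.comp_nat_app F w' f a)))

section

variable {q' : FibOver D'} {p₂ : FibOver D} {G : p.total ⟶ q.total} {θ : p.proj ≫ η ≅ G ≫ q.proj}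
  {hG : PreservesCart p.proj q.proj G} {G' : p₂.total ⟶ q'.total}
  {θ' : p₂.proj ≫ η ≅ G' ≫ q'.proj} {hG' : PreservesCart p₂.proj q'.proj G'} (F : p ⟶ p₂)
  (F' : q ⟶ q') (N : F.hom ≫ G' ≅ G ≫ F'.hom)
  (hN : ∀ X a, (StrongTrans.comp η X).map (phi F X a).hom ≫ ((compIso θ X).app a).hom ≫
    (phi F' X ((StrongTrans.comp G X).obj a)).inv =
      ((compIso θ' X).app ((StrongTrans.comp F.hom X).obj a)).hom ≫
        (pr q' X).map ((StrongTrans.Hom.comp N.hom X).app a))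

/-- The components of `bLiftNat`. -/
def bLiftNatApp (X : K) (a : p.total.fibre X) :
    (bLiftApp G' θ' X).obj ((StrongTrans.comp F.hom X).obj a) ≅
      (bMapApp F' X).obj ((bLiftApp G θ X).obj a) :=
  mkIso (phi F X a) ((compIso N X).app a) (hN X a)

lemma bLiftNat_nat {X Y : K} (f : Y ⟶ X) (a : p.total.fibre X) :
    (bLiftNatApp F F' N hN Y ((p.total.res f).obj a)).hom ≫
      (StrongTrans.nat (bLiftTrans G θ ≫ bMapTrans F') f).hom.app a =
    (StrongTrans.nat (F.hom ≫ bLiftTrans G' θ') f).hom.app a ≫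
      (bRes f).map (bLiftNatApp F F' N hN X a).hom := by
  have h₁ := StrongTrans.comp_nat_app (bLiftTrans G θ) (bMapTrans F') f a
  have h₂ := StrongTrans.comp_nat_app F.hom (bLiftTrans G' θ') f a
  refine CategoricalPullback.hom_ext ?_ ?_
  · have h₃ := congrArg Hom.fst h₁
    have h₄ := congrArg Hom.fst h₂
    refine (congrArg (_ ≫ ·) (h₃.trans (comp_id _))).trans ?_
    exact (phi_hom_nat F f a).trans (congrArg (· ≫ _) h₄.symm)
  · have h₃ := congrArg Hom.snd h₁
    have h₄ := congrArg Hom.snd h₂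
    exact (congrArg (_ ≫ ·) h₃).trans ((square_nat N f a).trans (congrArg (· ≫ _) h₄.symm))

/-- Arrows to base changes induced by squares are natural. -/
def bLiftNat : F ≫ bLift G' θ' hG' ≅ bLift G θ hG ≫ bMap η F' :=
  Slice.isoMk (mkModIso (F := F.hom ≫ bLiftTrans G' θ') (G := bLiftTrans G θ ≫ bMapTrans F')
    (fun X => NatIso.ofComponents (fun a => bLiftNatApp F F' N hN X a)
      (fun k => CategoricalPullback.hom_ext
        ((compIso F.iso X).hom.naturality k) ((compIso N X).hom.naturality k)))
    (fun f a => bLiftNat_nat F F' N hN f a)) (hom₂_ext fun X a => by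
    have e : (phi F X a).hom ≫ 𝟙 _ ≫ 𝟙 _ ≫ 𝟙 _ = 𝟙 _ ≫ 𝟙 _ ≫ (phi F X a).hom := by simp
    exact e)

end

end

section

variable {J : GrothendieckTopology K}
  {s : IndCat.{v, u, v', max u' v'} K ⥤ᵖ St.{v, u, v', max u' v'} J}
  (hs : PreservesFibrations (fibClass K) (fibClass K) (s.comp (stIncl J)))
  (σ : Biadjunction s (stIncl J)) {D : IndCat.{v, u, v', max u' v'} K}
  (hσ : ∀ E, LE J (σ.unit.app E))

include hσ in
lemma preservesCart_unit (p : FibOver D) :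
    PreservesCart p.proj ((s.comp (stIncl J)).map p.proj) (σ.unit.app p.total) := by
  have hpre : ∀ E, IsPre J ((s.comp (stIncl J)).obj E) := fun E => isPre_of_isStack (s.obj E).2
  exact preservesCart_of_hc p.fib fun _ _ _ hu => hu.tot_of_le (hpre _) (hpre _) (hσ _) (hσ _)
    (Square.of (σ.unit.naturality p.proj).symm)

/-- The unit of the adjunction between stackification and pseudopullback of fibrations. -/
def sUnitApp (p : FibOver D) : p ⟶ (iOver σ D).obj ((sOver s hs D).obj p) :=
  bLift (η := σ.unit.app D) (q := (Slice.mapSlice (s.comp (stIncl J)) hs D).obj p)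
    (σ.unit.app p.total) (σ.unit.naturality p.proj) (preservesCart_unit σ hσ p)

lemma sUnitNat_aux {p q : FibOver D} (F : p ⟶ q) :
    F.iso.hom ▷ σ.unit.app D ≫ (σ.unit.naturality p.proj).hom ≫ σ.unit.app p.total ◁
      ((s.comp (stIncl J)).map₂ F.iso.inv ≫ ((s.comp (stIncl J)).mapComp F.hom q.proj).hom) =
    (α_ _ _ _).hom ≫ F.hom ◁ (σ.unit.naturality q.proj).hom ≫ (α_ _ _ _).inv ≫
      (σ.unit.naturality F.hom).hom ▷ (s.comp (stIncl J)).map q.proj ≫ (α_ _ _ _).hom := by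
  have h₁ := σ.unit.naturality_naturality F.iso.hom
  have h₂ := σ.unit.naturality_comp F.hom q.proj
  have h₃ : (Pseudofunctor.id (IndCat K)).map₂ F.iso.hom ▷ σ.unit.app D = F.iso.hom ▷ σ.unit.app D :=
    rfl
  rw [h₃] at h₁
  have h₄ : ((Pseudofunctor.id (IndCat K)).mapComp F.hom q.proj).hom ▷ σ.unit.app D = 𝟙 _ :=
    id_whiskerRight _ _
  refine Eq.trans ?_ (h₂.trans ((congrArg (· ≫ _) h₄).trans (id_comp _)))
  refine (assoc _ _ _).symm.trans ((congrArg (· ≫ _) h₁).trans ?_)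
  rw [assoc, ← whiskerLeft_comp, ← PrelaxFunctor.map₂_comp_assoc, Iso.hom_inv_id,
    PrelaxFunctor.map₂_id, id_comp]

/-- The naturality of the unit. -/
def sUnitNat {p q : FibOver D} (F : p ⟶ q) :
    F ≫ sUnitApp hs σ hσ q ≅ sUnitApp hs σ hσ p ≫ (iOver σ D).map ((sOver s hs D).map F) :=
  bLiftNat F (Slice.mapSliceHom hs F) (σ.unit.naturality F.hom) (fun X a => by
    have h := congrArg (fun t => (StrongTrans.Hom.comp t X).app a) (sUnitNat_aux σ F)
    refine h.trans ?_
    refine (id_comp _).trans (congrArg (_ ≫ ·) ?_)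
    exact (id_comp _).trans (comp_id _))

/-- The unit. -/
def sUnit : TransTo (Pseudofunctor.id (FibOver D)) (sOver s hs D) (iOver σ D) where
  app := sUnitApp hs σ hσ
  nat F := sUnitNat hs σ hσ F
  nat_map₂ {p q F G} θ := bObj_hom₂_ext fun X a =>
    congrArg (fun t : F.hom ≫ σ.unit.app q.total ⟶ σ.unit.app p.total ≫
      (s.comp (stIncl J)).map G.hom => (StrongTrans.Hom.comp t X).app a)
        (σ.unit.naturality_naturality θ.hom)
  nat_id p := bObj_hom₂_ext fun X a => by
    have h := congrArg (fun t : 𝟙 p.total ≫ σ.unit.app p.total ⟶ σ.unit.app p.total ≫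
      𝟙 _ => (StrongTrans.Hom.comp t X).app a) (σ.unit.naturality_id p.total)
    refine Eq.trans ?_ (h.trans ?_)
    · exact congrArg (_ ≫ ·) ((congrArg (_ ≫ ·) (comp_id _)).trans (comp_id _))
    · rfl
  nat_comp {p q r} F G := bObj_hom₂_ext fun X a => by
    have h := congrArg (fun t => (StrongTrans.Hom.comp t X).app a)
      (σ.unit.naturality_comp F.hom G.hom)
    refine Eq.trans ?_ (h.trans ?_)
    · exact congrArg (_ ≫ ·) ((congrArg (_ ≫ ·) (comp_id _)).trans (comp_id _))
    · rfl

end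

end

lemma iso_cancel {C : Type*} [Category* C] {a b c d : C} (i : a ≅ b) (f : c ≅ b) (f' : d ≅ b)
    (m : c ⟶ d) (h : i.hom ≫ f'.inv = (i.hom ≫ f.inv) ≫ m) : m ≫ f'.hom = f.hom := by
  rw [assoc, Iso.cancel_iso_hom_left, Iso.eq_inv_comp] at h
  rw [← Iso.eq_comp_inv, h]

lemma iso_solve {C : Type*} [Category* C] {a b c d : C} (k : a ≅ b) (t : a ≅ c) (e : d ≅ c)
    (m : d ⟶ b) (h : e.hom = 𝟙 _ ≫ m ≫ k.inv ≫ t.hom) : k.hom = (t.hom ≫ e.inv) ≫ m := by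
  have : m = e.hom ≫ t.inv ≫ k.hom := by rw [h]; simp
  rw [this]; simp

section

variable {D D' : IndCat.{v, u, v', max u' v'} K}
  {η : D ⟶ D'} {q : FibOver D'} {p : FibOver D}

section

variable (v v' : p ⟶ bObj η q) (β : v.hom ≫ bSnd η q ≅ v'.hom ≫ bSnd η q)
  (hβ : ∀ X a, (StrongTrans.comp η X).map ((phi v X a).hom ≫ (phi v' X a).inv) ≫
    ((StrongTrans.comp v'.hom X).obj a : bFib η q X).iso.hom =
      ((StrongTrans.comp v.hom X).obj a : bFib η q X).iso.hom ≫
        (pr q X).map ((compIso β X).app a).hom)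

lemma bObjIso_nat {X Y : K} (f : Y ⟶ X) (a : p.total.fibre X) :
    (mkIso (phi v Y ((p.total.res f).obj a) ≪≫ (phi v' Y _).symm)
      ((compIso β Y).app _) (hβ Y _)).hom ≫ (StrongTrans.nat v'.hom f).hom.app a =
    (StrongTrans.nat v.hom f).hom.app a ≫ (bRes f).map
      (mkIso (phi v X a ≪≫ (phi v' X a).symm)
        ((compIso β X).app a) (hβ X a)).hom := by
  refine CategoricalPullback.hom_ext ?_ ?_
  · have h := StrongTrans.Hom.nat (v.iso ≪≫ v'.iso.symm).hom f a
    have e₁ : (StrongTrans.nat (v'.hom ≫ bProj η q) f).hom.app a =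
        Hom.fst ((StrongTrans.nat v'.hom f).hom.app a) :=
      (StrongTrans.comp_nat_app v'.hom (bProj η q) f a).trans (comp_id _)
    have e₂ : (StrongTrans.nat (v.hom ≫ bProj η q) f).hom.app a =
        Hom.fst ((StrongTrans.nat v.hom f).hom.app a) :=
      (StrongTrans.comp_nat_app v.hom (bProj η q) f a).trans (comp_id _)
    exact (congrArg (_ ≫ ·) e₁.symm).trans (h.trans (congrArg (· ≫ _) e₂))
  · have h := StrongTrans.Hom.nat β.hom f a
    have e₁ : (StrongTrans.nat (v'.hom ≫ bSnd η q) f).hom.app a =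
        Hom.snd ((StrongTrans.nat v'.hom f).hom.app a) :=
      (StrongTrans.comp_nat_app v'.hom (bSnd η q) f a).trans (comp_id _)
    have e₂ : (StrongTrans.nat (v.hom ≫ bSnd η q) f).hom.app a =
        Hom.snd ((StrongTrans.nat v.hom f).hom.app a) :=
      (StrongTrans.comp_nat_app v.hom (bSnd η q) f a).trans (comp_id _)
    exact (congrArg (_ ≫ ·) e₁.symm).trans (h.trans (congrArg (· ≫ _) e₂))

/-- Arrows to a base change are isomorphic when their second components are compatibly so. -/
def bObjIso : v ≅ v' :=
  Slice.isoMk (mkModIso (F := v.hom) (G := v'.hom)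
    (fun X => NatIso.ofComponents (fun a => mkIso
        (phi v X a ≪≫ (phi v' X a).symm) ((compIso β X).app a) (hβ X a))
      (fun k => CategoricalPullback.hom_ext
        ((compIso (v.iso ≪≫ v'.iso.symm) X).hom.naturality k)
        ((compIso β X).hom.naturality k)))
    (fun f a => bObjIso_nat v v' β hβ f a)) (hom₂_ext fun X a => by
    have e : ((phi v X a).hom ≫ (phi v' X a).inv) ≫ (phi v' X a).hom = (phi v X a).hom := by simp
    exact e)

end

section

variable {P : FibOver D'} {G : p.total ⟶ P.total} (θ : p.proj ≫ η ≅ G ≫ P.proj)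
  (hG : PreservesCart p.proj P.proj G)

lemma bLift_bMap_nat (F : P ⟶ q) {X Y : K} (f : Y ⟶ X) (a : p.total.fibre X) :
    Hom.snd
        ((StrongTrans.nat (Slice.Hom.hom (bLift G θ hG ≫ bMap η F)) f).hom.app a) =
      (StrongTrans.nat (G ≫ F.hom) f).hom.app a :=
  (congrArg Hom.snd
    (StrongTrans.comp_nat_app (bLiftTrans G θ) (bMapTrans F) f a)).trans
      (StrongTrans.comp_nat_app G F.hom f a).symm

def bLiftSnd (F : P ⟶ q) :
    Slice.Hom.hom (bLift G θ hG ≫ bMap η F) ≫ bSnd η q ≅ G ≫ F.hom :=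
  mkModIso (F := Slice.Hom.hom (bLift G θ hG ≫ bMap η F) ≫ bSnd η q) (G := G ≫ F.hom)
    (fun _ => Iso.refl _) (fun f a => by
      have e₂ : (StrongTrans.nat (Slice.Hom.hom (bLift G θ hG ≫ bMap η F) ≫ bSnd η q) f).hom.app a =
          Hom.snd
            ((StrongTrans.nat (Slice.Hom.hom (bLift G θ hG ≫ bMap η F)) f).hom.app a) :=
        (StrongTrans.comp_nat_app _ (bSnd η q) f a).trans (comp_id _)
      refine (id_comp _).trans (Eq.symm ((congrArg (_ ≫ ·)
        (CategoryTheory.Functor.map_id (q.total.res f) _)).trans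
          ((comp_id _).trans (e₂.trans ?_))))
      exact bLift_bMap_nat θ hG F f a)

lemma phi_bLift_bMap (F : P ⟶ q) (X : K) (a : p.total.fibre X) :
    (phi (bLift G θ hG ≫ bMap η F) X a).hom = 𝟙 _ :=
  (id_comp _).trans (id_comp _)

def bTwoSnd {F F' : P ⟶ q} (α : bLift G θ hG ≫ bMap η F ⟶ bLift G θ hG ≫ bMap η F') :
    G ≫ F.hom ⟶ G ≫ F'.hom :=
  (bLiftSnd θ hG F).inv ≫ α.hom ▷ bSnd η q ≫ (bLiftSnd θ hG F').hom

lemma bTwoSnd_app {F F' : P ⟶ q} (α : bLift G θ hG ≫ bMap η F ⟶ bLift G θ hG ≫ bMap η F')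
    (X : K) (a : p.total.fibre X) :
    (StrongTrans.Hom.comp (bTwoSnd θ hG α) X).app a =
      Hom.snd ((StrongTrans.Hom.comp α.hom X).app a) :=
  (id_comp _).trans (comp_id _)

lemma bTwoSnd_w {F F' : P ⟶ q} (α : bLift G θ hG ≫ bMap η F ⟶ bLift G θ hG ≫ bMap η F')
    (X : K) (a : p.total.fibre X) :
    (pr q X).map ((StrongTrans.Hom.comp (bTwoSnd θ hG α) X).app a) ≫
      (phi F' X ((StrongTrans.comp G X).obj a)).hom =
        (phi F X ((StrongTrans.comp G X).obj a)).hom := by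
  have h₀ := (((StrongTrans.Hom.comp α.hom X).app a :
    (bMapApp F X).obj ((bLiftApp G θ X).obj a) ⟶ (bMapApp F' X).obj ((bLiftApp G θ X).obj a))).w
  have h₁ : Hom.fst ((StrongTrans.Hom.comp α.hom X).app a) = 𝟙 _ := by
    have h := congrArg (fun t : Slice.Hom.hom (bLift G θ hG ≫ bMap η F) ≫ bProj η q ⟶ p.proj =>
      (StrongTrans.Hom.comp t X).app a) α.w
    exact ((comp_id _).symm.trans (congrArg (_ ≫ ·)
      (phi_bLift_bMap θ hG F' X a).symm)).trans (h.trans (phi_bLift_bMap θ hG F X a))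
  have h₂ : ((compIso θ X).app a).hom ≫ (phi F' X ((StrongTrans.comp G X).obj a)).inv =
      (((compIso θ X).app a).hom ≫ (phi F X ((StrongTrans.comp G X).obj a)).inv) ≫
        (pr q X).map (Hom.snd ((StrongTrans.Hom.comp α.hom X).app a)) := by
    refine Eq.trans ?_ h₀
    exact (id_comp _).symm.trans (congrArg (· ≫ _)
      ((CategoryTheory.Functor.map_id (StrongTrans.comp η X) _).symm.trans
        (congrArg (StrongTrans.comp η X).map h₁.symm)))
  rw [bTwoSnd_app]
  exact iso_cancel _ _ _ _ h₂

variable {J : GrothendieckTopology K} (hq : q.total.IsStack J) (hD' : D'.IsStack J)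
  (hP : IsPre J P.total) (hη : LE J η) (hG' : LE J G)

include hq hD' hP hη hG'

lemma isEquivalence_post_baseChange :
    (post (baseChange η) (show p ⟶ (baseChange η).obj P from bLift G θ hG) q).IsEquivalence where
  faithful := ⟨fun {F F' x y} h => Slice.hom₂_ext <|
    hG'.whiskerLeft_injective (isPre_of_isStack hq) <| hom₂_ext fun X a =>
      congrArg (fun t : bLift G θ hG ≫ bMap η F ⟶ bLift G θ hG ≫ bMap η F' =>
        Hom.snd ((StrongTrans.Hom.comp t.hom X).app a)) h⟩
  full := ⟨fun {F F'} α => by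
    obtain ⟨β, hβ⟩ := hG'.whiskerLeft_surjective (isPre_of_isStack hq) (bTwoSnd θ hG α)
    refine ⟨⟨β, hG'.whiskerLeft_injective (isPre_of_isStack hD') (hom₂_ext fun X a => ?_)⟩,
      bObj_hom₂_ext fun X a => ?_⟩
    · have h := congrArg (fun t : G ≫ F.hom ⟶ G ≫ F'.hom => (StrongTrans.Hom.comp t X).app a) hβ
      exact (congrArg (fun t => (pr q X).map t ≫ _) h).trans (bTwoSnd_w θ hG α X a)
    · have h := congrArg (fun t : G ≫ F.hom ⟶ G ≫ F'.hom => (StrongTrans.Hom.comp t X).app a) hβ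
      exact h.trans (bTwoSnd_app θ hG α X a)⟩
  essSurj := ⟨fun v => by
    obtain ⟨f, ⟨i⟩⟩ := hG'.exists_extension hq (v.hom ≫ bSnd η q)
    let κ : p.proj ≫ η ≅ (v.hom ≫ bSnd η q) ≫ q.proj :=
      whiskerRightIso v.iso.symm η ≪≫ α_ _ _ _ ≪≫ whiskerLeftIso v.hom (bIso η q) ≪≫
        (α_ _ _ _).symm
    have := hG'.isEquivalence_precomp hD'
    let e₀ : G ≫ f ≫ q.proj ≅ G ≫ P.proj :=
      (α_ _ _ _).symm ≪≫ whiskerRightIso i q.proj ≪≫ κ.symm ≪≫ θ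
    let e : f ≫ q.proj ≅ P.proj := (precomp D' G).preimageIso e₀
    have he : G ◁ e.hom = e₀.hom := (precomp D' G).map_preimage e₀.hom
    have hf : PreservesCart P.proj q.proj f := preservesCart_of_hc P.fib fun A B u hu =>
      hc_tot_of_le hP (isPre_of_isStack hD') hG' hη (Square.of θ.symm) p.fib
        (isPre_of_isStack hq) (isPre_of_isStack hD') (fun A B g hg => HC.congr (Square.of i)
          ((preservesCart_bSnd η q).hc q.fib (v.cart.hc (bObj η q).fib hg))) hu
    let F : P ⟶ q := ⟨f, e, hf⟩
    exact ⟨F, ⟨bObjIso _ v (bLiftSnd θ hG F ≪≫ i) (fun X a => by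
      have h := congrArg (fun t : G ≫ f ≫ q.proj ⟶ G ≫ P.proj =>
        (StrongTrans.Hom.comp t X).app a) he
      have h' := iso_solve ((compIso κ X).app a) ((compIso θ X).app a)
        (phi F X ((StrongTrans.comp G X).obj a)) _ h
      have e₁ : (phi (bLift G θ hG ≫ bMap η F) X a).hom ≫ (phi v X a).inv = (phi v X a).inv :=
        (congrArg (· ≫ _) (phi_bLift_bMap θ hG F X a)).trans (id_comp _)
      refine (congrArg (fun t => (StrongTrans.comp η X).map t ≫ _) e₁).trans ?_
      refine Eq.trans ?_ (h'.trans (congrArg (fun t => _ ≫ (pr q X).map t) ?_))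
      · exact congrArg (_ ≫ ·) ((id_comp _).trans (comp_id _)).symm
      · exact (id_comp _).symm)⟩⟩⟩

end

end

section

variable {J : GrothendieckTopology K}
  {s : IndCat.{v, u, v', max u' v'} K ⥤ᵖ St.{v, u, v', max u' v'} J}
  (hs : PreservesFibrations (fibClass K) (fibClass K) (s.comp (stIncl J)))
  (σ : Biadjunction s (stIncl J)) (D : IndCat.{v, u, v', max u' v'} K)
  (hσ : ∀ E, LE J (σ.unit.app E))

/-- Stackification of fibrations is left biadjoint to pseudopullback along the unit. -/
def sAdj : Biadjunction (sOver s hs D) (iOver σ D) where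
  unit := (sUnit hs σ hσ).toTrans
  isEquivalence_transpose p q := by
    have h := isEquivalence_post_baseChange (p := p) (σ.unit.naturality p.proj)
      (P := (Slice.mapSlice (s.comp (stIncl J)) hs D).obj p) (q := q.1)
      (preservesCart_unit σ hσ p) q.2 (s.obj D).2 (isPre_of_isStack (s.obj p.total).2) (hσ D)
      (hσ p.total)
    exact isEquivalence_post_incl (b := (sOver s hs D).obj p) (c := q) h

end

lemma comp_aux₁ {C : Type*} [Category* C] {x₁ x₂ x₃ x₄ x₅ x₆ x₇ x₈ : C} {a : x₁ ⟶ x₂}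
    {b : x₂ ⟶ x₃} {c : x₃ ⟶ x₄} {d : x₄ ⟶ x₅} {e : x₂ ⟶ x₅} {i : x₁ ⟶ x₆} {l : x₆ ⟶ x₇}
    {m : x₇ ⟶ x₃} {n : x₇ ⟶ x₈} {o : x₈ ⟶ x₄} (h₁ : b ≫ c ≫ d = e) (h₂ : i ≫ l ≫ m = a ≫ b)
    (h₃ : m ≫ c = n ≫ o) : a ≫ e = i ≫ (l ≫ n) ≫ o ≫ d := by
  rw [← h₁, ← assoc, ← h₂]
  simp [reassoc_of% h₃]

lemma comp_aux₂ {C : Type*} [Category* C] {x₁ x₂ x₃ x₄ x₅ x₆ : C} {a : x₁ ⟶ x₂} {b : x₂ ⟶ x₃}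
    {c : x₁ ⟶ x₄} {d : x₄ ⟶ x₃} {e : x₃ ⟶ x₅} {i : x₄ ⟶ x₆} {k : x₆ ⟶ x₅} (h₁ : a ≫ b = c ≫ d)
    (h₂ : d ≫ e = i ≫ k) : (c ≫ i) ≫ k = a ≫ b ≫ e := by
  rw [reassoc_of% h₁, h₂, assoc]

section

variable {D : IndCat.{v, u, v', max u' v'} K} {p q : FibOver D}

/-- The essential fibre point underlying an object of `∫ R(p)`. -/
abbrev rpt (A : ∫ᶜ (rObj p)) : rFib p A.base := A.fiber

/-- The object of `∫ E` underlying an object of `∫ R(p)`. -/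
abbrev topObj (A : ∫ᶜ (rObj p)) : ∫ᶜ p.total := ob (rpt A).pt

def topIso (A : ∫ᶜ (rObj p)) : A.base ⟶ (tot p.proj).obj (topObj A) :=
  ve (E := D) (a := cfib A.base) (rpt A).iso.hom

instance isIso_topIso (A : ∫ᶜ (rObj p)) : IsIso (topIso A) :=
  inferInstanceAs (IsIso (ve (E := D) (a := cfib A.base) (rpt A).iso.hom))

lemma topIso_base (A : ∫ᶜ (rObj p)) : (topIso A).base = 𝟙 A.base.base := rfl

/-- The cartesian arrow of `∫ E` exhibiting the transition in `R(p)`. -/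
def topLift {X Y : ∫ᶜ D} (f : Y ⟶ X) (x : rFib p X) :
    (ob ((rRes f).obj x).pt : ∫ᶜ p.total) ⟶ ob x.pt :=
  ve (rLift f x).hom ≫ ca f.base x.pt

lemma hc_topLift {X Y : ∫ᶜ D} (f : Y ⟶ X) (x : rFib p X) : HC p.proj (topLift f x) :=
  (hc_ve p.fib (rLift f x).isCart).trans (Car.hc p.proj (car_ca _ _))

lemma topLift_base {X Y : ∫ᶜ D} (f : Y ⟶ X) (x : rFib p X) : (topLift f x).base = f.base :=
  id_comp _

lemma tot_topLift {X Y : ∫ᶜ D} (f : Y ⟶ X) (x : rFib p X) :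
    (ve (E := D) (a := cfib Y) ((rRes f).obj x).iso.hom : Y ⟶ (tot p.proj).obj (ob _)) ≫
      (tot p.proj).map (topLift f x) = f ≫ ve (E := D) (a := cfib X) x.iso.hom := by
  have h₁ : tgt f x ≫ (StrongTrans.nat p.proj f.base).hom.app x.pt =
      chom f ≫ (D.res f.base).map x.iso.hom := by
    have e : (StrongTrans.nat p.proj f.base).inv.app x.pt ≫
      (StrongTrans.nat p.proj f.base).hom.app x.pt = 𝟙 _ := Iso.inv_hom_id_app _ _
    exact (assoc _ _ _).trans (congrArg (_ ≫ ·) ((assoc _ _ _).trans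
      ((congrArg (_ ≫ ·) e).trans (comp_id _))))
  have h₂ : ve (E := D) ((rRes f).obj x).iso.hom ≫ ve ((pr p Y.base).map (rLift f x).hom) =
      ve (tgt f x) := (ve_comp _ _).symm.trans (congrArg ve (rLift f x).w)
  have h₃ : ve (tgt f x) ≫ ar f.base ((StrongTrans.nat p.proj f.base).hom.app x.pt) =
      (ve (chom f) ≫ ca f.base (cfib X)) ≫ ve (E := D) x.iso.hom := by
    rw [ar_eq, ← assoc, ← ve_comp, h₁, ve_comp, assoc, res_map, assoc]
  have h₄ : ve (chom f) ≫ ca f.base (cfib X) = f := (ar_eq _ _).symm.trans (ar_vpart f)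
  refine (congrArg (ve (E := D) (a := cfib Y) ((rRes f).obj x).iso.hom ≫ ·)
    ((tot p.proj).map_comp (ve (rLift f x).hom) (ca f.base x.pt))).trans ?_
  refine (assoc _ _ _).symm.trans ?_
  refine (congrArg₂ (· ≫ ·) ((congrArg (_ ≫ ·) (tot_ve p.proj _)).trans h₂)
    (tot_cl p.proj f.base x.pt)).trans ?_
  exact h₃.trans (congrArg (· ≫ _) h₄)

def topMap {A B : ∫ᶜ (rObj p)} (m : A ⟶ B) : topObj A ⟶ topObj B :=
  ve (EssFib.Hom.hom (vpart m)) ≫ topLift m.base (rpt B)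

lemma topMap_ve {X : ∫ᶜ D} {x y : rFib p X} (k : x ⟶ y) :
    topMap (ve (E := rObj p) k) = ve k.hom := by
  have h : (rLift (𝟙 X) y).hom = ((rId X).hom.app y).hom ≫ (p.total.resId X.base).inv.app y.pt :=
    (rId_hom X y).symm
  have h₁ : topLift (𝟙 X) y = ve ((rId X).hom.app y).hom := by
    refine (congrArg (fun t => ve t ≫ ca (𝟙 X.base) y.pt) h).trans ?_
    refine (congrArg (· ≫ _) (ve_comp _ _)).trans ((assoc _ _ _).trans ?_)
    exact (congrArg (_ ≫ ·) (resId_cl y.pt)).trans (comp_id _)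
  have h₂ : (k ≫ (rId X).inv.app y) ≫ (rId X).hom.app y = k := by simp
  refine (congrArg (_ ≫ ·) h₁).trans ((ve_comp _ _).symm.trans (congrArg ve ?_))
  exact congrArg EssFib.Hom.hom h₂

lemma topMap_tot {A B : ∫ᶜ (rObj p)} (m : A ⟶ B) :
    topIso A ≫ (tot p.proj).map (topMap m) = m.base ≫ topIso B := by
  have h : ve (rpt A).iso.hom ≫ ve ((pr p A.base.base).map (EssFib.Hom.hom (vpart m))) =
      ve (E := D) ((rRes m.base).obj (rpt B)).iso.hom :=
    (ve_comp _ _).symm.trans (congrArg ve (EssFib.Hom.w (vpart m)))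
  refine Eq.trans ?_ (tot_topLift m.base (rpt B))
  refine (congrArg (_ ≫ ·) ((tot p.proj).map_comp _ _)).trans ?_
  refine (assoc _ _ _).symm.trans (congrArg (· ≫ _) ?_)
  exact (congrArg (_ ≫ ·) (tot_ve p.proj _)).trans h

lemma topMap_comp {A B C : ∫ᶜ (rObj p)} (g : A ⟶ B) (f : B ⟶ C) :
    topMap (g ≫ f) = topMap g ≫ topMap f := by
  have h₁ : vpart (g ≫ f) ≫ (rComp f.base g.base (g ≫ f).base rfl).hom.app (rpt C) =
      vpart g ≫ (rRes g.base).map (vpart f) := by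
    have e := chom_comp f g _ rfl
    have e' : ((rObj p).resComp f.base g.base (g ≫ f).base rfl).inv.app (cfib C) ≫
      ((rObj p).resComp f.base g.base (g ≫ f).base rfl).hom.app (cfib C) = 𝟙 _ :=
      Iso.inv_hom_id_app _ _
    refine (congrArg (_ ≫ ·) (rObj_resComp f.base g.base (g ≫ f).base rfl (rpt C)).symm).trans ?_
    refine (congrArg (· ≫ _) e).trans ((assoc _ _ _).trans (congrArg (_ ≫ ·) ?_))
    exact (assoc _ _ _).trans ((congrArg (_ ≫ ·) e').trans (comp_id _))
  have h₂ := rComp_hom f.base g.base (g ≫ f).base rfl (rpt C)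
  have h₃ := rRes_map_hom g.base (vpart f)
  have h₄ : topLift (g ≫ f).base (rpt C) = ve ((rComp f.base g.base (g ≫ f).base rfl).hom.app
      (rpt C)).hom ≫ topLift g.base ((rRes f.base).obj (rpt C)) ≫ topLift f.base (rpt C) := by
    have r := res_map g.base.base (rLift f.base (rpt C)).hom
    have c := resComp_cl (E := p.total) f.base.base g.base.base (g ≫ f).base.base rfl (rpt C).pt
    have e := congrArg ve h₂
    rw [ve_comp, ve_comp, ve_comp] at e
    exact comp_aux₁ c e r
  have h₅ : topLift g.base (rpt B) ≫ ve (EssFib.Hom.hom (vpart f)) =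
      ve ((rRes g.base).map (vpart f)).hom ≫ topLift g.base ((rRes f.base).obj (rpt C)) := by
    have e := congrArg ve h₃
    rw [ve_comp, ve_comp] at e
    exact comp_aux₂ e (res_map g.base.base (EssFib.Hom.hom (vpart f)))
  have h₆ := congrArg (fun t => ve (EssFib.Hom.hom t)) h₁
  refine (congrArg (_ ≫ ·) h₄).trans ?_
  refine (assoc _ _ _).symm.trans ?_
  refine (congrArg (· ≫ _) ((ve_comp _ _).symm.trans (h₆.trans (ve_comp _ _)))).trans ?_
  refine (assoc _ _ _).trans (Eq.trans (congrArg (_ ≫ ·) ?_) (assoc _ _ _).symm)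
  refine (assoc _ _ _).symm.trans ?_
  exact (congrArg (· ≫ _) h₅.symm).trans (assoc _ _ _)

lemma topMap_inj {A B : ∫ᶜ (rObj p)} {m n : A ⟶ B} (h : topMap m = topMap n) : m = n := by
  have hb : m.base = n.base := by
    rw [← cancel_mono (topIso B), ← topMap_tot, ← topMap_tot, h]
  obtain ⟨m', hm⟩ := exists_ar (a := A.fiber) (b := B.fiber) m hb
  subst hm
  have h' : EssFib.Hom.hom m' = EssFib.Hom.hom (vpart n) := ve_inj
    ((hc_topLift n.base (rpt B)).hom_ext ((tot_ve p.proj _).trans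
      (Eq.trans (congrArg ve ((cancel_epi (rpt A).iso.hom).1 ((EssFib.Hom.w m').trans
        (EssFib.Hom.w (vpart n)).symm))) (tot_ve p.proj _).symm)) h)
  exact congrArg (fun t => ar n.base t) (EssFib.hom_ext h')

lemma exists_topMap {A B : ∫ᶜ (rObj p)} (k : topObj A ⟶ topObj B) : ∃ m, topMap m = k := by
  let f : A.base ⟶ B.base := topIso A ≫ (tot p.proj).map k ≫ inv (topIso B)
  let t : (tot p.proj).obj (topObj A) ⟶ (tot p.proj).obj (ob ((rRes f).obj (rpt B)).pt) :=
    inv (topIso A) ≫ ve (E := D) (a := cfib A.base) ((rRes f).obj (rpt B)).iso.hom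
  obtain ⟨l, hl, hl'⟩ := (hc_topLift f (rpt B)).exists_lift k t (by
    refine (assoc _ _ _).trans ((congrArg (_ ≫ ·) (tot_topLift f (rpt B))).trans ?_)
    have e : inv (topIso A) ≫ f ≫ topIso B = (tot p.proj).map k := by simp -proj [f]
    exact e)
  have h : topIso A ≫ (tot p.proj).map l =
      ve (E := D) (a := cfib A.base) ((rRes f).obj (rpt B)).iso.hom :=
    (congrArg (_ ≫ ·) hl).trans (IsIso.hom_inv_id_assoc _ _)
  obtain ⟨l', rfl⟩ := exists_ve l (by
    have e := base_congr h
    exact (id_comp _).symm.trans e)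
  have w : (rpt A).iso.hom ≫ (pr p A.base.base).map l' = ((rRes f).obj (rpt B)).iso.hom :=
    ve_inj ((ve_comp _ _).trans ((congrArg (_ ≫ ·) (tot_ve p.proj l').symm).trans h))
  exact ⟨ar (E := rObj p) (a := rpt A) (b := rpt B) f ⟨l', w⟩, hl'⟩

lemma car_iff_hc_topMap {A B : ∫ᶜ (rObj p)} {m : A ⟶ B} : Car m ↔ HC p.proj (topMap m) := by
  have h₀ : Car m ↔ IsIso (vpart m) :=
    car_ar_iff (E := rObj p) (f := m.base) (a := A.fiber) (b := B.fiber)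
  rw [h₀]
  constructor
  · intro h
    have h₁ : IsIso (EssFib.Hom.hom (vpart m)) :=
      ⟨EssFib.Hom.hom (inv (vpart m)), congrArg EssFib.Hom.hom (IsIso.hom_inv_id (vpart m)),
        congrArg EssFib.Hom.hom (IsIso.inv_hom_id (vpart m))⟩
    exact (hc_of_isIso (ve (EssFib.Hom.hom (vpart m)))).trans (hc_topLift _ _)
  · intro h
    have h₁ : IsIso ((pr p A.base.base).map (EssFib.Hom.hom (vpart m))) := by
      have e := EssFib.Hom.w (vpart m)
      rw [← Iso.eq_inv_comp] at e
      rw [e]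
      infer_instance
    have h₂ : IsIso (ve (EssFib.Hom.hom (vpart m))) :=
      (HC.of_comp (hc_topLift _ _) h).isIso
        ((congrArg (fun t => IsIso t) (tot_ve p.proj (EssFib.Hom.hom (vpart m)))).mpr
          (inferInstanceAs (IsIso (ve ((pr p A.base.base).map (EssFib.Hom.hom (vpart m)))))))
    have h₃ := isIso_of_ve h₂
    exact (EssFib.isoMk (asIso (EssFib.Hom.hom (vpart m))) (EssFib.Hom.w (vpart m))).isIso_hom

lemma topMap_rMap (F : p ⟶ q) {A B : ∫ᶜ (rObj p)} (m : A ⟶ B) :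
    topMap ((tot (rMap F)).map m) = (tot F.hom).map (topMap m) := by
  have h₁ := tot_ar (rMap F) m.base (vpart m)
  have h₂ := congrArg ve (rNat_hom F m.base (rpt B))
  rw [ve_comp, ve_comp] at h₂
  refine (congrArg topMap h₁).trans ?_
  refine (congrArg (· ≫ topLift m.base _) (ve_comp _ _)).trans ?_
  refine Eq.trans ?_ ((tot F.hom).map_comp (ve (EssFib.Hom.hom (vpart m)))
    (topLift m.base (rpt B))).symm
  refine (assoc _ _ _).trans (congrArg₂ (· ≫ ·) (tot_ve F.hom _).symm ?_)
  refine Eq.trans ?_ ((tot F.hom).map_comp (ve (rLift m.base (rpt B)).hom)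
    (ca m.base.base (rpt B).pt)).symm
  have h₃ := (tot_cl F.hom m.base.base (rpt B).pt).trans (ar_eq _ _)
  refine Eq.trans ?_ (congrArg₂ (· ≫ ·) (tot_ve F.hom _) h₃).symm
  exact (assoc _ _ _).symm.trans ((congrArg (· ≫ _) h₂).trans (assoc _ _ _))

end

lemma comp_eq_comp_of_inv {C : Type*} [Category* C] {a b c d : C} {i : a ⟶ b} {i' : b ⟶ a}
    {j : c ⟶ d} {j' : d ⟶ c} {x : b ⟶ d} {y : a ⟶ c} (h : i ≫ x = y ≫ j) (hi : i' ≫ i = 𝟙 _)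
    (hj : j ≫ j' = 𝟙 _) : x ≫ j' = i' ≫ y := by
  rw [← comp_id y, ← hj, ← reassoc_of% h, reassoc_of% hi]

lemma comp_eq_id_of_isIso {C : Type*} [Category* C] {a b : C} {f : a ⟶ b} {g : b ⟶ a}
    (hg : IsIso g) (h : f ≫ g = 𝟙 _) : g ≫ f = 𝟙 _ := by
  rw [← cancel_mono g, assoc, h, comp_id, id_comp]

section

variable {D : IndCat.{v, u, v', max u' v'} K} {p q : FibOver D}

lemma topMap_id (A : ∫ᶜ (rObj p)) : topMap (𝟙 A) = 𝟙 (topObj A) := by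
  have h : 𝟙 A = ve (E := rObj p) (𝟙 (rpt A)) := (ve_id (E := rObj p) A.fiber).symm
  exact (congrArg topMap h).trans ((topMap_ve (𝟙 (rpt A))).trans (ve_id _))

lemma isIso_of_topMap {A B : ∫ᶜ (rObj p)} {m : A ⟶ B} (h : IsIso (topMap m)) : IsIso m := by
  obtain ⟨n, hn⟩ := exists_topMap (inv (topMap m))
  exact ⟨n, topMap_inj ((topMap_comp _ _).trans ((congrArg (_ ≫ ·) hn).trans
      ((IsIso.hom_inv_id _).trans (topMap_id A).symm))),
    topMap_inj ((topMap_comp _ _).trans ((congrArg (· ≫ _) hn).trans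
      ((IsIso.inv_hom_id _).trans (topMap_id B).symm)))⟩

/-- The canonical object of `∫ R(p)` above an object of `∫ E`. -/
abbrev secObj (A : ∫ᶜ p.total) : ∫ᶜ (rObj p) :=
  ob (E := rObj p) (X := (tot p.proj).obj A) (⟨A.fiber, Iso.refl _⟩ : rFib p _)

lemma topIso_secObj (A : ∫ᶜ p.total) : topIso (secObj A) = 𝟙 _ := ve_id _

def secMap {A B : ∫ᶜ p.total} (u : A ⟶ B) : secObj A ⟶ secObj B :=
  (exists_topMap (A := secObj A) (B := secObj B) u).choose

lemma topMap_secMap {A B : ∫ᶜ p.total} (u : A ⟶ B) : topMap (secMap u) = u :=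
  (exists_topMap (A := secObj A) (B := secObj B) u).choose_spec

lemma secMap_id (A : ∫ᶜ p.total) : secMap (𝟙 A) = 𝟙 _ :=
  topMap_inj ((topMap_secMap _).trans (topMap_id (secObj A)).symm)

lemma secMap_comp {A B C : ∫ᶜ p.total} (u : A ⟶ B) (w : B ⟶ C) :
    secMap (u ≫ w) = secMap u ≫ secMap w :=
  topMap_inj ((topMap_secMap _).trans ((topMap_comp _ _).trans
    (congrArg₂ (· ≫ ·) (topMap_secMap u) (topMap_secMap w))).symm)

lemma topMap_base {A B : ∫ᶜ (rObj p)} (m : A ⟶ B) : (topMap m).base = m.base.base :=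
  (id_comp _).trans (topLift_base m.base (rpt B))

lemma secMap_base {A B : ∫ᶜ p.total} (u : A ⟶ B) : (secMap u).base = (tot p.proj).map u := by
  have h := topMap_tot (secMap u)
  rw [topIso_secObj, topIso_secObj, topMap_secMap] at h
  exact (comp_id _).symm.trans (h.symm.trans (id_comp _))

/-- Every object of `∫ R(p)` is isomorphic to a canonical one. -/
def secCounit (A : ∫ᶜ (rObj p)) : secObj (topObj A) ⟶ A :=
  (exists_topMap (A := secObj (topObj A)) (B := A) (𝟙 _)).choose

lemma topMap_secCounit (A : ∫ᶜ (rObj p)) : topMap (secCounit A) = 𝟙 (topObj A) :=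
  (exists_topMap (A := secObj (topObj A)) (B := A) (𝟙 _)).choose_spec

instance (A : ∫ᶜ (rObj p)) : IsIso (secCounit A) :=
  isIso_of_topMap ((congrArg (fun t => IsIso t) (topMap_secCounit A)).mpr
    (inferInstanceAs (IsIso (𝟙 (topObj A)))))

lemma secCounit_base (A : ∫ᶜ (rObj p)) : (secCounit A).base ≫ topIso A = 𝟙 _ := by
  have h := topMap_tot (secCounit A)
  rw [topIso_secObj] at h
  refine h.symm.trans ((id_comp _).trans ?_)
  exact (congrArg (tot p.proj).map (topMap_secCounit A)).trans (CategoryTheory.Functor.map_id _ _)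

lemma secCounit_nat {A B : ∫ᶜ (rObj p)} (m : A ⟶ B) :
    secMap (topMap m) ≫ secCounit B = secCounit A ≫ m :=
  topMap_inj ((topMap_comp _ _).trans ((congrArg₂ (· ≫ ·) (topMap_secMap (topMap m))
    (topMap_secCounit B)).trans ((comp_id _).trans ((id_comp _).symm.trans
      ((topMap_comp _ _).trans (congrArg (· ≫ _) (topMap_secCounit A))).symm))))

lemma topMap_vAt {F G : p ⟶ q} (η : F ⟶ G) (A : ∫ᶜ (rObj p)) :
    topMap (vAt (rTwo η) A) = vAt η.hom (topObj A) :=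
  topMap_ve _

section

variable {F G : p ⟶ q} (β : rMap F ⟶ rMap G)

/-- The component of a 2-cell between indexed functors of essential fibres. -/
def rPre (A : ∫ᶜ p.total) : (tot F.hom).obj A ⟶ (tot G.hom).obj A :=
  topMap (vAt β (secObj A))

def rPreApp (A : ∫ᶜ p.total) : (StrongTrans.comp F.hom A.base).obj A.fiber ⟶
    (StrongTrans.comp G.hom A.base).obj A.fiber :=
  EssFib.Hom.hom ((StrongTrans.Hom.comp β ((tot p.proj).obj A)).app (secObj A).fiber)

lemma rPre_eq (A : ∫ᶜ p.total) : rPre β A = ve (rPreApp β A) :=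
  topMap_ve ((StrongTrans.Hom.comp β ((tot p.proj).obj A)).app (secObj A).fiber)

lemma rPreApp_w (A : ∫ᶜ p.total) : (pr q A.base).map (rPreApp β A) ≫ (phi G A.base A.fiber).hom =
    (phi F A.base A.fiber).hom :=
  iso_cancel (Iso.refl _) _ _ _
    (EssFib.Hom.w ((StrongTrans.Hom.comp β ((tot p.proj).obj A)).app (secObj A).fiber)).symm

lemma rPre_base (A : ∫ᶜ p.total) : (rPre β A).base = 𝟙 A.base := by
  have h := rPre_eq β A
  exact base_congr h

lemma rPre_nat {A B : ∫ᶜ (rObj p)} (m : A ⟶ B) :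
    (tot F.hom).map (topMap m) ≫ topMap (vAt β B) =
      topMap (vAt β A) ≫ (tot G.hom).map (topMap m) :=
  (congrArg (· ≫ _) (topMap_rMap F m).symm).trans ((topMap_comp _ _).symm.trans
    ((congrArg topMap (vAt_nat β m)).trans ((topMap_comp _ _).trans
      (congrArg (_ ≫ ·) (topMap_rMap G m)))))

lemma rPre_topObj (A : ∫ᶜ (rObj p)) : rPre β (topObj A) = topMap (vAt β A) := by
  have h := rPre_nat β (secCounit A)
  have e : ∀ F : p ⟶ q, (tot F.hom).map (topMap (secCounit A)) = 𝟙 _ := fun F =>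
    (congrArg (tot F.hom).map (topMap_secCounit A)).trans (CategoryTheory.Functor.map_id _ _)
  exact (comp_id _).symm.trans ((congrArg (_ ≫ ·) (e G).symm).trans (h.symm.trans
    ((congrArg (· ≫ _) (e F)).trans (id_comp _))))

lemma rPre_w (A : ∫ᶜ p.total) :
    (tot q.proj).map (rPre β A) ≫ vAt G.iso.hom A = vAt F.iso.hom A := by
  refine (congrArg (fun t => (tot q.proj).map t ≫ _) (rPre_eq β A)).trans ?_
  refine (congrArg (· ≫ _) (tot_ve q.proj (rPreApp β A))).trans ?_
  exact (ve_comp _ _).symm.trans (congrArg ve (rPreApp_w β A))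

lemma exists_rTwo : ∃ α : F ⟶ G, rTwo α = β := by
  let α : F.hom ⟶ G.hom := ofV (rPre β) (rPre_base β) (fun {A B} u => by
    have h := rPre_nat β (secMap u)
    rw [topMap_secMap] at h
    exact h)
  have hα : ∀ A, vAt α A = rPre β A := vAt_ofV _ _ _
  refine ⟨⟨α, vAt_ext fun A => ?_⟩, vAt_ext fun A => topMap_inj ?_⟩
  · refine (vAt_comp _ _ _).trans ?_
    exact (congrArg (· ≫ _) ((vAt_whiskerRight α q.proj A).trans
      (congrArg (tot q.proj).map (hα A)))).trans (rPre_w β A)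
  · exact (topMap_vAt _ A).trans ((hα _).trans (rPre_topObj β A))

end

section

variable (H : rObj p ⟶ rObj q)

lemma tot_topMap {A B : ∫ᶜ p.total} (u : A ⟶ B) :
    topIso ((tot H).obj (secObj A)) ≫ (tot q.proj).map (topMap ((tot H).map (secMap u))) =
      (tot p.proj).map u ≫ topIso ((tot H).obj (secObj B)) :=
  (topMap_tot ((tot H).map (secMap u))).trans (congrArg (· ≫ _) (secMap_base u))

lemma hc_topMap_map {A B : ∫ᶜ (rObj p)} {m : A ⟶ B} (h : HC p.proj (topMap m)) :
    HC q.proj (topMap ((tot H).map m)) :=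
  car_iff_hc_topMap.1 ((car_iff_hc_topMap.2 h).tot H)

/-- The indexed functor underlying an indexed functor between essential fibres. -/
def rInv : TotData p.total q.total where
  obj {X} a := (rpt ((tot H).obj (secObj (ob a)))).pt
  map u := topMap ((tot H).map (secMap u))
  base u := (topMap_base _).trans (base_congr (secMap_base u))
  map_id A := (congrArg (fun t => topMap ((tot H).map t)) (secMap_id A)).trans
    ((congrArg topMap ((tot H).map_id _)).trans (topMap_id _))
  map_comp u w := (congrArg (fun t => topMap ((tot H).map t)) (secMap_comp u w)).trans
    ((congrArg topMap ((tot H).map_comp _ _)).trans (topMap_comp _ _))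
  car {A B} u hu := by
    refine (hc_topMap_map H (m := secMap u) ?_).car ?_
    · rw [topMap_secMap]
      exact Car.hc _ hu
    · have h := (IsIso.inv_comp_eq _).2 (tot_topMap H u).symm
      have h₁ := (car_of_isIso (inv (topIso ((tot H).obj (secObj A))))).trans
        ((hu.tot p.proj).trans (car_of_isIso (topIso ((tot H).obj (secObj B)))))
      exact (congrArg (fun t => Car t) h).mp h₁

lemma tot_rInv {A B : ∫ᶜ p.total} (u : A ⟶ B) :
    (tot (rInv H).toTrans).map u = topMap ((tot H).map (secMap u)) :=
  TotData.tot_map _ u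

/-- The inverse of `topIso`. -/
def topInv (A : ∫ᶜ (rObj p)) : (tot p.proj).obj (topObj A) ⟶ A.base :=
  inv (topIso A)

lemma isIso_topInv (A : ∫ᶜ (rObj p)) : IsIso (topInv A) :=
  inferInstanceAs (IsIso (inv (topIso A)))

lemma topInv_topIso (A : ∫ᶜ (rObj p)) : topInv A ≫ topIso A = 𝟙 _ :=
  IsIso.inv_hom_id (topIso A)

lemma topIso_topInv (A : ∫ᶜ (rObj p)) : topIso A ≫ topInv A = 𝟙 _ :=
  IsIso.hom_inv_id (topIso A)

lemma topInv_base (A : ∫ᶜ (rObj p)) : (topInv A).base = 𝟙 A.base.base :=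
  base_inv (IsIso.inv_hom_id (topIso A)) (comp_id _)

def rInvHom : p ⟶ q where
  hom := (rInv H).toTrans
  iso := isoOfV (F := (rInv H).toTrans ≫ q.proj) (G := p.proj)
    (fun A => topInv ((tot H).obj (secObj A))) (fun A => topInv_base _)
    (fun A => isIso_topInv _) (fun {A B} u => by
      have h := congrArg (tot q.proj).map (tot_rInv H u)
      have h' := tot_topMap H u
      refine (congrArg (· ≫ topInv ((tot H).obj (secObj B)))
        ((tot_comp (rInv H).toTrans q.proj u).trans h)).trans ?_
      exact comp_eq_comp_of_inv h' (topInv_topIso _) (topIso_topInv _))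
  cart := preservesCart_of_hc p.fib fun A B u hu => by
    have h := hc_topMap_map H (m := secMap u) (by rw [topMap_secMap]; exact hu)
    exact (congrArg (fun t => HC q.proj t) (tot_rInv H u)).mpr h

lemma topIso_rInvHom (A : ∫ᶜ (rObj p)) : topIso ((tot (rMap (rInvHom H))).obj A) =
    topIso A ≫ topIso ((tot H).obj (secObj (topObj A))) := by
  have h₁ : vAt (rInvHom H).iso.hom (topObj A) = topInv ((tot H).obj (secObj (topObj A))) :=
    vAt_ofV _ _ _ _
  have h₂ : topIso ((tot (rMap (rInvHom H))).obj A) ≫ vAt (rInvHom H).iso.hom (topObj A) =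
      topIso A := by
    have e : ((rpt A).iso.hom ≫ (phi (rInvHom H) A.base.base (rpt A).pt).inv) ≫
      (phi (rInvHom H) A.base.base (rpt A).pt).hom = (rpt A).iso.hom := by simp
    exact (ve_comp _ _).symm.trans (congrArg ve e)
  have h₃ := (congrArg (_ ≫ ·) h₁.symm).trans h₂
  exact (comp_id _).symm.trans ((congrArg (_ ≫ ·)
    (topInv_topIso ((tot H).obj (secObj (topObj A)))).symm).trans
    ((assoc _ _ _).symm.trans (congrArg (· ≫ _) h₃)))

lemma isIso_topMap {A B : ∫ᶜ (rObj p)} {m : A ⟶ B} (h : IsIso m) : IsIso (topMap m) :=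
  ⟨topMap (inv m), (topMap_comp _ _).symm.trans
      ((congrArg topMap (IsIso.hom_inv_id m)).trans (topMap_id A)),
    (topMap_comp _ _).symm.trans ((congrArg topMap (IsIso.inv_hom_id m)).trans (topMap_id B))⟩

lemma exists_rMap_iso : ∃ F : p ⟶ q, Nonempty (rMap F ≅ H) := by
  let k (A : ∫ᶜ (rObj p)) : topObj ((tot H).obj (secObj (topObj A))) ⟶ topObj ((tot H).obj A) :=
    topMap ((tot H).map (secCounit A))
  have key (A : ∫ᶜ (rObj p)) : ∃ t : (tot (rMap (rInvHom H))).obj A ⟶ (tot H).obj A,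
      topMap t = k A :=
    exists_topMap (A := (tot (rMap (rInvHom H))).obj A) (B := (tot H).obj A) (k A)
  choose t ht using key
  refine ⟨rInvHom H, ⟨isoOfV t (fun A => ?_) (fun A => ?_) (fun {A B} u => ?_)⟩⟩
  · have h : (t A).base ≫ topIso ((tot H).obj A) = topIso ((tot H).obj A) := by
      have h₁ := topMap_tot ((tot H).map (secCounit A))
      have h₂ : topIso A ≫ (secCounit A).base = 𝟙 _ :=
        comp_eq_id_of_isIso (isIso_topIso A) (secCounit_base A)
      refine (topMap_tot (t A)).symm.trans ?_
      refine (congrArg₂ (fun x y => x ≫ (tot q.proj).map y) (topIso_rInvHom H A) (ht A)).trans ?_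
      refine (assoc _ _ _).trans ((congrArg (_ ≫ ·) h₁).trans ?_)
      exact (assoc _ _ _).symm.trans ((congrArg (· ≫ _) h₂).trans (id_comp _))
    exact (cancel_mono (topIso ((tot H).obj A))).1 (h.trans (id_comp _).symm)
  · exact isIso_of_topMap ((congrArg (fun t => IsIso t) (ht A)).mpr
      (isIso_topMap (isIso_tot H inferInstance)))
  · refine topMap_inj ((topMap_comp _ _).trans ?_)
    refine (congrArg₂ (· ≫ ·) ((topMap_rMap _ u).trans (tot_rInv H _)) (ht B)).trans ?_
    refine (topMap_comp _ _).symm.trans ?_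
    have h := congrArg (fun t => topMap ((tot H).map t)) (secCounit_nat u)
    refine (congrArg topMap ((tot H).map_comp _ _).symm).trans (h.trans ?_)
    refine (congrArg topMap ((tot H).map_comp _ _)).trans ((topMap_comp _ _).trans ?_)
    exact (congrArg (· ≫ _) (ht A).symm).trans (topMap_comp _ _).symm

end

lemma rTwo_inj {F G : p ⟶ q} {x y : F ⟶ G} (h : rTwo x = rTwo y) : x = y :=
  Slice.hom₂_ext (hom₂_ext fun X a =>
    congrArg (fun t : rMap F ⟶ rMap G => EssFib.Hom.hom ((StrongTrans.Hom.comp t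
      (ob (E := D) ((pr p X).obj a))).app (⟨a, Iso.refl _⟩ : rFib p (ob ((pr p X).obj a))))) h)

lemma isLocEquiv_R : IsLocEquiv (R D) := by
  intro p q
  refine ⟨⟨?_⟩, ⟨?_⟩, ⟨?_⟩⟩
  · intro F G x y h
    exact rTwo_inj h
  · intro F G β
    obtain ⟨α, hα⟩ := exists_rTwo (F := F) (G := G) β
    exact ⟨α, hα⟩
  · intro H
    obtain ⟨F, ⟨e⟩⟩ := exists_rMap_iso (p := p) (q := q) H
    exact ⟨F, ⟨e⟩⟩

end

section

lemma ar_eqToHom {K : Type u₁} [Category.{v₁} K] {E : IndCat.{v₁, u₁, v₂, u₂} K} {X : K}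
    {f : X ⟶ X} (h : 𝟙 X = f) (a : E.fibre X) :
    ar (E := E) f (a := a) (b := a) ((E.resId X).inv.app a ≫
      (E.map₂ (eqToHom (congrArg (fun t : X ⟶ X => t.op.toLoc) h))).toNatTrans.app a) =
        𝟙 (ob a) := by
  subst h
  refine Eq.trans (congrArg (ar (𝟙 X)) ?_) ((ar_eq (𝟙 X) _).trans (resId_cl a))
  refine (congrArg (_ ≫ ·) (congrArg (fun t => t.toNatTrans.app a) (E.map₂_id _))).trans ?_
  exact comp_id _

section

variable {D : IndCat.{v, u, max u v w, max u v w w'} K}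
  (A : IndCat.{max u v w, max u v w w', max u v w, max u v w w'} (∫ᶜ D))

/-- The objects of the fibre of `L(A)`. -/
structure LPt (X : K) where
  base : D.fibre X
  fib : A.fibre (ob base)

variable {A} in
/-- The object of `∫ A` underlying an object of the total category of `L(A)`. -/
abbrev LPt.top {X : K} (x : LPt A X) : ∫ᶜ A := ob (E := A) (X := ob x.base) x.fib

/-- The total category of `L(A)` is that of `A`. -/
def lCleaved : Cleaved.{v, u, max u v w, max u v w w'} K where
  Obj := LPt A
  cat :=
    { Hom x y := x.fib.top ⟶ y.fib.top
      id x := 𝟙 x.fib.top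
      comp f g := CategoryStruct.comp (obj := ∫ᶜ A) f g
      id_comp f := id_comp (obj := ∫ᶜ A) f
      comp_id f := comp_id (obj := ∫ᶜ A) f
      assoc f g h := assoc (obj := ∫ᶜ A) f g h }
  base {x y} (m : x.fib.top ⟶ y.fib.top) := m.base.base
  base_id _ := rfl
  base_comp _ _ := rfl
  res f b := ⟨(D.res f).obj b.base, (A.res (ca f b.base)).obj b.fib⟩
  ca f b := ca (E := A) (ca f b.base) b.fib
  base_ca _ _ := rfl
  exists_lift {c X Y} f b (m : c.fib.top ⟶ b.top) g h := by
    obtain ⟨k₀, hk₀, hk₀'⟩ := (car_ca f b.base).exists_lift m.base g h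
    obtain ⟨k, hk, hk'⟩ := (car_ca (E := A) (ca f b.base) b.fib).exists_lift m k₀ hk₀'
    exact ⟨k, (base_congr hk).trans hk₀, hk'⟩
  hom_ext {c X Y} f b k k' h h' :=
    (car_ca (E := A) (ca f b.base) b.fib).hom_ext ((car_ca f b.base).hom_ext h
      (congrArg (fun t : c.fib.top ⟶ b.top => t.base) h')) h'

/-- The total indexed category of `L(A)`. -/
abbrev lTotal : IndCat.{v, u, max u v w, max u v w w'} K := (lCleaved A).ind

variable {A}

abbrev lEl {X : K} (x : LPt A X) : ∫ᶜ (lTotal A) := ob ((lCleaved A).el x)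

section

variable {X Y Z : K} {x : LPt A X} {y : LPt A Y} {z : LPt A Z}

def lArr (m : x.top ⟶ y.top) : lEl x ⟶ lEl y := (lCleaved A).arr (a := x) (b := y) m

def lUnarr (m : lEl x ⟶ lEl y) : x.top ⟶ y.top := (lCleaved A).unarr m

lemma lUnarr_lArr (m : x.top ⟶ y.top) : lUnarr (lArr m) = m :=
  (lCleaved A).unarr_arr (a := x) (b := y) m

lemma lArr_lUnarr (m : lEl x ⟶ lEl y) : lArr (lUnarr m) = m :=
  (lCleaved A).arr_unarr m

lemma lArr_comp (m : x.top ⟶ y.top) (n : y.top ⟶ z.top) : lArr (m ≫ n) = lArr m ≫ lArr n :=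
  (lCleaved A).arr_comp (a := x) (b := y) (c := z) m n

lemma lArr_id : lArr (𝟙 x.top) = 𝟙 (lEl x) := (lCleaved A).arr_id x

lemma lUnarr_comp (m : lEl x ⟶ lEl y)
    (n : lEl y ⟶ lEl z) :
    lUnarr (m ≫ n) = lUnarr m ≫ lUnarr n :=
  (lCleaved A).unarr_comp m n

lemma lUnarr_id : lUnarr (𝟙 (lEl x)) = 𝟙 _ := (lCleaved A).unarr_id x

lemma lUnarr_base (m : lEl x ⟶ lEl y) :
    (lUnarr m).base.base = m.base := (lCleaved A).unarr_base m

variable (y) in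
/-- The chosen cartesian arrows of `∫ A`. -/
def lCa (f : X ⟶ Y) : ((lCleaved A).res f y : LPt A X).top ⟶ y.top :=
  ca (E := A) (ca f y.base) y.fib

lemma car_lArr_lCa (f : X ⟶ Y) : Car (lArr (lCa y f)) := (lCleaved A).car_arr_ca f y

lemma car_lUnarr_base (m : lEl x ⟶ lEl y) (hm : Car m) : Car (lUnarr m).base := by
  obtain ⟨k, hk, hk', e⟩ := Car.exists_desc (car_lArr_lCa (y := y) m.base) hm (𝟙 X)
    (id_comp _)
  have h₁ : IsIso k := hk'.isIso_of_base (hk ▸ inferInstance)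
  obtain ⟨l, h₁, h₂⟩ := h₁
  have h₃ : (lUnarr k).base ≫ (lUnarr l).base = 𝟙 _ := base_congr
    ((lUnarr_comp k l).symm.trans ((congrArg lUnarr h₁).trans lUnarr_id))
  have h₄ : (lUnarr l).base ≫ (lUnarr k).base = 𝟙 _ := base_congr
    ((lUnarr_comp l k).symm.trans ((congrArg lUnarr h₂).trans lUnarr_id))
  have h₅ : IsIso (lUnarr k).base := ⟨_, h₃, h₄⟩
  have h₆ : (lUnarr k).base ≫ ca m.base y.base = (lUnarr m).base := base_congr
    (((congrArg (lUnarr k ≫ ·) (lUnarr_lArr (lCa y m.base))).symm.trans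
      (lUnarr_comp k _).symm).trans (congrArg lUnarr e))
  exact h₆ ▸ (car_of_isIso _).trans (car_ca _ _)

end

variable (A) in
/-- The projection of `L(A)`. -/
def lProj : TotData (lTotal A) D where
  obj a := ((lCleaved A).unel a).base
  map {x y} m := (lUnarr (x := (lCleaved A).unel x.fiber) (y := (lCleaved A).unel y.fiber) m).base
  base _ := lUnarr_base _
  map_id x := base_congr (lUnarr_id (x := (lCleaved A).unel x.fiber))
  map_comp _ _ := base_congr (lUnarr_comp _ _)
  car _ hm := car_lUnarr_base _ hm

section

variable {X Y : K} {x : LPt A X} {y : LPt A Y}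

lemma tot_lProj (m : lEl x ⟶ lEl y) : (tot (lProj A).toTrans).map m = (lUnarr m).base :=
  TotData.tot_map _ m

lemma hc_lArr (m : x.top ⟶ y.top) (hm : Car m) : HC (lProj A).toTrans (lArr m) := by
  refine (isCart_iff _ _).2 fun C n h hh => ?_
  have h₀ := tot_lProj (lArr m)
  rw [lUnarr_lArr] at h₀
  let c : LPt A C.base := (lCleaved A).unel C.fiber
  have h₁ : h ≫ m.base = (lUnarr (x := c) (y := y) n).base :=
    (congrArg (h ≫ ·) h₀).symm.trans (hh.trans (tot_lProj n))
  obtain ⟨k, hk, hk'⟩ := hm.exists_lift (lUnarr (x := c) (y := y) n) h h₁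
  refine ⟨lArr (x := c) k, ⟨?_, ?_⟩, fun l hl => ?_⟩
  · exact (tot_lProj _).trans ((base_congr (lUnarr_lArr k)).trans hk)
  · exact (lArr_comp k m).symm.trans ((congrArg lArr hk').trans (lArr_lUnarr _))
  · refine (lArr_lUnarr (x := c) l).symm.trans (congrArg lArr ?_)
    refine hm.hom_ext ?_ ?_
    · exact (tot_lProj _).symm.trans (hl.1.trans hk.symm)
    · refine Eq.trans ?_ (((lUnarr_comp l (lArr m)).symm.trans (congrArg lUnarr hl.2)).trans hk'.symm)
      exact (congrArg (lUnarr (x := c) l ≫ ·) (lUnarr_lArr m)).symm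

end

lemma isIndexedFibration_lProj : IsIndexedFibration (lProj A).toTrans :=
  isIndexedFibration_of_exists_hc fun U e t => by
    let y : LPt A e.base := (lCleaved A).unel e.fiber
    let t' : U ⟶ ob y.base := t
    let x : LPt A U.base := ⟨U.fiber, (A.res t').obj y.fib⟩
    let m : x.top ⟶ y.top := ca (E := A) t' y.fib
    refine ⟨(lCleaved A).el x, 𝟙 _, lArr m, id_base _, IsIso.id _, hc_lArr _ (car_ca _ _), ?_⟩
    refine (tot_lProj _).trans ((base_congr (lUnarr_lArr m)).trans ?_)
    exact (id_comp t).symm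

variable (A) in
/-- `L` on objects. -/
def lObj : FibOver D := ⟨lTotal A, (lProj A).toTrans, isIndexedFibration_lProj⟩

abbrev lPt {X : ∫ᶜ D} (a : A.fibre X) : LPt A X.base := ⟨X.fiber, a⟩

/-- The unit of `L ⊣ R` on objects. -/
def lSecObj {X : ∫ᶜ D} (a : A.fibre X) : (rObj (lObj A)).fibre X :=
  (secObj (p := lObj A) (lEl (lPt a))).fiber

/-- The unit of `L ⊣ R` on arrows. -/
def lSec {a b : ∫ᶜ A} (m : a ⟶ b) :
    ob (E := rObj (lObj A)) (lSecObj a.fiber) ⟶ ob (E := rObj (lObj A)) (lSecObj b.fiber) :=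
  secMap (p := lObj A) (lArr (x := lPt a.fiber) (y := lPt b.fiber) m)

lemma topMap_lSec {a b : ∫ᶜ A} (m : a ⟶ b) :
    topMap (lSec m) = lArr (x := lPt a.fiber) (y := lPt b.fiber) m := topMap_secMap _

lemma lSec_id (a : ∫ᶜ A) : lSec (𝟙 a) = 𝟙 (ob (E := rObj (lObj A)) (lSecObj a.fiber)) :=
  (congrArg (secMap (p := lObj A)) (lArr_id (x := lPt a.fiber))).trans (secMap_id _)

lemma lSec_comp {a b c : ∫ᶜ A} (m : a ⟶ b) (n : b ⟶ c) : lSec (m ≫ n) = lSec m ≫ lSec n :=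
  topMap_inj ((topMap_lSec _).trans ((lArr_comp (x := lPt a.fiber) (y := lPt b.fiber)
    (z := lPt c.fiber) m n).trans (congrArg₂ CategoryStruct.comp (topMap_lSec m).symm
      (topMap_lSec n).symm |>.trans (topMap_comp _ _).symm)))

lemma lSec_base {a b : ∫ᶜ A} (m : a ⟶ b) : (lSec m).base = m.base :=
  (secMap_base (p := lObj A) _).trans ((tot_lProj _).trans
    (base_congr (lUnarr_lArr (x := lPt a.fiber) (y := lPt b.fiber) m)))

lemma car_lSec {a b : ∫ᶜ A} {m : a ⟶ b} (hm : Car m) : Car (lSec m) :=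
  car_iff_hc_topMap.2 ((congrArg (fun t => HC (lObj A).proj t)
    (topMap_lSec m)).mpr (hc_lArr (x := lPt a.fiber) (y := lPt b.fiber) m hm))

variable (A) in
/-- The unit of `L ⊣ R`. -/
def lUnit : TotData A (rObj (lObj A)) where
  obj a := lSecObj a
  map m := lSec m
  base m := lSec_base m
  map_id a := lSec_id a
  map_comp m n := lSec_comp m n
  car _ hm := car_lSec hm

lemma tot_lUnit {a b : ∫ᶜ A} (m : a ⟶ b) : (tot (lUnit A).toTrans).map m = lSec m :=
  TotData.tot_map _ m

lemma isEquiv_lUnit : IsEquiv (lUnit A).toTrans := by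
  refine isEquiv_of_tot _ (fun a b m n h => ?_) (fun a b φ => ?_) fun X x => ?_
  · have h₁ := congrArg topMap ((tot_lUnit m).symm.trans (h.trans (tot_lUnit n)))
    have h₂ := (topMap_lSec m).symm.trans (h₁.trans (topMap_lSec n))
    exact (lUnarr_lArr (x := lPt a.fiber) (y := lPt b.fiber) m).symm.trans
      ((congrArg lUnarr h₂).trans (lUnarr_lArr (x := lPt a.fiber) (y := lPt b.fiber) n))
  · let φ' : secObj (p := lObj A) (lEl (lPt a.fiber)) ⟶ secObj (p := lObj A) (lEl (lPt b.fiber)) := φ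
    refine ⟨lUnarr (x := lPt a.fiber) (y := lPt b.fiber) (topMap φ'), (tot_lUnit _).trans ?_⟩
    exact topMap_inj ((topMap_lSec _).trans (lArr_lUnarr _))
  · let x' : ∫ᶜ (rObj (lObj A)) := ob x
    let y : LPt A X.base := (lCleaved A).unel (topObj x').fiber
    let t : X ⟶ ob y.base := topIso x'
    let e : A.fibre X := (A.res t).obj y.fib
    let m : (lPt e).top ⟶ y.top := ca (E := A) t y.fib
    have hm : HC (lObj A).proj (lArr m) := hc_lArr m (car_ca _ _)
    obtain ⟨u, hu⟩ := exists_topMap (p := lObj A) (A := secObj (lEl (lPt e))) (B := x') (lArr m)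
    have hc : Car u := car_iff_hc_topMap.2 (hu ▸ hm)
    have h₁ : (tot (lObj A).proj).map (lArr m) = t :=
      (tot_lProj _).trans (base_congr (lUnarr_lArr m))
    have h₂ := topMap_tot u
    rw [hu] at h₂
    have h₃ : t = u.base ≫ t := (((congrArg₂ CategoryStruct.comp (topIso_secObj (p := lObj A)
      (lEl (lPt e))) h₁).trans (id_comp t)).symm.trans h₂)
    have h₄ : Mono t := @IsIso.mono_of_iso _ _ _ _ t (isIso_topIso x')
    exact ⟨e, u, ((cancel_mono t).1 ((id_comp t).trans h₃)).symm, hc⟩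

variable (D) in
/-- The universal arrows of `L ⊣ R`. -/
def lUniv : UnivData (R D) where
  obj A := lObj A
  η _ := (lUnit _).toTrans
  univ A := isUniv_of_isEquiv (R := R D) isLocEquiv_R isEquiv_lUnit

variable {X : K}

lemma restr_resId {U : D.fibre X} (a : A.fibre (ob U)) :
    ((restr A X).resId U).inv.app a = (A.resId (ob U)).inv.app a ≫
      (A.map₂ (eqToHom (congrArg (fun t : ob U ⟶ ob U => t.op.toLoc) (ve_id U).symm))).toNatTrans.app a := by
  rfl

lemma restr_resComp {U V W : D.fibre X} (f : V ⟶ U) (g : W ⟶ V) (a : A.fibre (ob U)) :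
    ((restr A X).resComp f g _ rfl).inv.app a =
      (A.resComp (ve f) (ve g) (ve (g ≫ f)) (ve_comp g f).symm).inv.app a := by
  rw [resComp_rfl]
  rfl

abbrev rPt (a : ∫ᶜ (restr A X)) : LPt A X := ⟨a.base, a.fiber⟩

def rMor {a b : ∫ᶜ (restr A X)} (m : a ⟶ b) : (rPt a).top ⟶ (rPt b).top :=
  ar (E := A) (ve m.base) (vpart m)

lemma rMor_comp {a b c : ∫ᶜ (restr A X)} (m : a ⟶ b) (n : b ⟶ c) :
    rMor (m ≫ n) = rMor m ≫ rMor n := by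
  refine (congrArg rMor (ar_comp (E := restr A X) n.base m.base _ rfl (vpart m) (vpart n))).trans
    (Eq.trans ?_ (ar_comp (E := A) (ve n.base) (ve m.base) (ve (m.base ≫ n.base))
      (ve_comp _ _).symm (vpart m) (vpart n)).symm)
  exact congrArg (fun t => ar (E := A) (ve (m.base ≫ n.base)) (a := a.fiber) (b := c.fiber)
    (vpart m ≫ (A.res (ve m.base)).map (vpart n) ≫ t)) (restr_resComp n.base m.base c.fiber)

lemma rMor_id (a : ∫ᶜ (restr A X)) : rMor (𝟙 a) = 𝟙 (rPt a).top :=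
  (congrArg (ar (E := A) (a := a.fiber) (b := a.fiber) _) (restr_resId a.fiber)).trans
    (ar_eqToHom (E := A) (ve_id a.base).symm a.fiber)

def rArr {a b : ∫ᶜ (restr A X)} (m : a ⟶ b) : lEl (rPt a) ⟶ lEl (rPt b) :=
  lArr (rMor m)

lemma rArr_comp {a b c : ∫ᶜ (restr A X)} (m : a ⟶ b) (n : b ⟶ c) :
    rArr (m ≫ n) = rArr m ≫ rArr n :=
  (congrArg lArr (rMor_comp m n)).trans (lArr_comp _ _)

lemma rArr_id (a : ∫ᶜ (restr A X)) : rArr (𝟙 a) = 𝟙 _ :=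
  (congrArg lArr (rMor_id a)).trans lArr_id

lemma lUnarr_rArr {a b : ∫ᶜ (restr A X)} (m : a ⟶ b) : lUnarr (rArr m) = rMor m :=
  lUnarr_lArr _

lemma rArr_base {a b : ∫ᶜ (restr A X)} (m : a ⟶ b) : (rArr m).base = 𝟙 X := rfl

variable (A X) in
/-- The Grothendieck construction of `A(X, -)` is the fibre of `L(A)` at `X`. -/
def lFib : ∫ᶜ (restr A X) ⥤ (lTotal A).fibre X where
  obj a := (lCleaved A).el (rPt a)
  map m := vert (rArr m) (rArr_base m)
  map_id a := ve_inj ((ve_vert _ _).trans ((rArr_id a).trans (ve_id _).symm))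
  map_comp m n := ve_inj ((ve_vert _ _).trans ((rArr_comp m n).trans
    ((congrArg₂ CategoryStruct.comp (ve_vert _ _).symm (ve_vert _ _).symm).trans
      (ve_comp _ _).symm)))

lemma ve_lFib {a b : ∫ᶜ (restr A X)} (m : a ⟶ b) : ve ((lFib A X).map m) = rArr m :=
  ve_vert _ (rArr_base m)

lemma isEquivalence_lFib : (lFib A X).IsEquivalence where
  faithful := ⟨fun {a b m n} h => by
    have h₁ := (ve_lFib m).symm.trans ((congrArg ve h).trans (ve_lFib n))
    have h₂ := (lUnarr_rArr m).symm.trans ((congrArg lUnarr h₁).trans (lUnarr_rArr n))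
    obtain ⟨n', rfl⟩ := exists_ar n (ve_inj (base_congr h₂)).symm
    exact (ar_vpart m).symm.trans (congrArg (ar m.base)
      (ar_inj (E := A) (f := ve m.base) (n := n') h₂))⟩
  full := ⟨fun {a b} φ => by
    obtain ⟨f, hf⟩ := exists_ve (lUnarr (x := rPt a) (y := rPt b) (ve φ)).base (lUnarr_base _)
    obtain ⟨m, hm⟩ := exists_ar (lUnarr (x := rPt a) (y := rPt b) (ve φ)) hf.symm
    refine ⟨ar (E := restr A X) f m, ve_inj ((ve_lFib _).trans ?_)⟩
    exact (congrArg lArr hm).trans (lArr_lUnarr _)⟩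
  essSurj := ⟨fun x => ⟨ob (E := restr A X) (X := ((lCleaved A).unel x).base)
    ((lCleaved A).unel x).fib, ⟨Iso.refl _⟩⟩⟩

lemma pr_lFib {a b : ∫ᶜ (restr A X)} (m : a ⟶ b) :
    ((lObj A).pr X).map ((lFib A X).map m) = m.base := by
  refine ve_inj (((tot_ve (lObj A).proj _).symm.trans (congrArg _ (ve_lFib m))).trans ?_)
  exact (tot_lProj _).trans (base_congr (lUnarr_rArr m))

variable (A X) in
lemma exists_fibre_equivalence :
    ∃ e : (lObj A).total.fibre X ≌ ∫ᶜ (restr A X),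
      Nonempty (e.functor ⋙ CoGrothendieck.forget _ ≅ (lObj A).pr X) := by
  have := isEquivalence_lFib (A := A) (X := X)
  let i : lFib A X ⋙ (lObj A).pr X ≅ CoGrothendieck.forget _ :=
    NatIso.ofComponents (fun a => Iso.refl _) (fun {a b} m =>
      (comp_id _).trans ((pr_lFib m).trans (id_comp _).symm))
  exact ⟨(lFib A X).asEquivalence.symm, ⟨Functor.isoWhiskerLeft _ i.symm ≪≫
    (Functor.associator _ _ _).symm ≪≫
    Functor.isoWhiskerRight (lFib A X).asEquivalence.counitIso _ ≪≫ Functor.leftUnitor _⟩⟩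

variable (D) in
lemma exists_left_biadjoint :
    ∃ (L : IndCat.{max u v w, max u v w w', max u v w, max u v w w'} (∫ᶜ D) ⥤ᵖ FibOver D)
      (σ : Biadjunction L (R D)), (∀ A, IsEquiv (σ.unit.app A)) ∧
        ∀ A X, ∃ e : (L.obj A).total.fibre X ≌ ∫ᶜ (restr A X),
          Nonempty (e.functor ⋙ CoGrothendieck.forget _ ≅ (L.obj A).pr X) :=
  ⟨(lUniv D).left, (lUniv D).biadjunction, fun _ => isEquiv_lUnit,
    fun A X => exists_fibre_equivalence A X⟩

end

end

section

variable {J : GrothendieckTopology K}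
  {E E' E'' : IndCat.{v, u, v', u'} K}

lemma LE.loc_car_vert {w : E ⟶ E'} (hw : LE J w) {X : K} {a b : E.fibre X} (k : ob a ⟶ ob b)
    (hk : k.base = 𝟙 X) [IsIso ((tot w).map k)] :
    Loc J (fun _ f => Car (ca f a ≫ k)) := by
  refine (hw.surj (inv ((tot w).map k))).bind fun Y f ⟨n, hn⟩ => ?_
  obtain ⟨kf, hkf, hkf'⟩ := (car_ca f b).exists_lift (ca f a ≫ k) (𝟙 Y)
    ((id_comp f).trans (((congrArg (f ≫ ·) hk)).trans (comp_id f)).symm)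
  have e₁ : LocEq J (n ≫ k) (ca f b) := hw.inj _ _ (by
    rw [Functor.map_comp, hn, assoc, IsIso.inv_hom_id, comp_id])
  have e₂ : LocEq J (kf ≫ n) (ca f a) := hw.inj _ _ (by
    rw [Functor.map_comp, hn, ← assoc, ← Functor.map_comp]
    refine (congrArg (fun t => (tot w).map t ≫ inv ((tot w).map k)) hkf').trans ?_
    rw [Functor.map_comp, assoc, IsIso.hom_inv_id, comp_id])
  have hb : n.base = f :=
    (comp_id n.base).symm.trans ((congrArg (n.base ≫ ·) hk).symm.trans e₁.1)
  refine (e₁.2.and e₂.2).mono fun Z g ⟨h₃, h₄⟩ => ?_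
  have hc := (car_ca g ((E.res f).obj a)).trans (car_ca f a)
  have hd := (car_ca g ((E.res f).obj b)).trans (car_ca f b)
  obtain ⟨kg, hkg, hkg'⟩ := (car_ca g ((E.res f).obj b)).exists_lift
    (ca g ((E.res f).obj a) ≫ kf) (𝟙 Z)
    ((id_comp g).trans ((congrArg (g ≫ ·) hkf).trans (comp_id g)).symm)
  obtain ⟨l, hl, hl'⟩ := hc.exists_lift (ca g ((E.res f).obj b) ≫ n) (𝟙 Z)
    ((id_comp _).trans (congrArg (g ≫ ·) hb).symm)
  have h₅ : kg ≫ l = 𝟙 _ := hc.hom_ext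
    ((congrArg₂ CategoryStruct.comp hkg hl).trans (id_comp _)) (by
      rw [assoc, hl', ← assoc, hkg', assoc, id_comp]; exact h₄)
  have h₆ : l ≫ kg = 𝟙 _ := hd.hom_ext
    ((congrArg₂ CategoryStruct.comp hl hkg).trans (id_comp _)) (by
      rw [assoc, ← assoc kg, hkg', assoc, hkf', id_comp,
        ← assoc (ca g _), ← assoc, hl', assoc]
      exact h₃)
  have : IsIso kg := ⟨l, h₅, h₆⟩
  obtain ⟨j, -, hj, hj'⟩ := Car.exists_desc hc (car_ca (g ≫ f) a) (𝟙 Z) (id_comp _)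
  have h₇ : (ca g ((E.res f).obj a) ≫ ca f a) ≫ k =
      kg ≫ ca g ((E.res f).obj b) ≫ ca f b := by
    rw [assoc, ← hkf', ← assoc, ← hkg', assoc]
  rw [← hj', assoc, h₇]
  exact hj.trans ((car_of_isIso kg).trans hd)

lemma LE.loc_car {w : E ⟶ E'} (hw : LE J w) {A B : ∫ᶜ E} (m : A ⟶ B) (hm : Car ((tot w).map m)) :
    Loc J (fun (Y : K) (f : Y ⟶ A.base) => Car (ca f A.fiber ≫ m)) := by
  obtain ⟨k, hk, hkm⟩ := Car.factor_ca m
  have h₁ : Car ((tot w).map k) := Car.of_comp ((car_ca m.base B.fiber).tot w)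
    (by rw [← Functor.map_comp, hkm]; exact hm)
  have : IsIso ((tot w).map k) := h₁.isIso_of_base (by rw [tot_base, hk]; exact IsIso.id _)
  refine (hw.loc_car_vert k hk).mono fun Y f hf => ?_
  rw [← hkm, ← assoc]
  exact hf.trans (car_ca _ _)

lemma LE.of_comp {w : E ⟶ E'} {b : E' ⟶ E''} {g : E ⟶ E''} (i : w ≫ b ≅ g) (hg : LE J g)
    (hb : LE J b) : LE J w := by
  let t (A : ∫ᶜ E) : (tot b).obj ((tot w).obj A) ⟶ (tot g).obj A := vAt i.hom A
  have ht (A) : IsIso (t A) := inferInstanceAs (IsIso (vAt i.hom A))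
  have nat {A B : ∫ᶜ E} (m : A ⟶ B) : (tot b).map ((tot w).map m) ≫ t B = t A ≫ (tot g).map m :=
    (congrArg (· ≫ t B) (tot_comp w b m).symm).trans (vAt_nat i.hom m)
  refine ⟨fun A B m n h => hg.inj _ _ ?_, fun A B φ => ?_, fun X x => ?_⟩
  · rw [← cancel_epi (t A), ← nat, ← nat, h]
  · refine (hg.surj (inv (t A) ≫ (tot b).map φ ≫ t B)).bind fun Y f ⟨n, hn⟩ => ?_
    have h : (tot b).map ((tot w).map n) = (tot b).map ((tot w).map (ca f A.fiber) ≫ φ) := by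
      rw [← cancel_mono (t B), nat, hn, ← assoc, ← nat, Functor.map_comp]
      simp only [assoc, IsIso.hom_inv_id_assoc]
    refine (hb.inj _ _ h).2.mono fun Z g hg => ?_
    obtain ⟨j, hj, hj'⟩ := (car_ca f A.fiber).exists_lift (ca (g ≫ f) A.fiber) g rfl
    refine ⟨j ≫ n, ?_⟩
    obtain ⟨l, -, hl⟩ := (car_ca g ((tot w).obj (ob ((E.res f).obj A.fiber))).fiber).exists_lift
      ((tot w).map j) (𝟙 Z) ((id_comp _).trans hj.symm)
    rw [Functor.map_comp, ← hj', Functor.map_comp, ← hl]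
    exact (assoc _ _ _).trans ((congrArg (l ≫ ·) hg).trans
      ((congrArg (l ≫ ·) (assoc _ _ _).symm).trans ((assoc _ _ _).symm.trans
        (congrArg (· ≫ φ) (assoc _ _ _).symm))))
  · refine (hg.ess ((StrongTrans.comp b X).obj x)).bind fun Y f ⟨e, u, hu, hu'⟩ => ?_
    obtain ⟨k, hk, hk', -⟩ := Car.exists_desc ((car_ca f x).tot b)
      ((car_of_isIso (t (ob e))).trans hu') (𝟙 Y)
      ((id_comp f).trans (((congrArg (· ≫ u.base) (vAt_base i.hom (ob e))).trans
        (id_comp _)).trans hu).symm)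
    refine (hb.surj (A := (tot w).obj (ob e)) (B := ob ((E'.res f).obj x)) k).bind
      fun Z g ⟨n, hn⟩ => ?_
    have hn' : Car ((tot b).map n) := hn ▸ ((car_ca g _).tot b).trans hk'
    have hgn : n.base = g := by
      have := base_congr hn
      exact this.trans ((congrArg (g ≫ ·) hk).trans (comp_id _))
    refine (hb.loc_car n hn').mono fun W h hh => ?_
    obtain ⟨l, hl, hl', -⟩ := Car.exists_desc ((car_ca h _).trans
      (car_ca g ((tot w).obj (ob e)).fiber)) ((car_ca (h ≫ g) e).tot w) (𝟙 W) (id_comp _)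
    refine ⟨(E.res (h ≫ g)).obj e, l ≫ (ca h _ ≫ n) ≫ ca f x, ?_,
      hl'.trans (hh.trans (car_ca f x))⟩
    have : (l ≫ (ca h _ ≫ n) ≫ ca f x).base = l.base ≫ (h ≫ n.base) ≫ f := rfl
    rw [this, hl, hgn]
    exact id_comp _

end

section

variable {J : GrothendieckTopology K}
  {D : IndCat.{v, u, v', max u' v'} K} {p q : FibOver D}

lemma Loc.giraud {X : ∫ᶜ D} {P : ∀ ⦃Y : ∫ᶜ D⦄, (Y ⟶ X) → Prop}
    (hP : ∀ ⦃Y Z : ∫ᶜ D⦄ (f : Y ⟶ X) (g : Z ⟶ Y), P f → P (g ≫ f))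
    (h : Loc J (fun _ f => P (ca f X.fiber))) : Loc (Fib.giraud J D) P :=
  ⟨⟨P, fun h g => hP _ g h⟩, h.sieve_mem (S := cartSieve ⟨P, fun h g => hP _ g h⟩)
    fun _ _ hf => hf, fun _ _ hf => hf⟩

lemma exists_topMap_ca (A : ∫ᶜ (rObj p)) {Y : K} (f : Y ⟶ A.base.base) :
    ∃ k : topObj (ob (E := rObj p) ((res _ (ca f A.base.fiber)).obj A.fiber)) ⟶
        ob (((p.total).res f).obj (topObj A).fiber), k.base = 𝟙 Y ∧
      k ≫ ca f (topObj A).fiber = topMap (ca (ca f A.base.fiber) A.fiber) :=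
  (car_ca f (topObj A).fiber).exists_lift (topMap (ca (ca f A.base.fiber) A.fiber)) (𝟙 Y)
    ((id_comp f).trans (topMap_base (ca (ca f A.base.fiber) A.fiber)).symm)

lemma le_rMap {F : p ⟶ q} (hF : LE J F.hom) : LE (giraud J D) (rMap F) := by
  refine ⟨fun A B m n h => ⟨base_eq_of_tot _ h, ?_⟩, fun A B φ => ?_, fun X x => ?_⟩
  · have h₁ := (topMap_rMap F m).symm.trans ((congrArg topMap h).trans (topMap_rMap F n))
    refine Loc.giraud (fun Y Z f g hf => ?_) ((hF.inj _ _ h₁).2.mono fun Y f hf => ?_)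
    · obtain ⟨k, -, hk⟩ := (car_ca f A.fiber).exists_lift (ca (g ≫ f) A.fiber) g rfl
      rw [← hk, assoc, assoc, hf]
    · refine topMap_inj ((topMap_comp _ m).trans (Eq.trans ?_ (topMap_comp _ n).symm))
      obtain ⟨k, -, hk⟩ := exists_topMap_ca A f
      rw [← hk, assoc, assoc, hf]
  · let φ' : (tot F.hom).obj (topObj A) ⟶ (tot F.hom).obj (topObj B) := topMap φ
    refine Loc.giraud (fun Y Z f g ⟨n, hn⟩ => ?_) ((hF.surj φ').mono fun Y f ⟨n, hn⟩ => ?_)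
    · obtain ⟨k, -, hk⟩ := (car_ca f A.fiber).exists_lift (ca (g ≫ f) A.fiber) g rfl
      refine ⟨k ≫ n, ?_⟩
      rw [← hk, Functor.map_comp, Functor.map_comp, hn,
        assoc]
    · obtain ⟨k, -, hk⟩ := exists_topMap_ca A f
      obtain ⟨m, hm⟩ := exists_topMap (B := B) (k ≫ n)
      refine ⟨m, topMap_inj ((topMap_rMap F m).trans (Eq.trans ?_ (topMap_comp _ φ).symm))⟩
      refine Eq.trans ?_ (congrArg (· ≫ φ') (topMap_rMap F _)).symm
      rw [hm, ← hk, Functor.map_comp, Functor.map_comp, hn]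
      exact (assoc _ _ _).symm
  · let x' : ∫ᶜ (rObj q) := ob x
    refine Loc.giraud (fun Y Z f g ⟨e, u, hu, hu'⟩ => ⟨(res _ g).obj e,
      (tot (rMap F)).map (ca g e) ≫ u, congrArg (g ≫ ·) hu, ((car_ca g e).tot _).trans hu'⟩)
      ((hF.ess (topObj x').fiber).mono fun Y f ⟨e, u, hu, hu'⟩ => ?_)
    let s : ∫ᶜ (rObj p) := secObj (ob e)
    obtain ⟨m, hm⟩ := exists_topMap (A := (tot (rMap F)).obj s) (B := x') u
    have h₁ : Car m := car_iff_hc_topMap.2 ((congrArg (fun t => HC q.proj t) hm).mpr (hu'.hc _))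
    have h₂ := topMap_tot m
    rw [hm] at h₂
    have h₃ : Car (m.base ≫ topIso x') := h₂ ▸
      (@car_of_isIso _ _ _ _ _ _ (isIso_topIso _)).trans (hu'.tot q.proj)
    have h₄ : Car m.base := Car.of_comp (@car_of_isIso _ _ _ _ _ _ (isIso_topIso x')) h₃
    have h₅ : m.base.base = f := (topMap_base m).symm.trans
      ((base_congr hm).trans hu)
    obtain ⟨v, -, -, hv⟩ := Car.exists_desc h₄ (car_ca f X.fiber) (𝟙 Y)
      ((congrArg (𝟙 Y ≫ ·) h₅).trans (id_comp f))
    exact ⟨((rObj p).res v).obj s.fiber, (tot (rMap F)).map (ca v s.fiber) ≫ m, hv,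
      ((car_ca v s.fiber).tot _).trans h₁⟩

end

section

variable {D D' : IndCat.{v, u, v', max u' v'} K} {η : D ⟶ D'}
  {q : FibOver D'}

def bCmp (A : ∫ᶜ (bTotal η q)) :
    (tot η).obj ((tot (bProj η q)).obj A) ⟶ (tot q.proj).obj ((tot (bSnd η q)).obj A) :=
  vAt (bIso η q).hom A

instance isIso_bCmp (A : ∫ᶜ (bTotal η q)) : IsIso (bCmp A) := inferInstanceAs (IsIso (vAt _ A))

lemma bCmp_base (A : ∫ᶜ (bTotal η q)) : (bCmp A).base = 𝟙 A.base := vAt_base _ A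

lemma bCmp_nat {A B : ∫ᶜ (bTotal η q)} (m : A ⟶ B) :
    (tot η).map ((tot (bProj η q)).map m) ≫ bCmp B =
      bCmp A ≫ (tot q.proj).map ((tot (bSnd η q)).map m) :=
  ((congrArg (· ≫ bCmp B) (tot_comp _ η m).symm).trans (vAt_nat (bIso η q).hom m)).trans
    (congrArg (bCmp A ≫ ·) (tot_comp _ q.proj m))

lemma bTotal_ext {A B : ∫ᶜ (bTotal η q)} {m n : A ⟶ B}
    (h₁ : (tot (bProj η q)).map m = (tot (bProj η q)).map n)
    (h₂ : (tot (bSnd η q)).map m = (tot (bSnd η q)).map n) : m = n := by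
  have hb : m.base = n.base := base_eq_of_tot _ h₁
  obtain ⟨k, hk, hk'⟩ := Car.factor_ca n
  obtain ⟨l, hl, hl'⟩ := (car_ca n.base B.fiber).exists_lift m (𝟙 _)
    ((id_comp _).trans hb.symm)
  obtain ⟨k, rfl⟩ := exists_ve k hk
  obtain ⟨l, rfl⟩ := exists_ve l hl
  have hc := car_ca n.base B.fiber
  rw [← hk', ← hl', Functor.map_comp, Functor.map_comp] at h₁ h₂
  have e₁ := (hc.tot (bProj η q)).hom_ext (by rw [tot_base, tot_base, ve_base, ve_base]) h₁
  have e₂ := (hc.tot (bSnd η q)).hom_ext (by rw [tot_base, tot_base, ve_base, ve_base]) h₂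
  have : l = k := CategoricalPullback.hom_ext
    (ve_inj ((tot_ve (bProj η q) l).symm.trans (e₁.trans (tot_ve (bProj η q) k))))
    (ve_inj ((tot_ve (bSnd η q) l).symm.trans (e₂.trans (tot_ve (bSnd η q) k))))
  rw [← hk', ← hl', this]

lemma exists_bTotal {A B : ∫ᶜ (bTotal η q)} (f : (tot (bProj η q)).obj A ⟶ (tot (bProj η q)).obj B)
    (g : (tot (bSnd η q)).obj A ⟶ (tot (bSnd η q)).obj B)
    (h : (tot η).map f ≫ bCmp B = bCmp A ≫ (tot q.proj).map g) :
    ∃ m : A ⟶ B, (tot (bProj η q)).map m = f ∧ (tot (bSnd η q)).map m = g := by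
  have hb : f.base = g.base := by
    have := base_congr h
    exact (comp_id f.base).symm.trans (this.trans (id_comp g.base))
  have hc := car_ca (E := bTotal η q) f.base B.fiber
  obtain ⟨k, hk, hk'⟩ := (hc.tot (bProj η q)).exists_lift f (𝟙 _) (id_comp _)
  obtain ⟨l, hl, hl'⟩ := (hc.tot (bSnd η q)).exists_lift g (𝟙 _) ((id_comp _).trans hb)
  have h' : (tot η).map k ≫ bCmp _ = bCmp A ≫ (tot q.proj).map l := by
    refine ((hc.tot (bSnd η q)).tot q.proj).hom_ext ?_ ?_
    · have : k.base ≫ 𝟙 _ = 𝟙 _ ≫ l.base := by rw [hk, hl]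
      exact this
    · refine (assoc _ _ _).trans ((congrArg ((tot η).map k ≫ ·) (bCmp_nat _).symm).trans ?_)
      refine ((assoc _ _ _).symm.trans (congrArg (· ≫ bCmp B)
        (((tot η).map_comp k _).symm.trans (congrArg (tot η).map hk')))).trans (h.trans ?_)
      exact (congrArg (bCmp A ≫ ·) ((congrArg (tot q.proj).map hl').symm.trans
        ((tot q.proj).map_comp l _))).trans (assoc _ _ _).symm
  obtain ⟨k', rfl⟩ := exists_ve k hk
  obtain ⟨l', rfl⟩ := exists_ve l hl
  let m : (show bFib η q A.base from A.fiber) ⟶ (bTotal η q |>.res f.base).obj B.fiber :=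
    ⟨k', l', ve_inj (by
      refine (ve_comp _ _).trans (Eq.trans ?_ (ve_comp _ _).symm)
      exact (congrArg (· ≫ bCmp _) (tot_ve η k')).symm.trans (h'.trans
        (congrArg (bCmp A ≫ ·) (tot_ve q.proj l'))))⟩
  refine ⟨ve (E := bTotal η q) m ≫ ca f.base B.fiber, ?_, ?_⟩
  · refine (Functor.map_comp _ _ _).trans (Eq.trans ?_ hk')
    exact congrArg (· ≫ _) (tot_ve (bProj η q) m)
  · refine (Functor.map_comp _ _ _).trans (Eq.trans ?_ hl')
    exact congrArg (· ≫ _) (tot_ve (bSnd η q) m)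

variable {J : GrothendieckTopology K}

lemma le_bSnd (hη : LE J η) : LE J (bSnd η q) := by
  refine ⟨fun A B m n h => ⟨base_eq_of_tot _ h, ?_⟩, fun A B φ => ?_, fun X y => ?_⟩
  · have h₁ : (tot η).map ((tot (bProj η q)).map m) = (tot η).map ((tot (bProj η q)).map n) := by
      rw [← cancel_mono (bCmp B), bCmp_nat, bCmp_nat, h]
    refine (hη.inj _ _ h₁).2.mono fun Y f hf => ?_
    obtain ⟨κ, -, hκ⟩ := Car.factor_ca ((tot (bProj η q)).map (ca f A.fiber))
    refine bTotal_ext ?_ ?_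
    · rw [Functor.map_comp, Functor.map_comp, ← hκ]
      exact (assoc _ _ _).trans ((congrArg (κ ≫ ·) hf).trans (assoc _ _ _).symm)
    · rw [Functor.map_comp, Functor.map_comp, h]
  · refine (hη.surj (bCmp A ≫ (tot q.proj).map φ ≫ inv (bCmp B))).mono fun Y f ⟨n, hn⟩ => ?_
    obtain ⟨κ, -, hκ⟩ := Car.factor_ca ((tot (bProj η q)).map (ca f A.fiber))
    obtain ⟨m, -, hm⟩ := exists_bTotal (A := ob ((res _ f).obj A.fiber)) (B := B) (κ ≫ n)
      ((tot (bSnd η q)).map (ca f A.fiber) ≫ φ) (by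
        have h₁ : (tot η).map (κ ≫ n) =
            (tot η).map ((tot (bProj η q)).map (ca f A.fiber)) ≫
              bCmp A ≫ (tot q.proj).map φ ≫ inv (bCmp B) := by
          refine (Functor.map_comp _ _ _).trans ((congrArg (_ ≫ ·) hn).trans ?_)
          refine (assoc _ _ _).symm.trans (congrArg (· ≫ _) ?_)
          exact (Functor.map_comp _ _ _).symm.trans (congrArg (tot η).map hκ)
        rw [h₁, Functor.map_comp, assoc, assoc, assoc,
          IsIso.inv_hom_id, comp_id, ← assoc, bCmp_nat, assoc])
    exact ⟨m, hm⟩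
  · refine (hη.ess ((pr q X).obj y)).mono fun Y f ⟨U, u, hu, hu'⟩ => ?_
    obtain ⟨i, hi, hi', -⟩ := Car.exists_desc ((car_ca f y).tot q.proj) hu' (𝟙 Y)
      ((id_comp f).trans hu.symm)
    have : IsIso i := hi'.isIso_of_base (hi ▸ IsIso.id _)
    obtain ⟨j, rfl⟩ := exists_ve i hi
    have := isIso_of_ve this
    exact ⟨(⟨U, (q.total.res f).obj y, asIso j⟩ : bFib η q Y), ca f y, rfl, car_ca f y⟩

end

section

variable {D D' : IndCat.{v, u, v', max u' v'} K} {η : D ⟶ D'}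
  {q : FibOver D'} {p : FibOver D} (G : p.total ⟶ q.total) (θ : p.proj ≫ η ≅ G ≫ q.proj)
  (hG : PreservesCart p.proj q.proj G)

def bLiftIso : (bLift G θ hG).hom ≫ bSnd η q ≅ G :=
  mkModIso (F := (bLift G θ hG).hom ≫ bSnd η q) (G := G) (fun _ => Iso.refl _) (fun f a => by
    have e₂ : (StrongTrans.nat ((bLift G θ hG).hom ≫ bSnd η q) f).hom.app a =
        Hom.snd ((StrongTrans.nat (bLift G θ hG).hom f).hom.app a) :=
      (StrongTrans.comp_nat_app _ (bSnd η q) f a).trans (comp_id _)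
    refine (id_comp _).trans (Eq.symm ((congrArg (_ ≫ ·)
      (CategoryTheory.Functor.map_id (q.total.res f) _)).trans
        ((comp_id _).trans (e₂.trans ?_))))
    rfl)

end

section

lemma comp_aux₃ {C : Type*} [Category* C] {x₁ x₂ x₃ x₄ x₅ x₆ : C} {a : x₁ ⟶ x₂} {b : x₂ ⟶ x₃}
    {c : x₃ ⟶ x₄} {d : x₄ ⟶ x₅} {e : x₂ ⟶ x₁} {i : x₁ ⟶ x₆} {k : x₆ ⟶ x₅}
    (h : b ≫ c ≫ d = (e ≫ i) ≫ k) (h' : a ≫ e = 𝟙 _) : (a ≫ b ≫ c) ≫ d = i ≫ k := by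
  rw [assoc, assoc, h, assoc, ← assoc, h', id_comp]

section

variable {D D' : IndCat.{v, u, v', max u' v'} K} {η : D ⟶ D'}
  {q : FibOver D'}

lemma hc_of_bSnd {A B : ∫ᶜ (bTotal η q)} {u : A ⟶ B} (h : HC q.proj ((tot (bSnd η q)).map u)) :
    HC (bProj η q) u := by
  refine (isCart_iff _ _).2 fun C n t ht => ?_
  have e : (inv (bCmp C) ≫ (tot η).map t ≫ bCmp A) ≫ (tot q.proj).map ((tot (bSnd η q)).map u) =
      (tot q.proj).map ((tot (bSnd η q)).map n) := by
    rw [assoc, assoc, ← bCmp_nat u, IsIso.inv_comp_eq, ← bCmp_nat n,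
      ← assoc, ← Functor.map_comp]
    exact congrArg (fun t => (tot η).map t ≫ bCmp B) ht
  obtain ⟨k, hk, hk'⟩ := h.exists_lift _ _ e
  obtain ⟨l, hl, hl'⟩ := exists_bTotal t k (by rw [hk, IsIso.hom_inv_id_assoc])
  refine ⟨l, ⟨hl, bTotal_ext ?_ ?_⟩, fun l' h' => bTotal_ext (h'.1.trans hl.symm) ?_⟩
  · rw [Functor.map_comp, hl, ht]
  · rw [Functor.map_comp, hl', hk']
  · refine h.hom_ext ?_ ?_
    · rw [← cancel_epi (bCmp C), ← bCmp_nat l', ← bCmp_nat l, h'.1, hl]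
    · rw [← Functor.map_comp, h'.2, hl', hk']

/-- The object of a base change underlying an object of its essential fibres. -/
abbrev bTop (A : ∫ᶜ (rObj (bObj η q))) : ∫ᶜ (bTotal η q) := topObj A

abbrev sObj (A : ∫ᶜ (rObj (bObj η q))) : ∫ᶜ q.total := (tot (bSnd η q)).obj (bTop A)

section

variable {A B C : ∫ᶜ (rObj (bObj η q))}

def bTopMap (m : A ⟶ B) : bTop A ⟶ bTop B := topMap m

lemma bTopMap_comp (m : A ⟶ B) (n : B ⟶ C) : bTopMap (m ≫ n) = bTopMap m ≫ bTopMap n := by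
  have := topMap_comp m n
  unfold bTopMap
  exact this

def sMap (m : A ⟶ B) : sObj A ⟶ sObj B := (tot (bSnd η q)).map (bTopMap m)

lemma sMap_comp (m : A ⟶ B) (n : B ⟶ C) : sMap (m ≫ n) = sMap m ≫ sMap n :=
  (congrArg (tot (bSnd η q)).map (bTopMap_comp m n)).trans ((tot (bSnd η q)).map_comp _ _)

lemma sMap_base (m : A ⟶ B) : (sMap m).base = m.base.base := topMap_base m

def sCmp (A : ∫ᶜ (rObj (bObj η q))) : (tot η).obj A.base ⟶ (tot q.proj).obj (sObj A) :=
  (tot η).map (topIso A) ≫ bCmp (bTop A)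

instance isIso_sCmp (A : ∫ᶜ (rObj (bObj η q))) : IsIso (sCmp A) := by
  exact @IsIso.comp_isIso _ _ _ _ _ _ _ (isIso_tot η (isIso_topIso A)) (isIso_bCmp (bTop A))

lemma sCmp_base (A : ∫ᶜ (rObj (bObj η q))) : (sCmp A).base = 𝟙 A.base.base :=
  (congrArg₂ CategoryStruct.comp (topIso_base A) (bCmp_base (bTop A))).trans (comp_id _)

lemma sCmp_nat (m : A ⟶ B) :
    (tot η).map m.base ≫ sCmp B = sCmp A ≫ (tot q.proj).map (sMap m) := by
  refine (assoc _ _ _).symm.trans (Eq.trans ?_ (assoc _ _ _).symm)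
  refine Eq.trans ?_ (congrArg ((tot η).map (topIso A) ≫ ·) (bCmp_nat (bTopMap m)))
  refine Eq.trans (congrArg (· ≫ bCmp (bTop B)) ?_) (assoc _ _ _)
  exact ((tot η).map_comp _ _).symm.trans ((congrArg (tot η).map (topMap_tot m).symm).trans
    ((tot η).map_comp _ _))

lemma sCmp_nat_of_base {m : A ⟶ B} {f : A.base ⟶ B.base} (h : m.base = f) :
    (tot η).map f ≫ sCmp B = sCmp A ≫ (tot q.proj).map (sMap m) := h ▸ sCmp_nat m

lemma sMap_ext {m n : A ⟶ B} (h : m.base = n.base) (h' : sMap m = sMap n) : m = n := by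
  refine topMap_inj (bTotal_ext ?_ h')
  have h₁ : Epi (topIso A) := @IsIso.epi_of_iso _ _ _ _ _ (isIso_topIso A)
  exact (cancel_epi (topIso A)).1 ((topMap_tot m).trans
    ((congrArg (· ≫ topIso B) h).trans (topMap_tot n).symm))

lemma exists_sMap (f : A.base ⟶ B.base) (g : sObj A ⟶ sObj B)
    (h : (tot η).map f ≫ sCmp B = sCmp A ≫ (tot q.proj).map g) :
    ∃ m : A ⟶ B, m.base = f ∧ sMap m = g := by
  obtain ⟨u, hu, hu'⟩ := exists_bTotal (topInv A ≫ f ≫ topIso B) g (by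
    have h₁ : (tot η).map (topInv A ≫ f ≫ topIso B) =
        (tot η).map (topInv A) ≫ (tot η).map f ≫ (tot η).map (topIso B) :=
      ((tot η).map_comp _ _).trans (congrArg ((tot η).map (topInv A) ≫ ·) ((tot η).map_comp _ _))
    have h₂ : (tot η).map (topInv A) ≫ (tot η).map (topIso A) = 𝟙 _ :=
      ((tot η).map_comp _ _).symm.trans ((congrArg (tot η).map (topInv_topIso A)).trans
        ((tot η).map_id _))
    exact (congrArg (· ≫ bCmp (bTop B)) h₁).trans (comp_aux₃ h h₂))
  obtain ⟨m, rfl⟩ := exists_topMap u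
  refine ⟨m, ?_, hu'⟩
  have h₁ : Mono (topIso B) := @IsIso.mono_of_iso _ _ _ _ _ (isIso_topIso B)
  refine (cancel_mono (topIso B)).1 ((topMap_tot m).symm.trans
    ((congrArg (topIso A ≫ ·) hu).trans ?_))
  exact (assoc _ _ _).symm.trans ((congrArg (· ≫ f ≫ topIso B)
    (topIso_topInv A)).trans (id_comp _))

lemma hc_sMap {m : A ⟶ B} (h : Car m) : HC q.proj (sMap m) :=
  (preservesCart_bSnd η q).hc q.fib (car_iff_hc_topMap.1 h)

lemma car_of_hc_sMap {m : A ⟶ B} (h : HC q.proj (sMap m)) : Car m :=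
  car_iff_hc_topMap.2 (hc_of_bSnd h)

lemma car_sMap {m : A ⟶ B} (h : Car m) (h' : Car m.base) : Car (sMap m) := by
  refine (hc_sMap h).car (Car.of_comp (w := 𝟙 _) (car_of_isIso _) ?_)
  rw [comp_id]
  have h₁ : (tot q.proj).map (sMap m) = inv (sCmp A) ≫ (tot η).map m.base ≫ sCmp B :=
    ((IsIso.inv_comp_eq _).2 (sCmp_nat m)).symm
  rw [h₁]
  exact (car_of_isIso _).trans ((h'.tot η).trans (car_of_isIso _))

end

/-- The chosen cartesian arrows over the chosen cartesian arrows of the base. -/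
def cCa (A : ∫ᶜ (rObj (bObj η q))) {Y : K} (g : Y ⟶ A.base.base) :
    ob (E := rObj (bObj η q)) (((rObj (bObj η q)).res (ca g A.base.fiber)).obj A.fiber) ⟶ A :=
  ca (ca g A.base.fiber) A.fiber

lemma car_sMap_cCa (A : ∫ᶜ (rObj (bObj η q))) {Y : K} (g : Y ⟶ A.base.base) :
    Car (sMap (cCa A g)) := car_sMap (car_ca _ _) (car_ca _ _)

variable {J : GrothendieckTopology K} (hq : q.total.IsStack J)

include hq in
lemma rObj_sep {A B : ∫ᶜ (rObj (bObj η q))} {m n : A ⟶ B} (hb : m.base = n.base)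
    (h : Loc J (fun _ g => cCa A g ≫ m = cCa A g ≫ n)) : m = n :=
  sMap_ext hb ((isPre_of_isStack hq).ext
    ((sMap_base m).trans ((base_congr hb).trans (sMap_base n).symm))
    (h.mono fun _ g hg => ⟨_, sMap (cCa A g), sMap_base _, car_sMap_cCa A g,
      (sMap_comp _ m).symm.trans ((congrArg sMap hg).trans (sMap_comp _ n))⟩))

variable (hD' : IsPre J D')

include hq hD' in
lemma exists_rObj_glue {A B : ∫ᶜ (rObj (bObj η q))} (f : A.base ⟶ B.base) {T : Sieve A.base.base}
    (hT : T ∈ J A.base.base) (m : ∀ ⦃Y : K⦄ (g : Y ⟶ A.base.base), T g →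
      (ob (E := rObj (bObj η q)) (((rObj (bObj η q)).res (ca g A.base.fiber)).obj A.fiber) ⟶ B))
    (hm : ∀ ⦃Y : K⦄ (g : Y ⟶ A.base.base) (hg : T g), (m g hg).base = ca g A.base.fiber ≫ f)
    (hc : ∀ ⦃Y Z : K⦄ (g : Y ⟶ A.base.base) (hg : T g) (g' : Z ⟶ A.base.base) (hg' : T g') k,
      k ≫ cCa A g = cCa A g' → k ≫ m g hg = m g' hg') :
    ∃ u : A ⟶ B, u.base = f ∧ ∀ ⦃Y : K⦄ (g : Y ⟶ A.base.base) (hg : T g),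
      cCa A g ≫ u = m g hg := by
  obtain ⟨u, hu, hu'⟩ := (isPre_of_isStack hq).glue (A := sObj A) (B := sObj B) f.base
    (I := fun _ g => PLift (T g)) (fun Y g _ => (sObj (ob (((rObj (bObj η q)).res
      (ca g A.base.fiber)).obj A.fiber))).fiber) (fun Y g _ => sMap (cCa A g))
    (fun Y g i => sMap (m g i.down)) (fun Y g i => sMap_base _) (fun Y g i => car_sMap_cCa A g)
    (fun Y g i => (sMap_base _).trans (base_congr (hm g i.down)))
    (fun Y Z g g' i j l hl => by
      obtain ⟨v, hv₀, hv⟩ := (car_ca g A.base.fiber).exists_lift (ca g' A.base.fiber) l.base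
        (((congrArg (l.base ≫ ·) (sMap_base (cCa A g))).symm.trans
          (base_congr hl)).trans (sMap_base (cCa A g')))
      obtain ⟨k, hk, hk'⟩ := (car_ca (ca g A.base.fiber) A.fiber).exists_lift (cCa A g') v hv
      have : l = sMap k := (car_sMap_cCa A g).hom_ext
        ((hv₀.symm.trans (base_congr hk).symm).trans (sMap_base k).symm)
        (hl.trans ((congrArg sMap hk').symm.trans (sMap_comp k _)))
      rw [this]
      exact (sMap_comp k _).symm.trans (congrArg sMap (hc g i.down g' j.down k hk')))
    ((Loc.of_sieve hT).mono fun Y g hg => ⟨⟨hg⟩⟩)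
  have h₁ : (tot η).map f ≫ sCmp B = sCmp A ≫ (tot q.proj).map u := by
    refine hD'.ext ?_ ((Loc.of_sieve hT).mono fun Y g hg => ⟨_, (tot η).map (ca g A.base.fiber),
      rfl, (car_ca _ _).tot η, ?_⟩)
    · exact (congrArg (f.base ≫ ·) (sCmp_base B)).trans ((comp_id _).trans (hu.symm.trans
        ((id_comp _).symm.trans (congrArg (· ≫ u.base) (sCmp_base A)).symm)))
    · have h₂ := sCmp_nat (m g hg)
      rw [hm, Functor.map_comp, ← hu' ⟨hg⟩, Functor.map_comp] at h₂
      refine ((assoc _ _ _).symm.trans h₂).trans ?_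
      exact (assoc _ _ _).symm.trans ((congrArg (· ≫ (tot q.proj).map u)
        (sCmp_nat (cCa A g)).symm).trans (assoc _ _ _))
  obtain ⟨w, hw, rfl⟩ := exists_sMap f u h₁
  refine ⟨w, hw, fun Y g hg => sMap_ext ?_ ((sMap_comp _ _).trans (hu' ⟨hg⟩))⟩
  exact (congrArg (ca g A.base.fiber ≫ ·) hw).trans (hm g hg).symm

include hq hD' in
lemma isPre_rObj : IsPre (giraud J D) (rObj (bObj η q)) := fun X S hS => by
  refine ⟨fun {a b} m n h => ve_inj (rObj_sep hq rfl
    ((Loc.of_sieve (S := cartSieve S) hS).mono fun Y g hg => h _ hg)), fun {a b} μ hμ hc => ?_⟩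
  have key : ∀ ⦃C : ∫ᶜ (rObj (bObj η q))⦄ ⦃Y Y' : ∫ᶜ D⦄ (f : Y ⟶ X) (hf : S f) (f' : Y' ⟶ X)
      (hf' : S f') (k : C ⟶ ob ((res _ f).obj a)) (k' : C ⟶ ob ((res _ f').obj a)),
      k ≫ ca f a = k' ≫ ca f' a → k ≫ μ f hf = k' ≫ μ f' hf' := by
    have aux : ∀ ⦃C : ∫ᶜ (rObj (bObj η q))⦄ ⦃Y : ∫ᶜ D⦄ (f : Y ⟶ X) (hf : S f)
        (k : C ⟶ ob ((res _ f).obj a)) (h : C.base ⟶ X) (hh : S h) (e : k.base ≫ f = h)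
        (l : C ⟶ ob ((res _ h).obj a)), l.base = 𝟙 _ → l ≫ ca h a = k ≫ ca f a →
        k ≫ μ f hf = l ≫ μ h hh := by
      intro C Y f hf k h hh e l hl hl'
      obtain ⟨r, hr, hr'⟩ := (car_ca f a).exists_lift (ca h a) k.base e
      have : k = l ≫ r := (car_ca f a).hom_ext
        (((congrArg₂ CategoryStruct.comp hl hr).trans (id_comp _)).symm)
        (by rw [assoc, hr', hl'])
      rw [this, assoc, hc f hf h hh r hr']
    intro C Y Y' f hf f' hf' k k' e
    have hb : k.base ≫ f = k'.base ≫ f' := base_congr e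
    obtain ⟨l, hl, hl'⟩ := (car_ca (k.base ≫ f) a).exists_lift (k ≫ ca f a) (𝟙 _)
      (id_comp _)
    have hh := S.downward_closed hf k.base
    rw [aux f hf k _ hh rfl l hl hl', aux f' hf' k' _ hh hb.symm l hl (hl'.trans e)]
  obtain ⟨u, hu, hu'⟩ := exists_rObj_glue hq hD' (A := ob a) (B := ob b) (𝟙 X)
    (T := cartSieve S) hS (fun Y g hg => μ (ca g X.fiber) hg)
    (fun Y g hg => (hμ _ hg).trans (comp_id _).symm)
    (fun Y Z g hg g' hg' k hk => hc _ hg _ hg' k hk)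
  obtain ⟨m, rfl⟩ := exists_ve u hu
  refine ⟨m, fun Y f hf => rObj_sep hq ((comp_id f).trans (hμ f hf).symm)
    (((Loc.of_sieve (S := cartSieve S) hS).pull f.base).mono fun Z g hg => ?_)⟩
  obtain ⟨j, -, hj⟩ := (car_ca (g ≫ f.base) X.fiber).exists_lift (ca g Y.fiber ≫ f) (𝟙 Z)
    (id_comp _)
  obtain ⟨k, -, hk⟩ := (car_ca (ca (g ≫ f.base) X.fiber) a).exists_lift
    (cCa (ob ((res _ f).obj a)) g ≫ ca f a) j hj
  refine Eq.trans ?_ (key _ hg f hf k (cCa (ob ((res _ f).obj a)) g) hk)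
  rw [← assoc, ← hk, assoc]
  exact congrArg (k ≫ ·) (hu' _ hg)

include hq hD' in
lemma isStack_rObj : (rObj (bObj η q)).IsStack (giraud J D) :=
    isStack_iff.2 fun X S hS => ⟨isPre_rObj hq hD' S hS, fun d => by
  let T : Sieve X.base := cartSieve S
  have hT : T ∈ J X.base := hS
  have hlf : ∀ ⦃Y Z : K⦄ (f : Y ⟶ X.base) (g : Z ⟶ X.base) (h : Z ⟶ Y), h ≫ f = g →
      ∃ k : ob ((D.res g).obj X.fiber) ⟶ ob ((D.res f).obj X.fiber),
        k.base = h ∧ Car k ∧ k ≫ ca f X.fiber = ca g X.fiber :=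
    fun Y Z f g h e => (car_ca f X.fiber).exists_desc (car_ca g X.fiber) h e
  choose lf hb hc hl using hlf
  obtain ⟨y, arr, arr_base, arr_car, arr_comp⟩ := DD.exists_arr (E := q.total) (S := T)
    (Ch := fun Y f => PLift (T f)) (fun Y f => ⟨fun h => ⟨⟨h⟩⟩, fun ⟨h⟩ => h.down⟩)
    (fun Y f c => (sObj (ob (d.obj (ca f X.fiber) c.down))).fiber)
    (fun Y Z f g c c' h e => sMap (d.tr _ c.down _ c'.down (lf f g h e) (hl f g h e)))
    (fun Y Z f g c c' h e => (sMap_base _).trans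
      ((base_congr (d.base _ _ _ _ _ _)).trans (hb f g h e)))
    (fun Y Z f g c c' h e => car_sMap (d.car _ _ _ _ _ _)
      ((congrArg Car (d.base _ c.down _ c'.down _ (hl f g h e))).mpr (hc f g h e)))
    (fun Y Z W f g k c c' c'' h e h' e' h'' e'' w => (sMap_comp _ _).symm.trans
      (congrArg sMap (d.comp _ _ _ _ _ _ _ _ _ _ _ _ ((car_ca f X.fiber).hom_ext
        ((congrArg₂ CategoryStruct.comp (hb g k h' e') (hb f g h e)).trans
          (w.trans (hb f k h'' e'').symm))
        ((assoc _ _ _).trans ((congrArg (_ ≫ ·) (hl f g h e)).trans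
          ((hl g k h' e').trans (hl f k h'' e'').symm)))))))
    (isStack_iff.1 hq T hT).2
  obtain ⟨i, hi, hi'⟩ := hD'.glue (A := (tot η).obj X) (B := (tot q.proj).obj (ob y)) (𝟙 X.base)
    (I := fun Y g => PLift (T g)) (fun Y g _ => ((tot η).obj (ob ((D.res g).obj X.fiber))).fiber)
    (fun Y g _ => (tot η).map (ca g X.fiber))
    (fun Y g c => sCmp (ob (d.obj (ca g X.fiber) c.down)) ≫ (tot q.proj).map (arr c))
    (fun Y g c => rfl) (fun Y g c => (car_ca _ _).tot η)
    (fun Y g c => ((congrArg₂ CategoryStruct.comp (sCmp_base _) (arr_base c)).trans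
      (id_comp g)).trans (comp_id g).symm)
    (fun Y Z g g' c c' l h => by
      have e : l.base ≫ g = g' := base_congr h
      have h₁ : l = (tot η).map (lf g g' l.base e) := ((car_ca g X.fiber).tot η).hom_ext
        (hb g g' l.base e).symm (h.trans ((congrArg (tot η).map (hl g g' l.base e)).symm.trans
          ((tot η).map_comp _ _)))
      have h₂ := sCmp_nat_of_base ((d.base _ c.down _ c'.down _ (hl g g' l.base e)))
      rw [← arr_comp c c' l.base e]
      exact (assoc _ _ _).symm.trans ((congrArg (· ≫ (tot q.proj).map (arr c))
        ((congrArg (· ≫ sCmp _) h₁).trans h₂)).trans ((assoc _ _ _).trans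
        (congrArg (sCmp _ ≫ ·) ((tot q.proj).map_comp _ _).symm))))
    ((Loc.of_sieve hT).mono fun Y g hg => ⟨⟨hg⟩⟩)
  have ci : Car i := hD'.car i ((Loc.of_sieve hT).mono fun Y g hg =>
    ⟨_, (tot η).map (ca g X.fiber), rfl, (car_ca _ _).tot η, (congrArg Car (hi' ⟨hg⟩)).mpr
      ((car_of_isIso _).trans ((arr_car ⟨hg⟩).tot q.proj))⟩)
  obtain ⟨j, rfl⟩ := exists_ve (a := ((tot η).obj X).fiber)
    (b := ((tot q.proj).obj (ob y)).fiber) i hi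
  have hj : IsIso j := car_ve_iff.1 ci
  let A : ∫ᶜ (rObj (bObj η q)) :=
    secObj (p := bObj η q) (ob (E := bTotal η q) (⟨X.fiber, y, asIso j⟩ : bFib η q X.base))
  have hA : sCmp A = ve j := by
    refine (congrArg (fun t => (tot η).map t ≫ ve j) (topIso_secObj _)).trans ?_
    exact (congrArg (· ≫ ve j) ((tot η).map_id X)).trans (id_comp _)
  let V : Sieve X := ⟨fun Y f => T f.base, fun {Y Z f} hf g => T.downward_closed hf g.base⟩
  have hv : ∀ ⦃Y : ∫ᶜ D⦄ (f : Y ⟶ X), ∃ k : Y ⟶ ob ((D.res f.base).obj X.fiber),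
      k.base = 𝟙 _ ∧ k ≫ ca f.base X.fiber = f := fun Y f =>
    (car_ca f.base X.fiber).exists_lift f (𝟙 _) (id_comp _)
  choose jf hjb hj' using hv
  have hVS : V ≤ S := fun Y f hf => by
    rw [← hj' f]
    exact S.downward_closed (show S (ca f.base X.fiber) from hf) _
  have hV : V ∈ giraud J D X := hT
  refine d.effective_of_restrict (isPre_rObj hq hD') hV hVS ⟨A.fiber, ?_⟩
  have hγ : ∀ ⦃Y : ∫ᶜ D⦄ (f : Y ⟶ X) (hf : V f), ∃ m : ob (d.obj f (hVS f hf)) ⟶ A,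
      m.base = f ∧ sMap m = sMap (d.tr _ hf f (hVS f hf) (jf f) (hj' f)) ≫ arr ⟨hf⟩ := by
    intro Y f hf
    refine exists_sMap (A := ob (d.obj f (hVS f hf))) (B := A) (show Y ⟶ A.base from f) _ ?_
    have h₁ := sCmp_nat_of_base (d.base _ hf f (hVS f hf) (jf f) (hj' f))
    rw [hA]
    refine Eq.trans ?_ ((congrArg (· ≫ (tot q.proj).map (arr ⟨hf⟩)) h₁).trans
      ((assoc _ _ _).trans (congrArg (sCmp _ ≫ ·) ((tot q.proj).map_comp _ _).symm)))
    refine Eq.trans ?_ ((congrArg ((tot η).map (jf f) ≫ ·) (hi' ⟨hf⟩)).trans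
      (assoc _ _ _).symm)
    exact (congrArg (· ≫ ve j) ((congrArg (tot η).map (hj' f)).symm.trans
      ((tot η).map_comp _ _))).trans (assoc _ _ _)
  choose γ hγb hγ using hγ
  exact ⟨{
    arr := γ
    base := hγb
    car := fun Y f hf => car_of_hc_sMap ((congrArg (HC q.proj) (hγ f hf)).mpr
      ((hc_sMap (d.car _ _ _ _ _ _)).trans ((arr_car _).hc q.proj)))
    comp := fun Y Z f hf g hg h e => sMap_ext
      ((congrArg₂ CategoryStruct.comp (d.base _ _ _ _ _ _) (hγb f hf)).trans
        (e.trans (hγb g hg).symm)) (by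
      refine (sMap_comp _ _).trans ((congrArg (sMap _ ≫ ·) (hγ f hf)).trans
        (Eq.trans ?_ (hγ g hg).symm))
      have e' : h.base ≫ f.base = g.base := base_congr e
      rw [← arr_comp ⟨hf⟩ ⟨hg⟩ h.base e']
      have h₂ : ∀ ⦃Y Z : ∫ᶜ D⦄ (f : Y ⟶ X) (h : Z ⟶ Y), (h ≫ jf f) ≫ ca f.base X.fiber = h ≫ f :=
        fun Y Z f h => (assoc _ _ _).trans (congrArg (h ≫ ·) (hj' f))
      have h₁ : h ≫ jf f = jf g ≫ lf f.base g.base h.base e' :=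
        (car_ca f.base X.fiber).hom_ext
          ((congrArg (h.base ≫ ·) (hjb f)).trans ((comp_id _).trans
            ((id_comp _).symm.trans (congrArg₂ CategoryStruct.comp (hjb g)
              (hb _ _ _ e')).symm)))
          ((h₂ f h).trans (e.trans ((assoc _ _ _).trans
            ((congrArg (jf g ≫ ·) (hl _ _ _ e')).trans (hj' g))).symm))
      refine (assoc _ _ _).symm.trans (Eq.trans ?_ (assoc _ _ _))
      refine congrArg (· ≫ arr ⟨hf⟩) ((sMap_comp _ _).symm.trans (Eq.trans (congrArg sMap ?_)
        (sMap_comp _ _)))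
      exact (d.comp _ hf f (hVS f hf) g (hVS g hg) (jf f) (hj' f) h e (h ≫ jf f)
        ((h₂ f h).trans e) rfl).trans
        (d.comp _ hf _ hg g (hVS g hg) _ (hl _ _ _ e') (jf g) (hj' g) _ _ h₁.symm).symm) }⟩⟩

end

end

section

variable {J : GrothendieckTopology K}
  {s : IndCat.{v, u, v', max u' v'} K ⥤ᵖ St.{v, u, v', max u' v'} J}
  (hs : PreservesFibrations (fibClass K) (fibClass K) (s.comp (stIncl J)))
  (σ : Biadjunction s (stIncl J)) {D : IndCat.{v, u, v', max u' v'} K}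
  (hσ : ∀ E, LE J (σ.unit.app E))

lemma isEquiv_rMap_sUnitApp {p : FibOver D}
    {A : IndCat.{max v v', max u u' v', v', max u' v'} (∫ᶜ D)} (hA : A.IsStack (giraud J D))
    {w : A ⟶ rObj p} (hw : IsEquiv w) : IsEquiv (rMap (sUnitApp hs σ hσ p)) := by
  have h₁ : LE J (sUnitApp hs σ hσ p).hom := by
    have i := bLiftIso (η := σ.unit.app D) (q := (Slice.mapSlice (s.comp (stIncl J)) hs D).obj p)
      (σ.unit.app p.total) (σ.unit.naturality p.proj) (preservesCart_unit σ hσ p)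
    have hb : LE J (bSnd (σ.unit.app D) ((Slice.mapSlice (s.comp (stIncl J)) hs D).obj p)) :=
      le_bSnd (hσ D)
    exact LE.of_comp i (hσ p.total) hb
  have h₂ : IsEquiv (w ≫ rMap (sUnitApp hs σ hσ p)) :=
    ((LE.of_isEquiv hw).comp (le_rMap h₁)).isEquiv hA
      (isStack_rObj (s.obj p.total).2 (isPre_of_isStack (s.obj D).2))
  obtain ⟨g, hg, -, ⟨i⟩⟩ := hw.exists_inv
  exact (hg.comp h₂).of_iso ((α_ _ _ _).symm ≪≫ whiskerRightIso i _ ≪≫ λ_ _)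

include hσ in
set_option maxHeartbeats 1000000 in
lemma nonempty_sOver_iOver_equivalence (c : StOver J ((s.comp (stIncl J)).obj D)) :
    Nonempty ((sOver s hs D).obj ((iOver σ D).obj c) ≌ c) := by
  obtain ⟨F, ⟨i⟩⟩ := ((sAdj hs σ D hσ).isUniv ((iOver σ D).obj c)).exists_lift (c := c) (𝟙 _)
  let T : St J := s.obj ((iOver σ D).obj c).total
  let f : T ⟶ ⟨c.1.total, c.2⟩ := InducedBicategory.mkHom F.hom.hom
  let i' : (sUnitApp hs σ hσ ((iOver σ D).obj c) ≫ bMap (σ.unit.app D) F.hom).hom ≅ 𝟙 _ :=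
    ⟨i.hom.hom, i.inv.hom, congrArg Slice.Hom₂.hom i.hom_inv_id,
      congrArg Slice.Hom₂.hom i.inv_hom_id⟩
  have j : σ.unit.app ((iOver σ D).obj c).total ≫ (stIncl J).map f ≅ bSnd (σ.unit.app D) c.1 :=
    (bLiftSnd _ _ F.hom).symm ≪≫ whiskerRightIso i' _ ≪≫ λ_ _
  have hF : IsEquiv F.hom.hom :=
    ((σ.isUniv _).isEquiv_of_iso ((le_bSnd (hσ D)).isUniv c.2) (f := f) j).map (stIncl J)
  obtain ⟨g, hg, ⟨i₁⟩, ⟨i₂⟩⟩ := hF.exists_inv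
  have h : IsEquiv F.hom := Slice.isEquiv_of_hom F.hom g (preservesCart_of_isEquiv c.1.fib hg
    (whiskerLeftIso g F.hom.iso.symm ≪≫ (α_ _ _ _).symm ≪≫ whiskerRightIso i₂ _ ≪≫ λ_ _)) i₁ i₂
  exact nonempty_fullSub_equivalence h.nonempty_equivalence.some

end

end

end Fib

set_option maxHeartbeats 1000000 in
theorem theorem4p2 {C : Type u} [Category.{v} C] (J : GrothendieckTopology C)
    (D : IndCat.{v, u, max u v w, max u v w w'} C) :
    ∃ (L : IndCat.{max u v w, max u v w w', max u v w, max u v w w'}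
          (Pseudofunctor.CoGrothendieck D) ⥤ᵖ FibOver D)
      (s : IndCat.{v, u, max u v w, max u v w w'} C ⥤ᵖ St J)
      (σ : Biadjunction s (stIncl J))
      (hs : PreservesFibrations (fibClass C) (fibClass C) (s.comp (stIncl J)))
      (sG : IndCat.{max u v w, max u v w w', max u v w, max u v w w'}
          (Pseudofunctor.CoGrothendieck D) ⥤ᵖ St (giraud J D))
      (hR : ∀ q : StOver J ((s.comp (stIncl J)).obj D),
        Pseudofunctor.IsStack (((iOver σ D).comp (R D)).obj q) (giraud J D)),
      (Nonempty (Biadjunction L (R D)) ∧ IsBiequivalence L ∧ IsBiequivalence (R D) ∧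
        ∀ A X, ∃ e : (L.obj A).total.fibre X ≌ Pseudofunctor.CoGrothendieck (restr A X),
          Nonempty (e.functor ⋙ Pseudofunctor.CoGrothendieck.forget _ ≅ (L.obj A).pr X)) ∧
      Nonempty (Biadjunction sG (stIncl (giraud J D))) ∧
      Nonempty (Biadjunction (sOver s hs D) (iOver σ D)) ∧
      (Nonempty (Biadjunction (lStack s hs L) (rStack σ D hR)) ∧
        IsBiequivalence (lStack s hs L) ∧ IsBiequivalence (rStack σ D hR)) ∧
      Nonempty ((rStack σ D hR).comp (stIncl (giraud J D)) ≌ (iOver σ D).comp (R D)) ∧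
      Nonempty ((lStack s hs L).comp (iOver σ D) ≌ (stIncl (giraud J D)).comp L) ∧
      Nonempty (sG.comp (lStack s hs L) ≌ L.comp (sOver s hs D)) ∧
      Nonempty ((sOver s hs D).comp (rStack σ D hR) ≌ (R D).comp sG) := by
  obtain ⟨s, σ, hσ⟩ := exists_stackification.{v, u, w, w'} J
  have hs := preservesFibrations_of_le σ hσ
  obtain ⟨L, ρ, hρ, hL⟩ := exists_left_biadjoint.{v, u, w, w'} D
  have hR : ∀ q : StOver J ((s.comp (stIncl J)).obj D),
      Pseudofunctor.IsStack (((iOver σ D).comp (R D)).obj q) (giraud J D) := fun q =>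
    isStack_rObj q.2 (isPre_of_isStack (s.obj D).2)
  have hL' : ∀ p, ∃ A, Nonempty (L.obj A ≌ p) := fun p =>
    ⟨_, ρ.exists_counit_equivalence hρ isLocEquiv_R p⟩
  obtain ⟨sG, h₁, h₂, h₃, h₄, h₅, h₆⟩ := square ρ (sAdj hs σ D hσ) hρ isLocEquiv_R
    (P := fun A => A.IsStack (giraud J D)) hR
    (fun A hA => isEquiv_rMap_sUnitApp hs σ hσ hA (hρ A))
    (nonempty_sOver_iOver_equivalence hs σ hσ)
  exact ⟨L, s, σ, hs, sG, hR, ⟨⟨ρ⟩, ρ.isBiequivalence_left hρ hL', ρ.isBiequivalence_right hρ hL',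
    hL⟩, h₁, ⟨sAdj hs σ D hσ⟩, h₂, h₃, h₄, h₅, h₆⟩
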